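/- Let $\mathbb{k}$ be a field of characteristic $0$; everything is $\mathbb{Z}/2$-graded with the Koszul sign rule. Let $\mathrm{CGra}$ be the operad of connected graphs with numbered vertices and odd edges, loops allowed: $\mathrm{CGra}(n)$ is spanned by connected graphs on $\{1,\dots,n\}$ with ordered edges, modulo a sign for each transposition of edges (so a graph with a repeated edge vanishes), and $\upsilon_1\circ_i\upsilon_2$ is the sum over all ways of inserting $\upsilon_2$ at the $i$-th vertex of $\upsilon_1$ and reconnecting, independently, the edge ends of $\upsilon_1$ attached to this vertex to vertices of $\upsilon_2$. Let $$\mathfrak{a}_{\mathrm{CGra}}=\prod_{n\ge 1,\,k\ge 0}\mathrm{CGra}(n)^{\mathbb{S}_n}\hbar^k$$ with $\hbar$ even, with the $\hbar$-bilinear pre-Lie product $f\star g=\sum_{\sigma}(f\circ_1 g)^\sigma$ (for $f,g$ of arities $n,m$, the sum is over $(m,n-1)$-shuffles $\sigma$), the bracket $[f,g]=f\star g-(-1)^{|f||g|}g\star f$, and the filtration by the weight $n-1+k$. Let $\theta$ be the sum of the graph with two vertices and one edge, and of $\hbar$ times the one-vertex graph with one loop. It is a Maurer--Cartan element. Put $\partial^\theta=[\theta,\cdot]$,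 and let $\mathfrak a^\theta_{\mathrm{CGra}}$ be $\mathfrak a_{\mathrm{CGra}}$ with the differential $\partial^\theta$; let $Z_{\mathrm{even}}$ and $H_{\mathrm{even}}$ be the spaces of its even cycles and of its even homology classes. A complete $\mathrm{CGra}$-algebra is a $\mathbb{Z}/2$-graded complex $(\mathfrak g,\mathrm d)$ with a complete Hausdorff decreasing filtration $\mathfrak g=\mathcal F_0\supseteq\mathcal F_1\supseteq\cdots$ by graded subcomplexes, and a morphism of dg operads $\Psi:\mathrm{CGra}\to\mathrm{End}_{\mathfrak g}$ with $\Psi(\gamma)(\mathcal F_{i_1},\dots,\mathcal F_{i_n})\subseteq\mathcal F_{i_1+\cdots+i_n}$; morphisms are even linear maps respecting $\mathrm d$, $\mathcal F$ and all the operations. Let $\{\,,\}$ and $\Delta$ be the actions of the one-edge graph and of the loop graph. A Maurer--Cartan element of $\mathfrak g^\hbar$ is an even $\alpha\in(\mathcal F_1\mathfrak g)[[\hbar]]$ with $\mathrm d\alpha+\hbar\Delta\alpha+\frac12\{\alpha,\alpha\}=0$; these form the set $\mathrm{MC}(\mathfrak g^\hbar)$, and $\mathcal{MC}(\mathfrak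 g^\hbar)$ is its quotient by gauge equivalence, i.e. by identifying $$\alpha\ \sim\ \alpha+\sum_{k\ge1}\tfrac1{k!}\bigl(\mathrm{ad}_\xi^k(\alpha)+\mathrm{ad}_\xi^{k-1}(\mathrm d\xi+\hbar\Delta\xi)\bigr),\qquad \xi\in\mathcal F_1\mathfrak g_{\mathrm{odd}}[[\hbar]],\quad \mathrm{ad}_\xi=\{\xi,\cdot\}.$$ Theorem. (1) The Baker--Campbell--Hausdorff series converges on $Z_{\mathrm{even}}$ and makes it a group with unit $0$; this group structure descends to $H_{\mathrm{even}}$. (2) For every complete $\mathrm{CGra}$-algebra $\mathfrak g$, the formula $$\lambda\cdot\alpha=\sum_{n\ge1,\,k\ge0}\tfrac1{n!}\,\Psi\bigl((e^{\lambda})^k_n\bigr)(\alpha,\dots,\alpha)\,\hbar^k,\qquad e^\lambda=\mathbb 1+\lambda+\tfrac1{2!}\lambda\star\lambda+\tfrac1{3!}(\lambda\star\lambda)\star\lambda+\cdots,$$ where $\mathbb 1$ is the one-vertex graph without edges and $(e^\lambda)_n^k\in\mathrm{CGra}(n)$ is the coefficient of $\hbar^k$ in arity $n$ of $e^\lambda$,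 converges and defines a group morphism $(Z_{\mathrm{even}},\mathrm{BCH},0)\to\mathrm{Aut}(\mathrm{MC}(\mathfrak g^\hbar))$ into the group of bijections, which induces a group morphism $$\bigl(H_{\mathrm{even}}(\mathfrak a^\theta_{\mathrm{CGra}}),\mathrm{BCH},0\bigr)\longrightarrow\mathrm{Aut}\bigl(\mathcal{MC}(\mathfrak g^\hbar)\bigr).$$ (3) Both actions are functorial: for every morphism $f:\mathfrak g\to\mathfrak g'$ of complete $\mathrm{CGra}$-algebras, the maps induced by $f$ on Maurer--Cartan elements and on moduli spaces commute with the actions. -/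

import Mathlib

universe u v

noncomputable section

namespace DeformationGroup

/-! ## Graphs with odd edges -/

section Graphs

variable (k : Type u) [Field k]

/-- Linear combinations of graphs with vertex set `V` and odd (undirected) edges, loops allowed: a
graph with edges `e₁, …, e_r`, in this order, is the product `e₁ ⋯ e_r` of the exterior algebra on
all possible edges. Exchanging two edges produces a sign, and a repeated edge gives zero. -/
abbrev Gra (V : Type) : Type u := ExteriorAlgebra k (Sym2 V →₀ k)

/-- The edge `e` as an element of `Gra k V`. -/
def edge {V : Type} (e : Sym2 V) : Gra k V := ExteriorAlgebra.ι k (Finsupp.single e 1)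

/-- The graph with the ordered list `L` of edges. -/
def graph {V : Type} (L : List (Sym2 V)) : Gra k V := (L.map (edge k)).prod

/-- The (possibly with loops, which do not matter here) graph spanned by `L` is connected; in
particular it has at least one vertex. -/
def IsConn {V : Type} (L : List (Sym2 V)) : Prop :=
  (SimpleGraph.fromEdgeSet {e : Sym2 V | e ∈ L}).Connected

/-- The space of connected graphs on the vertex set `V`; `CGra k (Fin n)` is the arity `n` component
of the operad of connected graphs, with vertices numbered by `Fin n`. It vanishes for `n = 0`. -/
def CGra (V : Type) : Submodule k (Gra k V) :=
  Submodule.span k {γ | ∃ L : List (Sym2 V), IsConn L ∧ γ = graph k L}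

/-- Graphs whose number of edges has parity `q`. -/
def parity (V : Type) (q : ZMod 2) : Submodule k (Gra k V) :=
  Submodule.span k {γ | ∃ L : List (Sym2 V), (L.length : ZMod 2) = q ∧ γ = graph k L}

variable {k}

/-- Renaming (or including) the vertices along `f`. -/
def relabel {V W : Type} (f : V → W) : Gra k V →ₐ[k] Gra k W :=
  ExteriorAlgebra.map (Finsupp.lmapDomain k k (Sym2.map f))

/-- Sum of all edges of `W` obtained by reconnecting the two ends of an edge of `V`, independently,
to the vertices lying over them. -/
def reconnectEdge {V W : Type} [DecidableEq V] [Fintype W] (π : W → V) (e : Sym2 V) :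
    Sym2 W →₀ k :=
  Sym2.lift ⟨fun u v => ∑ u' with π u' = u, ∑ v' with π v' = v, Finsupp.single s(u', v') (1 : k),
    fun u v => by
      dsimp only
      rw [Finset.sum_comm]
      exact Finset.sum_congr rfl fun _ _ => Finset.sum_congr rfl fun _ _ => by
        rw [Sym2.eq_swap]⟩ e

/-- Given a collapse `π : W → V` of vertices, the sum over all the ways of reconnecting the edges
of a graph on `V` to vertices of `W`: an end at `v` is plugged to any vertex of `π ⁻¹ v`. -/
def reconnect {V W : Type} [DecidableEq V] [Fintype W] (π : W → V) : Gra k V →ₐ[k] Gra k W :=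
  ExteriorAlgebra.map (Finsupp.linearCombination k (reconnectEdge (k := k) π))

end Graphs

/-! ## The operad of connected graphs -/

section Operad

variable {k : Type u} [Field k]

/-- The map collapsing the `m` consecutive elements `a, …, a + m - 1` of `Fin (a + m + c)` to the
element `a` of `Fin (a + 1 + c)`, otherwise preserving the order. -/
def collapse (a m c : ℕ) : Fin (a + m + c) → Fin (a + 1 + c) :=
  Fin.append (Fin.append (fun i : Fin a => Fin.castAdd c (Fin.castAdd 1 i))
    (fun _ : Fin m => Fin.castAdd c (Fin.natAdd a (0 : Fin 1)))) (fun i : Fin c => Fin.natAdd (a + 1) i)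

/-- The inclusion of `Fin m` as the collapsed block of `Fin (a + m + c)`. -/
def block (a m c : ℕ) (j : Fin m) : Fin (a + m + c) := Fin.castAdd c (Fin.natAdd a j)

/-- Partial composition of graphs: insertion of `g` at vertex number `a` (counted from `0`) of `f`,
renumbering the vertices, and summing over all the ways of reconnecting the edges of `f` plugged to
that vertex. The edges of `f` come first. -/
def graComp (a m c : ℕ) (f : Gra k (Fin (a + 1 + c))) (g : Gra k (Fin m)) :
    Gra k (Fin (a + m + c)) :=
  reconnect (collapse a m c) f * relabel (block a m c) g

theorem relabel_graph {V W : Type} (f : V → W) (L : List (Sym2 V)) :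
    relabel f (graph k L) = graph k (L.map (Sym2.map f)) := by
  simp only [graph, map_list_prod, List.map_map]
  congr 1
  apply List.map_congr_left
  intro e _
  simp [edge, relabel, ExteriorAlgebra.map_apply_ι, Finsupp.mapDomain_single]

theorem graph_append {V : Type} (L L' : List (Sym2 V)) :
    graph k (L ++ L') = graph k L * graph k L' := by
  simp [graph]

/-- `e'` is one of the edges obtained from `e` by reconnecting its ends. -/
def LiesOver {V W : Type} (π : W → V) (e : Sym2 V) (e' : Sym2 W) : Prop := e'.map π = e

theorem reconnect_graph_mem {V W : Type} [DecidableEq V] [Fintype W] (π : W → V)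
    (L : List (Sym2 V)) :
    reconnect π (graph k L) ∈ Submodule.span k
      {γ | ∃ L' : List (Sym2 W), List.Forall₂ (LiesOver π) L L' ∧ γ = graph k L'} := by
  induction L with
  | nil => exact Submodule.subset_span ⟨[], List.Forall₂.nil, by simp [graph]⟩
  | cons e L ih =>
    have h1 : reconnect π (graph k (e :: L)) = reconnect π (edge k e) * reconnect π (graph k L) := by
      simp [graph]
    have h2 : reconnect π (edge k e) ∈ Submodule.span k
        {γ : Gra k W | ∃ e', LiesOver π e e' ∧ γ = edge k e'} := by
      induction e with
      | h x y =>
        simp only [reconnect, edge, ExteriorAlgebra.map_apply_ι, Finsupp.linearCombination_single,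
          one_smul, reconnectEdge, Sym2.lift_mk, map_sum]
        refine Submodule.sum_mem _ fun u' hu => Submodule.sum_mem _ fun v' hv => ?_
        refine Submodule.subset_span ⟨s(u', v'), ?_, rfl⟩
        simp only [Finset.mem_filter, Finset.mem_univ, true_and] at hu hv
        simp [LiesOver, hu, hv]
    rw [h1]
    have h3 := Submodule.mul_mem_mul h2 ih
    rw [Submodule.span_mul_span] at h3
    refine Submodule.span_mono ?_ h3
    rintro _ ⟨_, ⟨e', he', rfl⟩, _, ⟨L', hL', rfl⟩, rfl⟩
    exact ⟨e' :: L', List.Forall₂.cons he' hL', by simp [graph]⟩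

theorem isConn_append {V W : Type} (π : W → V) (hπ : Function.Surjective π)
    (L : List (Sym2 V)) (hL : IsConn L) (L' L'' : List (Sym2 W))
    (h' : List.Forall₂ (LiesOver π) L L')
    (h'' : ∀ w w' : W, π w = π w' →
      (SimpleGraph.fromEdgeSet {e : Sym2 W | e ∈ L''}).Reachable w w') :
    IsConn (L' ++ L'') := by
  set G := SimpleGraph.fromEdgeSet {e : Sym2 W | e ∈ L' ++ L''} with hG
  have hle : SimpleGraph.fromEdgeSet {e : Sym2 W | e ∈ L''} ≤ G :=
    SimpleGraph.fromEdgeSet_mono (fun e he => List.mem_append_right _ he)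
  have hfib : ∀ w w' : W, π w = π w' → G.Reachable w w' := fun w w' h => (h'' w w' h).mono hle
  have hadj : ∀ w w' : W, s(w, w') ∈ L' → G.Reachable w w' := by
    intro w w' h
    by_cases hw : w = w'
    · subst hw; exact SimpleGraph.Reachable.refl _
    · exact SimpleGraph.Adj.reachable (by
        rw [hG, SimpleGraph.fromEdgeSet_adj]
        exact ⟨List.mem_append_left _ h, hw⟩)
  have key : ∀ x y : V, (SimpleGraph.fromEdgeSet {e : Sym2 V | e ∈ L}).Reachable x y →
      ∀ w w' : W, π w = x → π w' = y → G.Reachable w w' := by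
    rintro x y ⟨p⟩
    induction p with
    | nil => intro w w' h1 h2; exact hfib _ _ (h1.trans h2.symm)
    | cons hxy p ih =>
      intro w w' h1 h2
      rename_i x y z
      rw [SimpleGraph.fromEdgeSet_adj] at hxy
      obtain ⟨e', he', hlie⟩ : ∃ e' ∈ L', LiesOver π s(x, y) e' := by
        have hmem : s(x, y) ∈ L := hxy.1
        clear * - h' hmem
        induction h' with
        | nil => simp at hmem
        | cons hab _ ih =>
          rcases List.mem_cons.1 hmem with h | h
          · exact ⟨_, List.mem_cons_self, h ▸ hab⟩
          · obtain ⟨e', h1, h2⟩ := ih h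
            exact ⟨e', List.mem_cons_of_mem _ h1, h2⟩
      induction e' with
      | h s t =>
        simp only [LiesOver, Sym2.map_mk, Sym2.eq_iff] at hlie
        rcases hlie with ⟨hs, ht⟩ | ⟨hs, ht⟩
        · exact ((hfib w s (h1.trans hs.symm)).trans (hadj _ _ he')).trans (ih t w' ht h2)
        · exact ((hfib w t (h1.trans ht.symm)).trans (hadj _ _ he').symm).trans (ih s w' hs h2)
  have : Nonempty W := by
    obtain ⟨v⟩ := hL.nonempty
    obtain ⟨w, _⟩ := hπ v
    exact ⟨w⟩
  exact SimpleGraph.Connected.mk fun w w' => key _ _ (hL.preconnected _ _) w w' rfl rfl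

theorem relabel_mem {V : Type} (σ : Equiv.Perm V) {γ : Gra k V} (hγ : γ ∈ CGra k V) :
    relabel σ γ ∈ CGra k V := by
  refine Submodule.span_induction (p := fun γ _ => relabel σ γ ∈ CGra k V) ?_ ?_ ?_ ?_ hγ
  · rintro _ ⟨L, hL, rfl⟩
    rw [relabel_graph]
    refine Submodule.subset_span ⟨_, ?_, rfl⟩
    have := isConn_append (σ.symm : V → V) σ.symm.surjective L hL (L.map (Sym2.map σ)) [] ?_ ?_
    · simpa using this
    · rw [List.forall₂_map_right_iff]
      refine List.forall₂_same.2 fun e _ => ?_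
      simp [LiesOver, Sym2.map_map]
    · intro w w' h
      rw [σ.symm.injective h]
  · simp
  · intro x y _ _ hx hy
    simpa using Submodule.add_mem _ hx hy
  · intro a x _ hx
    simpa using Submodule.smul_mem _ a hx

/-- Every vertex of `Fin (a + m + c)` is before, inside or after the block. -/
theorem fin_cases_block {a m c : ℕ} (P : Fin (a + m + c) → Prop)
    (h1 : ∀ i : Fin a, P (Fin.castAdd c (Fin.castAdd m i))) (h2 : ∀ j, P (block a m c j))
    (h3 : ∀ i : Fin c, P (Fin.natAdd (a + m) i)) (x : Fin (a + m + c)) : P x :=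
  Fin.addCases (fun y => Fin.addCases h1 h2 y) h3 x

theorem collapse_fibre {a m c : ℕ} (w w' : Fin (a + m + c))
    (h : collapse a m c w = collapse a m c w') :
    w = w' ∨ ∃ j j', w = block a m c j ∧ w' = block a m c j' := by
  revert h
  refine fin_cases_block (fun w => collapse a m c w = collapse a m c w' → w = w' ∨
    ∃ j j', w = block a m c j ∧ w' = block a m c j') (fun i => ?_) (fun i => ?_) (fun i => ?_) w
  all_goals
    refine fin_cases_block (fun w' => collapse a m c _ = collapse a m c w' → _ = w' ∨
      ∃ j j', _ = block a m c j ∧ w' = block a m c j') (fun j => ?_) (fun j => ?_) (fun j => ?_) w'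
    all_goals
      intro h
      first
      | exact Or.inr ⟨_, _, rfl, rfl⟩
      | (left
         have hi := i.isLt
         have hj := j.isLt
         simp [collapse, block, Fin.ext_iff] at h ⊢
         try omega)

theorem collapse_surjective {a m c : ℕ} (hm : Nonempty (Fin m)) :
    Function.Surjective (collapse a m c) := by
  obtain ⟨j⟩ := hm
  intro x
  induction x using Fin.addCases with
  | left y =>
    induction y using Fin.addCases with
    | left i => exact ⟨Fin.castAdd c (Fin.castAdd m i), by simp [collapse]⟩
    | right i => exact ⟨block a m c j, by simp [collapse, block, Subsingleton.elim i 0]⟩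
  | right i => exact ⟨Fin.natAdd (a + m) i, by simp [collapse]⟩

theorem graComp_mem {a m c : ℕ} {f : Gra k (Fin (a + 1 + c))} {g : Gra k (Fin m)}
    (hf : f ∈ CGra k (Fin (a + 1 + c))) (hg : g ∈ CGra k (Fin m)) :
    graComp a m c f g ∈ CGra k (Fin (a + m + c)) := by
  refine Submodule.span_induction (p := fun f _ => graComp a m c f g ∈ CGra k _) ?_ ?_ ?_ ?_ hf
  · rintro _ ⟨L, hL, rfl⟩
    refine Submodule.span_induction
      (p := fun g _ => graComp a m c (graph k L) g ∈ CGra k _) ?_ ?_ ?_ ?_ hg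
    · rintro _ ⟨L₂, hL₂, rfl⟩
      have h1 := reconnect_graph_mem (k := k) (collapse a m c) L
      have h2 : relabel (block a m c) (graph k L₂) ∈ Submodule.span k
          {graph k (L₂.map (Sym2.map (block a m c)))} := by
        rw [relabel_graph]; exact Submodule.subset_span rfl
      have h3 := Submodule.mul_mem_mul h1 h2
      rw [Submodule.span_mul_span] at h3
      refine Submodule.span_mono ?_ h3
      rintro _ ⟨_, ⟨L', hL', rfl⟩, _, rfl, rfl⟩
      refine ⟨L' ++ L₂.map (Sym2.map (block a m c)), ?_, by rw [graph_append]⟩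
      refine isConn_append (collapse a m c) (collapse_surjective hL₂.nonempty) L hL _ _ hL' ?_
      intro w w' hw
      rcases collapse_fibre w w' hw with rfl | ⟨j, j', rfl, rfl⟩
      · exact SimpleGraph.Reachable.refl _
      · have hinj : Function.Injective (block a m c) := by
          intro i i' h
          simpa [block] using h
        let em : SimpleGraph.fromEdgeSet {e : Sym2 (Fin m) | e ∈ L₂} →g
            SimpleGraph.fromEdgeSet {e | e ∈ L₂.map (Sym2.map (block a m c))} :=
          { toFun := block a m c
            map_rel' := by
              intro x y h
              rw [SimpleGraph.fromEdgeSet_adj] at h ⊢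
              exact ⟨List.mem_map.2 ⟨s(x, y), h.1, rfl⟩, fun e => h.2 (hinj e)⟩ }
        exact (hL₂.preconnected j j').map em
    · simp [graComp]
    · intro x y _ _ hx hy
      simpa [graComp, mul_add] using Submodule.add_mem _ hx hy
    · intro b x _ hx
      simpa [graComp] using Submodule.smul_mem _ b hx
  · simp [graComp]
  · intro x y _ _ hx hy
    simpa [graComp, add_mul] using Submodule.add_mem _ hx hy
  · intro b x _ hx
    simpa [graComp] using Submodule.smul_mem _ b hx

/-- The action of the symmetric group on the connected graphs with `n` numbered vertices. -/
def CGra.perm {n : ℕ} (σ : Equiv.Perm (Fin n)) (f : CGra k (Fin n)) : CGra k (Fin n) :=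
  ⟨relabel σ f, relabel_mem σ f.2⟩

/-- The partial composition product of the operad of connected graphs. -/
def CGra.comp (a m c : ℕ) (f : CGra k (Fin (a + 1 + c))) (g : CGra k (Fin m)) :
    CGra k (Fin (a + m + c)) :=
  ⟨graComp a m c f g, graComp_mem f.2 g.2⟩

theorem isConn_point (L : List (Sym2 (Fin 1))) : IsConn L :=
  SimpleGraph.Connected.mk fun x y => by rw [Subsingleton.elim x y]

theorem isConn_edge : IsConn [s((0 : Fin 2), 1)] := by
  refine SimpleGraph.Connected.mk fun x y => ?_
  by_cases h : x = y
  · rw [h]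
  · refine SimpleGraph.Adj.reachable ?_
    rw [SimpleGraph.fromEdgeSet_adj]
    refine ⟨?_, h⟩
    fin_cases x <;> fin_cases y <;> simp_all [Sym2.eq_swap]

variable (k)

/-- The one-vertex graph without edges, which is the unit of the operad. -/
def CGra.unit : CGra k (Fin 1) := ⟨graph k [], Submodule.subset_span ⟨[], isConn_point _, rfl⟩⟩

/-- The one-vertex graph with one loop (the tadpole). -/
def CGra.loop : CGra k (Fin 1) :=
  ⟨graph k [s(0, 0)], Submodule.subset_span ⟨_, isConn_point _, rfl⟩⟩

/-- The graph with two vertices and one edge joining them. -/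
def CGra.stick : CGra k (Fin 2) :=
  ⟨graph k [s(0, 1)], Submodule.subset_span ⟨_, isConn_edge, rfl⟩⟩

end Operad

/-! ## Infinite sums with respect to a filtration, and the Baker–Campbell–Hausdorff formula -/

section Sums

variable {k : Type u} [Field k] {L : Type v} [AddCommGroup L] [Module k L]

/-- The series `∑ uᵢ` converges to `s` for the topology defined by the filtration `F`. -/
def HasFSum (F : ℕ → Submodule k L) (u : ℕ → L) (s : L) : Prop :=
  ∀ N, ∃ M, ∀ m ≥ M, s - ∑ i ∈ Finset.range m, u i ∈ F N

/-- The right-normed bracket `[a₁, [a₂, … [a_{l-1}, a_l] … ]]` of a word. -/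
def nested (br : L → L → L) : List L → L
  | [] => 0
  | [a] => a
  | a :: b :: w => br a (nested br (b :: w))

variable (k)

/-- The part of degree `l` of the Baker–Campbell–Hausdorff series (Dynkin's formula):
`∑ (-1)^(n-1)/n ∑ 1/(l · r₁! s₁! ⋯ r_n! s_n!) [x^{r₁} y^{s₁} ⋯ x^{r_n} y^{s_n}]` over all `n ≥ 1`
and all `(rᵢ, sᵢ) ≠ (0, 0)` with total sum `l`. -/
def bchTerm (br : L → L → L) (x y : L) (l : ℕ) : L :=
  ∑ n ∈ Finset.Icc 1 l,
    ∑ r ∈ (Fintype.piFinset fun _ : Fin n => Finset.range (l + 1) ×ˢ Finset.range (l + 1)) with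
        (∀ i, 0 < (r i).1 + (r i).2) ∧ ∑ i, ((r i).1 + (r i).2) = l,
      ((-1) ^ (n + 1) / (n * l * ∏ i, ((r i).1.factorial * (r i).2.factorial)) : k) •
        nested br (List.ofFn fun i =>
          List.replicate (r i).1 x ++ List.replicate (r i).2 y).flatten

end Sums

/-! ## The deformation complex -/

section Convolution

variable (k : Type u) [Field k]

/-- The ambient space of families `x n j` of graphs with `n` numbered vertices; `x n j` is the
coefficient of `ħ ^ j`. -/
abbrev Conv : Type u := ∀ n : ℕ, ℕ → Gra k (Fin n)

/-- The space `∏_{n, j} CGra(n)^{𝕊_n} ħ^j` underlying the deformation complex (the component of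
arity `n = 0` vanishes). -/
def convCGra : Submodule k (Conv k) where
  carrier := {x | ∀ n j, x n j ∈ CGra k (Fin n) ∧
    ∀ σ : Equiv.Perm (Fin n), relabel σ (x n j) = x n j}
  add_mem' hx hy n j := ⟨Submodule.add_mem _ (hx n j).1 (hy n j).1, fun σ => by
    simp [(hx n j).2 σ, (hy n j).2 σ]⟩
  zero_mem' n j := ⟨Submodule.zero_mem _, fun σ => by simp⟩
  smul_mem' a x hx n j := ⟨Submodule.smul_mem _ a (hx n j).1, fun σ => by simp [(hx n j).2 σ]⟩

/-- The elements of `ℤ/2`-degree `q`. -/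
def convParity (q : ZMod 2) : Submodule k (Conv k) where
  carrier := {x | ∀ n j, x n j ∈ parity k (Fin n) q}
  add_mem' hx hy n j := Submodule.add_mem _ (hx n j) (hy n j)
  zero_mem' _ _ := Submodule.zero_mem _
  smul_mem' a _ hx n j := Submodule.smul_mem _ a (hx n j)

variable {k}

/-- The collapse of a subset `S` of `Fin n` to the vertex `0`; the other vertices are numbered
`1, 2, …` in the same order. -/
def collapseSet {n : ℕ} (S : Finset (Fin n)) (v : Fin n) : Fin (Sᶜ.card + 1) :=
  if h : v ∈ Sᶜ then ((Sᶜ.orderIsoOfFin rfl).symm ⟨v, h⟩).succ else 0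

/-- Insertion at the first vertex of `f` of the graph `g` whose vertices are numbered by `S`, the
other vertices of `f` being numbered by the complement of `S` (preserving the orders). -/
def insertSet {n : ℕ} (S : Finset (Fin n)) (f : Gra k (Fin (Sᶜ.card + 1)))
    (g : Gra k (Fin S.card)) : Gra k (Fin n) :=
  reconnect (collapseSet S) f * relabel (S.orderEmbOfFin rfl) g

/-- The pre-Lie product, `ħ`-bilinear extension of
`(f ⋆ g)(n) = ∑_{S} (f ∘₁ g)^S`, where the sum runs over all subsets `S` of the `n` inputs, that is
over all shuffles. -/
def preLie : Conv k →ₗ[k] Conv k →ₗ[k] Conv k :=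
  LinearMap.mk₂ k
    (fun x y n j => ∑ S : Finset (Fin n), ∑ i ∈ Finset.HasAntidiagonal.antidiagonal j,
      insertSet S (x (Sᶜ.card + 1) i.1) (y S.card i.2))
    (fun x x' y => by
      funext n j; simp [insertSet, add_mul, Finset.sum_add_distrib])
    (fun a x y => by
      funext n j; simp [insertSet, Finset.smul_sum])
    (fun x y y' => by
      funext n j; simp [insertSet, mul_add, Finset.sum_add_distrib])
    (fun a x y => by
      funext n j; simp [insertSet, Finset.smul_sum])

/-- The weight filtration: the weight of `γ ħ ^ j` with `γ` of arity `n` is `n - 1 + j`. -/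
def weightFil (N : ℕ) : Submodule k (Conv k) where
  carrier := {x | ∀ n j, n + j < N + 1 → x n j = 0}
  add_mem' hx hy n j h := by simp [hx n j h, hy n j h]
  zero_mem' _ _ _ := rfl
  smul_mem' a x hx n j h := by simp [hx n j h]

/-- The unit `𝟙`: the one-vertex graph without edges, in arity one and `ħ`-degree zero. -/
def convOne : Conv k := fun n j => if n = 1 ∧ j = 0 then 1 else 0

/-- `prePow x m = ( ⋯ ((x ⋆ x) ⋆ x) ⋯ ) ⋆ x`, with `m` factors. -/
def prePow (x : Conv k) : ℕ → Conv k
  | 0 => convOne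
  | 1 => x
  | m + 2 => preLie (prePow x (m + 1)) x

/-- `E` is the pre-Lie exponential `e^x = 𝟙 + x + (x ⋆ x)/2! + ((x ⋆ x) ⋆ x)/3! + ⋯`. -/
def IsPreLieExp (x E : Conv k) : Prop :=
  HasFSum (weightFil (k := k)) (fun m => (1 / (m.factorial : k)) • prePow x m) E

/-- The Lie bracket of even elements: `[x, y] = x ⋆ y - y ⋆ x`. -/
def evenBracket (x y : Conv k) : Conv k := preLie x y - preLie y x

/-- `z` is the value `BCH(x, y)` of the Baker–Campbell–Hausdorff series at even elements. -/
def IsBCH (x y z : Conv k) : Prop :=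
  HasFSum (weightFil (k := k)) (bchTerm k evenBracket x y) z

variable (k)

/-- The Maurer–Cartan element `θ`: the graph with one edge and two vertices plus `ħ` times the
one-vertex graph with one loop. -/
def theta : Conv k
  | 2, 0 => CGra.stick k
  | 1, 1 => CGra.loop k
  | _, _ => 0

/-- The twisted differential `∂^θ = [θ, ·]` on elements of `ℤ/2`-degree `q`, with
`[θ, x] = θ ⋆ x - (-1)^q x ⋆ θ` since `θ` is odd. (The operad has no internal differential.) -/
def twistedDiff (q : ZMod 2) : Conv k →ₗ[k] Conv k :=
  preLie (theta k) - (((-1 : ℤˣ) ^ q : ℤˣ) : ℤ) • preLie.flip (theta k)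

/-- The even cycles of the deformation complex. -/
def evenCycles : Submodule k (Conv k) :=
  convCGra k ⊓ convParity k 0 ⊓ LinearMap.ker (twistedDiff k 0)

/-- The even boundaries: images of odd elements under the twisted differential. -/
def evenBoundaries : Submodule k (Conv k) :=
  (convCGra k ⊓ convParity k 1).map (twistedDiff k 1)

/-- The even homology `H_even(𝔞^θ)` of the deformation complex: even cycles modulo boundaries. -/
abbrev EvenHomology : Type u := evenCycles k ⧸ (evenBoundaries k).submoduleOf (evenCycles k)

/-- The homology class of an even cycle. -/
def homologyClass (x : evenCycles k) : EvenHomology k := Submodule.Quotient.mk x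

end Convolution

/-! ## Complete algebras over the operad of connected graphs -/

section Algebras

/-- The Koszul sign produced by reordering elements `x₀, …, x_{n-1}` of degrees `p` into
`x_{σ 0}, …, x_{σ (n-1)}`. -/
def koszulSign {n : ℕ} (p : Fin n → ZMod 2) (σ : Equiv.Perm (Fin n)) : ℤˣ :=
  ∏ i : Fin n, ∏ j : Fin n, if i < j ∧ σ j < σ i then (-1 : ℤˣ) ^ (p (σ i) * p (σ j)) else 1

/-- A complete `ℤ/2`-graded algebra over the operad of connected graphs: a `ℤ/2`-graded complex with
a complete (exhaustive, Hausdorff) decreasing filtration `V = F 0 ⊇ F 1 ⊇ ⋯` by graded subcomplexes,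
and a morphism of dg operads from the operad of connected graphs to the endomorphism operad which
respects the filtrations. -/
structure CompleteCGraAlgebra (k : Type u) [Field k] (V : Type v) [AddCommGroup V]
    [Module k V] where
  /-- the even and odd parts -/
  deg : ZMod 2 → Submodule k V
  isCompl_deg : IsCompl (deg 0) (deg 1)
  /-- the differential -/
  d : V →ₗ[k] V
  d_deg : ∀ p, ∀ x ∈ deg p, d x ∈ deg (p + 1)
  d_d : ∀ x, d (d x) = 0
  /-- the filtration -/
  F : ℕ → Submodule k V
  F_zero : F 0 = ⊤
  F_anti : Antitone F
  F_graded : ∀ N, F N = (F N ⊓ deg 0) ⊔ (F N ⊓ deg 1)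
  d_F : ∀ N, ∀ x ∈ F N, d x ∈ F N
  hausdorff : ∀ x, (∀ N, x ∈ F N) → x = 0
  complete : ∀ u : ℕ → V, (∀ N, u N ∈ F N) → ∃ s, HasFSum F u s
  /-- the structure maps -/
  act : ∀ n, CGra k (Fin n) →ₗ[k] MultilinearMap k (fun _ : Fin n => V) V
  act_deg : ∀ n (f : CGra k (Fin n)) (q : ZMod 2), (f : Gra k (Fin n)) ∈ parity k (Fin n) q →
    ∀ (p : Fin n → ZMod 2) (x : Fin n → V), (∀ i, x i ∈ deg (p i)) →
      act n f x ∈ deg (q + ∑ i, p i)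
  act_F : ∀ n (f : CGra k (Fin n)) (N : Fin n → ℕ) (x : Fin n → V), (∀ i, x i ∈ F (N i)) →
    act n f x ∈ F (∑ i, N i)
  /-- compatibility with the differentials -/
  act_d : ∀ n (f : CGra k (Fin n)) (q : ZMod 2), (f : Gra k (Fin n)) ∈ parity k (Fin n) q →
    ∀ (p : Fin n → ZMod 2) (x : Fin n → V), (∀ i, x i ∈ deg (p i)) →
      d (act n f x) = ((-1 : ℤˣ) ^ q) •
        ∑ i, ((-1 : ℤˣ) ^ (∑ j with j < i, p j)) • act n f (Function.update x i (d (x i)))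
  /-- the unit acts as the identity -/
  act_unit : ∀ x : Fin 1 → V, act 1 (CGra.unit k) x = x 0
  /-- equivariance -/
  act_perm : ∀ n (f : CGra k (Fin n)) (σ : Equiv.Perm (Fin n)) (p : Fin n → ZMod 2)
    (x : Fin n → V), (∀ i, x i ∈ deg (p i)) →
      act n (CGra.perm σ f) x = koszulSign p σ • act n f (fun i => x (σ i))
  /-- compatibility with the partial compositions -/
  act_comp : ∀ a m c (f : CGra k (Fin (a + 1 + c))) (g : CGra k (Fin m)) (q : ZMod 2),
    (g : Gra k (Fin m)) ∈ parity k (Fin m) q →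
    ∀ (p : Fin (a + m + c) → ZMod 2) (x : Fin (a + m + c) → V), (∀ i, x i ∈ deg (p i)) →
      act (a + m + c) (CGra.comp a m c f g) x =
        ((-1 : ℤˣ) ^ (q * ∑ i : Fin a, p (Fin.castAdd c (Fin.castAdd m i)))) •
          act (a + 1 + c) f
            (Fin.append
              (Fin.append (fun i : Fin a => x (Fin.castAdd c (Fin.castAdd m i)))
                (fun _ : Fin 1 => act m g (fun j => x (block a m c j))))
              (fun i : Fin c => x (Fin.natAdd (a + m) i)))

namespace CompleteCGraAlgebra

variable {k : Type u} [Field k] {V : Type v} [AddCommGroup V] [Module k V]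
variable {V' : Type v} [AddCommGroup V'] [Module k V']

/-- A morphism of complete algebras. -/
structure Hom (g : CompleteCGraAlgebra k V) (g' : CompleteCGraAlgebra k V') where
  toLin : V →ₗ[k] V'
  map_deg : ∀ p, ∀ x ∈ g.deg p, toLin x ∈ g'.deg p
  map_F : ∀ N, ∀ x ∈ g.F N, toLin x ∈ g'.F N
  map_d : ∀ x, toLin (g.d x) = g'.d (toLin x)
  map_act : ∀ n f (x : Fin n → V), toLin (g.act n f x) = g'.act n f (fun i => toLin (x i))

variable (g : CompleteCGraAlgebra k V)

/-- The shifted Lie bracket. -/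
def bracket (x y : V) : V := g.act 2 (CGra.stick k) ![x, y]

/-- The operator `Δ`. -/
def Delta (x : V) : V := g.act 1 (CGra.loop k) ![x]

/-! The quantum shifted Lie algebra `𝔤^ħ`: an element `∑ x_p ħ^p` of `𝔤[[ħ]]` is the sequence of its
coefficients. -/

/-- The differential `d + ħ Δ` of `𝔤^ħ`. -/
def hD (x : ℕ → V) : ℕ → V
  | 0 => g.d (x 0)
  | p + 1 => g.d (x (p + 1)) + g.Delta (x p)

/-- The `ħ`-bilinear extension of the shifted Lie bracket. -/
def hBracket (x y : ℕ → V) : ℕ → V := fun p =>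
  ∑ i ∈ Finset.HasAntidiagonal.antidiagonal p, g.bracket (x i.1) (y i.2)

/-- The Maurer–Cartan elements of `𝔤^ħ`: the even elements of `(F 1)[[ħ]]` such that
`d α + ħ Δ α + ½ {α, α} = 0`. -/
def MC : Type v :=
  {α : ℕ → V // (∀ p, α p ∈ g.F 1 ⊓ g.deg 0) ∧ g.hD α + (1 / 2 : k) • g.hBracket α α = 0}

/-- The `i`-th term of `α + ∑_{i ≥ 1} 1/i! (ad_ξ^i (α) + ad_ξ^{i-1} (d ξ + ħ Δ ξ))`. -/
def gaugeTerm (ξ α : ℕ → V) : ℕ → ℕ → V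
  | 0 => α
  | i + 1 => (1 / ((i + 1).factorial : k)) •
      ((g.hBracket ξ)^[i + 1] α + (g.hBracket ξ)^[i] (g.hD ξ))

/-- `β` is obtained from `α` by the action of an element `ξ` of the gauge group, whose underlying
set consists of the odd elements of `(F 1)[[ħ]]`. -/
def GaugeRel (α β : g.MC) : Prop :=
  ∃ ξ : ℕ → V, (∀ p, ξ p ∈ g.F 1 ⊓ g.deg 1) ∧
    ∀ p, HasFSum g.F (fun i => g.gaugeTerm ξ α.1 i p) (β.1 p)

/-- The moduli space of Maurer–Cartan elements of `𝔤^ħ` up to gauge equivalence. -/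
def Moduli : Type v := Quot g.GaugeRel

/-- The class of a Maurer–Cartan element in the moduli space. -/
def moduliClass (α : g.MC) : g.Moduli := Quot.mk _ α

/-- The coefficient of `ħ^p` in `f (α, …, α)`, where `f` is extended `ħ`-multilinearly. -/
def hEval {n : ℕ} (f : CGra k (Fin n)) (α : ℕ → V) (p : ℕ) : V :=
  ∑ j ∈ Finset.piAntidiag (Finset.univ : Finset (Fin n)) p, g.act n f (fun i => α (j i))

/-- The coefficient of `ħ^p` in `∑_k 1/n! (E n k)(α, …, α) ħ^k`. -/
def actionTerm (E : ∀ n, ℕ → CGra k (Fin n)) (α : ℕ → V) (p n : ℕ) : V :=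
  (1 / (n.factorial : k)) • ∑ i ∈ Finset.HasAntidiagonal.antidiagonal p, g.hEval (E n i.1) α i.2

/-- `β = x · α = ∑_{n, j} 1/n! (e^x)^j_n (α, …, α) ħ^j`, where `e^x` is the pre-Lie exponential. -/
def IsAction (x : Conv k) (α β : ℕ → V) : Prop :=
  ∃ E : ∀ n, ℕ → CGra k (Fin n), IsPreLieExp x (fun n j => (E n j : Gra k (Fin n))) ∧
    ∀ p, HasFSum g.F (g.actionTerm E α p) (β p)

namespace Hom

variable {g} {g' : CompleteCGraAlgebra k V'} (ψ : Hom g g')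

/-- The coefficientwise extension of a morphism to formal power series. -/
def ext (x : ℕ → V) : ℕ → V' := fun p => ψ.toLin (x p)

theorem ext_hD (x : ℕ → V) : ψ.ext (g.hD x) = g'.hD (ψ.ext x) := by
  funext p
  cases p with
  | zero => simp [ext, hD, ψ.map_d]
  | succ p =>
    simp only [ext, hD, map_add, ψ.map_d, Delta, ψ.map_act]
    congr 3
    funext i
    simp

theorem ext_hBracket (x y : ℕ → V) :
    ψ.ext (g.hBracket x y) = g'.hBracket (ψ.ext x) (ψ.ext y) := by
  funext p
  simp only [ext, hBracket, map_sum, bracket, ψ.map_act]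
  refine Finset.sum_congr rfl fun i _ => ?_
  congr 1
  funext j
  fin_cases j <;> rfl

theorem ext_add (x y : ℕ → V) : ψ.ext (x + y) = ψ.ext x + ψ.ext y := by
  funext p; simp [ext]

theorem ext_smul (a : k) (x : ℕ → V) : ψ.ext (a • x) = a • ψ.ext x := by
  funext p; simp [ext]

theorem ext_iterate (ξ x : ℕ → V) (i : ℕ) :
    ψ.ext ((g.hBracket ξ)^[i] x) = (g'.hBracket (ψ.ext ξ))^[i] (ψ.ext x) := by
  induction i with
  | zero => rfl
  | succ i ih => rw [Function.iterate_succ_apply', Function.iterate_succ_apply', ext_hBracket, ih]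

theorem ext_gaugeTerm (ξ α : ℕ → V) (i : ℕ) :
    ψ.ext (g.gaugeTerm ξ α i) = g'.gaugeTerm (ψ.ext ξ) (ψ.ext α) i := by
  cases i with
  | zero => rfl
  | succ i => simp only [gaugeTerm, ext_smul, ext_add, ext_iterate, ext_hD]

/-- The induced map on Maurer–Cartan elements. -/
def mapMC (α : g.MC) : g'.MC :=
  ⟨ψ.ext α.1, fun p => ⟨ψ.map_F _ _ (α.2.1 p).1, ψ.map_deg _ _ (α.2.1 p).2⟩, by
    have h := congrArg ψ.ext α.2.2
    rw [ext_add, ext_smul, ext_hD, ext_hBracket] at h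
    rw [h]
    funext p; simp [ext]⟩

theorem gaugeRel_mapMC (α β : g.MC) (h : g.GaugeRel α β) :
    g'.GaugeRel (ψ.mapMC α) (ψ.mapMC β) := by
  obtain ⟨ξ, hξ, hs⟩ := h
  refine ⟨ψ.ext ξ, fun p => ⟨ψ.map_F _ _ (hξ p).1, ψ.map_deg _ _ (hξ p).2⟩, fun p N => ?_⟩
  obtain ⟨M, hM⟩ := hs p N
  refine ⟨M, fun m hm => ?_⟩
  have h1 := ψ.map_F _ _ (hM m hm)
  rw [map_sub, map_sum] at h1
  have h2 : ∀ i, g'.gaugeTerm (ψ.ext ξ) (ψ.mapMC α).1 i p = ψ.toLin (g.gaugeTerm ξ α.1 i p) :=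
    fun i => (congrFun (ψ.ext_gaugeTerm ξ α.1 i) p).symm
  simp only [h2]
  exact h1

/-- The induced map on moduli spaces. -/
def mapModuli : g.Moduli → g'.Moduli := Quot.map ψ.mapMC ψ.gaugeRel_mapMC

end Hom

end CompleteCGraAlgebra

end Algebras

end DeformationGroup

end

open DeformationGroup DeformationGroup.CompleteCGraAlgebra

set_option linter.unusedSectionVars false

set_option linter.unusedSectionVars false

namespace DeformationGroup

/-! ## Power series at nilpotent elements -/

/-! Symmetric families of graphs are treated as formal functions on 𝔤^ħ. For f in 𝔞 put f(α) = ∑ ħ^j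
f_{n,j}(α, …, α)/n! (`ev`), with derivatives Df(α)v (`dev`) and D²f(α)(v, w) (`ddev`). Then ⋆ is
differentiation along a vector field, (f ⋆ f')(α) = Df(α)(f'(α)) (`ev_pl`), with the corresponding
chain rule for derivatives (`dev_pl`). The element θ is the function ħΔα + ½{α, α}, so the
Maurer–Cartan equation says that the curvature dα + θ(α) vanishes. With R_λ the right pre-Lie
multiplication by λ, e^λ = exp(R_λ)(𝟙) is the time-one flow of the vector field λ, and f(e^λ·α) =
(exp(R_λ) f)(α) (`ev_cexp`): with a time t inserted, both sides solve the same differential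
equation, for all f at once (`ev_evPath`).

Group law. The associator of ⋆ is a sum over pairs of disjoint sets of vertices
(`insertSum_associator`), hence graded symmetric in its last two arguments. So ⋆ is pre-Lie and R is
an anti-representation of the Lie algebra of even cycles. An even cycle has no component of weight
zero (`evenCycles_weight`), so the operators R_λ are nilpotent modulo each step of the filtration.
There the Baker–Campbell–Hausdorff formula in Dynkin's form (`nexp_bch`, obtained from a
differential equation for log(e^{tx} e^{ty})) gives exp(R_{BCH(x,y)}) = exp(R_y) exp(R_x). Since 𝟙 ⋆
x = x, R is faithful, and the group axioms are inherited from operators. Applied to 𝟙, the same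
identity gives the action law. Homologous arguments change each term of the series by a boundary
whose primitive has growing weight, so the product descends to homology
(`bchMul_sub_mem_boundaries`).

Maurer–Cartan elements. For a cycle λ, λ ⋆ θ = θ ⋆ λ, and the pre-Lie identity yields exp(R_λ)θ =
e^λ ⋆ θ (`convExp_theta`). Read on functions, the curvature of e^λ·α is the derivative of e^λ at α
applied to the curvature of α (`curv_ev`), hence vanishes with it.

Gauge equivalence is handled through flows, that is, paths a(t) with a' = (d + ħΔ)x + {x, a} for a
time-dependent odd x(t). The endpoints of a sufficiently convergent flow differ by one gauge
transformation (`gauge_of_path`): the time-ordered exponential is the exponential of its Magnus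
expansion, which lives in the Lie algebra of odd elements. At a Maurer–Cartan element the derivative
of e^λ sends gauge directions to gauge directions (`dir_trans`), so cycles act on the moduli space
(`gauge_trans`). If λ = ∂^θ h, the path e^{tλ}·α is the flow generated by x(t) = h(e^{tλ}·α), so
boundaries act trivially (`gauge_boundary`). Functoriality holds because morphisms commute with all
the series involved. -/

theorem sum_antidiagonal_eq_sum_range {M : Type*} [AddCommMonoid M] {K L : ℕ} {F : ℕ → ℕ → M}
    (hF : ∀ i j, F i j ≠ 0 → i < K ∧ j < K ∧ i + j < L) :
    ∑ n ∈ Finset.range L, ∑ p ∈ Finset.HasAntidiagonal.antidiagonal n, F p.1 p.2 =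
      ∑ i ∈ Finset.range K, ∑ j ∈ Finset.range K, F i j := by
  rw [Finset.sum_sigma', ← Finset.sum_product']
  refine Finset.sum_bij_ne_zero (fun a _ _ => a.2) ?_ ?_ ?_ ?_
  · rintro ⟨n, i, j⟩ h h'
    have := hF i j h'
    simp [this.1, this.2.1]
  · rintro ⟨n, i, j⟩ h _ ⟨n', i', j'⟩ h' _ e
    simp only [Prod.mk.injEq, Finset.mem_sigma, Finset.HasAntidiagonal.mem_antidiagonal] at e h h'
    obtain ⟨rfl, rfl⟩ := e
    have : n = n' := by omega
    subst this; rfl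
  · rintro ⟨i, j⟩ _ h'
    exact ⟨⟨i + j, i, j⟩, by simp [(hF i j h').2.2], h', rfl⟩
  · intros; rfl

section NilpotentCalculus

variable {k : Type u} [Field k] {A : Type*} [Ring A] [Algebra k A]

/-- The value at `a` of a power series truncated at order `K`; it is multiplicative in the power
series if `a ^ K = 0`. -/
noncomputable def nilEval (K : ℕ) (a : A) : PowerSeries k →ₗ[k] A :=
  ∑ i ∈ Finset.range K, (PowerSeries.coeff i).smulRight (a ^ i)

theorem nilEval_apply (K : ℕ) (a : A) (f : PowerSeries k) :
    nilEval K a f = ∑ i ∈ Finset.range K, PowerSeries.coeff i f • a ^ i := by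
  simp [nilEval]

theorem nilEval_eq_of_le {K K' : ℕ} (h : K ≤ K') {a : A} (ha : a ^ K = 0) (f : PowerSeries k) :
    nilEval K' a f = nilEval K a f := by
  rw [nilEval_apply, nilEval_apply]
  refine (Finset.sum_subset (Finset.range_mono h) fun i _ hi => ?_).symm
  rw [pow_eq_zero_of_le (by simpa using hi) ha, smul_zero]

theorem nilEval_one {K : ℕ} {a : A} (ha : a ^ K = 0) : nilEval K a (1 : PowerSeries k) = 1 := by
  rw [← nilEval_eq_of_le (Nat.le_succ K) ha, nilEval_apply, Finset.sum_range_succ']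
  simp [PowerSeries.coeff_one]

/-- Truncation is harmless: the part of the product of degree at least K vanishes together with a ^
K. -/
theorem nilEval_mul {K : ℕ} {a : A} (ha : a ^ K = 0) (f g : PowerSeries k) :
    nilEval K a (f * g) = nilEval K a f * nilEval K a g := by
  simp only [nilEval_apply, PowerSeries.coeff_mul, Finset.sum_mul_sum, Finset.sum_smul]
  rw [← sum_antidiagonal_eq_sum_range (L := K) (K := K)
    (F := fun i j => (PowerSeries.coeff i f • a ^ i) * (PowerSeries.coeff j g • a ^ j))]
  · refine Finset.sum_congr rfl fun n _ => Finset.sum_congr rfl fun p hp => ?_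
    rw [smul_mul_smul_comm, ← pow_add, Finset.HasAntidiagonal.mem_antidiagonal.1 hp]
  · intro i j h
    have : i + j < K := by
      by_contra h'
      rw [smul_mul_smul_comm, ← pow_add, pow_eq_zero_of_le (by omega) ha, smul_zero] at h
      exact h rfl
    omega

theorem nilEval_X {K : ℕ} {a : A} (ha : a ^ K = 0) :
    nilEval K a (PowerSeries.X : PowerSeries k) = a := by
  rw [← nilEval_eq_of_le (show K ≤ K + 2 by omega) ha, nilEval_apply, Finset.sum_eq_single 1]
  · simp
  · intro b _ hb; simp [PowerSeries.coeff_X, hb]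
  · simp

theorem nilEval_pow {K : ℕ} {a : A} (ha : a ^ K = 0) (f : PowerSeries k) (n : ℕ) :
    nilEval K a (f ^ n) = nilEval K a f ^ n := by
  induction n with
  | zero => simp [nilEval_one ha]
  | succ n ih => rw [pow_succ, pow_succ, nilEval_mul ha, ih]

/-- Multiples of `X ^ K` vanish. -/
theorem nilEval_congr {K : ℕ} (a : A) {f g : PowerSeries k}
    (h : ∀ i < K, PowerSeries.coeff i f = PowerSeries.coeff i g) :
    nilEval K a f = nilEval K a g := by
  rw [nilEval_apply, nilEval_apply]
  exact Finset.sum_congr rfl fun i hi => by rw [h i (by simpa using hi)]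

variable [CharZero k]

/-- The exponential of a nilpotent element. -/
noncomputable def nexp (k : Type u) [Field k] {A : Type*} [Ring A] [Algebra k A]
    (K : ℕ) (a : A) : A :=
  ∑ i ∈ Finset.range K, (1 / (i.factorial : k)) • a ^ i

theorem nexp_eq (K : ℕ) (a : A) : nexp k K a = nilEval K a (PowerSeries.exp k) := by
  simp [nexp, nilEval_apply, PowerSeries.coeff_exp]

theorem nexp_map {B : Type*} [Ring B] [Algebra k B] (φ : A →ₐ[k] B) (K : ℕ) (a : A) :
    φ (nexp k K a) = nexp k K (φ a) := by
  simp [nexp]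

theorem nexp_mul_neg {K : ℕ} {a : A} (ha : a ^ K = 0) : nexp k K a * nexp k K (-a) = 1 := by
  have : nexp k K (-a) = nilEval K a (PowerSeries.evalNegHom (PowerSeries.exp k)) := by
    rw [nexp, nilEval_apply]
    refine Finset.sum_congr rfl fun i _ => ?_
    rw [PowerSeries.evalNegHom, PowerSeries.coeff_rescale, PowerSeries.coeff_exp, neg_pow a,
      mul_smul, ← smul_comm]
    congr 1
    · simp
    · rcases neg_one_pow_eq_or k i with h | h <;> rcases Nat.even_or_odd i with h' | h' <;>
        simp [h'.neg_one_pow]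
  rw [this, nexp_eq, ← nilEval_mul ha, PowerSeries.exp_mul_exp_neg_eq_one, nilEval_one ha]

theorem nexp_neg_mul {K : ℕ} {a : A} (ha : a ^ K = 0) : nexp k K (-a) * nexp k K a = 1 := by
  have := nexp_mul_neg (k := k) (a := -a) (K := K) (by rw [neg_pow, ha, mul_zero])
  rwa [neg_neg] at this

/-- The power series `(e^z - 1)/z`. -/
noncomputable def expQuot (k : Type u) [Field k] : PowerSeries k :=
  PowerSeries.mk fun m => 1 / ((m + 1).factorial : k)

theorem X_mul_expQuot : PowerSeries.X * expQuot k = PowerSeries.exp k - 1 := by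
  ext n
  cases n with
  | zero => simp
  | succ n =>
    rw [PowerSeries.coeff_succ_X_mul, expQuot, PowerSeries.coeff_mk]
    simp [PowerSeries.coeff_exp, PowerSeries.coeff_one]

theorem expQuot_mul_inv : expQuot k * (expQuot k)⁻¹ = 1 :=
  PowerSeries.mul_inv_cancel _ (by simp [expQuot, ← PowerSeries.coeff_zero_eq_constantCoeff_apply])

/-- `z / (e^z - 1) = ∑ (-1)^n (e^z - 1)^n / (n + 1)`, up to order `K`. -/
theorem coeff_expQuot_inv {K i : ℕ} (hi : i < K) :
    PowerSeries.coeff i (expQuot k)⁻¹ = PowerSeries.coeff i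
      (∑ n ∈ Finset.range K, ((-1) ^ n / (n + 1) : k) • (PowerSeries.exp k - 1) ^ n) := by
  set U := PowerSeries.exp k - 1 with hU
  set ψ := ∑ n ∈ Finset.range K, ((-1) ^ n / (n + 1) : k) • U ^ n with hψ
  have hUX : U = PowerSeries.X * expQuot k := X_mul_expQuot.symm
  have hdU : PowerSeries.derivative k U = 1 + U := by
    simp [hU, PowerSeries.derivative_exp]
  -- U ψ is the truncated logarithm of 1 + U. Since U' = 1 + U, its derivative is a telescoping
  -- geometric sum; as X divides U, it follows that U ψ agrees with X through order K.
  have hd : PowerSeries.derivative k (U * ψ) = 1 - (-U) ^ K := by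
    rw [← mul_neg_geom_sum, hψ, Finset.mul_sum, map_sum, Finset.mul_sum]
    refine Finset.sum_congr rfl fun n _ => ?_
    rw [mul_smul_comm, ← pow_succ', Derivation.map_smul, Derivation.leibniz_pow, hdU, neg_pow U]
    have hn : (n + 1 : k) ≠ 0 := by exact_mod_cast Nat.succ_ne_zero n
    simp only [Nat.add_sub_cancel, smul_eq_mul, ← Nat.cast_smul_eq_nsmul k, smul_smul]
    push_cast
    rw [div_mul_cancel₀ _ hn]
    rcases neg_one_pow_eq_or k n with h | h <;> rcases Nat.even_or_odd n with h' | h' <;>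
      simp [h'.neg_one_pow] <;> ring
  have h1 : ∀ j < K + 1, PowerSeries.coeff j (U * ψ) = PowerSeries.coeff j PowerSeries.X := by
    intro j hj
    cases j with
    | zero => simp [hUX]
    | succ j =>
      have h2 := congrArg (PowerSeries.coeff j) hd
      have h3 : PowerSeries.coeff j ((-U) ^ K) = 0 := by
        rw [hUX, ← mul_neg, mul_pow, PowerSeries.coeff_X_pow_mul', if_neg (by omega)]
      rw [PowerSeries.coeff_derivative, map_sub, h3, sub_zero] at h2
      have hn : (j + 1 : k) ≠ 0 := by exact_mod_cast Nat.succ_ne_zero j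
      rw [PowerSeries.coeff_X]
      rw [PowerSeries.coeff_one] at h2
      by_cases hj0 : j = 0
      · subst hj0; simpa using h2
      · rw [if_neg hj0] at h2
        simpa [hj0, hn] using h2
  -- Cancelling the factor X of U = X * `expQuot` costs one order.
  have h4 : ∀ j < K, PowerSeries.coeff j (expQuot k * ψ) = PowerSeries.coeff j 1 := by
    intro j hj
    have := h1 (j + 1) (by omega)
    rw [hUX, mul_assoc, PowerSeries.coeff_succ_X_mul] at this
    rw [this, PowerSeries.coeff_X, PowerSeries.coeff_one]
    simp
  have h5 : ψ - (expQuot k)⁻¹ = (expQuot k)⁻¹ * (expQuot k * ψ - 1) := by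
    rw [mul_sub, ← mul_assoc, mul_comm _ (expQuot k), expQuot_mul_inv]; simp
  have h6 : PowerSeries.coeff i (ψ - (expQuot k)⁻¹) = 0 := by
    rw [h5, PowerSeries.coeff_mul]
    refine Finset.sum_eq_zero fun p hp => ?_
    rw [map_sub, h4 _ (by have := Finset.HasAntidiagonal.mem_antidiagonal.1 hp; omega), sub_self, mul_zero]
  rw [map_sub, sub_eq_zero] at h6
  exact h6.symm

/-- The inner derivation `w ↦ Z w - w Z`. -/
noncomputable def adEnd (k : Type u) [Field k] {A : Type*} [Ring A] [Algebra k A] (Z : A) :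
    Module.End k A :=
  LinearMap.mulLeft k Z - LinearMap.mulRight k Z

theorem adEnd_apply (Z w : A) : adEnd k Z w = Z * w - w * Z := rfl

/-- ad Z is the difference of left and right multiplication by Z, which commute and are both killed
by the N-th power. -/
theorem adEnd_pow_eq_zero {N K : ℕ} (h : 2 * N ≤ K) {Z : A} (hZ : Z ^ N = 0) :
    adEnd k Z ^ K = 0 := by
  rw [adEnd, sub_eq_add_neg]
  refine Commute.add_pow_eq_zero_of_add_le_succ_of_pow_eq_zero (m := N) (n := N) ?_ ?_ ?_
    (by omega)
  · exact (show Commute (LinearMap.mulLeft k Z : Module.End k A) (LinearMap.mulRight k Z) from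
      LinearMap.commute_mulLeft_right Z Z).neg_right
  · rw [LinearMap.pow_mulLeft, hZ]; ext; simp
  · change (-(LinearMap.mulRight k Z : Module.End k A)) ^ N = 0
    refine (neg_pow (LinearMap.mulRight k Z : Module.End k A) N).trans ?_
    rw [LinearMap.pow_mulRight, hZ]; ext; simp

/-- A derivation of a power. -/
theorem derivation_pow (D : A →+ A) (hD : ∀ a b, D (a * b) = D a * b + a * D b) (Z : A) (n : ℕ) :
    D (Z ^ n) = ∑ p ∈ Finset.HasAntidiagonal.antidiagonal n,
      (n.choose (p.1 + 1) : k) • ((adEnd k Z ^ p.1) (D Z) * Z ^ (p.2 - 1)) := by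
  induction n with
  | zero =>
    have : D 1 = 0 := by simpa using hD 1 1
    simp [this]
  | succ n ih =>
    -- The summand with p.2 = 0 carries the binomial coefficient n choose (n + 1) = 0, so the
    -- truncated exponent p.2 - 1 never matters.
    have e1 : ∀ (n : ℕ), ∑ p ∈ Finset.HasAntidiagonal.antidiagonal (n + 1), ((n + 1).choose (p.1 + 1) : k) •
        ((adEnd k Z ^ p.1) (D Z) * Z ^ (p.2 - 1)) =
        ∑ p ∈ Finset.HasAntidiagonal.antidiagonal n, ((n + 1).choose (p.1 + 1) : k) •
        ((adEnd k Z ^ p.1) (D Z) * Z ^ p.2) := by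
      intro n
      rw [Finset.Nat.sum_antidiagonal_succ']
      simp
    rw [e1, pow_succ', hD]
    -- Pascal's rule. Reindexing the first half isolates D Z * Z ^ n; the remaining terms pair up as
    -- ad Z u + u Z = Z u into Z * D (Z ^ n).
    have e2 : ∀ p ∈ Finset.HasAntidiagonal.antidiagonal n, ((n + 1).choose (p.1 + 1) : k) •
        ((adEnd k Z ^ p.1) (D Z) * Z ^ p.2) = (n.choose p.1 : k) •
        ((adEnd k Z ^ p.1) (D Z) * Z ^ p.2) + (n.choose (p.1 + 1) : k) •
        ((adEnd k Z ^ p.1) (D Z) * Z ^ p.2) := by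
      intro p _
      rw [Nat.choose_succ_succ]; push_cast; rw [add_smul]
    rw [Finset.sum_congr rfl e2, Finset.sum_add_distrib]
    have e3 : ∑ p ∈ Finset.HasAntidiagonal.antidiagonal n, (n.choose p.1 : k) •
        ((adEnd k Z ^ p.1) (D Z) * Z ^ p.2) = D Z * Z ^ n +
        ∑ p ∈ Finset.HasAntidiagonal.antidiagonal n, (n.choose (p.1 + 1) : k) •
        ((adEnd k Z ^ (p.1 + 1)) (D Z) * Z ^ (p.2 - 1)) := by
      cases n with
      | zero => simp
      | succ n =>
        rw [Finset.Nat.sum_antidiagonal_succ, Finset.Nat.sum_antidiagonal_succ']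
        simp
    rw [e3, add_assoc, ← Finset.sum_add_distrib]
    congr 1
    rw [ih, Finset.mul_sum]
    refine Finset.sum_congr rfl fun p hp => ?_
    rw [mul_smul_comm, ← smul_add, pow_succ', Module.End.mul_apply, adEnd_apply]
    rcases Nat.eq_zero_or_pos p.2 with h0 | h0
    · have : p.1 = n := by have := Finset.HasAntidiagonal.mem_antidiagonal.1 hp; omega
      simp [this]
    · congr 1
      obtain ⟨q, hq⟩ : ∃ q, p.2 = q + 1 := ⟨p.2 - 1, by omega⟩
      rw [hq, Nat.add_sub_cancel, pow_succ']
      noncomm_ring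

/-- The derivative of the exponential. -/
theorem derivation_nexp {N K : ℕ} (h : 2 * N ≤ K) (D : A →ₗ[k] A)
    (hD : ∀ a b, D (a * b) = D a * b + a * D b) {Z : A} (hZ : Z ^ N = 0) :
    D (nexp k K Z) = nilEval K (adEnd k Z) (expQuot k) (D Z) * nexp k K Z := by
  -- The truncation is enlarged so that, after one order is lost to the derivative, the triangle i +
  -- j < 2 K contains the whole square i, j < K.
  have hK : nexp k K Z = nexp k (2 * K + 1) Z := by
    rw [nexp_eq, nexp_eq]
    exact (nilEval_eq_of_le (by omega) (pow_eq_zero_of_le (by omega) hZ) _).symm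
  conv_lhs => rw [hK]
  rw [nexp, map_sum]
  have e1 : ∀ n ∈ Finset.range (2 * K + 1), D ((1 / (n.factorial : k)) • Z ^ n) =
      ∑ p ∈ Finset.HasAntidiagonal.antidiagonal n, (if p.2 = 0 then 0 else
        (1 / ((p.1 + 1).factorial : k)) • (adEnd k Z ^ p.1) (D Z) *
        (1 / ((p.2 - 1).factorial : k)) • Z ^ (p.2 - 1)) := by
    intro n _
    have := derivation_pow (k := k) D.toAddMonoidHom hD Z n
    rw [map_smul]
    simp only [LinearMap.toAddMonoidHom_coe] at this
    rw [this, Finset.smul_sum]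
    refine Finset.sum_congr rfl fun p hp => ?_
    have hp' := Finset.HasAntidiagonal.mem_antidiagonal.1 hp
    split_ifs with h0
    · rw [Nat.choose_eq_zero_of_lt (by omega)]; simp
    · rw [smul_smul, smul_mul_smul_comm]
      congr 1
      have hle : p.1 + 1 ≤ n := by omega
      have := Nat.choose_mul_factorial_mul_factorial hle
      have h2 : n - (p.1 + 1) = p.2 - 1 := by omega
      rw [h2] at this
      have f1 : (n.factorial : k) ≠ 0 := by exact_mod_cast n.factorial_ne_zero
      have f2 : ((p.1 + 1).factorial : k) ≠ 0 := by exact_mod_cast (p.1 + 1).factorial_ne_zero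
      have f3 : ((p.2 - 1).factorial : k) ≠ 0 := by exact_mod_cast (p.2 - 1).factorial_ne_zero
      rw [div_mul_eq_mul_div, one_mul, div_mul_div_comm, div_eq_div_iff f1 (mul_ne_zero f2 f3)]
      rw [one_mul, one_mul]
      exact_mod_cast (by rw [← this]; ring)
  rw [Finset.sum_congr rfl e1, Finset.sum_range_succ']
  have e2 : ∀ n ∈ Finset.range (2 * K), (∑ p ∈ Finset.HasAntidiagonal.antidiagonal (n + 1), (if p.2 = 0 then 0 else
        (1 / ((p.1 + 1).factorial : k)) • (adEnd k Z ^ p.1) (D Z) *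
        (1 / ((p.2 - 1).factorial : k)) • Z ^ (p.2 - 1))) =
      ∑ p ∈ Finset.HasAntidiagonal.antidiagonal n, (1 / ((p.1 + 1).factorial : k)) • (adEnd k Z ^ p.1) (D Z) *
        (1 / (p.2.factorial : k)) • Z ^ p.2 := by
    intro n _
    rw [Finset.Nat.sum_antidiagonal_succ']
    simp
  rw [Finset.sum_congr rfl e2, sum_antidiagonal_eq_sum_range (K := K)
    (F := fun i j => (1 / ((i + 1).factorial : k)) • (adEnd k Z ^ i) (D Z) *
        (1 / (j.factorial : k)) • Z ^ j)]
  · simp [nilEval_apply, nexp, expQuot, Finset.sum_mul_sum]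
  · intro i j hij
    have h1 : i < K := by
      by_contra hi
      rw [adEnd_pow_eq_zero (k := k) (N := N) (K := i) (by omega) hZ] at hij
      simp at hij
    have h2 : j < K := by
      by_contra hj
      rw [pow_eq_zero_of_le (n := j) (by omega) hZ] at hij
      simp at hij
    omega

/-- Conjugation by e^Z is e^{ad Z}: apply `derivation_nexp` to the derivation [·, w], whose value at
Z is ad Z w, and use that `expQuot` times z is e^z - 1. -/
theorem nexp_adEnd {N K : ℕ} (h : 2 * N ≤ K) {Z : A} (hZ : Z ^ N = 0) (w : A) :
    nexp k K (adEnd k Z) w * nexp k K Z = nexp k K Z * w := by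
  have h1 := derivation_nexp (k := k) h (-adEnd k w) (fun a b => by
    simp only [LinearMap.neg_apply, adEnd_apply]; noncomm_ring) hZ
  have had := adEnd_pow_eq_zero (k := k) h hZ
  have h2 : (-adEnd k w) Z = adEnd k Z w := by simp [adEnd_apply]
  have h3 : nilEval K (adEnd k Z) (expQuot k) (adEnd k Z w) = nexp k K (adEnd k Z) w - w := by
    have : nilEval K (adEnd k Z) (expQuot k * PowerSeries.X) =
        nexp k K (adEnd k Z) - (1 : Module.End k A) := by
      rw [mul_comm, X_mul_expQuot, map_sub, nilEval_one had, nexp_eq]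
    rw [nilEval_mul had, nilEval_X had] at this
    exact congrArg (fun f : Module.End k A => f w) this
  rw [h2, h3] at h1
  simp only [LinearMap.neg_apply, adEnd_apply, sub_mul] at h1
  rw [neg_sub] at h1
  have := congrArg (· + w * nexp k K Z) h1
  simpa using this.symm

/-- The logarithm of the exponential. -/
theorem log_nexp {K : ℕ} {a : A} (ha : a ^ K = 0) :
    ∑ n ∈ Finset.range K, ((-1) ^ n / (n + 1) : k) • (nexp k K a - 1) ^ (n + 1) = a := by
  have h1 : nilEval K a (expQuot k)⁻¹ =
      ∑ n ∈ Finset.range K, ((-1) ^ n / (n + 1) : k) • (nexp k K a - 1) ^ n := by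
    rw [nilEval_congr a fun i hi => coeff_expQuot_inv hi, map_sum]
    refine Finset.sum_congr rfl fun n _ => ?_
    rw [map_smul, nilEval_pow ha, map_sub, nilEval_one ha, nexp_eq]
  have h2 : nexp k K a - 1 = nilEval K a (expQuot k * PowerSeries.X) := by
    rw [mul_comm, X_mul_expQuot, map_sub, nilEval_one ha, nexp_eq]
  have h3 : nilEval K a ((expQuot k)⁻¹ * (expQuot k * PowerSeries.X)) = a := by
    rw [← mul_assoc, mul_comm _ (expQuot k), expQuot_mul_inv, one_mul, nilEval_X ha]
  rw [nilEval_mul ha, h1, ← h2, Finset.sum_mul] at h3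
  simpa only [smul_mul_assoc, ← pow_succ] using h3

theorem nexp_injective {K : ℕ} {a b : A} (ha : a ^ K = 0) (hb : b ^ K = 0)
    (h : nexp k K a = nexp k K b) : a = b := by
  rw [← log_nexp (k := k) ha, ← log_nexp (k := k) hb, h]

end NilpotentCalculus

end DeformationGroup
namespace DeformationGroup

/-! ## Solving the equation of the time-ordered exponential in a Lie algebra -/

section Magnus

variable {k : Type u} [Field k] {L : Type*} [AddCommGroup L] [Module k L]

/-- The Cauchy product of two sequences. -/
def cauchy (br : L → L → L) (u v : ℕ → L) : ℕ → L := fun m =>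
  ∑ p ∈ Finset.HasAntidiagonal.antidiagonal m, br (u p.1) (v p.2)

theorem cauchy_congr (br : L → L → L) {u u' v v' : ℕ → L} {m : ℕ}
    (hu : ∀ i ≤ m, u i = u' i) (hv : ∀ i ≤ m, v i = v' i) :
    ∀ i ≤ m, cauchy br u v i = cauchy br u' v' i := by
  intro i hi
  refine Finset.sum_congr rfl fun p hp => ?_
  have := Finset.HasAntidiagonal.mem_antidiagonal.1 hp
  rw [hu _ (by omega), hv _ (by omega)]

theorem cauchy_iterate_congr (br : L → L → L) {u u' v : ℕ → L} {m : ℕ}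
    (hu : ∀ i ≤ m, u i = u' i) (n : ℕ) :
    ∀ i ≤ m, (cauchy br u)^[n] v i = (cauchy br u')^[n] v i := by
  induction n with
  | zero => intros; rfl
  | succ n ih =>
    rw [Function.iterate_succ_apply', Function.iterate_succ_apply']
    exact cauchy_congr br hu ih

/-- One step of the recursion for `magnus`. -/
def magnusStep (br : L → L → L) (β : ℕ → k) (a X : ℕ → L) : ℕ → L
  | 0 => 0
  | m + 1 => (1 / (m + 1) : k) • ∑ n ∈ Finset.range (m + 1), β n • (cauchy br X)^[n] a m

/-- The coefficients of the solution of `X' = ∑ βₙ ad_X ^ n (a)`, `X 0 = 0`. -/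
def magnus (br : L → L → L) (β : ℕ → k) (a : ℕ → L) (m : ℕ) : L :=
  (magnusStep br β a)^[m + 1] 0 m

/-- Each step of the recursion gains one order of accuracy, so the iteration stabilises coefficient
by coefficient and its limit is a fixed point. -/
theorem magnusStep_congr (br : L → L → L) (β : ℕ → k) (a : ℕ → L) {X X' : ℕ → L} {m : ℕ}
    (h : ∀ i < m, X i = X' i) : ∀ i < m + 1, magnusStep br β a X i = magnusStep br β a X' i := by
  intro i hi
  cases i with
  | zero => rfl
  | succ i =>
    simp only [magnusStep]
    congr 1
    refine Finset.sum_congr rfl fun n _ => ?_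
    rw [cauchy_iterate_congr br (m := i) (fun j hj => h j (by omega)) n i le_rfl]

theorem magnusStep_iterate (br : L → L → L) (β : ℕ → k) (a : ℕ → L) (r : ℕ) :
    ∀ i < r, (magnusStep br β a)^[r] 0 i = magnus br β a i := by
  have h1 : ∀ r, ∀ i < r, (magnusStep br β a)^[r + 1] 0 i = (magnusStep br β a)^[r] 0 i := by
    intro r
    induction r with
    | zero => intro i hi; omega
    | succ r ih =>
      intro i hi
      have := magnusStep_congr br β a ih i hi
      rwa [← Function.iterate_succ_apply' (magnusStep br β a),
        ← Function.iterate_succ_apply' (magnusStep br β a)] at this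
  induction r with
  | zero => intro i hi; omega
  | succ r ih =>
    intro i hi
    rcases Nat.lt_succ_iff_lt_or_eq.1 hi with h | h
    · rw [h1 r i h, ih i h]
    · subst h; rfl

theorem magnus_zero (br : L → L → L) (β : ℕ → k) (a : ℕ → L) : magnus br β a 0 = 0 := rfl

theorem magnus_succ (br : L → L → L) (β : ℕ → k) (a : ℕ → L) (m : ℕ) :
    magnus br β a (m + 1) = (1 / (m + 1) : k) •
      ∑ n ∈ Finset.range (m + 1), β n • (cauchy br (magnus br β a))^[n] a m := by
  have := magnusStep_congr br β a (magnusStep_iterate br β a (m + 1)) (m + 1) (by omega)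
  rw [← Function.iterate_succ_apply' (magnusStep br β a)] at this
  exact this

theorem cauchy_iterate_mem {br : L → L → L} {J : ℕ → Submodule k L}
    (hJ : ∀ i j, ∀ a ∈ J i, ∀ b ∈ J j, br a b ∈ J (i + j)) {X a : ℕ → L}
    {m : ℕ} (hX : ∀ i ≤ m, X i ∈ J i) (ha : ∀ i, a i ∈ J (i + 1)) (n : ℕ) :
    ∀ i ≤ m, (cauchy br X)^[n] a i ∈ J (i + 1) := by
  induction n with
  | zero => intro i _; exact ha i
  | succ n ih =>
    intro i hi
    rw [Function.iterate_succ_apply']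
    refine Submodule.sum_mem _ fun p hp => ?_
    have hp' := Finset.HasAntidiagonal.mem_antidiagonal.1 hp
    have := hJ _ _ _ (hX p.1 (by omega)) _ (ih p.2 (by omega))
    rwa [show p.1 + (p.2 + 1) = i + 1 by omega] at this

theorem magnus_mem {br : L → L → L} (β : ℕ → k) {J : ℕ → Submodule k L}
    (hJ : ∀ i j, ∀ a ∈ J i, ∀ b ∈ J j, br a b ∈ J (i + j)) {a : ℕ → L}
    (ha : ∀ i, a i ∈ J (i + 1)) (m : ℕ) : magnus br β a m ∈ J m := by
  induction m using Nat.strong_induction_on with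
  | _ m ih =>
    cases m with
    | zero => exact Submodule.zero_mem _
    | succ m =>
      rw [magnus_succ]
      refine Submodule.smul_mem _ _ (Submodule.sum_mem _ fun n _ => Submodule.smul_mem _ _ ?_)
      exact cauchy_iterate_mem hJ (fun i hi => ih i (by omega)) ha n m le_rfl

/-- X has no constant term, so every bracket with it raises the order by one. This is why the sum
over n in `magnus_succ` may stop at m. -/
theorem cauchy_iterate_eq_zero {br : L → L → L} (h0 : ∀ b, br 0 b = 0) (h0' : ∀ b, br b 0 = 0)
    {X : ℕ → L} (hX : X 0 = 0) (a : ℕ → L) (n : ℕ) : ∀ i < n, (cauchy br X)^[n] a i = 0 := by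
  induction n with
  | zero => intro i hi; omega
  | succ n ih =>
    intro i hi
    rw [Function.iterate_succ_apply']
    refine Finset.sum_eq_zero fun p hp => ?_
    have hp' := Finset.HasAntidiagonal.mem_antidiagonal.1 hp
    rcases Nat.eq_zero_or_pos p.1 with h | h
    · rw [h, hX, h0]
    · rw [ih p.2 (by omega), h0']

end Magnus

section Polynomials

open Polynomial

variable {k : Type u} [Field k] [CharZero k] {A : Type*} [Ring A] [Algebra k A]

/-- The commutator. -/
def comm {A : Type*} [Ring A] (a b : A) : A := a * b - b * a

theorem coeff_adEnd_pow (P Q : A[X]) (n : ℕ) :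
    (((adEnd k P) ^ n) Q).coeff = (cauchy comm P.coeff)^[n] Q.coeff := by
  induction n with
  | zero => rfl
  | succ n ih =>
    rw [Function.iterate_succ_apply', ← ih, pow_succ', Module.End.mul_apply, adEnd_apply]
    funext m
    rw [coeff_sub, coeff_mul, coeff_mul, cauchy]
    rw [← Finset.Nat.sum_antidiagonal_swap (n := m) (f := fun p => (((adEnd k P) ^ n) Q).coeff p.1 * P.coeff p.2),
      ← Finset.sum_sub_distrib]
    rfl

end Polynomials

end DeformationGroup
namespace DeformationGroup

/-! ### Linear differential equations over an algebra with a nilpotent filtration -/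

section Polynomials

open Polynomial

variable {k : Type u} [Field k] [CharZero k] {A : Type*} [Ring A] [Algebra k A]

/-- The derivative of polynomials with coefficients in a noncommutative algebra. -/
noncomputable def polyDeriv (k : Type u) [Field k] (A : Type*) [Ring A] [Algebra k A] :
    A[X] →ₗ[k] A[X] :=
  (derivative : A[X] →ₗ[A] A[X]).restrictScalars k

theorem polyDeriv_apply (P : A[X]) : polyDeriv k A P = derivative P := rfl

/-- A linear differential equation has at most one solution with given initial value. -/
theorem poly_ode_unique (k : Type u) [Field k] [CharZero k] [Algebra k A] (a P Q : A[X]) (hP : derivative P = a * P) (hQ : derivative Q = a * Q)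
    (h0 : P.coeff 0 = Q.coeff 0) : P = Q := by
  ext m
  induction m using Nat.strong_induction_on with
  | _ m ih =>
    cases m with
    | zero => exact h0
    | succ m =>
      have h1 := congrArg (fun R => coeff R m) hP
      have h2 := congrArg (fun R => coeff R m) hQ
      simp only [coeff_derivative, coeff_mul] at h1 h2
      have h3 : P.coeff (m + 1) * ((m : A) + 1) = Q.coeff (m + 1) * ((m : A) + 1) := by
        rw [h1, h2]
        refine Finset.sum_congr rfl fun p hp => ?_
        rw [ih p.2 (by have := Finset.HasAntidiagonal.mem_antidiagonal.1 hp; omega)]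
      have hc : ((m : A) + 1) = algebraMap k A (m + 1) := by simp
      have hne : (m + 1 : k) ≠ 0 := by exact_mod_cast Nat.succ_ne_zero m
      rw [hc, ← Algebra.commutes, ← Algebra.commutes, ← Algebra.smul_def, ← Algebra.smul_def] at h3
      exact smul_right_injective _ hne h3

/-- Evaluation at a scalar. -/
noncomputable def polyEval (A : Type*) [Ring A] [Algebra k A] (c : k) : A[X] →ₐ[k] A :=
  eval₂AlgHom (AlgHom.id k A) (algebraMap k A c) fun a => (Algebra.commutes c a).symm

theorem polyEval_monomial (c : k) (m : ℕ) (a : A) :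
    polyEval A c (monomial m a) = c ^ m • a := by
  change eval₂ (RingHom.id A) (algebraMap k A c) (monomial m a) = _
  rw [eval₂_monomial, ← map_pow, ← Algebra.commutes, Algebra.smul_def]
  rfl

theorem polyEval_zero (P : A[X]) : polyEval A (0 : k) P = P.coeff 0 := by
  induction P using Polynomial.induction_on' with
  | add p q hp hq => simp [hp, hq]
  | monomial n a => rw [polyEval_monomial, coeff_monomial]; cases n <;> simp

/-- A multiplicative filtration of an algebra, with `J N = 0`. -/
structure NilFiltration (J : ℕ → Submodule k A) (N : ℕ) : Prop where
  mul_mem : ∀ i j, ∀ a ∈ J i, ∀ b ∈ J j, a * b ∈ J (i + j)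
  anti : Antitone J
  eq_bot : J N = ⊥
  pos : 0 < N

namespace NilFiltration

variable {J : ℕ → Submodule k A} {N : ℕ}

theorem eq_zero (hJ : NilFiltration J N) {m : ℕ} (h : N ≤ m) {a : A} (ha : a ∈ J m) : a = 0 := by
  have := hJ.anti h ha
  rwa [hJ.eq_bot, Submodule.mem_bot] at this

theorem pow_mem (hJ : NilFiltration J N) {a : A} (ha : a ∈ J 1) (n : ℕ) : a ^ (n + 1) ∈ J (n + 1) := by
  induction n with
  | zero => simpa using ha
  | succ n ih => rw [pow_succ]; exact hJ.mul_mem _ _ _ ih _ ha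

theorem pow_eq_zero (hJ : NilFiltration J N) {a : A} (ha : a ∈ J 1) : a ^ N = 0 := by
  obtain ⟨n, rfl⟩ : ∃ n, N = n + 1 := ⟨N - 1, by have := hJ.pos; omega⟩
  exact hJ.eq_zero le_rfl (hJ.pow_mem ha n)

theorem comm_mem (hJ : NilFiltration J N) (i j : ℕ) (a : A) (ha : a ∈ J i) (b : A) (hb : b ∈ J j) :
    comm a b ∈ J (i + j) :=
  Submodule.sub_mem _ (hJ.mul_mem _ _ _ ha _ hb) (by
    rw [add_comm]; exact hJ.mul_mem _ _ _ hb _ ha)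

/-- The coefficientwise filtration on polynomials. -/
def poly (J : ℕ → Submodule k A) (i : ℕ) : Submodule k A[X] where
  carrier := {P | ∀ m, P.coeff m ∈ J i}
  add_mem' hP hQ m := by rw [coeff_add]; exact Submodule.add_mem _ (hP m) (hQ m)
  zero_mem' m := by rw [coeff_zero]; exact Submodule.zero_mem _
  smul_mem' c P hP m := by rw [coeff_smul]; exact Submodule.smul_mem _ _ (hP m)

theorem nilFiltration_poly (hJ : NilFiltration J N) : NilFiltration (poly J) N where
  mul_mem i j P hP Q hQ m := by
    rw [coeff_mul]
    exact Submodule.sum_mem _ fun p _ => hJ.mul_mem _ _ _ (hP _) _ (hQ _)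
  anti i j h P hP m := hJ.anti h (hP m)
  eq_bot := by
    refine (Submodule.eq_bot_iff _).2 fun P hP => ?_
    ext m
    have := hP m
    rwa [hJ.eq_bot, Submodule.mem_bot] at this
  pos := hJ.pos

theorem monomial_mem {i : ℕ} {a : A} (ha : a ∈ J i) (m : ℕ) : monomial m a ∈ poly J i := by
  intro n
  rw [coeff_monomial]
  split_ifs
  · exact ha
  · exact Submodule.zero_mem _

end NilFiltration

/-- The polynomial solving the equation of the time-ordered exponential of `a`. -/
noncomputable def magnusPoly (k : Type u) [Field k] {A : Type*} [Ring A] [Algebra k A] (N : ℕ)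
    (a : ℕ → A) : A[X] :=
  ∑ m ∈ Finset.range N, monomial m (magnus comm (fun n => PowerSeries.coeff n (expQuot k)⁻¹) a m)

variable {J : ℕ → Submodule k A} {N K : ℕ}

/-- Cutting at N loses nothing: the coefficient of order m lies in J m, which is zero from N on. -/
theorem coeff_magnusPoly (hJ : NilFiltration J N) {a : ℕ → A} (ha : ∀ i, a i ∈ J (i + 1)) (m : ℕ) :
    (magnusPoly k N a).coeff m =
      magnus comm (fun n => PowerSeries.coeff n (expQuot k)⁻¹) a m := by
  rw [magnusPoly, finsetSum_coeff]
  simp only [coeff_monomial, Finset.sum_ite_eq', Finset.mem_range]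
  split_ifs with h
  · rfl
  · exact (hJ.eq_zero (not_lt.1 h) (magnus_mem _ hJ.comm_mem ha m)).symm

theorem magnusPoly_mem (hJ : NilFiltration J N) {a : ℕ → A} (ha : ∀ i, a i ∈ J (i + 1)) :
    magnusPoly k N a ∈ NilFiltration.poly J 1 := by
  intro m
  rw [coeff_magnusPoly hJ ha]
  cases m with
  | zero => exact Submodule.zero_mem _
  | succ m => exact hJ.anti (by omega) (magnus_mem _ hJ.comm_mem ha _)

/-- Coefficient by coefficient this is `magnus_succ`. The two truncations, at K by nilpotency of ad
and at m + 1 by order in the variable, are compared through the common bound K + (m + 1). The series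
z/(e^z - 1) is chosen to cancel the factor (e^z - 1)/z produced by `derivation_nexp`. -/
theorem derivative_magnusPoly (hJ : NilFiltration J N) (hK : 2 * N ≤ K) {a : A[X]}
    (ha : ∀ i, a.coeff i ∈ J (i + 1)) :
    derivative (magnusPoly k N a.coeff) =
      nilEval K (adEnd k (magnusPoly k N a.coeff)) (expQuot k)⁻¹ a := by
  set Z := magnusPoly k N a.coeff with hZ
  have hc : Z.coeff = magnus comm (fun n => PowerSeries.coeff n (expQuot k)⁻¹) a.coeff :=
    funext fun m => coeff_magnusPoly hJ ha m
  have hnil := adEnd_pow_eq_zero (k := k) hK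
    (hJ.nilFiltration_poly.pow_eq_zero (magnusPoly_mem hJ ha))
  ext m
  rw [← nilEval_eq_of_le (show K ≤ K + (m + 1) by omega) hnil, nilEval_apply,
    coeff_derivative, LinearMap.sum_apply, finsetSum_coeff]
  simp only [LinearMap.smul_apply, coeff_smul, coeff_adEnd_pow]
  rw [← hZ, hc, magnus_succ]
  have hne : (m + 1 : k) ≠ 0 := by exact_mod_cast Nat.succ_ne_zero m
  have : ((m : A) + 1) = algebraMap k A (m + 1) := by simp
  rw [this, ← Algebra.commutes, ← Algebra.smul_def, smul_smul, mul_one_div_cancel hne, one_smul]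
  refine Finset.sum_subset (Finset.range_mono (by omega)) fun n _ hn => ?_
  rw [cauchy_iterate_eq_zero (by simp [comm]) (by simp [comm]) (magnus_zero _ _ _) _ _ _
    (by simp at hn; omega), smul_zero]

/-- The time-ordered exponential is the exponential of `magnusPoly`. -/
theorem derivative_nexp_magnusPoly (hJ : NilFiltration J N) (hK : 2 * N ≤ K) {a : A[X]}
    (ha : ∀ i, a.coeff i ∈ J (i + 1)) :
    derivative (nexp k K (magnusPoly k N a.coeff)) = a * nexp k K (magnusPoly k N a.coeff) := by
  have hZ := hJ.nilFiltration_poly.pow_eq_zero (magnusPoly_mem (k := k) hJ ha)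
  rw [← polyDeriv_apply (k := k), derivation_nexp hK (polyDeriv k A) (fun P Q => derivative_mul) hZ,
    polyDeriv_apply, derivative_magnusPoly hJ hK ha, ← Module.End.mul_apply,
    ← nilEval_mul (adEnd_pow_eq_zero hK hZ), expQuot_mul_inv,
    nilEval_one (adEnd_pow_eq_zero hK hZ), Module.End.one_apply]

theorem coeff_zero_nexp {P : A[X]} (h0 : P.coeff 0 = 0) (hK : 0 < K) :
    (nexp k K P).coeff 0 = 1 := by
  obtain ⟨K, rfl⟩ : ∃ K', K = K' + 1 := ⟨K - 1, by omega⟩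
  rw [← polyEval_zero (k := k), nexp_map, polyEval_zero, h0, nexp, Finset.sum_range_succ']
  simp

/-! ## The Baker–Campbell–Hausdorff formula -/

/-- `e^{t x}` for constant `x`. -/
theorem derivative_nexp_monomial (hJ : NilFiltration J N) (hK : 2 * N ≤ K) {x : A}
    (hx : x ∈ J 1) : derivative (nexp k K (monomial 1 x)) = C x * nexp k K (monomial 1 x) := by
  have hX := hJ.nilFiltration_poly.pow_eq_zero (NilFiltration.monomial_mem hx 1)
  have hK' : K ≠ 0 := by have := hJ.pos; omega
  -- The derivative x of t x commutes with t x, so only the constant term 1 of `expQuot` survives.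
  have h1 : adEnd k (monomial 1 x) (C x) = 0 := by
    rw [adEnd_apply, ← monomial_zero_left, monomial_mul_monomial, monomial_mul_monomial]; simp
  rw [← polyDeriv_apply (k := k), derivation_nexp hK (polyDeriv k A) (fun P Q => derivative_mul) hX,
    polyDeriv_apply, derivative_monomial]
  congr 1
  simp only [Nat.cast_one, mul_one, Nat.sub_self, monomial_zero_left]
  rw [nilEval_apply, LinearMap.sum_apply, Finset.sum_eq_single 0]
  · simp [expQuot]
  · intro i _ hi
    obtain ⟨i, rfl⟩ := Nat.exists_eq_succ_of_ne_zero hi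
    rw [LinearMap.smul_apply, pow_succ, Module.End.mul_apply, h1, map_zero, smul_zero]
  · intro h; simp at h; omega

theorem adEnd_monomial_pow (x w : A) (r j : ℕ) :
    (adEnd k (monomial 1 x) ^ r) (monomial j w) = monomial (r + j) ((adEnd k x ^ r) w) := by
  induction r with
  | zero => simp
  | succ r ih =>
    rw [pow_succ', Module.End.mul_apply, ih, adEnd_apply, monomial_mul_monomial,
      monomial_mul_monomial, pow_succ', Module.End.mul_apply, adEnd_apply, map_sub]
    congr 3 <;> omega

/-- The logarithmic derivative `x + e^{t ad x} y` of `e^{tx} e^{ty}`. -/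
noncomputable def logDeriv (k : Type u) [Field k] {A : Type*} [Ring A] [Algebra k A] (K : ℕ)
    (x y : A) : A[X] :=
  C x + nexp k K (adEnd k (monomial 1 x)) (C y)

theorem logDeriv_mem (hJ : NilFiltration J N) {x y : A} (hx : x ∈ J 1) (hy : y ∈ J 1) (i : ℕ) :
    (logDeriv k K x y).coeff i ∈ J (i + 1) := by
  rw [logDeriv, coeff_add]
  refine Submodule.add_mem _ ?_ ?_
  · rw [coeff_C]; split_ifs with h
    · rw [h]; exact hx
    · exact Submodule.zero_mem _
  · have had : ∀ r, (adEnd k x ^ r) y ∈ J (r + 1) := by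
      intro r
      induction r with
      | zero => exact hy
      | succ r ih =>
        rw [pow_succ', Module.End.mul_apply, add_comm]
        have := hJ.comm_mem _ _ _ hx _ ih
        rwa [add_comm] at this ⊢
    rw [nexp, LinearMap.sum_apply, finsetSum_coeff]
    refine Submodule.sum_mem _ fun r _ => ?_
    rw [LinearMap.smul_apply, coeff_smul, ← monomial_zero_left, adEnd_monomial_pow, coeff_monomial]
    refine Submodule.smul_mem _ _ ?_
    split_ifs with h
    · rw [← h]; exact had r
    · exact Submodule.zero_mem _

/-- Both sides solve P' = a P, P(0) = 1 with a = x + e^{t ad x} y: on the right, e^{tx} y = (e^{t ad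
x} y) e^{tx} by `nexp_adEnd`. -/
theorem nexp_magnusPoly_logDeriv (hJ : NilFiltration J N) (hK : 2 * N ≤ K) {x y : A}
    (hx : x ∈ J 1) (hy : y ∈ J 1) :
    nexp k K (magnusPoly k N (logDeriv k K x y).coeff) =
      nexp k K (monomial 1 x) * nexp k K (monomial 1 y) := by
  have ha := logDeriv_mem (k := k) (K := K) hJ hx hy
  have hK' : 0 < K := by have := hJ.pos; omega
  refine poly_ode_unique k (logDeriv k K x y) _ _ (derivative_nexp_magnusPoly hJ hK ha) ?_ ?_
  · have hX := hJ.nilFiltration_poly.pow_eq_zero (NilFiltration.monomial_mem hx 1)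
    rw [derivative_mul, derivative_nexp_monomial hJ hK hx, derivative_nexp_monomial hJ hK hy,
      logDeriv, add_mul, ← mul_assoc (nexp k K _) (C y), ← nexp_adEnd hK hX]
    simp only [mul_assoc]
  · rw [coeff_zero_nexp (by rw [coeff_magnusPoly hJ ha, magnus_zero]) hK', mul_coeff_zero,
      coeff_zero_nexp (by simp [coeff_monomial]) hK', coeff_zero_nexp (by simp [coeff_monomial]) hK',
      mul_one]

/-- Both sides are conjugations, by e^Z and by e^{tx} e^{ty}, which are equal; the invertible factor
e^Z is then cancelled on the right. -/
theorem nexp_adEnd_magnusPoly (hJ : NilFiltration J N) (hK : 2 * N ≤ K) {x y : A}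
    (hx : x ∈ J 1) (hy : y ∈ J 1) :
    nexp k K (adEnd k (magnusPoly k N (logDeriv k K x y).coeff)) =
      nexp k K (adEnd k (monomial 1 x)) * nexp k K (adEnd k (monomial 1 y)) := by
  have ha := logDeriv_mem (k := k) (K := K) hJ hx hy
  have hB := hJ.nilFiltration_poly
  have hZ := hB.pow_eq_zero (magnusPoly_mem (k := k) hJ ha)
  have hX := hB.pow_eq_zero (NilFiltration.monomial_mem hx 1)
  have hY := hB.pow_eq_zero (NilFiltration.monomial_mem hy 1)
  ext1 w
  have h1 := nexp_adEnd (k := k) hK hZ w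
  have h2 : (nexp k K (adEnd k (monomial 1 x)) * nexp k K (adEnd k (monomial 1 y))) w *
      nexp k K (magnusPoly k N (logDeriv k K x y).coeff) =
      nexp k K (magnusPoly k N (logDeriv k K x y).coeff) * w := by
    rw [nexp_magnusPoly_logDeriv hJ hK hx hy, Module.End.mul_apply, ← mul_assoc,
      nexp_adEnd hK hX, mul_assoc, nexp_adEnd hK hY, mul_assoc]
  have h3 := nexp_mul_neg (k := k) (pow_eq_zero_of_le (n := K) (by omega) hZ)
  have := congrArg (· * nexp k K (-magnusPoly k N (logDeriv k K x y).coeff)) (h1.trans h2.symm)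
  simpa only [mul_assoc, h3, mul_one] using this

end Polynomials

end DeformationGroup
namespace DeformationGroup

/-! ### Dynkin's explicit form of the Baker–Campbell–Hausdorff series -/

section Dynkin

/-- The word `x^{r₀} y^{s₀} x^{r₁} y^{s₁} ⋯`. -/
def bchWord {L : Type*} (x y : L) {n : ℕ} (r : Fin n → ℕ × ℕ) : List L :=
  (List.ofFn fun i => List.replicate (r i).1 x ++ List.replicate (r i).2 y).flatten

theorem bchWord_cons {L : Type*} (x y : L) {n : ℕ} (p : ℕ × ℕ) (r : Fin n → ℕ × ℕ) :
    bchWord x y (Fin.cons p r : Fin (n + 1) → ℕ × ℕ) =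
      List.replicate p.1 x ++ List.replicate p.2 y ++ bchWord x y r := by
  simp [bchWord, List.ofFn_succ]

theorem bchWord_length {L : Type*} (x y : L) {n : ℕ} (r : Fin n → ℕ × ℕ) :
    (bchWord x y r).length = ∑ i, ((r i).1 + (r i).2) := by
  simp [bchWord, List.length_flatten, List.map_ofFn, Function.comp_def, List.sum_ofFn]

theorem bchWord_map {L M : Type*} (f : L → M) (x y : L) {n : ℕ} (r : Fin n → ℕ × ℕ) :
    (bchWord x y r).map f = bchWord (f x) (f y) r := by
  simp [bchWord, List.map_flatten, List.map_ofFn, Function.comp_def]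

theorem nested_cons {L : Type*} [AddCommGroup L] (br : L → L → L) (a : L) {w : List L}
    (hw : w ≠ []) : nested br (a :: w) = br a (nested br w) := by
  cases w with
  | nil => exact absurd rfl hw
  | cons b w => rfl

theorem sum_piFinset_succ {α M : Type*} [DecidableEq α] [AddCommMonoid M] (P : Finset α) (n : ℕ)
    (f : (Fin (n + 1) → α) → M) :
    ∑ r ∈ Fintype.piFinset (fun _ : Fin (n + 1) => P), f r =
      ∑ p ∈ P, ∑ r ∈ Fintype.piFinset (fun _ : Fin n => P), f (Fin.cons p r) := by
  rw [← Finset.sum_product']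
  refine Finset.sum_nbij' (fun r => (r 0, Fin.tail r)) (fun p => Fin.cons p.1 p.2) ?_ ?_ ?_ ?_ ?_
  · intro r hr
    rw [Fintype.mem_piFinset] at hr
    simp only [Finset.mem_product, Fintype.mem_piFinset]
    exact ⟨hr 0, fun i => hr i.succ⟩
  · rintro ⟨p, r⟩ hr
    simp only [Finset.mem_product, Fintype.mem_piFinset] at hr ⊢
    intro i
    refine Fin.cases ?_ (fun j => ?_) i
    · exact hr.1
    · exact hr.2 j
  · intro r _; exact Fin.cons_self_tail r
  · rintro ⟨p, r⟩ _; simp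
  · intro r _; rw [Fin.cons_self_tail]

variable {k : Type u} [Field k] [CharZero k] {A : Type*} [Ring A] [Algebra k A]

theorem nested_replicate_append (x : A) (r : ℕ) {w : List A} (hw : w ≠ []) :
    nested comm (List.replicate r x ++ w) = (adEnd k x ^ r) (nested comm w) := by
  induction r with
  | zero => rfl
  | succ r ih =>
    rw [List.replicate_succ, List.cons_append, nested_cons _ _ (by simp [hw]), ih, pow_succ',
      Module.End.mul_apply, adEnd_apply, comm]

/-- The exponent of the variable records the length of the word, so extracting a coefficient
isolates one degree of the series. -/
theorem nested_monomial (w : List A) :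
    nested comm (w.map (Polynomial.monomial 1)) = Polynomial.monomial w.length (nested comm w) := by
  induction w with
  | nil => simp [nested]
  | cons a w ih =>
    by_cases hw : w = []
    · subst hw; rfl
    · rw [List.map_cons, nested_cons _ _ (by simpa using hw), ih, nested_cons _ _ hw, comm,
        Polynomial.monomial_mul_monomial, Polynomial.monomial_mul_monomial, comm, map_sub,
        List.length_cons, add_comm]

/-- Pairs of exponents. -/
def expPairs (K : ℕ) : Finset (ℕ × ℕ) :=
  {p ∈ Finset.range K ×ˢ Finset.range K | 0 < p.1 + p.2}

/-- The scalar `1 / (r! s!)`. -/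
noncomputable def expCoeff (k : Type u) [Field k] (p : ℕ × ℕ) : k :=
  1 / (p.1.factorial * p.2.factorial : ℕ)

theorem sum_expPairs {M : Type*} [AddCommGroup M] {K : ℕ} (hK : 0 < K) (f : ℕ × ℕ → M) :
    ∑ p ∈ expPairs K, f p =
      ∑ i ∈ Finset.range K, ∑ j ∈ Finset.range K, f (i, j) - f (0, 0) := by
  rw [← Finset.sum_product', expPairs, eq_sub_iff_add_eq, add_comm,
    ← Finset.add_sum_erase _ (fun p : ℕ × ℕ => f (p.1, p.2)) (show (0, 0) ∈ Finset.range K ×ˢ Finset.range K by simp [hK])]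
  congr 1
  refine Finset.sum_congr ?_ fun p _ => rfl
  ext ⟨i, j⟩
  simp only [Finset.mem_filter, Finset.mem_erase, ne_eq, Prod.mk.injEq]
  constructor
  · rintro ⟨h, h'⟩; exact ⟨by omega, h⟩
  · rintro ⟨h, h'⟩; exact ⟨h', by omega⟩

theorem nexp_mul_nexp_sub_one {K : ℕ} (hK : 0 < K) (a b : A) :
    nexp k K a * nexp k K b - 1 = ∑ p ∈ expPairs K, expCoeff k p • (a ^ p.1 * b ^ p.2) := by
  rw [sum_expPairs hK, nexp, nexp, Finset.sum_mul_sum]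
  congr 1
  · refine Finset.sum_congr rfl fun i _ => Finset.sum_congr rfl fun j _ => ?_
    rw [smul_mul_smul_comm, expCoeff]; push_cast; rw [one_div_mul_one_div]
  · simp [expCoeff]

/-- Among the words x^i y^j only x and the words x^i y contribute, since a right-normed bracket
ending in a repeated letter vanishes. This puts the innermost factor of Dynkin's formula in the same
shape as the others. -/
theorem logDeriv_eq_sum {K : ℕ} (hK : 2 ≤ K) (x y : A) :
    x + nexp k K (adEnd k x) y = ∑ p ∈ expPairs K, expCoeff k p •
      nested comm (List.replicate p.1 x ++ List.replicate p.2 y) := by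
  have hxx : adEnd k x x = 0 := by simp [adEnd_apply]
  have hyy : comm y y = 0 := by simp [comm]
  have hrep : ∀ (a : A) (r : ℕ), nested comm (List.replicate (r + 2) a) = 0 := by
    intro a r
    induction r with
    | zero => simp [nested, comm]
    | succ r ih => rw [List.replicate_succ, nested_cons _ _ (by simp), ih]; simp [comm]
  have h0 : ∀ i, nested comm (List.replicate i x ++ List.replicate 0 y) =
      if i = 1 then x else 0 := by
    intro i
    rw [List.replicate_zero, List.append_nil]
    match i with
    | 0 => rfl
    | 1 => rfl
    | i + 2 => rw [hrep]; simp
  have h1 : ∀ i, nested comm (List.replicate i x ++ List.replicate 1 y) = (adEnd k x ^ i) y :=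
    fun i => nested_replicate_append x i (by simp)
  have h2 : ∀ i j, nested comm (List.replicate i x ++ List.replicate (j + 2) y) = 0 := by
    intro i j
    rw [nested_replicate_append (k := k) x i (by simp), hrep, map_zero]
  obtain ⟨K, rfl⟩ : ∃ K', K = K' + 2 := ⟨K - 2, by omega⟩
  rw [sum_expPairs (by omega)]
  have e : ∀ i ∈ Finset.range (K + 2), ∑ j ∈ Finset.range (K + 2), expCoeff k (i, j) •
      nested comm (List.replicate i x ++ List.replicate j y) =
      (1 / (i.factorial : k)) • (adEnd k x ^ i) y + if i = 1 then x else 0 := by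
    intro i _
    rw [Finset.sum_range_succ', Finset.sum_range_succ', Finset.sum_eq_zero]
    · rw [zero_add, h1, h0]
      congr 1
      · simp [expCoeff]
      · split_ifs with hi
        · subst hi; simp [expCoeff]
        · simp
    · intro j _
      rw [h2, smul_zero]
  rw [Finset.sum_congr rfl e, Finset.sum_add_distrib, Finset.sum_ite_eq', if_pos (by simp)]
  simp [nested, nexp, LinearMap.sum_apply, add_comm]

/-- Each factor e^{ad x} e^{ad y} - 1 prepends a nonempty block x^r y^s to the words, with
coefficient 1/(r! s!). -/
theorem iterate_logDeriv {K : ℕ} (hK : 2 ≤ K) (x y : A) (n : ℕ) :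
    ((nexp k K (adEnd k x) * nexp k K (adEnd k y) - 1) ^ n) (x + nexp k K (adEnd k x) y) =
      ∑ r ∈ Fintype.piFinset (fun _ : Fin (n + 1) => expPairs K),
        (∏ i, expCoeff k (r i)) • nested comm (bchWord x y r) := by
  induction n with
  | zero =>
    rw [pow_zero, Module.End.one_apply, logDeriv_eq_sum hK, sum_piFinset_succ]
    refine Finset.sum_congr rfl fun p _ => ?_
    simp [bchWord]
  | succ n ih =>
    rw [pow_succ', Module.End.mul_apply, ih, sum_piFinset_succ _ (n + 1),
      nexp_mul_nexp_sub_one (by omega), LinearMap.sum_apply]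
    refine Finset.sum_congr rfl fun p _ => ?_
    rw [LinearMap.smul_apply, map_sum, Finset.smul_sum]
    refine Finset.sum_congr rfl fun r hr => ?_
    have hne : bchWord x y r ≠ [] := by
      have h0 := (Fintype.mem_piFinset.1 hr) 0
      rw [expPairs, Finset.mem_filter] at h0
      intro h
      have := bchWord_length x y r
      rw [h, List.length_nil] at this
      have := (Finset.sum_eq_zero_iff.1 this.symm) 0 (Finset.mem_univ _)
      omega
    rw [map_smul, bchWord_cons, List.append_assoc, nested_replicate_append (k := k) _ _ (by simp [hne]),
      nested_replicate_append (k := k) _ _ hne, smul_smul,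
      Fin.prod_univ_succ (fun i => expCoeff k ((Fin.cons p r : Fin (n + 2) → ℕ × ℕ) i))]
    simp only [Fin.cons_zero, Fin.cons_succ]
    rfl

/-- Multiplying by l removes the 1/l of Dynkin's formula, which comes from integrating the
derivative of the logarithm. Blocks are nonempty, so at most l of them fit into a word of length l,
and the ranges of summation can be enlarged to any K > l. The index n here counts blocks minus one.
-/
theorem bchTerm_eq {L : Type*} [AddCommGroup L] [Module k L] (br : L → L → L) (x y : L) (l : ℕ) {K : ℕ} (hK : l < K) :
    (l : k) • bchTerm k br x y l = ∑ n ∈ Finset.range K, ((-1) ^ n / (n + 1) : k) •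
      ∑ r ∈ Fintype.piFinset (fun _ : Fin (n + 1) => expPairs K) with
          ∑ i, ((r i).1 + (r i).2) = l,
        (∏ i, expCoeff k (r i)) • nested br (bchWord x y r) := by
  have h1 : ∑ n ∈ Finset.range K, ((-1) ^ n / (n + 1) : k) •
      ∑ r ∈ Fintype.piFinset (fun _ : Fin (n + 1) => expPairs K) with
          ∑ i, ((r i).1 + (r i).2) = l,
        (∏ i, expCoeff k (r i)) • nested br (bchWord x y r) =
      ∑ n ∈ Finset.range l, ((-1) ^ n / (n + 1) : k) •
      ∑ r ∈ Fintype.piFinset (fun _ : Fin (n + 1) => expPairs K) with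
          ∑ i, ((r i).1 + (r i).2) = l,
        (∏ i, expCoeff k (r i)) • nested br (bchWord x y r) := by
    refine (Finset.sum_subset (Finset.range_mono hK.le) fun n _ hn => ?_).symm
    rw [Finset.filter_false_of_mem, Finset.sum_empty, smul_zero]
    intro r hr h
    have : ∑ _i : Fin (n + 1), (1 : ℕ) ≤ ∑ i, ((r i).1 + (r i).2) := by
      refine Finset.sum_le_sum fun i _ => ?_
      have := (Fintype.mem_piFinset.1 hr) i
      rw [expPairs, Finset.mem_filter] at this
      exact this.2
    simp at this hn
    omega
  have h2 : Finset.Icc 1 l = (Finset.range l).image (· + 1) := by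
    ext n
    simp only [Finset.mem_Icc, Finset.mem_image, Finset.mem_range]
    exact ⟨fun h => ⟨n - 1, by omega, by omega⟩, by rintro ⟨m, h, rfl⟩; omega⟩
  rw [h1, bchTerm, h2, Finset.sum_image (by intro a _ b _ h; simpa using h), Finset.smul_sum]
  refine Finset.sum_congr rfl fun n hn => ?_
  have hl : (l : k) ≠ 0 := by
    have := Finset.mem_range.1 hn
    exact_mod_cast (by omega : l ≠ 0)
  rw [Finset.smul_sum, Finset.smul_sum]
  refine Finset.sum_congr ?_ fun r _ => ?_
  · ext r
    simp only [Finset.mem_filter, Fintype.mem_piFinset, expPairs, Finset.mem_product,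
      Finset.mem_range]
    constructor
    · rintro ⟨_, h, hs⟩
      have hle : ∀ i, (r i).1 + (r i).2 ≤ l := fun i => hs ▸
        Finset.single_le_sum (f := fun i => (r i).1 + (r i).2) (fun _ _ => Nat.zero_le _)
          (Finset.mem_univ i)
      exact ⟨fun i => ⟨⟨by have := hle i; omega, by have := hle i; omega⟩, h i⟩, hs⟩
    · rintro ⟨h, hs⟩
      have hle : ∀ i, (r i).1 + (r i).2 ≤ l := fun i => hs ▸
        Finset.single_le_sum (f := fun i => (r i).1 + (r i).2) (fun _ _ => Nat.zero_le _)
          (Finset.mem_univ i)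
      exact ⟨fun i => ⟨by have := hle i; omega, by have := hle i; omega⟩, fun i => (h i).2, hs⟩
  · rw [smul_smul, smul_smul, ← bchWord]
    congr 1
    have hp : (∏ i, ((r i).1.factorial * (r i).2.factorial) : k) ≠ 0 :=
      Finset.prod_ne_zero_iff.2 fun i _ => by
        exact_mod_cast (Nat.mul_pos (Nat.factorial_pos _) (Nat.factorial_pos _)).ne'
    have hn1 : (n + 1 : k) ≠ 0 := by exact_mod_cast Nat.succ_ne_zero n
    simp only [expCoeff, Finset.prod_div_distrib, Finset.prod_const_one]
    push_cast
    rw [pow_add, pow_add]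
    field_simp

/-- **The Baker–Campbell–Hausdorff formula** in Dynkin's form, for nilpotent elements. -/
theorem nexp_bch {J : ℕ → Submodule k A} {N K : ℕ} (hJ : NilFiltration J N) (hK : 2 * N ≤ K)
    {x y : A} (hx : x ∈ J 1) (hy : y ∈ J 1) :
    nexp k K (∑ l ∈ Finset.range N, bchTerm k comm x y l) = nexp k K x * nexp k K y := by
  have ha := logDeriv_mem (k := k) (K := K) hJ hx hy
  have hB := hJ.nilFiltration_poly
  have hN := hJ.pos
  set Z := magnusPoly k N (logDeriv k K x y).coeff with hZdef
  have hZ := hB.pow_eq_zero (magnusPoly_mem (k := k) hJ ha)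
  have hX := NilFiltration.monomial_mem hx 1
  -- Z' = (ad Z / (e^{ad Z} - 1)) a, with the quotient expanded as a logarithmic series in e^{ad Z}
  -- - 1 = e^{t ad x} e^{t ad y} - 1.
  have hd : Polynomial.derivative Z = ∑ n ∈ Finset.range K, ((-1) ^ n / (n + 1) : k) •
      ((nexp k K (adEnd k (Polynomial.monomial 1 x)) *
        nexp k K (adEnd k (Polynomial.monomial 1 y)) - 1) ^ n) (logDeriv k K x y) := by
    have had := adEnd_pow_eq_zero (k := k) hK hZ
    rw [derivative_magnusPoly hJ hK ha,
      nilEval_congr _ fun i hi => coeff_expQuot_inv hi, map_sum, LinearMap.sum_apply]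
    refine Finset.sum_congr rfl fun n _ => ?_
    rw [map_smul, nilEval_pow had, map_sub, nilEval_one had, ← nexp_eq,
      nexp_adEnd_magnusPoly hJ hK hx hy, LinearMap.smul_apply]
  have hXad : ∀ P Q : Polynomial A, adEnd k P (Polynomial.X * Q) =
      Polynomial.X * adEnd k P Q := by
    intro P Q
    rw [adEnd_apply, adEnd_apply, mul_sub, ← mul_assoc, ← Polynomial.X_mul, mul_assoc, mul_assoc]
  have hXexp : ∀ P Q : Polynomial A, nexp k K (adEnd k P) (Polynomial.X * Q) =
      Polynomial.X * nexp k K (adEnd k P) Q := by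
    intro P Q
    have hp : ∀ r, (adEnd k P ^ r) (Polynomial.X * Q) = Polynomial.X * (adEnd k P ^ r) Q := by
      intro r
      induction r with
      | zero => rfl
      | succ r ih => rw [pow_succ', Module.End.mul_apply, ih, hXad]; rfl
    simp only [nexp, LinearMap.sum_apply, LinearMap.smul_apply, hp, Finset.mul_sum, mul_smul_comm]
  have hXU : ∀ (n : ℕ) (Q : Polynomial A),
      ((nexp k K (adEnd k (Polynomial.monomial 1 x)) *
        nexp k K (adEnd k (Polynomial.monomial 1 y)) - 1) ^ n) (Polynomial.X * Q) =
      Polynomial.X * ((nexp k K (adEnd k (Polynomial.monomial 1 x)) *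
        nexp k K (adEnd k (Polynomial.monomial 1 y)) - 1) ^ n) Q := by
    intro n Q
    induction n with
    | zero => rfl
    | succ n ih =>
      rw [pow_succ', Module.End.mul_apply, ih, LinearMap.sub_apply, Module.End.mul_apply, hXexp,
        hXexp, Module.End.one_apply, ← mul_sub]
      rfl
  -- Multiplication by t turns a into the expression of `logDeriv_eq_sum` in the elements t x and t
  -- y, and turns Z' into t Z', whose coefficient of order l is l times that of Z.
  have hXa : Polynomial.X * logDeriv k K x y = Polynomial.monomial 1 x +
      nexp k K (adEnd k (Polynomial.monomial 1 x)) (Polynomial.monomial 1 y) := by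
    rw [logDeriv, mul_add, ← hXexp]
    simp [← Polynomial.C_mul_X_eq_monomial]
  have hc : ∀ l ∈ Finset.range N, Z.coeff l = bchTerm k comm x y l := by
    intro l hl
    rw [Finset.mem_range] at hl
    rcases Nat.eq_zero_or_pos l with h0 | h0
    · subst h0
      rw [hZdef, coeff_magnusPoly hJ ha, magnus_zero]
      simp [bchTerm]
    · have hlk : (l : k) ≠ 0 := by exact_mod_cast h0.ne'
      refine smul_right_injective _ hlk ?_
      dsimp only
      rw [bchTerm_eq (k := k) comm x y l (show l < K by omega)]
      have h1 : (l : k) • Z.coeff l = (Polynomial.X * Polynomial.derivative Z).coeff l := by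
        obtain ⟨l, rfl⟩ : ∃ l', l = l' + 1 := ⟨l - 1, by omega⟩
        rw [Polynomial.coeff_X_mul, Polynomial.coeff_derivative, Nat.cast_smul_eq_nsmul,
          nsmul_eq_mul, (Nat.cast_commute (l + 1) _).eq]
        push_cast; rfl
      rw [h1, hd, Finset.mul_sum, Polynomial.finsetSum_coeff]
      refine Finset.sum_congr rfl fun n _ => ?_
      rw [mul_smul_comm, ← hXU, hXa, iterate_logDeriv (by omega), Polynomial.coeff_smul,
        Polynomial.finsetSum_coeff]
      congr 1
      rw [Finset.sum_filter]
      refine Finset.sum_congr rfl fun r _ => ?_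
      rw [← bchWord_map, nested_monomial, bchWord_length, Polynomial.coeff_smul,
        Polynomial.coeff_monomial]
      split_ifs <;> simp
  -- The formula is the value at t = 1.
  have h := congrArg (polyEval A (1 : k)) (nexp_magnusPoly_logDeriv hJ hK hx hy)
  rw [map_mul, nexp_map, nexp_map, nexp_map, polyEval_monomial, polyEval_monomial, one_pow,
    one_smul, one_smul] at h
  rw [← h]
  congr 1
  rw [magnusPoly, map_sum]
  refine Finset.sum_congr rfl fun l hl => ?_
  rw [polyEval_monomial, one_pow, one_smul, ← hc l hl, hZdef, coeff_magnusPoly hJ ha]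

/-- Dynkin's formula is compatible with morphisms. -/
theorem map_nested {L M : Type*} [AddCommGroup L] [AddCommGroup M] {brL : L → L → L}
    {brM : M → M → M} (φ : L →+ M) (h : ∀ a b, φ (brL a b) = brM (φ a) (φ b)) (w : List L) :
    φ (nested brL w) = nested brM (w.map φ) := by
  induction w with
  | nil => exact map_zero φ
  | cons a w ih =>
    by_cases hw : w = []
    · subst hw; rfl
    · rw [nested_cons _ _ hw, h, ih, List.map_cons, nested_cons _ _ (by simpa using hw)]

theorem map_bchTerm {L M : Type*} [AddCommGroup L] [AddCommGroup M] [Module k L] [Module k M]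
    {brL : L → L → L} {brM : M → M → M} (φ : L →ₗ[k] M)
    (h : ∀ a b, φ (brL a b) = brM (φ a) (φ b)) (x y : L) (l : ℕ) :
    φ (bchTerm k brL x y l) = bchTerm k brM (φ x) (φ y) l := by
  simp only [bchTerm, map_sum, map_smul]
  refine Finset.sum_congr rfl fun n _ => Finset.sum_congr rfl fun r _ => ?_
  congr 1
  rw [← bchWord, ← bchWord, ← bchWord_map]
  exact map_nested φ.toAddMonoidHom h _

end Dynkin

end DeformationGroup
namespace DeformationGroup

/-! ## Graphs on arbitrary finite sets of vertices -/

section GraphMaps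

variable {k : Type u} [Field k]

theorem gra_hom_ext {V : Type} {B : Type*} [Ring B] [Algebra k B] {φ ψ : Gra k V →ₐ[k] B}
    (h : ∀ e, φ (edge k e) = ψ (edge k e)) : φ = ψ := by
  refine ExteriorAlgebra.hom_ext (Finsupp.lhom_ext' fun e => LinearMap.ext_ring ?_)
  exact h e

theorem relabel_edge {V W : Type} (f : V → W) (e : Sym2 V) :
    relabel f (edge k e) = edge k (e.map f) := by
  simp [edge, relabel, ExteriorAlgebra.map_apply_ι, Finsupp.mapDomain_single]

theorem relabel_comp {U V W : Type} (f : U → V) (g : V → W) (x : Gra k U) :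
    relabel g (relabel f x) = relabel (g ∘ f) x := by
  have : (relabel g).comp (relabel f) = (relabel (g ∘ f) : Gra k U →ₐ[k] Gra k W) :=
    gra_hom_ext fun e => by
      rw [AlgHom.comp_apply, relabel_edge, relabel_edge, relabel_edge, Sym2.map_map]
  exact DFunLike.congr_fun this x

theorem relabel_id {V : Type} (x : Gra k V) : relabel id x = x := by
  have : relabel id = AlgHom.id k (Gra k V) :=
    gra_hom_ext fun e => by rw [relabel_edge, Sym2.map_id]; rfl
  exact DFunLike.congr_fun this x

theorem reconnect_edge {V W : Type} [DecidableEq V] [Fintype W] (π : W → V) (u v : V) :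
    reconnect π (edge k s(u, v)) =
      ∑ u' with π u' = u, ∑ v' with π v' = v, edge k s(u', v') := by
  simp [reconnect, edge, ExteriorAlgebra.map_apply_ι, reconnectEdge]

theorem reconnect_comp {U V W : Type} [DecidableEq U] [DecidableEq V] [Fintype V] [Fintype W]
    (ρ : V → U) (π : W → V) (x : Gra k U) :
    reconnect π (reconnect ρ x) = reconnect (ρ ∘ π) x := by
  have hf : ∀ (u : U) (f : W → Gra k W), ∑ v with ρ v = u, ∑ w with π w = v, f w =
      ∑ w with (ρ ∘ π) w = u, f w := by
    intro u f
    rw [← Finset.sum_fiberwise_of_maps_to (s := {w | (ρ ∘ π) w = u}) (t := {v | ρ v = u}) (g := π)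
      (by intro w; simp)]
    refine Finset.sum_congr rfl fun v hv => Finset.sum_congr ?_ fun _ _ => rfl
    ext w
    simp only [Finset.mem_filter, Finset.mem_univ, true_and] at hv ⊢
    constructor
    · rintro rfl; exact ⟨hv, rfl⟩
    · exact fun h => h.2
  have : (reconnect π).comp (reconnect ρ) = (reconnect (ρ ∘ π) : Gra k U →ₐ[k] Gra k W) :=
    gra_hom_ext fun e => by
      induction e with
      | h a b =>
        rw [AlgHom.comp_apply, reconnect_edge, reconnect_edge, map_sum, ← hf a]
        refine Finset.sum_congr rfl fun v _ => ?_
        rw [map_sum, Finset.sum_congr rfl fun w _ => reconnect_edge π v w, Finset.sum_comm]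
        refine Finset.sum_congr rfl fun w _ => hf b _
  exact DFunLike.congr_fun this x

theorem reconnect_id {V : Type} [DecidableEq V] [Fintype V] (x : Gra k V) :
    reconnect id x = x := by
  have : reconnect id = AlgHom.id k (Gra k V) :=
    gra_hom_ext fun e => by
      induction e with
      | h a b => rw [reconnect_edge]; simp [Finset.filter_eq']
  exact DFunLike.congr_fun this x

/-- Reconnecting commutes with the inclusion of vertices in a cartesian square. -/
theorem reconnect_relabel {P T V Q : Type} [DecidableEq T] [DecidableEq Q] [Fintype P] [Fintype V]
    {ι : T → Q} {π : V → Q} {ι' : P → V} {π' : P → T} (hι : Function.Injective ι)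
    (hι' : Function.Injective ι') (hcomm : ∀ p, π (ι' p) = ι (π' p))
    (hpull : ∀ v t, π v = ι t → ∃ p, ι' p = v) (x : Gra k T) :
    reconnect π (relabel ι x) = relabel ι' (reconnect π' x) := by
  have hf : ∀ (t : T) (f : V → Gra k V), ∑ v with π v = ι t, f v = ∑ p with π' p = t, f (ι' p) := by
    intro t f
    refine (Finset.sum_bij (fun p _ => ι' p) ?_ (fun a _ b _ h => hι' h) ?_ (fun _ _ => rfl)).symm
    · intro p hp
      simp only [Finset.mem_filter, Finset.mem_univ, true_and] at hp ⊢
      rw [hcomm, hp]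
    · intro v hv
      simp only [Finset.mem_filter, Finset.mem_univ, true_and] at hv
      obtain ⟨p, rfl⟩ := hpull v t hv
      exact ⟨p, by simpa using hι ((hcomm p).symm.trans hv), rfl⟩
  have : (reconnect π).comp (relabel ι) =
      ((relabel ι').comp (reconnect π') : Gra k T →ₐ[k] Gra k V) :=
    gra_hom_ext fun e => by
      induction e with
      | h a b =>
        rw [AlgHom.comp_apply, AlgHom.comp_apply, relabel_edge, Sym2.map_mk, reconnect_edge,
          reconnect_edge, map_sum, hf a]
        refine Finset.sum_congr rfl fun p _ => ?_
        rw [map_sum, hf b]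
        refine Finset.sum_congr rfl fun q _ => ?_
        rw [relabel_edge, Sym2.map_mk]
  exact DFunLike.congr_fun this x

/-- Formal power series in `ħ` of graphs. -/
abbrev GraSer (k : Type u) [Field k] (V : Type) : Type u := PowerSeries (Gra k V)

/-- Renaming of vertices. -/
noncomputable def rl {V W : Type} (f : V → W) : GraSer k V →+* GraSer k W :=
  PowerSeries.map (relabel f).toRingHom

open Classical in
/-- Reconnecting of edges. -/
noncomputable def rc {V W : Type} [Finite W] (π : W → V) : GraSer k V →+* GraSer k W :=
  PowerSeries.map (@reconnect k _ V W _ (Fintype.ofFinite W) π).toRingHom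

theorem coeff_rl {V W : Type} (f : V → W) (x : GraSer k V) (j : ℕ) :
    PowerSeries.coeff j (rl f x) = relabel f (PowerSeries.coeff j x) := PowerSeries.coeff_map _ _ _

theorem reconnect_congr {V W : Type} (d d' : DecidableEq V) (f f' : Fintype W) (π : W → V) :
    @reconnect k _ V W d f π = @reconnect k _ V W d' f' π := by
  rw [Subsingleton.elim d d', Subsingleton.elim f f']

theorem coeff_rc {V W : Type} [DecidableEq V] [Fintype W] (π : W → V) (x : GraSer k V) (j : ℕ) :
    PowerSeries.coeff j (rc π x) = reconnect π (PowerSeries.coeff j x) := by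
  refine (PowerSeries.coeff_map _ _ _).trans ?_
  exact DFunLike.congr_fun (reconnect_congr _ _ _ _ π) _

theorem rl_comp {U V W : Type} (f : U → V) (g : V → W) (x : GraSer k U) :
    rl g (rl f x) = rl (g ∘ f) x := by
  ext j; rw [coeff_rl, coeff_rl, coeff_rl, relabel_comp]

theorem rl_id {V : Type} (x : GraSer k V) : rl id x = x := by
  ext j; rw [coeff_rl, relabel_id]

open Classical in
theorem rc_id {V : Type} [Finite V] (x : GraSer k V) : rc id x = x := by
  let _ := Fintype.ofFinite V
  ext j; rw [coeff_rc, reconnect_id]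

open Classical in
theorem rc_comp {U V W : Type} [Finite V] [Finite W] (ρ : V → U) (π : W → V) (x : GraSer k U) :
    rc π (rc ρ x) = rc (ρ ∘ π) x := by
  let _ := Fintype.ofFinite V
  let _ := Fintype.ofFinite W
  ext j; rw [coeff_rc, coeff_rc, coeff_rc, reconnect_comp]

open Classical in
theorem rc_rl {P T V Q : Type} [Finite P] [Finite V]
    {ι : T → Q} {π : V → Q} {ι' : P → V} {π' : P → T} (hι : Function.Injective ι)
    (hι' : Function.Injective ι') (hcomm : ∀ p, π (ι' p) = ι (π' p))
    (hpull : ∀ v t, π v = ι t → ∃ p, ι' p = v) (x : GraSer k T) :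
    rc π (rl ι x) = rl ι' (rc π' x) := by
  let _ := Fintype.ofFinite V
  let _ := Fintype.ofFinite P
  ext j; rw [coeff_rc, coeff_rl, coeff_rl, coeff_rc, reconnect_relabel hι hι' hcomm hpull]

end GraphMaps

/-! ### Symmetric graphs evaluated on arbitrary finite sets of vertices -/

section Species

variable {k : Type u} [Field k]

/-- The component of arity `n` of `x`. -/
noncomputable def ser (x : Conv k) (n : ℕ) : GraSer k (Fin n) := PowerSeries.mk (x n)

/-- The value on a finite set `V` of vertices of the family of symmetric graphs `x`. -/
noncomputable def sp (x : Conv k) (V : Type) [Finite V] : GraSer k V :=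
  rl (Finite.equivFin V).symm (ser x (Nat.card V))

/-- Invariance under the symmetric groups. -/
def IsSymm (x : Conv k) : Prop := ∀ n j (σ : Equiv.Perm (Fin n)), relabel σ (x n j) = x n j

theorem isSymm_of_mem {x : Conv k} (hx : x ∈ convCGra k) : IsSymm x := fun n j => (hx n j).2

theorem rl_ser {x : Conv k} (hx : IsSymm x) {n : ℕ} (σ : Equiv.Perm (Fin n)) :
    rl σ (ser x n) = ser x n := by
  ext j; rw [coeff_rl, ser, PowerSeries.coeff_mk, hx]

/-- Invariance under permutations makes the numbering chosen in `sp` irrelevant. -/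
theorem sp_eq {x : Conv k} (hx : IsSymm x) {V : Type} [Finite V] {n : ℕ} (e : Fin n ≃ V) :
    sp x V = rl e (ser x n) := by
  obtain rfl : Nat.card V = n := by rw [← Nat.card_congr e, Nat.card_fin]
  conv_lhs => rw [sp, ← rl_ser hx (e.trans (Finite.equivFin V)), rl_comp]
  congr 2
  funext i
  simp

theorem sp_map {x : Conv k} (hx : IsSymm x) {V W : Type} [Finite V] [Finite W] (e : V ≃ W) :
    rl e (sp x V) = sp x W := by
  rw [sp, sp_eq hx ((Finite.equivFin V).symm.trans e), rl_comp]
  rfl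

theorem sp_fin {x : Conv k} (hx : IsSymm x) (n : ℕ) : sp x (Fin n) = ser x n := by
  rw [sp_eq hx (Equiv.refl _)]; exact rl_id _

theorem rc_sp {x : Conv k} (hx : IsSymm x) {V Q Q' : Type} [Finite V] [Finite Q] [Finite Q']
    (π : V → Q) (e : Q ≃ Q') : rc (e ∘ π) (sp x Q') = rc π (sp x Q) := by
  rw [← sp_map hx e, rc_rl (ι' := id) (π' := π) e.injective Function.injective_id (fun _ => rfl)
    (fun v _ _ => ⟨v, rfl⟩), rl_id]

/-- The sum over all the ways of reconnecting the edges of `x` along the collapse of the fibres of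
`π` to points. -/
noncomputable def blow (x : Conv k) {V Q : Type} [Finite V] (π : V → Q) : GraSer k V :=
  rc (Set.rangeFactorization π) (sp x (Set.range π))

theorem blow_surj {x : Conv k} (hx : IsSymm x) {V Q : Type} [Finite V] [Finite Q] {π : V → Q}
    (hπ : Function.Surjective π) : blow x π = rc π (sp x Q) := by
  rw [blow, ← rc_sp hx (Set.rangeFactorization π) (Equiv.subtypeUnivEquiv fun q => hπ q)]
  rfl

/-- Only the partition of V into fibres matters: two maps with the same fibres differ by a bijection
between their ranges. This replaces all bookkeeping of numberings of collapsed vertices. -/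
theorem blow_congr {x : Conv k} (hx : IsSymm x) {V Q Q' : Type} [Finite V] {π : V → Q}
    {π' : V → Q'} (h : ∀ v w, π v = π w ↔ π' v = π' w) : blow x π = blow x π' := by
  let f : Set.range π → Set.range π' := fun q => Set.rangeFactorization π' q.2.choose
  have hf : ∀ v, f (Set.rangeFactorization π v) = Set.rangeFactorization π' v := fun v =>
    Subtype.ext ((h _ _).1 (Set.rangeFactorization π v).2.choose_spec)
  have hbij : Function.Bijective f := by
    constructor
    · rintro ⟨_, v, rfl⟩ ⟨_, w, rfl⟩ hvw
      have := (hf v).symm.trans (hvw.trans (hf w))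
      exact Subtype.ext ((h v w).2 (congrArg Subtype.val this))
    · rintro ⟨_, v, rfl⟩
      exact ⟨_, hf v⟩
  rw [blow, blow, ← rc_sp hx (Set.rangeFactorization π) (Equiv.ofBijective f hbij)]
  congr 2
  exact funext hf

/-- The component of `y` on the subset `S` of the vertices. -/
noncomputable def place (y : Conv k) {V : Type} [Finite V] (S : Set V) : GraSer k V :=
  rl Subtype.val (sp y S)

theorem place_eq {y : Conv k} (hy : IsSymm y) {V P : Type} [Finite V] [Finite P] {ι : P → V}
    (hι : Function.Injective ι) {S : Set V} (hS : Set.range ι = S) :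
    rl ι (sp y P) = place y S := by
  subst hS
  rw [place, ← sp_map hy (Equiv.ofInjective ι hι), rl_comp]
  rfl

end Species

end DeformationGroup
namespace DeformationGroup

/-! ### The pre-Lie product as a sum over subsets, and its associator -/

section PreLieSpecies

variable {k : Type u} [Field k]

open Classical in
/-- The collapse of the subset `S` to a point. -/
noncomputable def colMap {V : Type} (S : Set V) (v : V) : Option V := if v ∈ S then none else some v

theorem colMap_eq_iff {V : Type} (S : Set V) (v w : V) :
    colMap S v = colMap S w ↔ v = w ∨ (v ∈ S ∧ w ∈ S) := by
  unfold colMap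
  split_ifs with h h' h' <;> simp_all <;> (try rintro rfl) <;> (try contradiction)

theorem collapseSet_eq_iff {n : ℕ} (S : Finset (Fin n)) (v w : Fin n) :
    collapseSet S v = collapseSet S w ↔ v = w ∨ (v ∈ S ∧ w ∈ S) := by
  unfold collapseSet
  split_ifs with h h' h' <;> simp only [Finset.mem_compl] at h h'
  · simp [h]
  · simp [h, Fin.succ_ne_zero]
    rintro rfl; exact h' h
  · simp [h', (Fin.succ_ne_zero _).symm]
    rintro rfl; exact h h'
  · simp_all

theorem collapseSet_surjective {n : ℕ} {S : Finset (Fin n)} (hS : S.Nonempty) :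
    Function.Surjective (collapseSet S) := by
  intro i
  refine Fin.cases ?_ (fun i => ?_) i
  · obtain ⟨v, hv⟩ := hS
    exact ⟨v, by simp [collapseSet, hv]⟩
  · refine ⟨(Sᶜ).orderIsoOfFin rfl i, ?_⟩
    have hm : ((Sᶜ).orderIsoOfFin rfl i : Fin n) ∈ Sᶜ := Subtype.coe_prop _
    simp only [collapseSet]
    rw [dif_pos hm]
    exact congrArg Fin.succ (((Sᶜ).orderIsoOfFin rfl).symm_apply_apply i)

/-- The component of arity zero vanishes. -/
def NoConst (x : Conv k) : Prop := ∀ j, x 0 j = 0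

theorem cgra_zero {γ : Gra k (Fin 0)} (h : γ ∈ CGra k (Fin 0)) : γ = 0 := by
  have : CGra k (Fin 0) = ⊥ := by
    rw [CGra, Submodule.span_eq_bot]
    rintro _ ⟨L, hL, rfl⟩
    exact (IsEmpty.false hL.nonempty.some).elim
  rwa [this, Submodule.mem_bot] at h

theorem noConst_of_mem {x : Conv k} (hx : x ∈ convCGra k) : NoConst x :=
  fun j => cgra_zero (hx 0 j).1

theorem preLie_apply (x y : Conv k) (n j : ℕ) : preLie x y n j =
    ∑ S : Finset (Fin n), ∑ i ∈ Finset.HasAntidiagonal.antidiagonal j,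
      insertSet S (x (Sᶜ.card + 1) i.1) (y S.card i.2) := rfl

variable {x y z : Conv k}

open Classical in
/-- The pre-Lie product on the set `V` of vertices. -/
noncomputable def insertSum (x y : Conv k) (V : Type) [Fintype V] : GraSer k V :=
  ∑ S : Finset V with S.Nonempty, blow x (colMap (S : Set V)) * place y (S : Set V)

/-- The orderings of S and of its complement used by `preLie` disappear through `blow_congr` and
`place_eq`. The empty S contributes nothing because y has no component of arity zero. -/
theorem ser_preLie (hx : IsSymm x) (hy : IsSymm y) (hy0 : NoConst y) (n : ℕ) :
    ser (preLie x y) n = insertSum x y (Fin n) := by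
  classical
  have h1 : ser (preLie x y) n = ∑ S : Finset (Fin n),
      rc (collapseSet S) (ser x (Sᶜ.card + 1)) * rl (S.orderEmbOfFin rfl) (ser y S.card) := by
    ext j
    rw [ser, PowerSeries.coeff_mk, preLie_apply, map_sum]
    refine Finset.sum_congr rfl fun S _ => ?_
    rw [PowerSeries.coeff_mul]
    refine Finset.sum_congr rfl fun i _ => ?_
    rw [coeff_rc, coeff_rl, ser, ser, PowerSeries.coeff_mk, PowerSeries.coeff_mk, insertSet]
  rw [h1, insertSum, Finset.sum_filter]
  refine Finset.sum_congr rfl fun S _ => ?_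
  split_ifs with hS
  · congr 1
    · rw [← sp_fin hx, ← blow_surj hx (collapseSet_surjective hS)]
      refine blow_congr hx fun v w => ?_
      rw [collapseSet_eq_iff, colMap_eq_iff]; rfl
    · rw [← sp_fin hy]
      exact place_eq hy (S.orderEmbOfFin rfl).injective (by simp)
  · rw [Finset.not_nonempty_iff_eq_empty] at hS
    subst hS
    have : ser y (Finset.card (∅ : Finset (Fin n))) = 0 := by
      ext j
      rw [ser, PowerSeries.coeff_mk, map_zero]
      exact hy0 j
    rw [this, map_zero, mul_zero]

theorem rl_blow (hx : IsSymm x) {V W Q : Type} [Finite V] [Finite W] (e : V ≃ W) (π : V → Q) :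
    rl e (blow x π) = blow x (π ∘ e.symm) := by
  have h1 : rl e (blow x π) = rc (Set.rangeFactorization π ∘ e.symm) (sp x (Set.range π)) := by
    rw [blow, ← rc_rl (ι := id) (π := Set.rangeFactorization π ∘ e.symm) Function.injective_id
      e.injective (fun p => by simp) (fun v _ _ => ⟨e.symm v, by simp⟩), rl_id]
  rw [h1, ← blow_surj hx (Set.rangeFactorization_surjective.comp e.symm.surjective)]
  refine blow_congr hx fun v w => ?_
  simp [Set.rangeFactorization, Subtype.ext_iff]

theorem rl_place (hy : IsSymm y) {V W : Type} [Finite V] [Finite W] {f : V → W}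
    (hf : Function.Injective f) (S : Set V) : rl f (place y S) = place y (f '' S) := by
  rw [place, rl_comp]
  exact place_eq hy (hf.comp Subtype.val_injective) (by rw [Set.range_comp, Subtype.range_coe])

theorem rl_insertSum (hx : IsSymm x) (hy : IsSymm y) {V W : Type} [Fintype V] [Fintype W]
    (e : V ≃ W) : rl e (insertSum x y V) = insertSum x y W := by
  classical
  rw [insertSum, insertSum, map_sum]
  refine Finset.sum_equiv e.finsetCongr ?_ ?_
  · intro S; simp
  · intro S _
    rw [map_mul, rl_blow hx, rl_place hy e.injective]
    congr 1
    · refine blow_congr hx fun v w => ?_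
      simp [colMap_eq_iff]
    · simp

theorem isSymm_preLie (hx : IsSymm x) (hy : IsSymm y) (hy0 : NoConst y) :
    IsSymm (preLie x y) := by
  intro n j σ
  have h := congrArg (PowerSeries.coeff j) (rl_insertSum hx hy σ)
  rw [← ser_preLie hx hy hy0, coeff_rl, ser, PowerSeries.coeff_mk] at h
  exact h

theorem sp_preLie (hx : IsSymm x) (hy : IsSymm y) (hy0 : NoConst y) (V : Type) [Fintype V] :
    sp (preLie x y) V = insertSum x y V := by
  rw [sp, ser_preLie hx hy hy0, rl_insertSum hx hy]

theorem preLie_noConst (hy0 : NoConst y) : NoConst (preLie x y) := by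
  intro j
  rw [preLie_apply]
  refine Finset.sum_eq_zero fun S _ => Finset.sum_eq_zero fun i _ => ?_
  have hS : S = ∅ := Finset.eq_empty_of_isEmpty S
  subst hS
  have : y (Finset.card (∅ : Finset (Fin 0))) i.2 = 0 := hy0 _
  rw [insertSet, this, map_zero, mul_zero]

theorem rc_blow (hx : IsSymm x) {V W Q : Type} [Finite V] [Finite W] {q : V → W}
    (hq : Function.Surjective q) (π : W → Q) : rc q (blow x π) = blow x (π ∘ q) := by
  rw [blow, rc_comp, ← blow_surj hx (Set.rangeFactorization_surjective.comp hq)]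
  refine blow_congr hx fun v w => ?_
  simp [Set.rangeFactorization, Subtype.ext_iff]

theorem rc_place {V W : Type} [Finite V] [Finite W] (q : V → W) (T : Set W) :
    rc q (place y T) = rl Subtype.val (rc (fun v : q ⁻¹' T => (⟨q v, v.2⟩ : T)) (sp y T)) := by
  rw [place]
  refine rc_rl (ι := Subtype.val) (ι' := Subtype.val) (π' := fun v : q ⁻¹' T => (⟨q v, v.2⟩ : T))
    Subtype.val_injective Subtype.val_injective ?_ ?_ _
  · intro _; rfl
  · intro v t h
    exact ⟨⟨v, by rw [Set.mem_preimage, h]; exact t.2⟩, rfl⟩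

open Classical in
/-- The collapse of two subsets to two points. -/
noncomputable def colMap₂ {V : Type} (S T : Set V) (v : V) : Option (Option V) :=
  if v ∈ S then none else some (if v ∈ T then none else some v)

theorem colMap₂_eq_iff {V : Type} {S T : Set V} (h : Disjoint S T) (v w : V) :
    colMap₂ S T v = colMap₂ S T w ↔ v = w ∨ (v ∈ S ∧ w ∈ S) ∨ (v ∈ T ∧ w ∈ T) := by
  have hv : ¬(v ∈ S ∧ v ∈ T) := fun h' => Set.disjoint_left.1 h h'.1 h'.2
  have hw : ¬(w ∈ S ∧ w ∈ T) := fun h' => Set.disjoint_left.1 h h'.1 h'.2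
  unfold colMap₂
  by_cases hvw : v = w
  · subst hvw; exact iff_of_true rfl (Or.inl rfl)
  · split_ifs <;> simp_all

/-- Insertion of `y` at `U`, and of `z` at the subset `S` of `U`. -/
noncomputable def nestedInsert (x y z : Conv k) {V : Type} [Finite V] (U S : Set V) : GraSer k V :=
  blow x (colMap U) * (rl Subtype.val (blow y (colMap (Subtype.val ⁻¹' S : Set U))) * place z S)

/-- Insertion of `y` at `T` and of `z` at `S`. -/
noncomputable def disjointInsert (x y z : Conv k) {V : Type} [Finite V] (T S : Set V) :
    GraSer k V :=
  blow x (colMap₂ S T) * (place y T * place z S)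

open Classical in
-- The set U carries y ⋆ z and S ⊆ U carries z; the sum over S is moved outside so as to be compared
-- with the other bracketing.
theorem insertSum_preLie_right (hy : IsSymm y) (hz : IsSymm z) (hz0 : NoConst z)
    (V : Type) [Fintype V] :
    insertSum x (preLie y z) V = ∑ S : Finset V with S.Nonempty,
      ∑ U : Finset V with S ⊆ U, nestedInsert x y z (U : Set V) (S : Set V) := by
  have h1 : ∀ U : Finset V, blow x (colMap (U : Set V)) * place (preLie y z) (U : Set V) =
      ∑ S : Finset V with S.Nonempty ∧ S ⊆ U, nestedInsert x y z (U : Set V) (S : Set V) := by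
    intro U
    rw [place, sp_preLie hy hz hz0, insertSum, map_sum, Finset.mul_sum]
    refine Finset.sum_bij' (fun S _ => S.map (Function.Embedding.subtype _))
      (fun S _ => S.preimage Subtype.val Subtype.val_injective.injOn) ?_ ?_ ?_ ?_ ?_
    · intro S hS
      simp only [Finset.mem_filter, Finset.mem_univ, true_and] at hS ⊢
      refine ⟨by simpa using hS, fun v hv => ?_⟩
      obtain ⟨⟨w, hw⟩, _, rfl⟩ := Finset.mem_map.1 hv
      exact hw
    · intro S hS
      simp only [Finset.mem_filter, Finset.mem_univ, true_and] at hS ⊢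
      obtain ⟨v, hv⟩ := hS.1
      exact ⟨⟨v, hS.2 hv⟩, by simpa using hv⟩
    · intro S _; ext ⟨v, hv⟩
      have : v ∈ U := hv
      simp [this]
    · intro S hS; ext v
      simp only [Finset.mem_filter, Finset.mem_univ, true_and] at hS
      have := @hS.2 v
      simp; tauto
    · intro S _
      rw [nestedInsert, map_mul, rl_place hz Subtype.val_injective]
      congr 3
      · refine blow_congr hy fun v w => ?_
        simp [colMap_eq_iff]
      · simp
  rw [insertSum, Finset.sum_congr rfl fun U _ => h1 U, Finset.sum_sigma', Finset.sum_sigma']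
  refine Finset.sum_bij' (fun a _ => ⟨a.2, a.1⟩) (fun a _ => ⟨a.2, a.1⟩) ?_ ?_ ?_ ?_ ?_
  · rintro ⟨U, S⟩ h; simp at h ⊢; exact h.2
  · rintro ⟨S, U⟩ h; simp at h ⊢; exact ⟨h.1.mono h.2, h⟩
  · intros; rfl
  · intros; rfl
  · intros; rfl

open Classical in
-- Collapse S to a point. A subset T of the collapsed set either contains this point, and its
-- preimage U ⊇ S gives exactly a nested insertion, or it misses it, and then y and z are inserted
-- at disjoint sets.
theorem insertSum_preLie_left (hx : IsSymm x) (hy : IsSymm y) (hy0 : NoConst y)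
    (V : Type) [Fintype V] :
    insertSum (preLie x y) z V = ∑ S : Finset V with S.Nonempty,
      (∑ U : Finset V with S ⊆ U, nestedInsert x y z (U : Set V) (S : Set V) +
       ∑ T : Finset V with T.Nonempty ∧ Disjoint T S,
         disjointInsert x y z (T : Set V) (S : Set V)) := by
  rw [insertSum]
  refine Finset.sum_congr rfl fun S hS => ?_
  simp only [Finset.mem_filter, Finset.mem_univ, true_and] at hS
  obtain ⟨s, hs⟩ := hS
  let q := Set.rangeFactorization (colMap (S : Set V))
  have hq : Function.Surjective q := Set.rangeFactorization_surjective
  have hker : ∀ v w, q v = q w ↔ v = w ∨ (v ∈ S ∧ w ∈ S) := fun v w => by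
    rw [← Finset.mem_coe, ← Finset.mem_coe, ← colMap_eq_iff]
    simp [q, Set.rangeFactorization, Subtype.ext_iff]
  let _ : Fintype (Set.range (colMap (S : Set V))) := Fintype.ofFinite _
  have h1 : blow (preLie x y) (colMap (S : Set V)) =
      ∑ T : Finset (Set.range (colMap (S : Set V))) with T.Nonempty,
        blow x (colMap (T : Set _) ∘ q) * rc q (place y (T : Set _)) := by
    rw [blow, sp_preLie hx hy hy0, insertSum, map_sum]
    refine Finset.sum_congr rfl fun T _ => ?_
    rw [map_mul, rc_blow hx hq]
  rw [h1, Finset.sum_mul, ← Finset.sum_filter_add_sum_filter_not _ (fun T => q s ∈ T)]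
  congr 1
  · rw [Finset.filter_filter]
    refine Finset.sum_bij' (fun T _ => ({v | q v ∈ T} : Finset V)) (fun U _ => U.image q)
      ?_ ?_ ?_ ?_ ?_
    · intro T hT
      simp only [Finset.mem_filter, Finset.mem_univ, true_and] at hT ⊢
      intro v hv
      simp only [Finset.mem_filter, Finset.mem_univ, true_and]
      rw [(hker v s).2 (Or.inr ⟨hv, hs⟩)]; exact hT.2
    · intro U hU
      simp only [Finset.mem_filter, Finset.mem_univ, true_and] at hU ⊢
      exact ⟨⟨q s, Finset.mem_image_of_mem q (hU hs)⟩, Finset.mem_image_of_mem q (hU hs)⟩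
    · intro T _; ext t
      obtain ⟨v, rfl⟩ := hq t
      simp only [Finset.mem_image, Finset.mem_filter, Finset.mem_univ, true_and]
      exact ⟨by rintro ⟨w, hw, e⟩; rwa [← e], fun h => ⟨v, h, rfl⟩⟩
    · intro U hU; ext v
      simp only [Finset.mem_image, Finset.mem_filter, Finset.mem_univ, true_and] at hU ⊢
      refine ⟨?_, fun h => ⟨v, h, rfl⟩⟩
      rintro ⟨w, hw, e⟩
      rcases (hker w v).1 e with rfl | h
      · exact hw
      · exact hU h.2
    · intro T hT
      simp only [Finset.mem_filter, Finset.mem_univ, true_and] at hT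
      have hST : ∀ v ∈ S, q v ∈ T := fun v hv => by
        rw [(hker v s).2 (Or.inr ⟨hv, hs⟩)]; exact hT.2
      rw [nestedInsert, rc_place, mul_assoc]
      congr 1
      · refine blow_congr hx fun v w => ?_
        simp only [Function.comp_apply, colMap_eq_iff, hker, Finset.mem_coe, Finset.mem_filter,
          Finset.mem_univ, true_and]
        have := hST v; have := hST w; tauto
      · congr 1
        rw [← blow_surj hy (π := fun v : q ⁻¹' (T : Set _) => (⟨q v, v.2⟩ : (T : Set _)))]
        · have hU : ((({v | q v ∈ T} : Finset V)) : Set V) = q ⁻¹' (T : Set _) := by ext; simp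
          rw [hU]
          congr 1
          refine blow_congr hy fun v w => ?_
          simp only [hker, colMap_eq_iff, Set.mem_preimage, Finset.mem_coe,
            Subtype.ext_iff]
        · rintro ⟨t, ht⟩
          obtain ⟨v, rfl⟩ := hq t
          exact ⟨⟨v, ht⟩, rfl⟩
  · rw [Finset.filter_filter]
    refine Finset.sum_bij' (fun T _ => ({v | q v ∈ T} : Finset V)) (fun U _ => U.image q)
      ?_ ?_ ?_ ?_ ?_
    · intro T hT
      simp only [Finset.mem_filter, Finset.mem_univ, true_and] at hT ⊢
      refine ⟨?_, ?_⟩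
      · obtain ⟨t, ht⟩ := hT.1
        obtain ⟨v, rfl⟩ := hq t
        exact ⟨v, by simpa using ht⟩
      · rw [Finset.disjoint_left]
        intro v hv hvS
        simp only [Finset.mem_filter, Finset.mem_univ, true_and] at hv
        rw [(hker v s).2 (Or.inr ⟨hvS, hs⟩)] at hv
        exact hT.2 hv
    · intro U hU
      simp only [Finset.mem_filter, Finset.mem_univ, true_and] at hU ⊢
      refine ⟨hU.1.image q, ?_⟩
      rw [Finset.mem_image]
      rintro ⟨v, hv, e⟩
      have : v ∈ S := by
        rcases (hker v s).1 e with rfl | h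
        · exact hs
        · exact h.1
      exact Finset.disjoint_left.1 hU.2 hv this
    · intro T _; ext t
      obtain ⟨v, rfl⟩ := hq t
      simp only [Finset.mem_image, Finset.mem_filter, Finset.mem_univ, true_and]
      exact ⟨by rintro ⟨w, hw, e⟩; rwa [← e], fun h => ⟨v, h, rfl⟩⟩
    · intro U hU; ext v
      simp only [Finset.mem_image, Finset.mem_filter, Finset.mem_univ, true_and] at hU ⊢
      refine ⟨?_, fun h => ⟨v, h, rfl⟩⟩
      rintro ⟨w, hw, e⟩
      rcases (hker w v).1 e with rfl | h
      · exact hw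
      · exact (Finset.disjoint_left.1 hU.2 hw h.1).elim
    · intro T hT
      simp only [Finset.mem_filter, Finset.mem_univ, true_and] at hT
      have hST : ∀ v ∈ S, q v ∉ T := fun v hv => by
        rw [(hker v s).2 (Or.inr ⟨hv, hs⟩)]; exact hT.2
      have hU : ((({v | q v ∈ T} : Finset V)) : Set V) = q ⁻¹' (T : Set _) := by ext; simp
      have hdisj : Disjoint (S : Set V) (q ⁻¹' (T : Set _)) := by
        rw [Set.disjoint_left]; exact fun v hv => hST v hv
      rw [disjointInsert, mul_assoc, hU]
      congr 1
      · refine blow_congr hx fun v w => ?_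
        rw [colMap₂_eq_iff hdisj]
        simp only [Function.comp_apply, colMap_eq_iff, hker, Finset.mem_coe, Set.mem_preimage]
        tauto
      · congr 1
        rw [rc_place]
        -- T misses the collapsed point, so q is one-to-one over T and reconnecting the edges of y
        -- along q only renames vertices.
        have hb : Function.Bijective (fun v : q ⁻¹' (T : Set _) => (⟨q v, v.2⟩ : (T : Set _))) := by
          constructor
          · rintro ⟨v, hv⟩ ⟨w, hw⟩ e
            rcases (hker v w).1 (congrArg Subtype.val e) with h | h
            · exact Subtype.ext h
            · exact (hST v h.1 hv).elim
          · rintro ⟨t, ht⟩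
            obtain ⟨v, rfl⟩ := hq t
            exact ⟨⟨v, ht⟩, rfl⟩
        have := rc_sp hy (V := q ⁻¹' (T : Set _)) id (Equiv.ofBijective _ hb)
        rw [place]
        congr 1
        refine this.trans ?_
        exact rc_id _

/-- The associator of the pre-Lie product. -/
theorem insertSum_associator (hx : IsSymm x) (hy : IsSymm y) (hy0 : NoConst y) (hz : IsSymm z)
    (hz0 : NoConst z) (V : Type) [Fintype V] [DecidableEq V] :
    insertSum (preLie x y) z V - insertSum x (preLie y z) V = ∑ S : Finset V with S.Nonempty,
       ∑ T : Finset V with T.Nonempty ∧ Disjoint T S,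
         disjointInsert x y z (T : Set V) (S : Set V) := by
  rw [insertSum_preLie_left hx hy hy0, insertSum_preLie_right hy hz hz0, ← Finset.sum_sub_distrib]
  simp only [add_sub_cancel_left]
  congr!

end PreLieSpecies

/-! ### Signs, weights and connectedness; the graded pre-Lie identity -/

section Parity

variable {k : Type u} [Field k]

theorem graph_cons {V : Type} (e : Sym2 V) (L : List (Sym2 V)) :
    graph k (e :: L) = edge k e * graph k L := by simp [graph]

theorem edge_mul_graph {V : Type} (e : Sym2 V) (L : List (Sym2 V)) :
    edge k e * graph k L = (-1 : k) ^ L.length • (graph k L * edge k e) := by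
  induction L with
  | nil => simp [graph]
  | cons a L ih =>
    have h := ExteriorAlgebra.ι_add_mul_swap (R := k) (Finsupp.single e (1 : k)) (Finsupp.single a 1)
    have h' : edge k e * edge k a = -(edge k a * edge k e) := eq_neg_of_add_eq_zero_left h
    rw [graph_cons, ← mul_assoc, h', neg_mul, mul_assoc, ih, mul_smul_comm, mul_assoc,
      List.length_cons, pow_succ, mul_neg_one, neg_smul]

theorem graph_mul_graph {V : Type} (L L' : List (Sym2 V)) :
    graph k L * graph k L' = (-1 : k) ^ (L.length * L'.length) • (graph k L' * graph k L) := by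
  induction L with
  | nil => simp [graph]
  | cons a L ih =>
    rw [graph_cons, mul_assoc, ih, mul_smul_comm, ← mul_assoc, edge_mul_graph, smul_mul_assoc,
      smul_smul, ← pow_add, mul_assoc, List.length_cons, add_mul, one_mul]

/-- The Koszul sign of two parities. -/
def ksign (k : Type u) [Field k] (p q : ZMod 2) : k := if p = 1 ∧ q = 1 then -1 else 1

theorem neg_one_pow_mul (a b : ℕ) : (-1 : k) ^ (a * b) = ksign k a b := by
  unfold ksign
  simp only [ZMod.natCast_eq_one_iff_odd]
  split_ifs with h
  · exact (h.1.mul h.2).neg_one_pow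
  · rw [← Nat.odd_mul, Nat.not_odd_iff_even] at h
    exact h.neg_one_pow

theorem parity_mul_comm {V : Type} {p q : ZMod 2} {a b : Gra k V} (ha : a ∈ parity k V p)
    (hb : b ∈ parity k V q) : a * b = ksign k p q • (b * a) := by
  induction ha using Submodule.span_induction with
  | mem a h =>
    obtain ⟨L, rfl, rfl⟩ := h
    induction hb using Submodule.span_induction with
    | mem b h =>
      obtain ⟨L', rfl, rfl⟩ := h
      rw [graph_mul_graph, neg_one_pow_mul]
    | zero => simp
    | add x y _ _ hx hy => rw [mul_add, hx, hy, add_mul, smul_add]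
    | smul c x _ hx => rw [mul_smul_comm, hx, smul_mul_assoc, smul_comm]
  | zero => simp
  | add x y _ _ hx hy => rw [mul_add, add_mul, hx, hy, smul_add]
  | smul c x _ hx => rw [mul_smul_comm, smul_mul_assoc, hx, smul_comm]

theorem parity_mul {V : Type} {p q : ZMod 2} {a b : Gra k V} (ha : a ∈ parity k V p)
    (hb : b ∈ parity k V q) : a * b ∈ parity k V (p + q) := by
  have h := Submodule.mul_mem_mul ha hb
  rw [parity, parity, Submodule.span_mul_span] at h
  refine Submodule.span_mono ?_ h
  rintro _ ⟨_, ⟨L, rfl, rfl⟩, _, ⟨L', rfl, rfl⟩, rfl⟩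
  exact ⟨L ++ L', by simp, (graph_append _ _).symm⟩

theorem relabel_parity {V W : Type} (f : V → W) {q : ZMod 2} {a : Gra k V}
    (ha : a ∈ parity k V q) : relabel f a ∈ parity k W q := by
  have : parity k V q ≤ (parity k W q).comap (relabel f).toLinearMap := by
    rw [parity, Submodule.span_le]
    rintro _ ⟨L, rfl, rfl⟩
    exact Submodule.subset_span ⟨L.map (Sym2.map f), by simp, relabel_graph f L⟩
  exact this ha

theorem reconnect_parity {V W : Type} [DecidableEq V] [Fintype W] (π : W → V) {q : ZMod 2}
    {a : Gra k V} (ha : a ∈ parity k V q) : reconnect π a ∈ parity k W q := by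
  have : parity k V q ≤ (parity k W q).comap (reconnect π).toLinearMap := by
    rw [parity, Submodule.span_le]
    rintro _ ⟨L, rfl, rfl⟩
    refine Submodule.span_mono ?_ (reconnect_graph_mem π L)
    rintro _ ⟨L', h, rfl⟩
    exact ⟨L', by rw [h.length_eq], rfl⟩
  exact this ha

theorem insertSet_parity {n : ℕ} (S : Finset (Fin n)) {p q : ZMod 2}
    {f : Gra k (Fin (Sᶜ.card + 1))} {g : Gra k (Fin S.card)} (hf : f ∈ parity k _ p)
    (hg : g ∈ parity k _ q) : insertSet S f g ∈ parity k _ (p + q) :=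
  parity_mul (reconnect_parity _ hf) (relabel_parity _ hg)

theorem preLie_parity {x y : Conv k} {p q : ZMod 2} (hx : x ∈ convParity k p)
    (hy : y ∈ convParity k q) : preLie x y ∈ convParity k (p + q) := by
  intro n j
  rw [preLie_apply]
  exact Submodule.sum_mem _ fun S _ => Submodule.sum_mem _ fun i _ =>
    insertSet_parity S (hx _ _) (hy _ _)

/-- The arities |Sᶜ| + 1 and |S| of the factors satisfy (|Sᶜ| + 1 - 1) + (|S| - 1) = n - 1, so
weights add up. -/
theorem preLie_weight {x y : Conv k} {a b : ℕ} (hx : x ∈ weightFil a) (hy : y ∈ weightFil b) :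
    preLie x y ∈ weightFil (a + b) := by
  intro n j h
  rw [preLie_apply]
  refine Finset.sum_eq_zero fun S _ => Finset.sum_eq_zero fun i hi => ?_
  have hi' := Finset.HasAntidiagonal.mem_antidiagonal.1 hi
  have hS : Sᶜ.card + S.card = n := by
    rw [Finset.card_compl, Fintype.card_fin]
    have := S.card_le_univ
    rw [Fintype.card_fin] at this
    omega
  rw [insertSet]
  by_cases h1 : Sᶜ.card + 1 + i.1 < a + 1
  · rw [hx _ _ h1, map_zero, zero_mul]
  · rw [hy _ _ (by omega), map_zero, mul_zero]

theorem insertSet_mem {n : ℕ} (S : Finset (Fin n))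
    {f : Gra k (Fin (Sᶜ.card + 1))} {g : Gra k (Fin S.card)} (hf : f ∈ CGra k _)
    (hg : g ∈ CGra k _) : insertSet S f g ∈ CGra k (Fin n) := by
  refine Submodule.span_induction (p := fun f _ => insertSet S f g ∈ CGra k _) ?_ ?_ ?_ ?_ hf
  · rintro _ ⟨L, hL, rfl⟩
    refine Submodule.span_induction
      (p := fun g _ => insertSet S (graph k L) g ∈ CGra k _) ?_ ?_ ?_ ?_ hg
    · rintro _ ⟨L₂, hL₂, rfl⟩
      have h1 := reconnect_graph_mem (k := k) (collapseSet S) L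
      have h2 : relabel (S.orderEmbOfFin rfl) (graph k L₂) ∈ Submodule.span k
          {graph k (L₂.map (Sym2.map (S.orderEmbOfFin rfl)))} := by
        rw [relabel_graph]; exact Submodule.subset_span rfl
      have h3 := Submodule.mul_mem_mul h1 h2
      rw [Submodule.span_mul_span] at h3
      refine Submodule.span_mono ?_ h3
      rintro _ ⟨_, ⟨L', hL', rfl⟩, _, rfl, rfl⟩
      refine ⟨L' ++ L₂.map (Sym2.map (S.orderEmbOfFin rfl)), ?_, by rw [graph_append]⟩
      have hS : S.Nonempty := by
        rw [← Finset.card_pos]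
        obtain ⟨i⟩ := hL₂.nonempty
        exact i.pos
      refine isConn_append _ (collapseSet_surjective hS) L hL _ _ hL' ?_
      intro w w' hw
      rcases (collapseSet_eq_iff S w w').1 hw with rfl | ⟨hw, hw'⟩
      · exact SimpleGraph.Reachable.refl _
      · obtain ⟨i, rfl⟩ : ∃ i, S.orderEmbOfFin rfl i = w := 
          (Set.ext_iff.1 (Finset.range_orderEmbOfFin S rfl) w).2 hw
        obtain ⟨i', rfl⟩ : ∃ i, S.orderEmbOfFin rfl i = w' := 
          (Set.ext_iff.1 (Finset.range_orderEmbOfFin S rfl) w').2 hw'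
        let em : SimpleGraph.fromEdgeSet {e : Sym2 (Fin S.card) | e ∈ L₂} →g
            SimpleGraph.fromEdgeSet {e | e ∈ L₂.map (Sym2.map (S.orderEmbOfFin rfl))} :=
          { toFun := S.orderEmbOfFin rfl
            map_rel' := by
              intro x y h
              rw [SimpleGraph.fromEdgeSet_adj] at h ⊢
              exact ⟨List.mem_map.2 ⟨s(x, y), h.1, rfl⟩,
                fun e => h.2 ((S.orderEmbOfFin rfl).injective e)⟩ }
        exact (hL₂.preconnected i i').map em
    · simp [insertSet]
    · intro x y _ _ hx hy
      simpa [insertSet, mul_add] using Submodule.add_mem _ hx hy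
    · intro b x _ hx
      simpa [insertSet] using Submodule.smul_mem _ b hx
  · simp [insertSet]
  · intro x y _ _ hx hy
    simpa [insertSet, add_mul] using Submodule.add_mem _ hx hy
  · intro b x _ hx
    simpa [insertSet] using Submodule.smul_mem _ b hx

theorem preLie_mem {x y : Conv k} (hx : x ∈ convCGra k) (hy : y ∈ convCGra k) :
    preLie x y ∈ convCGra k := by
  intro n j
  refine ⟨?_, isSymm_preLie (isSymm_of_mem hx) (isSymm_of_mem hy) (noConst_of_mem hy) n j⟩
  rw [preLie_apply]
  exact Submodule.sum_mem _ fun S _ => Submodule.sum_mem _ fun i _ =>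
    insertSet_mem S (hx _ _).1 (hy _ _).1

theorem coeff_place_mem {y : Conv k} {q : ZMod 2} (hy : y ∈ convParity k q) {V : Type} [Finite V]
    (S : Set V) (j : ℕ) : PowerSeries.coeff j (place y S) ∈ parity k V q := by
  rw [place, coeff_rl, sp, coeff_rl, ser, PowerSeries.coeff_mk]
  exact relabel_parity _ (relabel_parity _ (hy _ _))

theorem place_mul_comm {y z : Conv k} {p q : ZMod 2} (hy : y ∈ convParity k p)
    (hz : z ∈ convParity k q) {V : Type} [Finite V] (S T : Set V) :
    place y T * place z S = ksign k p q • (place z S * place y T) := by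
  ext j
  rw [PowerSeries.coeff_smul, PowerSeries.coeff_mul, PowerSeries.coeff_mul, Finset.smul_sum,
    ← Finset.Nat.sum_antidiagonal_swap]
  refine Finset.sum_congr rfl fun i _ => ?_
  exact parity_mul_comm (coeff_place_mem hy _ _) (coeff_place_mem hz _ _)

/-- The graded pre-Lie identity. -/
theorem preLie_identity {x y z : Conv k} {p q : ZMod 2} (hx : x ∈ convCGra k) (hy : y ∈ convCGra k)
    (hz : z ∈ convCGra k) (hyp : y ∈ convParity k p) (hzq : z ∈ convParity k q) :
    preLie (preLie x y) z - preLie x (preLie y z) =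
      ksign k p q • (preLie (preLie x z) y - preLie x (preLie z y)) := by
  have hx' := isSymm_of_mem hx
  have hy' := isSymm_of_mem hy
  have hz' := isSymm_of_mem hz
  have hy0 := noConst_of_mem hy
  have hz0 := noConst_of_mem hz
  have key : ∀ n, ser (preLie (preLie x y) z) n - ser (preLie x (preLie y z)) n =
      ksign k p q • (ser (preLie (preLie x z) y) n - ser (preLie x (preLie z y)) n) := by
    intro n
    rw [ser_preLie (isSymm_preLie hx' hy' hy0) hz' hz0,
      ser_preLie hx' (isSymm_preLie hy' hz' hz0) (preLie_noConst hz0),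
      ser_preLie (isSymm_preLie hx' hz' hz0) hy' hy0,
      ser_preLie hx' (isSymm_preLie hz' hy' hy0) (preLie_noConst hy0),
      insertSum_associator hx' hy' hy0 hz' hz0, insertSum_associator hx' hz' hz0 hy' hy0,
      Finset.smul_sum]
    simp only [Finset.smul_sum]
    rw [Finset.sum_sigma', Finset.sum_sigma']
    -- Exchange (z, S) with (y, T). The collapse of the two disjoint sets is symmetric, and the only
    -- sign comes from commuting the two inserted graphs.
    refine Finset.sum_bij' (fun a _ => ⟨a.2, a.1⟩) (fun a _ => ⟨a.2, a.1⟩) ?_ ?_ ?_ ?_ ?_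
    · rintro ⟨U, S⟩ h; simp at h ⊢; exact ⟨h.2.1, h.1, h.2.2.symm⟩
    · rintro ⟨U, S⟩ h; simp at h ⊢; exact ⟨h.2.1, h.1, h.2.2.symm⟩
    · intros; rfl
    · intros; rfl
    · rintro ⟨S, T⟩ h
      simp only [Finset.mem_sigma, Finset.mem_filter, Finset.mem_univ, true_and] at h
      have hd : Disjoint (T : Set (Fin n)) (S : Set (Fin n)) := by exact_mod_cast h.2.2
      rw [disjointInsert, disjointInsert, place_mul_comm hyp hzq, mul_smul_comm]
      congr 2
      refine blow_congr hx' fun v w => ?_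
      rw [colMap₂_eq_iff hd, colMap₂_eq_iff hd.symm]
      tauto
  funext n j
  have := congrArg (PowerSeries.coeff j) (key n)
  rw [PowerSeries.coeff_smul, map_sub, map_sub] at this
  simp only [ser, PowerSeries.coeff_mk] at this
  exact this

end Parity

end DeformationGroup
namespace DeformationGroup

/-! ## Convergent series -/

section FSum

variable {k : Type u} [Field k] {L : Type*} [AddCommGroup L] [Module k L]
variable {M : Type*} [AddCommGroup M] [Module k M]
variable {F : ℕ → Submodule k L} {u w : ℕ → L} {s t : L}

theorem HasFSum.unique (hF : ∀ x, (∀ N, x ∈ F N) → x = 0) (hs : HasFSum F u s)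
    (ht : HasFSum F u t) : s = t := by
  refine sub_eq_zero.1 (hF _ fun N => ?_)
  obtain ⟨M₁, h₁⟩ := hs N
  obtain ⟨M₂, h₂⟩ := ht N
  have := Submodule.sub_mem _ (h₁ (max M₁ M₂) (le_max_left _ _)) (h₂ (max M₁ M₂) (le_max_right _ _))
  simpa using this

theorem HasFSum.map {F' : ℕ → Submodule k M} (T : L →ₗ[k] M) (hT : ∀ N, ∀ x ∈ F N, T x ∈ F' N)
    (hs : HasFSum F u s) : HasFSum F' (fun i => T (u i)) (T s) := by
  intro N
  obtain ⟨m, h⟩ := hs N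
  refine ⟨m, fun i hi => ?_⟩
  have := hT _ _ (h i hi)
  rwa [map_sub, map_sum] at this

theorem HasFSum.add (hs : HasFSum F u s) (ht : HasFSum F w t) :
    HasFSum F (fun i => u i + w i) (s + t) := by
  intro N
  obtain ⟨M₁, h₁⟩ := hs N
  obtain ⟨M₂, h₂⟩ := ht N
  refine ⟨max M₁ M₂, fun m hm => ?_⟩
  have := Submodule.add_mem _ (h₁ m ((le_max_left _ _).trans hm)) (h₂ m ((le_max_right _ _).trans hm))
  rwa [sub_add_sub_comm, ← Finset.sum_add_distrib] at this

/-- Turns bare convergence into an explicit bound on the remainder. -/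
theorem HasFSum.sub_mem (hs : HasFSum F u s) {N m : ℕ}
    (hu : ∀ i ≥ m, u i ∈ F N) : s - ∑ i ∈ Finset.range m, u i ∈ F N := by
  obtain ⟨M', h⟩ := hs N
  have h1 := h (max M' m) (le_max_left _ _)
  have h2 : ∑ i ∈ Finset.range (max M' m), u i - ∑ i ∈ Finset.range m, u i ∈ F N := by
    rw [← Finset.sum_Ico_eq_sub _ (le_max_right _ _)]
    exact Submodule.sum_mem _ fun i hi => hu i (Finset.mem_Ico.1 hi).1
  simpa using Submodule.add_mem _ h1 h2

theorem hasFSum_of_sub_mem (hF : Antitone F) (h : ∀ N, s - ∑ i ∈ Finset.range N, u i ∈ F N) :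
    HasFSum F u s := fun N => ⟨N, fun m hm => hF hm (h m)⟩

theorem HasFSum.shift (hs : HasFSum F u s) :
    HasFSum F (fun i => u (i + 1)) (s - u 0) := by
  intro N
  obtain ⟨m, h⟩ := hs N
  refine ⟨m, fun i hi => ?_⟩
  have := h (i + 1) (by omega)
  rw [Finset.sum_range_succ'] at this
  rwa [sub_sub, add_comm (u 0)]

end FSum

/-! ## Endomorphisms of the quotients of a filtered module -/

section QuotEnd

variable {k : Type u} [Field k] {M : Type*} [AddCommGroup M] [Module k M]

/-- The endomorphisms of `M ⧸ F N` raising the filtration by `i`. -/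
def quotFil (F : ℕ → Submodule k M) (N i : ℕ) : Submodule k (Module.End k (M ⧸ F N)) where
  carrier := {T | ∀ m, ∀ x ∈ F m, ∃ y ∈ F (m + i), T ((F N).mkQ x) = (F N).mkQ y}
  add_mem' := by
    intro T T' h h' m x hx
    obtain ⟨y, hy, e⟩ := h m x hx
    obtain ⟨y', hy', e'⟩ := h' m x hx
    exact ⟨y + y', Submodule.add_mem _ hy hy', by rw [LinearMap.add_apply, e, e', map_add]⟩
  zero_mem' m x _ := ⟨0, Submodule.zero_mem _, by simp⟩
  smul_mem' := by
    intro c T h m x hx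
    obtain ⟨y, hy, e⟩ := h m x hx
    exact ⟨c • y, Submodule.smul_mem _ c hy, by rw [LinearMap.smul_apply, e, map_smul]⟩

/-- An operator raising the filtration by N sends F 0 = ⊤ into F N, so it vanishes on the quotient.
-/
theorem nilFiltration_quot {F : ℕ → Submodule k M} (h0 : F 0 = ⊤) (hF : Antitone F) {N : ℕ}
    (hN : 0 < N) : NilFiltration (quotFil F N) N where
  mul_mem i j T hT S hS m x hx := by
    obtain ⟨y, hy, e⟩ := hS m x hx
    obtain ⟨z, hz, e'⟩ := hT _ y hy
    exact ⟨z, by rwa [show m + (i + j) = m + j + i by omega], by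
      rw [Module.End.mul_apply, e, e']⟩
  anti i j hij T hT m x hx := by
    obtain ⟨y, hy, e⟩ := hT m x hx
    exact ⟨y, hF (by omega) hy, e⟩
  eq_bot := by
    refine (Submodule.eq_bot_iff _).2 fun T hT => LinearMap.ext fun v => ?_
    obtain ⟨x, rfl⟩ := (F N).mkQ_surjective v
    obtain ⟨y, hy, e⟩ := hT 0 x (by rw [h0]; trivial)
    rw [e, LinearMap.zero_apply]
    rw [Nat.zero_add] at hy
    simpa using hy
  pos := hN

theorem mapQ_mem_quotFil {F : ℕ → Submodule k M} {N i : ℕ} (T : M →ₗ[k] M)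
    (hT : ∀ m, ∀ x ∈ F m, T x ∈ F (m + i)) (h : F N ≤ (F N).comap T) :
    ((F N).mapQ (F N) T h : Module.End k (M ⧸ F N)) ∈ quotFil F N i := fun m x hx =>
  ⟨T x, hT m x hx, rfl⟩

end QuotEnd

/-! ## The group of even cycles -/

section Cycles

variable {k : Type u} [Field k]

theorem weightFil_anti : Antitone (weightFil (k := k)) := fun a b hab x hx n j h =>
  hx n j (by omega)

theorem weightFil_hausdorff (x : Conv k) (h : ∀ N, x ∈ weightFil N) : x = 0 := by
  funext n j
  exact h (n + j) n j (by omega)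

/-- The sum of a series of elements of increasing weights. -/
noncomputable def convSum (w : ℕ → Conv k) : Conv k := fun n j => ∑ l ∈ Finset.range (n + j), w l n j

/-- A term of weight l contributes to arity n and order ħ^j only if l ≤ n - 1 + j, whence the range
n + j in `convSum`. -/
theorem hasFSum_convSum {w : ℕ → Conv k} (hw : ∀ l, w l ∈ weightFil l) :
    HasFSum weightFil w (convSum w) := by
  refine hasFSum_of_sub_mem weightFil_anti fun m n j h => ?_
  have : (∑ i ∈ Finset.range m, w i) n j = ∑ i ∈ Finset.range m, w i n j := by
    rw [Finset.sum_apply, Finset.sum_apply]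
  change convSum w n j - _ = 0
  rw [this, convSum, sub_eq_zero]
  refine Finset.sum_subset (Finset.range_mono (by omega)) fun i _ hi => ?_
  exact hw i n j (by simp at hi; omega)

theorem convSum_mem_cgra {w : ℕ → Conv k} (hw : ∀ l, w l ∈ convCGra k) :
    convSum w ∈ convCGra k := fun n j =>
  ⟨Submodule.sum_mem _ fun l _ => (hw l n j).1, fun σ => by
    rw [convSum, map_sum]
    exact Finset.sum_congr rfl fun l _ => (hw l n j).2 σ⟩

theorem convSum_mem_parity {w : ℕ → Conv k} {q : ZMod 2} (hw : ∀ l, w l ∈ convParity k q) :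
    convSum w ∈ convParity k q := fun n j => Submodule.sum_mem _ fun l _ => hw l n j

theorem mem_weightFil_zero {x : Conv k} (hx : x ∈ convCGra k) : x ∈ weightFil 0 := by
  intro n j h
  obtain rfl : n = 0 := by omega
  exact noConst_of_mem hx j

theorem edge_mem_parity {V : Type} (e : Sym2 V) : graph k [e] ∈ parity k V 1 :=
  Submodule.subset_span ⟨[e], by simp, rfl⟩

theorem theta_mem : theta k ∈ convCGra k := by
  intro n j
  unfold theta
  split
  · refine ⟨(CGra.stick k).2, fun σ => ?_⟩
    change relabel σ (graph k _) = graph k _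
    rw [relabel_graph]
    congr 1
    have : σ 0 = 0 ∧ σ 1 = 1 ∨ σ 0 = 1 ∧ σ 1 = 0 := by
      have h : σ 0 ≠ σ 1 := fun h => by simpa using σ.injective h
      revert h
      generalize σ 0 = a
      generalize σ 1 = b
      revert a b
      decide
    rcases this with h | h
    · simp [h.1, h.2]
    · simp [h.1, h.2, Sym2.eq_swap]
  · refine ⟨(CGra.loop k).2, fun σ => ?_⟩
    rw [Subsingleton.elim σ 1]
    exact relabel_id _
  · simp

theorem theta_parity : theta k ∈ convParity k 1 := by
  intro n j
  unfold theta
  split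
  · exact edge_mem_parity _
  · exact edge_mem_parity _
  · exact Submodule.zero_mem _

theorem theta_weight : theta k ∈ weightFil 1 := by
  intro n j h
  unfold theta
  split
  · omega
  · omega
  · rfl

theorem convOne_mem : convOne ∈ convCGra k := by
  intro n j
  unfold convOne
  split_ifs with h
  · obtain ⟨rfl, rfl⟩ := h
    refine ⟨(CGra.unit k).2, fun σ => map_one _⟩
  · exact ⟨Submodule.zero_mem _, fun σ => map_zero _⟩

theorem convOne_parity : convOne ∈ convParity k 0 := by
  intro n j
  unfold convOne
  split_ifs with h
  · exact Submodule.subset_span ⟨[], by simp, by simp [graph]⟩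
  · exact Submodule.zero_mem _

theorem ser_convOne (n : ℕ) : ser (convOne : Conv k) n = if n = 1 then 1 else 0 := by
  ext j
  rw [ser, PowerSeries.coeff_mk, convOne]
  by_cases h : n = 1
  · by_cases hj : j = 0 <;> simp [h, hj, PowerSeries.coeff_one]
  · simp [h]

theorem sp_convOne (V : Type) [Finite V] :
    sp (convOne : Conv k) V = if Nat.card V = 1 then 1 else 0 := by
  rw [sp, ser_convOne]; split_ifs <;> simp

theorem convOne_preLie {x : Conv k} (hx : x ∈ convCGra k) : preLie convOne x = x := by
  classical
  have hs := isSymm_of_mem hx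
  have h : ∀ n, ser (preLie convOne x) n = ser x n := by
    intro n
    rcases Nat.eq_zero_or_pos n with rfl | hn
    · ext j
      rw [ser, ser, PowerSeries.coeff_mk, PowerSeries.coeff_mk, noConst_of_mem hx,
        preLie_noConst (noConst_of_mem hx)]
    rw [ser_preLie (isSymm_of_mem convOne_mem) hs (noConst_of_mem hx), insertSum,
      Finset.sum_eq_single Finset.univ]
    · have h1 : blow (convOne : Conv k) (colMap ((Finset.univ : Finset (Fin n)) : Set (Fin n))) = 1 := by
        rw [blow, sp_convOne, if_pos, map_one]
        rw [Nat.card_eq_one_iff_unique]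
        refine ⟨⟨?_⟩, ⟨⟨_, ⟨⟨0, hn⟩, rfl⟩⟩⟩⟩
        rintro ⟨_, v, rfl⟩ ⟨_, w, rfl⟩
        simp [colMap]
      have h2 : place x ((Finset.univ : Finset (Fin n)) : Set (Fin n)) = ser x n := by
        rw [← place_eq hs (ι := id) Function.injective_id (by simp), rl_id, sp_fin hs]
      rw [h1, h2, one_mul]
    · intro S hS hne
      have h1 : blow (convOne : Conv k) (colMap (S : Set (Fin n))) = 0 := by
        rw [blow, sp_convOne, if_neg, map_zero]
        intro hc
        have hsub := (Nat.card_eq_one_iff_unique.1 hc).1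
        apply hne
        obtain ⟨s, hs⟩ := (Finset.mem_filter.1 hS).2
        ext v
        have := (Subtype.ext_iff.1 (hsub.elim ⟨_, ⟨v, rfl⟩⟩ ⟨_, ⟨s, rfl⟩⟩) : colMap (S : Set (Fin n)) v = colMap (S : Set (Fin n)) s)
        rw [colMap_eq_iff] at this
        simp only [Finset.mem_univ, iff_true]
        rcases this with rfl | h
        · exact hs
        · exact h.1
      rw [h1, zero_mul]
    · intro h
      refine (h ?_).elim
      simp only [Finset.mem_filter, Finset.mem_univ, true_and]
      exact ⟨⟨0, hn⟩, Finset.mem_univ _⟩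
  funext n j
  have := congrArg (PowerSeries.coeff j) (h n)
  simpa only [ser, PowerSeries.coeff_mk] using this

/-- 𝟙 can be inserted at each of the n singletons, and each insertion gives back x. -/
theorem preLie_convOne {x : Conv k} (hx : x ∈ convCGra k) (n j : ℕ) :
    preLie x convOne n j = (n : k) • x n j := by
  classical
  have hs := isSymm_of_mem hx
  have h : ser (preLie x convOne) n = (n : k) • ser x n := by
    rw [ser_preLie hs (isSymm_of_mem convOne_mem) (noConst_of_mem convOne_mem), insertSum]
    have e : ∀ S : Finset (Fin n), blow x (colMap (S : Set (Fin n))) *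
        place (convOne : Conv k) (S : Set (Fin n)) = if S.card = 1 then ser x n else 0 := by
      intro S
      have hc : Nat.card ((S : Set (Fin n))) = S.card := by simp
      rw [place, sp_convOne, hc]
      split_ifs with h1
      · rw [map_one, mul_one, ← sp_fin hs n, ← rc_id (sp x (Fin n)),
          ← blow_surj hs Function.surjective_id]
        refine blow_congr hs fun v w => ?_
        rw [colMap_eq_iff, id, id]
        refine ⟨?_, Or.inl⟩
        rintro (h | h)
        · exact h
        · exact Finset.card_le_one.1 h1.le v h.1 w h.2
      · rw [map_zero, mul_zero]
    simp only [e]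
    have hf : ({S | S.Nonempty ∧ S.card = 1} : Finset (Finset (Fin n))) =
        Finset.powersetCard 1 Finset.univ := by
      ext S
      simp only [Finset.mem_filter, Finset.mem_univ, true_and, Finset.mem_powersetCard,
        Finset.subset_univ, and_iff_right_iff_imp]
      intro h
      rw [← Finset.card_pos]; omega
    rw [← Finset.sum_filter, Finset.filter_filter, Finset.sum_const, hf, Finset.card_powersetCard]
    simp [Nat.cast_smul_eq_nsmul]
  have := congrArg (PowerSeries.coeff j) h
  rw [PowerSeries.coeff_smul] at this
  simpa only [ser, PowerSeries.coeff_mk] using this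

theorem edge_ne_zero {V : Type} (e : Sym2 V) : edge k e ≠ 0 := by
  rw [edge, Ne, ExteriorAlgebra.ι_eq_zero_iff]
  simp

/-- The loop is the only possible edge and its square is zero. -/
theorem gra_one_even {γ : Gra k (Fin 1)} (h : γ ∈ parity k (Fin 1) 0) : ∃ c : k, γ = c • 1 := by
  have : parity k (Fin 1) 0 ≤ Submodule.span k {1} := by
    rw [parity, Submodule.span_le]
    rintro _ ⟨L, hL, rfl⟩
    match L with
    | [] => exact Submodule.subset_span (by simp [graph])
    | [a] => simp at hL
    | a :: b :: L =>
      rw [Subsingleton.elim b a, graph_cons, graph_cons, ← mul_assoc, edge, ExteriorAlgebra.ι_sq_zero,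
        zero_mul]
      exact Submodule.zero_mem _
  obtain ⟨c, hc⟩ := Submodule.mem_span_singleton.1 (this h)
  exact ⟨c, hc.symm⟩

theorem twistedDiff_apply_zero (x : Conv k) :
    twistedDiff k 0 x = preLie (theta k) x - preLie x (theta k) := by
  simp [twistedDiff]

theorem twistedDiff_apply_one (x : Conv k) :
    twistedDiff k 1 x = preLie (theta k) x + preLie x (theta k) := by
  have : ((-1 : ℤˣ) ^ (1 : ZMod 2) : ℤˣ) = -1 := by decide
  simp [twistedDiff, this]

theorem mem_evenCycles {x : Conv k} : x ∈ evenCycles k ↔ x ∈ convCGra k ∧ x ∈ convParity k 0 ∧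
    preLie (theta k) x = preLie x (theta k) := by
  rw [evenCycles, Submodule.mem_inf, Submodule.mem_inf, LinearMap.mem_ker, twistedDiff_apply_zero,
    sub_eq_zero, and_assoc]

/-- The part of weight zero is a multiple c 𝟙. In arity 2 and ħ-degree 0 the cycle condition
compares θ ⋆ c𝟙 = 2cθ with c𝟙 ⋆ θ = cθ, which forces c = 0. All exponentials and BCH series of even
cycles converge because of this. -/
theorem evenCycles_weight {x : Conv k} (hx : x ∈ evenCycles k) : x ∈ weightFil 1 := by
  obtain ⟨h1, h2, h3⟩ := mem_evenCycles.1 hx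
  obtain ⟨c, hc⟩ := gra_one_even (h2 1 0)
  have hx' : x - c • convOne ∈ weightFil 1 := by
    intro n j h
    change x n j - c • convOne n j = 0
    by_cases hn : n = 1 ∧ j = 0
    · obtain ⟨rfl, rfl⟩ := hn
      rw [hc]; simp [convOne]
    · have : n = 0 := by omega
      subst this
      rw [noConst_of_mem h1]; simp [convOne]
  have ha := preLie_weight theta_weight hx' 2 0 (by omega)
  have hb := preLie_weight hx' theta_weight 2 0 (by omega)
  rw [map_sub, map_smul] at ha
  rw [map_sub, map_smul, LinearMap.sub_apply, LinearMap.smul_apply, convOne_preLie theta_mem] at hb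
  change preLie (theta k) x 2 0 - c • preLie (theta k) convOne 2 0 = 0 at ha
  change preLie x (theta k) 2 0 - c • theta k 2 0 = 0 at hb
  rw [preLie_convOne theta_mem] at ha
  rw [h3, ← hb, sub_right_inj, smul_smul] at ha
  have h0 : (c * (2 : ℕ) - c) • theta k 2 0 = 0 := by rw [sub_smul, ha, sub_self]
  have h4 : theta k 2 0 ≠ 0 := by
    have : theta k 2 0 = edge k s(0, 1) := by simp [theta, CGra.stick, graph]
    rw [this]; exact edge_ne_zero _
  have h5 : c = 0 := by
    rcases smul_eq_zero.1 h0 with h | h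
    · rw [← h]; push_cast; ring
    · exact (h4 h).elim
  rwa [h5, zero_smul, sub_zero] at hx'

/-- The twisted differential is a derivation of the brackets with an even cycle. -/
theorem twistedDiff_bracket {a c : Conv k} (ha : a ∈ evenCycles k) (hc : c ∈ convCGra k) :
    (c ∈ convParity k 0 → twistedDiff k 0 (evenBracket a c) = evenBracket a (twistedDiff k 0 c)) ∧
    (c ∈ convParity k 1 → twistedDiff k 1 (evenBracket a c) = evenBracket a (twistedDiff k 1 c)) := by
  obtain ⟨h1, h2, h3⟩ := mem_evenCycles.1 ha
  constructor
  · intro hq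
    -- The pre-Lie identities for (θ, a, c), (a, c, θ) and (c, a, θ), together with θ ⋆ a = a ⋆ θ,
    -- give the derivation property by linear combination.
    have e1 := preLie_identity theta_mem h1 hc h2 hq
    have e2 := preLie_identity h1 hc theta_mem hq theta_parity
    have e3 := preLie_identity hc h1 theta_mem h2 theta_parity
    simp only [ksign, zero_ne_one, and_false, and_true, if_false, one_smul] at e1 e2 e3
    simp only [evenBracket, twistedDiff_apply_zero, map_sub, LinearMap.sub_apply]
    rw [h3] at e1
    rw [h3] at e3
    linear_combination (norm := abel_nf) (-1 : ℤ) • e1 + (-1 : ℤ) • e2 + e3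
  · intro hq
    have e1 := preLie_identity theta_mem h1 hc h2 hq
    have e2 := preLie_identity h1 hc theta_mem hq theta_parity
    have e3 := preLie_identity hc h1 theta_mem h2 theta_parity
    simp only [ksign, zero_ne_one, false_and, and_self, if_true, if_false, one_smul, neg_smul] at e1 e2 e3
    simp only [evenBracket, twistedDiff_apply_one, map_sub, map_add, LinearMap.add_apply]
    rw [h3] at e1
    rw [h3] at e3
    linear_combination (norm := abel_nf) (-1 : ℤ) • e1 + (1 : ℤ) • e2 - e3

end Cycles

end DeformationGroup
namespace DeformationGroup

/-! ### Exponentials in filtered anti-representations -/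

section BCHRep

variable {k : Type u} [Field k] [CharZero k] {M : Type*} [AddCommGroup M] [Module k M]
  {Z : Type*} [AddCommGroup Z] [Module k Z]

/-- An anti-representation of a Lie algebra by endomorphisms of a filtered module which raise the
filtration, and a product on this Lie algebra which acts like the Baker–Campbell–Hausdorff series. -/
structure BCHRep (F : ℕ → Submodule k M) (br mul : Z → Z → Z) where
  R : Z →ₗ[k] Module.End k M
  zero : F 0 = ⊤
  anti : Antitone F
  mem : ∀ y m, ∀ x ∈ F m, R y x ∈ F (m + 1)
  bracket : ∀ a b x, R (br a b) x = R b (R a x) - R a (R b x)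
  mul : ∀ x y N v, R (mul x y - ∑ l ∈ Finset.range N, bchTerm k br x y l) v ∈ F N

namespace BCHRep

variable {F : ℕ → Submodule k M} {br mul : Z → Z → Z} (ρ : BCHRep F br mul)

theorem le_comap (y : Z) (N : ℕ) : F N ≤ (F N).comap (ρ.R y) := fun x hx =>
  ρ.anti (Nat.le_succ N) (ρ.mem y N x hx)

/-- The induced operators modulo `F N`, with the sign which makes them a representation. -/
def Q (N : ℕ) : Z →ₗ[k] Module.End k (M ⧸ F N) where
  toFun y := -(F N).mapQ _ (ρ.R y) (ρ.le_comap y N)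
  map_add' y y' := by
    ext x
    change -(F N).mkQ (ρ.R (y + y') x) = -(F N).mkQ (ρ.R y x) + -(F N).mkQ (ρ.R y' x)
    rw [map_add, LinearMap.add_apply, map_add, neg_add]
  map_smul' c y := by
    ext x
    change -(F N).mkQ (ρ.R (c • y) x) = c • -(F N).mkQ (ρ.R y x)
    rw [map_smul, LinearMap.smul_apply, map_smul, smul_neg]

theorem Q_mkQ (N : ℕ) (y : Z) (x : M) : ρ.Q N y ((F N).mkQ x) = -(F N).mkQ (ρ.R y x) := rfl

theorem Q_mem (N : ℕ) (y : Z) : ρ.Q N y ∈ quotFil F N 1 :=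
  Submodule.neg_mem _ (mapQ_mem_quotFil _ (ρ.mem y) _)

theorem Q_bracket (N : ℕ) (a b : Z) : ρ.Q N (br a b) = comm (ρ.Q N a) (ρ.Q N b) := by
  ext x
  change ρ.Q N (br a b) ((F N).mkQ x) =
    ρ.Q N a (ρ.Q N b ((F N).mkQ x)) - ρ.Q N b (ρ.Q N a ((F N).mkQ x))
  rw [Q_mkQ, Q_mkQ, Q_mkQ, map_neg, map_neg, Q_mkQ, Q_mkQ, ρ.bracket, map_sub]
  abel

theorem Q_mul (N : ℕ) (x y : Z) :
    ρ.Q N (mul x y) = ∑ l ∈ Finset.range N, bchTerm k comm (ρ.Q N x) (ρ.Q N y) l := by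
  have h : ρ.Q N (mul x y - ∑ l ∈ Finset.range N, bchTerm k br x y l) = 0 := by
    ext v
    change -(F N).mkQ _ = 0
    rw [neg_eq_zero]
    exact (Submodule.Quotient.mk_eq_zero _).2 (ρ.mul x y N v)
  rw [map_sub, sub_eq_zero] at h
  rw [h, map_sum]
  exact Finset.sum_congr rfl fun l _ => map_bchTerm (ρ.Q N) (ρ.Q_bracket N) x y l

theorem nilFiltration (ρ : BCHRep F br mul) {N : ℕ} (hN : 0 < N) : NilFiltration (quotFil F N) N :=
  nilFiltration_quot ρ.zero ρ.anti hN

theorem Q_pow {N : ℕ} (hN : 0 < N) (y : Z) : ρ.Q N y ^ (2 * N) = 0 :=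
  pow_eq_zero_of_le (by omega) ((ρ.nilFiltration hN).pow_eq_zero (ρ.Q_mem N y))

/-- The exponentials modulo `F N`. -/
noncomputable def E (N : ℕ) (y : Z) : Module.End k (M ⧸ F N) := nexp k (2 * N) (ρ.Q N y)

/-- Modulo F N the operators are nilpotent, and the remainder of the product beyond degree N acts by
zero, so the nilpotent formula `nexp_bch` applies. -/
theorem E_mul {N : ℕ} (hN : 0 < N) (x y : Z) : ρ.E N (mul x y) = ρ.E N x * ρ.E N y := by
  rw [E, Q_mul]
  exact nexp_bch (ρ.nilFiltration hN) le_rfl (ρ.Q_mem N x) (ρ.Q_mem N y)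

theorem E_zero {N : ℕ} (hN : 0 < N) : ρ.E N 0 = 1 := by
  rw [E, map_zero, nexp_eq, nilEval_apply,
    Finset.sum_eq_single_of_mem 0 (by simpa using hN)]
  · simp
  · intro i _ hi
    rw [zero_pow hi, smul_zero]

theorem E_neg_mul {N : ℕ} (hN : 0 < N) (x : Z) : ρ.E N (-x) * ρ.E N x = 1 := by
  rw [E, E, map_neg]
  exact nexp_neg_mul (ρ.Q_pow hN x)

theorem E_mul_neg {N : ℕ} (hN : 0 < N) (x : Z) : ρ.E N x * ρ.E N (-x) = 1 := by
  rw [E, E, map_neg]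
  exact nexp_mul_neg (ρ.Q_pow hN x)

/-- The logarithm recovers the operators modulo every F N; level N + 1 is used because the
hypothesis concerns positive levels only. -/
theorem E_injective {x y : Z} (h : ∀ N > 0, ρ.E N x = ρ.E N y) (N : ℕ) (v : M) :
    ρ.R x v - ρ.R y v ∈ F N := by
  have h1 := nexp_injective (ρ.Q_pow N.succ_pos x) (ρ.Q_pow N.succ_pos y) (h _ N.succ_pos)
  have h2 := congrArg (fun T => T ((F (N + 1)).mkQ v)) h1
  simp only [Q_mkQ] at h2
  exact ρ.anti (Nat.le_succ N) ((Submodule.Quotient.eq _).1 (neg_injective h2))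

theorem iterate_mem (y : Z) {z : M} (m : ℕ) : (ρ.R y)^[m] z ∈ F m := by
  induction m with
  | zero => rw [ρ.zero]; trivial
  | succ m ih => rw [Function.iterate_succ_apply']; exact ρ.mem _ _ _ ih

/-- `Q` carries a minus sign, so exp(R_y) is the exponential attached to -y; the convergent series
agrees with its truncation modulo F N. -/
theorem E_neg_apply (N : ℕ) (y : Z) {z s : M}
    (hs : HasFSum F (fun m => (1 / (m.factorial : k)) • (ρ.R y)^[m] z) s) :
    ρ.E N (-y) ((F N).mkQ z) = (F N).mkQ s := by
  have h1 : ∀ m, (ρ.Q N (-y) ^ m) ((F N).mkQ z) = (F N).mkQ ((ρ.R y)^[m] z) := by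
    intro m
    induction m with
    | zero => rfl
    | succ m ih =>
      rw [pow_succ', Module.End.mul_apply, ih, Q_mkQ, map_neg, LinearMap.neg_apply, map_neg, neg_neg,
        Function.iterate_succ_apply']
  have h2 := hs.sub_mem (N := N) (m := 2 * N) fun i hi =>
    Submodule.smul_mem _ _ (ρ.anti (by omega) (ρ.iterate_mem y i))
  have h3 : (F N).mkQ s = (F N).mkQ (∑ m ∈ Finset.range (2 * N),
      (1 / (m.factorial : k)) • (ρ.R y)^[m] z) := (Submodule.Quotient.eq _).2 h2
  rw [E, nexp, LinearMap.sum_apply, h3, map_sum]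
  refine Finset.sum_congr rfl fun m _ => ?_
  rw [LinearMap.smul_apply, h1, map_smul]

/-- `exp(R_{x * y}) = exp(R_y) exp(R_x)`. -/
theorem exp_mul (x y : Z) {z s₁ s₂ s₃ : M}
    (h₁ : HasFSum F (fun m => (1 / (m.factorial : k)) • (ρ.R (mul x y))^[m] z) s₁)
    (h₂ : HasFSum F (fun m => (1 / (m.factorial : k)) • (ρ.R x)^[m] z) s₂)
    (h₃ : HasFSum F (fun m => (1 / (m.factorial : k)) • (ρ.R y)^[m] s₂) s₃) (N : ℕ) :
    s₁ - s₃ ∈ F N := by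
  refine ρ.anti (Nat.le_succ N) ((Submodule.Quotient.eq _).1 ?_)
  have hN := N.succ_pos
  have e1 := ρ.E_neg_apply (N + 1) _ h₁
  have e2 := ρ.E_neg_apply (N + 1) _ h₂
  have e3 := ρ.E_neg_apply (N + 1) _ h₃
  rw [← e2, ← Module.End.mul_apply] at e3
  -- Inverting E(x * y) = E(x) E(y) reverses the order of the factors.
  have e4 : ρ.E (N + 1) (-mul x y) = ρ.E (N + 1) (-y) * ρ.E (N + 1) (-x) := by
    have a1 := ρ.E_mul hN x y
    have a2 := ρ.E_mul_neg hN (mul x y)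
    have a3 := ρ.E_neg_mul hN x
    have a4 := ρ.E_neg_mul hN y
    rw [a1] at a2
    refine (left_inv_eq_right_inv (a := ρ.E (N + 1) x * ρ.E (N + 1) y) ?_ a2).symm
    rw [mul_assoc, ← mul_assoc (ρ.E (N + 1) (-x)), a3, one_mul, a4]
  rw [e4, e3] at e1
  exact e1.symm

end BCHRep

end BCHRep

/-! ### The group of even cycles and its pre-Lie exponentials -/

section CycleGroup

variable {k : Type u} [Field k]

theorem evenBracket_mem {a b : Conv k} (ha : a ∈ evenCycles k) (hb : b ∈ evenCycles k) :
    evenBracket a b ∈ evenCycles k := by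
  obtain ⟨a1, a2, a3⟩ := mem_evenCycles.1 ha
  obtain ⟨b1, b2, b3⟩ := mem_evenCycles.1 hb
  refine ⟨⟨Submodule.sub_mem _ (preLie_mem a1 b1) (preLie_mem b1 a1), ?_⟩, ?_⟩
  · have h1 := preLie_parity a2 b2
    have h2 := preLie_parity b2 a2
    rw [add_zero] at h1 h2
    exact Submodule.sub_mem _ h1 h2
  · change twistedDiff k 0 (evenBracket a b) = 0
    rw [(twistedDiff_bracket ha b1).1 b2, twistedDiff_apply_zero, b3, sub_self]
    simp [evenBracket]

theorem evenBracket_weight {a b : Conv k} {i j : ℕ} (ha : a ∈ weightFil i) (hb : b ∈ weightFil j) :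
    evenBracket a b ∈ weightFil (i + j) :=
  Submodule.sub_mem _ (preLie_weight ha hb) (by rw [add_comm]; exact preLie_weight hb ha)

theorem nested_mem {w : List (Conv k)} (hw : ∀ a ∈ w, a ∈ evenCycles k) :
    nested evenBracket w ∈ evenCycles k ∧ nested evenBracket w ∈ weightFil w.length := by
  induction w with
  | nil => exact ⟨Submodule.zero_mem _, Submodule.zero_mem _⟩
  | cons a w ih =>
    have ha := hw a (by simp)
    obtain ⟨h1, h2⟩ := ih fun b hb => hw b (by simp [hb])
    by_cases h : w = []
    · subst h
      exact ⟨ha, evenCycles_weight ha⟩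
    · rw [nested_cons _ _ h]
      refine ⟨evenBracket_mem ha h1, ?_⟩
      rw [List.length_cons, add_comm]
      exact evenBracket_weight (evenCycles_weight ha) h2

theorem mem_bchWord {L : Type*} {x y a : L} {n : ℕ} {r : Fin n → ℕ × ℕ} (h : a ∈ bchWord x y r) :
    a = x ∨ a = y := by
  simp only [bchWord, List.mem_flatten, List.mem_ofFn] at h
  obtain ⟨_, ⟨i, rfl⟩, h⟩ := h
  rcases List.mem_append.1 h with h | h
  · exact Or.inl (List.eq_of_mem_replicate h)
  · exact Or.inr (List.eq_of_mem_replicate h)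

theorem bchTerm_mem {x y : Conv k} (hx : x ∈ evenCycles k) (hy : y ∈ evenCycles k) (l : ℕ) :
    bchTerm k evenBracket x y l ∈ evenCycles k ∧ bchTerm k evenBracket x y l ∈ weightFil l := by
  have h : ∀ {n : ℕ} (r : Fin n → ℕ × ℕ), ∀ a ∈ bchWord x y r, a ∈ evenCycles k := by
    intro n r a ha
    rcases mem_bchWord ha with rfl | rfl
    · exact hx
    · exact hy
  constructor
  · exact Submodule.sum_mem _ fun n _ => Submodule.sum_mem _ fun r _ =>
      Submodule.smul_mem _ _ (nested_mem (h r)).1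
  · refine Submodule.sum_mem _ fun n _ => Submodule.sum_mem _ fun r hr =>
      Submodule.smul_mem _ _ ?_
    have := (nested_mem (h r)).2
    rw [bchWord_length, ((Finset.mem_filter.1 hr).2).2] at this
    exact this

theorem HasFSum.preLie_left {a s : Conv k} {w : ℕ → Conv k} (ha : a ∈ weightFil 0)
    (hs : HasFSum weightFil w s) : HasFSum weightFil (fun i => preLie a (w i)) (preLie a s) :=
  hs.map (preLie a) fun N x hx => by simpa using preLie_weight ha hx

theorem HasFSum.preLie_right {a s : Conv k} {w : ℕ → Conv k} (ha : a ∈ weightFil 0)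
    (hs : HasFSum weightFil w s) : HasFSum weightFil (fun i => preLie (w i) a) (preLie s a) :=
  hs.map (preLie.flip a) fun N x hx => by simpa using preLie_weight hx ha

theorem HasFSum.congr {L : Type*} [AddCommGroup L] [Module k L] {F : ℕ → Submodule k L}
    {u w : ℕ → L} {s : L} (hs : HasFSum F u s) (h : ∀ i, u i = w i) : HasFSum F w s := by
  rwa [show u = w from funext h] at hs

theorem convSum_mem_evenCycles {w : ℕ → Conv k} (hw : ∀ l, w l ∈ evenCycles k)
    (hw' : ∀ l, w l ∈ weightFil l) : convSum w ∈ evenCycles k := by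
  have h := hasFSum_convSum hw'
  have hθ : theta k ∈ weightFil 0 := mem_weightFil_zero theta_mem
  refine mem_evenCycles.2 ⟨convSum_mem_cgra fun l => (mem_evenCycles.1 (hw l)).1,
    convSum_mem_parity fun l => (mem_evenCycles.1 (hw l)).2.1, ?_⟩
  exact (h.preLie_left hθ).unique weightFil_hausdorff
    ((h.preLie_right hθ).congr fun l => ((mem_evenCycles.1 (hw l)).2.2).symm)

/-- The product of even cycles given by the Baker–Campbell–Hausdorff series. -/
noncomputable def bchMul (x y : evenCycles k) : evenCycles k :=
  ⟨convSum (bchTerm k evenBracket x.1 y.1),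
    convSum_mem_evenCycles (fun l => (bchTerm_mem x.2 y.2 l).1) fun l => (bchTerm_mem x.2 y.2 l).2⟩

theorem isBCH_bchMul (x y : evenCycles k) : IsBCH (x : Conv k) y (bchMul x y : Conv k) :=
  hasFSum_convSum fun l => (bchTerm_mem x.2 y.2 l).2

/-- The weight filtration of the deformation complex. -/
noncomputable def cgraFil (k : Type u) [Field k] (N : ℕ) : Submodule k (convCGra k) :=
  (weightFil N).comap (convCGra k).subtype

theorem cgraFil_zero : cgraFil k 0 = ⊤ :=
  (Submodule.eq_top_iff').2 fun x => mem_weightFil_zero x.2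

theorem cgraFil_anti : Antitone (cgraFil k) := fun _ _ h _ hx => weightFil_anti h hx

/-- The right pre-Lie multiplication. -/
noncomputable def rightMul (y : evenCycles k) : Module.End k (convCGra k) :=
  (preLie.flip (y : Conv k)).restrict fun _ hx => preLie_mem hx (mem_evenCycles.1 y.2).1

theorem rightMul_coe (y : evenCycles k) (x : convCGra k) : (rightMul y x : Conv k) = preLie x y := rfl

theorem rightMul_mem {y : evenCycles k} {j : ℕ} (hy : (y : Conv k) ∈ weightFil j) (m : ℕ)
    (x : convCGra k) (hx : x ∈ cgraFil k m) : rightMul y x ∈ cgraFil k (m + j) :=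
  preLie_weight hx hy

/-- The bracket of even cycles. -/
noncomputable def cycleBracket (a b : evenCycles k) : evenCycles k :=
  ⟨evenBracket a b, evenBracket_mem a.2 b.2⟩

/-- The symmetry of the associator, rearranged: right multiplications form an anti-representation.
-/
theorem preLie_evenBracket {a b x : Conv k} (ha : a ∈ evenCycles k) (hb : b ∈ evenCycles k)
    (hx : x ∈ convCGra k) :
    preLie x (evenBracket a b) = preLie (preLie x a) b - preLie (preLie x b) a := by
  obtain ⟨a1, a2, _⟩ := mem_evenCycles.1 ha
  obtain ⟨b1, b2, _⟩ := mem_evenCycles.1 hb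
  have e := preLie_identity hx a1 b1 a2 b2
  rw [ksign, if_neg (by simp), one_smul] at e
  rw [evenBracket, map_sub]
  have h : ∀ p q r s : Conv k, p - q = r - s → q - s = p - r := fun p q r s h => by
    rw [sub_eq_sub_iff_add_eq_add] at h ⊢
    rw [add_comm, ← h, add_comm]
  exact h _ _ _ _ e

theorem rightMul_bracket (a b : evenCycles k) (x : convCGra k) :
    rightMul (cycleBracket a b) x = rightMul b (rightMul a x) - rightMul a (rightMul b x) :=
  Subtype.ext (preLie_evenBracket a.2 b.2 x.2)

variable [CharZero k]

theorem bchMul_sub_mem (N : ℕ) (x y : evenCycles k) :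
    ((bchMul x y - ∑ l ∈ Finset.range N, bchTerm k cycleBracket x y l : evenCycles k) : Conv k) ∈
      weightFil N := by
  have h1 := (isBCH_bchMul x y).sub_mem (N := N) (m := N)
    fun i hi => weightFil_anti hi (bchTerm_mem x.2 y.2 i).2
  have h2 : ((∑ l ∈ Finset.range N, bchTerm k cycleBracket x y l : evenCycles k) : Conv k) =
      ∑ l ∈ Finset.range N, bchTerm k evenBracket (x : Conv k) y l := by
    rw [← Submodule.subtype_apply, map_sum]
    exact Finset.sum_congr rfl fun l _ =>
      map_bchTerm (evenCycles k).subtype (fun _ _ => rfl) x y l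
  rwa [AddSubgroupClass.coe_sub, h2]

/-- Right pre-Lie multiplication, as a representation of the even cycles. -/
noncomputable def rightMulRep (k : Type u) [Field k] [CharZero k] :
    BCHRep (k := k) (cgraFil k) (cycleBracket (k := k)) bchMul where
  R :=
    { toFun := rightMul
      map_add' := fun y y' => by
        ext1 x; ext1
        change preLie (x : Conv k) (y + y' : Conv k) = preLie (x : Conv k) y + preLie (x : Conv k) y'
        exact map_add _ _ _
      map_smul' := fun c y => by
        ext1 x; ext1
        change preLie (x : Conv k) (c • (y : Conv k)) = c • preLie (x : Conv k) y
        exact map_smul _ _ _ }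
  zero := cgraFil_zero
  anti := cgraFil_anti
  mem y := rightMul_mem (evenCycles_weight y.2)
  bracket := rightMul_bracket
  mul x y N v := by
    have := rightMul_mem (bchMul_sub_mem N x y) 0 v (by rw [cgraFil_zero]; trivial)
    rwa [Nat.zero_add] at this

/-- Right multiplication is faithful, because applying it to 𝟙 gives 𝟙 ⋆ x = x. Identities between
cycles can therefore be checked on exponentials of operators. -/
theorem cycle_ext {x y : evenCycles k}
    (h : ∀ N > 0, (rightMulRep k).E N x = (rightMulRep k).E N y) : x = y := by
  ext1
  refine sub_eq_zero.1 (weightFil_hausdorff _ fun N => ?_)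
  have h1 := (rightMulRep k).E_injective h N ⟨convOne, convOne_mem⟩
  rw [← convOne_preLie (mem_evenCycles.1 x.2).1, ← convOne_preLie (mem_evenCycles.1 y.2).1]
  exact h1

/-- The group of even cycles under the Baker–Campbell–Hausdorff product. -/
@[reducible] noncomputable def cycleGroup (k : Type u) [Field k] [CharZero k] :
    Group (evenCycles k) :=
  letI : Mul (evenCycles k) := ⟨bchMul⟩
  letI : One (evenCycles k) := ⟨0⟩
  letI : Inv (evenCycles k) := ⟨fun x => -x⟩
  Group.ofLeftAxioms
    (fun x y z => cycle_ext fun N hN => by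
      change (rightMulRep k).E N (bchMul (bchMul x y) z) = (rightMulRep k).E N (bchMul x (bchMul y z))
      simp only [(rightMulRep k).E_mul hN, mul_assoc])
    (fun x => cycle_ext fun N hN => by
      change (rightMulRep k).E N (bchMul 0 x) = (rightMulRep k).E N x
      rw [(rightMulRep k).E_mul hN, (rightMulRep k).E_zero hN, one_mul])
    (fun x => cycle_ext fun N hN => by
      change (rightMulRep k).E N (bchMul (-x) x) = (rightMulRep k).E N 0
      rw [(rightMulRep k).E_mul hN, (rightMulRep k).E_zero hN, (rightMulRep k).E_neg_mul hN])

/-! ### Exponentials -/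

/-- The series `∑ 1/m! ( ⋯ (z ⋆ x) ⋯ ) ⋆ x`. -/
noncomputable def expSeries (x z : Conv k) (m : ℕ) : Conv k :=
  (1 / (m.factorial : k)) • (preLie.flip x)^[m] z

theorem iterate_preLie_mem {x z : Conv k} (hx : x ∈ convCGra k) (hz : z ∈ convCGra k) (m : ℕ) :
    (preLie.flip x)^[m] z ∈ convCGra k := by
  induction m with
  | zero => exact hz
  | succ m ih => rw [Function.iterate_succ_apply']; exact preLie_mem ih hx

theorem iterate_preLie_parity {x z : Conv k} {q : ZMod 2} (hx : x ∈ convParity k 0)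
    (hz : z ∈ convParity k q) (m : ℕ) : (preLie.flip x)^[m] z ∈ convParity k q := by
  induction m with
  | zero => exact hz
  | succ m ih =>
    rw [Function.iterate_succ_apply']
    simpa using preLie_parity ih hx

theorem iterate_preLie_weight {x z : Conv k} {i : ℕ} (hx : x ∈ weightFil 1) (hz : z ∈ weightFil i)
    (m : ℕ) : (preLie.flip x)^[m] z ∈ weightFil (i + m) := by
  induction m with
  | zero => exact hz
  | succ m ih => rw [Function.iterate_succ_apply', ← add_assoc]; exact preLie_weight ih hx

theorem expSeries_mem {x z : Conv k} (hx : x ∈ evenCycles k) (hz : z ∈ convCGra k) (m : ℕ) :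
    expSeries x z m ∈ convCGra k :=
  Submodule.smul_mem _ _ (iterate_preLie_mem (mem_evenCycles.1 hx).1 hz m)

theorem expSeries_weight {x z : Conv k} (hx : x ∈ evenCycles k) (hz : z ∈ convCGra k) (m : ℕ) :
    expSeries x z m ∈ weightFil m := by
  have := iterate_preLie_weight (evenCycles_weight hx) (mem_weightFil_zero hz) m
  rw [Nat.zero_add] at this
  exact Submodule.smul_mem _ _ this

/-- `exp(R_x)(z)`, where `R_x` is the right pre-Lie multiplication by `x`. -/
noncomputable def convExp (x z : Conv k) : Conv k := convSum (expSeries x z)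

theorem hasFSum_convExp {x z : Conv k} (hx : x ∈ evenCycles k) (hz : z ∈ convCGra k) :
    HasFSum weightFil (expSeries x z) (convExp x z) :=
  hasFSum_convSum (expSeries_weight hx hz)

theorem convExp_mem {x z : Conv k} (hx : x ∈ evenCycles k) (hz : z ∈ convCGra k) :
    convExp x z ∈ convCGra k := convSum_mem_cgra (expSeries_mem hx hz)

theorem convExp_parity {x z : Conv k} {q : ZMod 2} (hx : x ∈ evenCycles k) (hz : z ∈ convParity k q) :
    convExp x z ∈ convParity k q :=
  convSum_mem_parity fun m => Submodule.smul_mem _ _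
    (iterate_preLie_parity (mem_evenCycles.1 hx).2.1 hz m)

/-- Identifies the pre-Lie exponential e^x with exp(R_x)(𝟙); the case m = 1 is 𝟙 ⋆ x = x. -/
theorem prePow_eq {x : Conv k} (hx : x ∈ convCGra k) (m : ℕ) :
    prePow x m = (preLie.flip x)^[m] convOne := by
  match m with
  | 0 => rfl
  | 1 => exact (convOne_preLie hx).symm
  | m + 2 =>
    rw [prePow, prePow_eq hx (m + 1), Function.iterate_succ_apply' _ (m + 1)]
    rfl

theorem isPreLieExp_convExp {x : Conv k} (hx : x ∈ evenCycles k) :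
    IsPreLieExp x (convExp x convOne) :=
  (hasFSum_convExp hx convOne_mem).congr fun m => by
    rw [prePow_eq (mem_evenCycles.1 hx).1]; rfl

theorem hasFSum_convExp' (x : evenCycles k) (z : convCGra k) :
    HasFSum (cgraFil k) (fun m => (1 / (m.factorial : k)) • (rightMul x)^[m] z)
      ⟨convExp x z, convExp_mem x.2 z.2⟩ := by
  intro N
  obtain ⟨M, h⟩ := hasFSum_convExp x.2 z.2 N
  refine ⟨M, fun m hm => ?_⟩
  have h1 := h m hm
  have h2 : ∀ m, ((rightMul x)^[m] z : Conv k) = (preLie.flip (x : Conv k))^[m] z := by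
    intro m
    induction m with
    | zero => rfl
    | succ m ih => rw [Function.iterate_succ_apply', rightMul_coe, ih, Function.iterate_succ_apply']; rfl
  change ((_ - _ : convCGra k) : Conv k) ∈ weightFil N
  rw [AddSubgroupClass.coe_sub, Submodule.coe_sum]
  simp only [Submodule.coe_smul, h2]
  exact h1

/-- `exp(R_{x * y}) = exp(R_y) exp(R_x)`. -/
theorem convExp_bchMul (x y : evenCycles k) {z : Conv k} (hz : z ∈ convCGra k) :
    convExp (bchMul x y : Conv k) z = convExp (y : Conv k) (convExp x z) :=
  sub_eq_zero.1 (weightFil_hausdorff _ fun N => (rightMulRep k).exp_mul x y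
    (hasFSum_convExp' (bchMul x y) ⟨z, hz⟩) (hasFSum_convExp' x ⟨z, hz⟩)
    (hasFSum_convExp' y ⟨_, convExp_mem x.2 hz⟩) N)

/-- In the pre-Lie identity for (A, x, θ) with A = R_x^m 𝟙, the terms A ⋆ (x ⋆ θ) and A ⋆ (θ ⋆ x)
cancel, x being a cycle; what remains is (A ⋆ x) ⋆ θ = (A ⋆ θ) ⋆ x. -/
theorem iterate_preLie_theta {x : Conv k} (hx : x ∈ evenCycles k) (m : ℕ) :
    (preLie.flip x)^[m] (theta k) = preLie ((preLie.flip x)^[m] convOne) (theta k) := by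
  obtain ⟨x1, x2, x3⟩ := mem_evenCycles.1 hx
  induction m with
  | zero => exact (convOne_preLie theta_mem).symm
  | succ m ih =>
    rw [Function.iterate_succ_apply', ih, Function.iterate_succ_apply']
    have e := preLie_identity (iterate_preLie_mem x1 convOne_mem m) x1 theta_mem x2 theta_parity
    simp only [ksign, zero_ne_one, false_and, if_false, one_smul] at e
    rw [x3] at e
    exact (sub_left_injective e).symm

theorem convExp_theta {x : Conv k} (hx : x ∈ evenCycles k) :
    convExp x (theta k) = preLie (convExp x convOne) (theta k) := by
  refine (hasFSum_convExp hx theta_mem).unique weightFil_hausdorff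
    (((hasFSum_convExp hx convOne_mem).preLie_right (mem_weightFil_zero theta_mem)).congr fun m => ?_)
  rw [expSeries, expSeries, iterate_preLie_theta hx, map_smul, LinearMap.smul_apply]

end CycleGroup

/-! ### The group of homology classes -/

section HomologyGroup

variable {k : Type u} [Field k]

/-- The even boundaries of elements of weight at least `N`. -/
noncomputable def boundaryFil (k : Type u) [Field k] (N : ℕ) : Submodule k (Conv k) :=
  (convCGra k ⊓ convParity k 1 ⊓ weightFil N).map (twistedDiff k 1)

theorem boundaryFil_zero : boundaryFil k 0 = evenBoundaries k := by
  rw [boundaryFil, evenBoundaries, inf_eq_left.2]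
  exact fun x hx => mem_weightFil_zero hx.1

theorem evenBracket_boundary {a b : Conv k} {i j : ℕ} (ha : a ∈ evenCycles k) (haw : a ∈ weightFil i)
    (hb : b ∈ boundaryFil k j) : evenBracket a b ∈ boundaryFil k (i + j) := by
  obtain ⟨h, ⟨⟨h1, h2⟩, h3⟩, rfl⟩ := hb
  obtain ⟨a1, a2, _⟩ := mem_evenCycles.1 ha
  refine ⟨evenBracket a h, ⟨⟨?_, ?_⟩, evenBracket_weight haw h3⟩, (twistedDiff_bracket ha h1).2 h2⟩
  · exact Submodule.sub_mem _ (preLie_mem a1 h1) (preLie_mem h1 a1)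
  · have e1 := preLie_parity a2 h2
    have e2 := preLie_parity h2 a2
    rw [zero_add] at e1
    rw [add_zero] at e2
    exact Submodule.sub_mem _ e1 e2

/-- Letters are replaced one at a time. Each bracket with an even cycle raises the weight of the
primitive by one at least, while the primitive at the replaced letter may have weight zero; hence
length minus one. -/
theorem nested_sub_mem {w w' : List (Conv k)} (h : List.Forall₂ (fun a b => a ∈ evenCycles k ∧
    b ∈ evenCycles k ∧ a - b ∈ evenBoundaries k) w w') :
    nested evenBracket w - nested evenBracket w' ∈ boundaryFil k (w.length - 1) := by
  induction h with
  | nil => simp [nested]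
  | @cons a b w w' hab hw ih =>
    obtain ⟨ha, hb, hs⟩ := hab
    rw [← boundaryFil_zero] at hs
    have hlen := hw.length_eq
    by_cases h0 : w = []
    · subst h0
      obtain rfl : w' = [] := by simpa using hlen.symm
      exact hs
    · have h0' : w' ≠ [] := by rintro rfl; simp at hlen; exact h0 hlen
      have hw' : ∀ c ∈ w', c ∈ evenCycles k := by
        clear * - hw
        induction hw with
        | nil => simp
        | cons h _ ih => exact List.forall_mem_cons.2 ⟨h.2.1, ih⟩
      obtain ⟨n1, n2⟩ := nested_mem hw'
      rw [nested_cons _ _ h0, nested_cons _ _ h0']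
      have hpos : 0 < w.length := List.length_pos_iff.2 h0
      have e1 := evenBracket_boundary ha (evenCycles_weight ha) ih
      have e2 := evenBracket_boundary n1 n2 hs
      rw [show 1 + (w.length - 1) = (a :: w).length - 1 by simp; omega] at e1
      rw [show w'.length + 0 = (a :: w).length - 1 by simp; omega] at e2
      have := Submodule.sub_mem _ e1 e2
      convert this using 1
      simp only [evenBracket, map_sub, LinearMap.sub_apply]
      abel

theorem bchTerm_sub_mem {x y x' y' : Conv k} (hx : x ∈ evenCycles k) (hy : y ∈ evenCycles k)
    (hx' : x' ∈ evenCycles k) (hy' : y' ∈ evenCycles k) (hxx : x - x' ∈ evenBoundaries k)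
    (hyy : y - y' ∈ evenBoundaries k) (l : ℕ) :
    bchTerm k evenBracket x y l - bchTerm k evenBracket x' y' l ∈ boundaryFil k (l - 1) := by
  rw [bchTerm, bchTerm, ← Finset.sum_sub_distrib]
  refine Submodule.sum_mem _ fun n _ => ?_
  rw [← Finset.sum_sub_distrib]
  refine Submodule.sum_mem _ fun r hr => ?_
  rw [← smul_sub]
  refine Submodule.smul_mem _ _ ?_
  have h1 : List.Forall₂ (fun a b => a ∈ evenCycles k ∧
    b ∈ evenCycles k ∧ a - b ∈ evenBoundaries k) (bchWord x y r) (bchWord x' y' r) := by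
    -- Both words are images of one word in two letters, so they can be compared letter by letter.
    have e1 : bchWord x y r = (bchWord false true r).map fun b => if b then y else x := by
      rw [bchWord_map]; rfl
    have e2 : bchWord x' y' r = (bchWord false true r).map fun b => if b then y' else x' := by
      rw [bchWord_map]; rfl
    rw [e1, e2, List.forall₂_map_left_iff, List.forall₂_map_right_iff]
    refine List.forall₂_same.2 fun b _ => ?_
    cases b
    · exact ⟨hx, hx', hxx⟩
    · exact ⟨hy, hy', hyy⟩
  have h2 := nested_sub_mem h1
  rw [bchWord_length, ((Finset.mem_filter.1 hr).2).2] at h2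
  exact h2

/-- The primitives of the differences of successive terms have weights tending to infinity, so they
can be summed, and the differential applied to the sum. -/
theorem bchMul_sub_mem_boundaries {x y x' y' : evenCycles k}
    (hxx : (x : Conv k) - x' ∈ evenBoundaries k) (hyy : (y : Conv k) - y' ∈ evenBoundaries k) :
    (bchMul x y : Conv k) - bchMul x' y' ∈ evenBoundaries k := by
  -- The term of degree zero vanishes; after the shift, the l-th primitive has weight at least l, as
  -- `convSum` requires.
  have h := fun l => bchTerm_sub_mem x.2 y.2 x'.2 y'.2 hxx hyy (l + 1)
  choose h hh he using h
  have hw : ∀ l, h l ∈ weightFil l := fun l => (hh l).2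
  refine ⟨convSum h, ⟨convSum_mem_cgra fun l => (hh l).1.1, convSum_mem_parity fun l => (hh l).1.2⟩,
    ?_⟩
  have hθ : theta k ∈ weightFil 0 := mem_weightFil_zero theta_mem
  have s1 : HasFSum weightFil (fun l => twistedDiff k 1 (h l)) (twistedDiff k 1 (convSum h)) :=
    (hasFSum_convSum hw).map _ fun N a ha => by
      rw [twistedDiff_apply_one]
      have e1 := preLie_weight hθ ha
      rw [Nat.zero_add] at e1
      exact Submodule.add_mem _ e1 (preLie_weight ha hθ)
  have s2 := ((isBCH_bchMul x y).add ((isBCH_bchMul x' y').map (-LinearMap.id)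
    fun N a ha => Submodule.neg_mem _ ha)).shift
  have h0 : ∀ a b : Conv k, bchTerm k evenBracket a b 0 = 0 := fun a b => by simp [bchTerm]
  simp only [h0, map_zero, add_zero, sub_zero, LinearMap.neg_apply, LinearMap.id_apply,
    ← sub_eq_add_neg] at s2
  exact s1.unique weightFil_hausdorff (s2.congr fun l => (he l).symm)

theorem homologyClass_eq_iff {x y : evenCycles k} :
    homologyClass k x = homologyClass k y ↔ (x : Conv k) - y ∈ evenBoundaries k :=
  Submodule.Quotient.eq _

/-- The product of homology classes. -/
noncomputable def homologyMul (a b : EvenHomology k) : EvenHomology k :=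
  Quotient.map₂ (sc := Submodule.quotientRel _) bchMul (fun x x' hx y y' hy => by
    exact (Submodule.quotientRel_def _).2 (bchMul_sub_mem_boundaries
      (homologyClass_eq_iff.1 (Quotient.sound (s := Submodule.quotientRel _) hx))
      (homologyClass_eq_iff.1 (Quotient.sound (s := Submodule.quotientRel _) hy)))) a b

variable [CharZero k]

/-- The group of even homology classes. -/
@[reducible] noncomputable def homologyGroup (k : Type u) [Field k] [CharZero k] :
    Group (EvenHomology k) :=
  letI := cycleGroup k
  letI : Mul (EvenHomology k) := ⟨homologyMul⟩
  letI : One (EvenHomology k) := ⟨0⟩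
  letI : Inv (EvenHomology k) := ⟨fun x => -x⟩
  Group.ofLeftAxioms
    (fun a b c => by
      obtain ⟨x, rfl⟩ := Submodule.Quotient.mk_surjective _ a
      obtain ⟨y, rfl⟩ := Submodule.Quotient.mk_surjective _ b
      obtain ⟨z, rfl⟩ := Submodule.Quotient.mk_surjective _ c
      exact congrArg (homologyClass k) (mul_assoc x y z))
    (fun a => by
      obtain ⟨x, rfl⟩ := Submodule.Quotient.mk_surjective _ a
      exact congrArg (homologyClass k) (one_mul x))
    (fun a => by
      obtain ⟨x, rfl⟩ := Submodule.Quotient.mk_surjective _ a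
      exact congrArg (homologyClass k) (inv_mul_cancel x))

end HomologyGroup

end DeformationGroup
namespace DeformationGroup

/-! ## Unconditional sums -/

section SumsTo

variable {k : Type u} [Field k] {L : Type*} [AddCommGroup L] [Module k L]
variable {M : Type*} [AddCommGroup M] [Module k M] {ι κ : Type*}
variable {F : ℕ → Submodule k L} {x : ι → L} {s : L}

/-- The family `x` converges to zero. -/
def Null (F : ℕ → Submodule k L) (x : ι → L) : Prop := ∀ N, ∃ t : Finset ι, ∀ i ∉ t, x i ∈ F N

/-- The family `x` has the sum `s`. -/
def SumsTo (F : ℕ → Submodule k L) (x : ι → L) (s : L) : Prop :=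
  ∀ N, ∃ t : Finset ι, (∀ i ∉ t, x i ∈ F N) ∧ s - ∑ i ∈ t, x i ∈ F N

theorem sub_sum_mem {N : ℕ} {t t' : Finset ι} (h : ∀ i ∉ t, x i ∈ F N)
    (hs : s - ∑ i ∈ t, x i ∈ F N) (htt : t ⊆ t') : s - ∑ i ∈ t', x i ∈ F N := by
  classical
  rw [← Finset.sum_sdiff htt, add_comm, ← sub_sub]
  exact Submodule.sub_mem _ hs (Submodule.sum_mem _ fun i hi => h i (Finset.mem_sdiff.1 hi).2)

theorem SumsTo.unique {s' : L} (hF : ∀ x, (∀ N, x ∈ F N) → x = 0) (h : SumsTo F x s)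
    (h' : SumsTo F x s') : s = s' := by
  classical
  refine sub_eq_zero.1 (hF _ fun N => ?_)
  obtain ⟨t, h1, h2⟩ := h N
  obtain ⟨t', h1', h2'⟩ := h' N
  have := Submodule.sub_mem _ (sub_sum_mem h1 h2 (Finset.subset_union_left (s₂ := t')))
    (sub_sum_mem h1' h2' (Finset.subset_union_right (s₁ := t)))
  simpa using this

theorem SumsTo.mem {N : ℕ} (h : SumsTo F x s) (hx : ∀ i, x i ∈ F N) : s ∈ F N := by
  obtain ⟨t, h1, h2⟩ := h N
  simpa using Submodule.add_mem _ h2 (Submodule.sum_mem _ fun i (_ : i ∈ t) => hx i)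

theorem SumsTo.map {F' : ℕ → Submodule k M} (h : SumsTo F x s) (T : L →ₗ[k] M)
    (hT : ∀ N, ∃ N', ∀ y ∈ F N', T y ∈ F' N) : SumsTo F' (fun i => T (x i)) (T s) := by
  intro N
  obtain ⟨N', hN⟩ := hT N
  obtain ⟨t, h1, h2⟩ := h N'
  refine ⟨t, fun i hi => hN _ (h1 i hi), ?_⟩
  have := hN _ h2
  rwa [map_sub, map_sum] at this

theorem SumsTo.add {y : ι → L} {s' : L} (h : SumsTo F x s) (h' : SumsTo F y s') :
    SumsTo F (fun i => x i + y i) (s + s') := by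
  classical
  intro N
  obtain ⟨t, h1, h2⟩ := h N
  obtain ⟨t', h1', h2'⟩ := h' N
  refine ⟨t ∪ t', fun i hi => ?_, ?_⟩
  · rw [Finset.mem_union, not_or] at hi
    exact Submodule.add_mem _ (h1 i hi.1) (h1' i hi.2)
  · rw [Finset.sum_add_distrib, add_sub_add_comm]
    exact Submodule.add_mem _ (sub_sum_mem h1 h2 Finset.subset_union_left)
      (sub_sum_mem h1' h2' Finset.subset_union_right)

theorem SumsTo.congr {y : ι → L} (h : SumsTo F x s) (e : ∀ i, x i = y i) : SumsTo F y s := by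
  rwa [show x = y from funext e] at h

theorem SumsTo.reindex (e : κ ≃ ι) (h : SumsTo F x s) : SumsTo F (fun j => x (e j)) s := by
  intro N
  obtain ⟨t, h1, h2⟩ := h N
  refine ⟨t.map e.symm.toEmbedding, fun j hj => h1 _ fun h => hj ?_, ?_⟩
  · simpa using h
  · simpa using h2

/-- A summable family may be summed fibre by fibre. A finite set exhausting the family modulo F N is
enlarged to a union of finite pieces of fibres, each piece computing the sum of its fibre modulo F
N. -/
theorem SumsTo.sigma {β : κ → Type*} {x : (Σ c, β c) → L} {y : κ → L} (h : SumsTo F x s)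
    (hy : ∀ c, SumsTo F (fun b => x ⟨c, b⟩) (y c)) : SumsTo F y s := by
  classical
  intro N
  obtain ⟨t, h1, h2⟩ := h N
  have key : ∀ c, ∃ r : Finset (β c), (∀ b ∉ r, (⟨c, b⟩ : Σ c, β c) ∉ t) ∧
      y c - ∑ b ∈ r, x ⟨c, b⟩ ∈ F N := by
    intro c
    obtain ⟨r, h3, h4⟩ := hy c N
    refine ⟨r ∪ t.preimage (Sigma.mk c) sigma_mk_injective.injOn, fun b hb => ?_,
      sub_sum_mem h3 h4 Finset.subset_union_left⟩
    rw [Finset.mem_union, not_or, Finset.mem_preimage] at hb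
    exact hb.2
  choose r hr hr' using key
  refine ⟨t.image Sigma.fst, fun c hc => ?_, ?_⟩
  · refine (hy c).mem fun b => h1 _ fun h => hc (Finset.mem_image.2 ⟨_, h, rfl⟩)
  · have h5 : t ⊆ (t.image Sigma.fst).sigma r := by
      rintro ⟨c, b⟩ hb
      refine Finset.mem_sigma.2 ⟨Finset.mem_image.2 ⟨_, hb, rfl⟩, ?_⟩
      by_contra h
      exact hr c b h hb
    have h6 := sub_sum_mem h1 h2 h5
    rw [Finset.sum_sigma] at h6
    have h7 : ∑ c ∈ t.image Sigma.fst, (y c - ∑ b ∈ r c, x ⟨c, b⟩) ∈ F N :=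
      Submodule.sum_mem _ fun c _ => hr' c
    rw [Finset.sum_sub_distrib] at h7
    have h8 := Submodule.sub_mem _ h6 h7
    rwa [sub_sub_sub_cancel_right] at h8

theorem SumsTo.prod {x : ι × κ → L} {y : ι → L} (h : SumsTo F x s)
    (hy : ∀ c, SumsTo F (fun b => x (c, b)) (y c)) : SumsTo F y s :=
  (h.reindex (Equiv.sigmaEquivProd ι κ)).sigma hy

theorem SumsTo.prod_swap {x : ι × κ → L} {y : κ → L} (h : SumsTo F x s)
    (hy : ∀ c, SumsTo F (fun b => x (b, c)) (y c)) : SumsTo F y s :=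
  (h.reindex (Equiv.prodComm κ ι)).prod hy

theorem SumsTo.fiber (π : ι → κ) (fib : κ → Finset ι) (hfib : ∀ i c, i ∈ fib c ↔ π i = c)
    (h : SumsTo F x s) : SumsTo F (fun c => ∑ i ∈ fib c, x i) s := by
  classical
  intro N
  obtain ⟨t, h1, h2⟩ := h N
  refine ⟨t.image π, fun c hc => Submodule.sum_mem _ fun i hi => h1 i fun h => hc ?_, ?_⟩
  · exact Finset.mem_image.2 ⟨i, h, (hfib i c).1 hi⟩
  · rw [← Finset.sum_biUnion]
    · exact sub_sum_mem h1 h2 fun i hi => Finset.mem_biUnion.2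
        ⟨π i, Finset.mem_image_of_mem _ hi, (hfib _ _).2 rfl⟩
    · intro c _ c' _ hcc
      rw [Function.onFun, Finset.disjoint_left]
      intro i hi hi'
      exact hcc (((hfib i c).1 hi).symm.trans ((hfib i c').1 hi'))

theorem sumsTo_single (i₀ : ι) (h : ∀ i, i ≠ i₀ → x i = 0) : SumsTo F x (x i₀) := fun N =>
  ⟨{i₀}, fun i hi => by rw [h i (by simpa using hi)]; exact Submodule.zero_mem _, by simp⟩

theorem sumsTo_finset (t : Finset ι) (h : ∀ i ∉ t, x i = 0) : SumsTo F x (∑ i ∈ t, x i) := fun N =>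
  ⟨t, fun i hi => by rw [h i hi]; exact Submodule.zero_mem _, by simp⟩

theorem SumsTo.hasFSum {x : ℕ → L} (h : SumsTo F x s) : HasFSum F x s := by
  intro N
  obtain ⟨t, h1, h2⟩ := h N
  refine ⟨t.sup id + 1, fun m hm => sub_sum_mem h1 h2 fun i hi => ?_⟩
  have : i ≤ t.sup id := Finset.le_sup (f := id) hi
  simp; omega

/-- Exhaust the index set by increasing finite sets T N outside which the terms lie in F N; the
increments of the partial sums form a series to which completeness applies. -/
theorem Null.exists_sumsTo (hF : Antitone F)
    (hc : ∀ u : ℕ → L, (∀ N, u N ∈ F N) → ∃ s, HasFSum F u s) (hx : Null F x) :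
    ∃ s, SumsTo F x s := by
  classical
  choose t ht using hx
  set T : ℕ → Finset ι := fun N => (Finset.range (N + 1)).biUnion t with hT
  have hmono : Monotone T := fun a b h => Finset.biUnion_subset_biUnion_of_subset_left _
    (Finset.range_mono (by omega))
  have hT' : ∀ N, ∀ i ∉ T N, x i ∈ F N := fun N i hi => ht N i fun h =>
    hi (Finset.mem_biUnion.2 ⟨N, by simp, h⟩)
  obtain ⟨s, hs⟩ := hc (fun N => ∑ i ∈ T (N + 1), x i - ∑ i ∈ T N, x i) fun N => by
    rw [← Finset.sum_sdiff (hmono (Nat.le_succ N)), add_sub_cancel_right]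
    exact Submodule.sum_mem _ fun i hi => hT' N i (Finset.mem_sdiff.1 hi).2
  refine ⟨s + ∑ i ∈ T 0, x i, fun N => ?_⟩
  obtain ⟨m, hm⟩ := hs N
  refine ⟨T (max m N), fun i hi => hF (le_max_right m N) (hT' _ i hi), ?_⟩
  have := hm (max m N) (le_max_left _ _)
  rw [Finset.sum_range_sub (fun N => ∑ i ∈ T N, x i)] at this
  convert this using 1
  abel

/-- The sum of a family, if it converges. -/
noncomputable def fsum (F : ℕ → Submodule k L) (x : ι → L) : L :=
  open Classical in if h : ∃ s, SumsTo F x s then h.choose else 0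

theorem sumsTo_fsum (h : ∃ s, SumsTo F x s) : SumsTo F x (fsum F x) := by
  rw [fsum, dif_pos h]
  exact h.choose_spec

end SumsTo

end DeformationGroup
namespace DeformationGroup

/-! ## Power series with coefficients in a complete algebra -/

/-- The filtration degree of the coefficient of order `m` of an element of filtration degree `N`. -/
def seriesWeight (N m : ℕ) : ℕ := min N (max 1 (N - m))

/-- This inequality makes the operations on power series respect the filtration. The variable counts
for one unit of weight, except that for N ≥ 1 every coefficient must remain in F 1; in particular,
step 1 consists of all series with coefficients in F 1. -/
theorem seriesWeight_sum {ι : Type*} (t : Finset ι) (N c : ι → ℕ) :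
    seriesWeight (∑ i ∈ t, N i) (∑ i ∈ t, c i) ≤ ∑ i ∈ t, seriesWeight (N i) (c i) := by
  classical
  induction t using Finset.induction_on with
  | empty => simp [seriesWeight]
  | insert i t hi ih =>
    rw [Finset.sum_insert hi, Finset.sum_insert hi, Finset.sum_insert hi]
    refine le_trans ?_ (Nat.add_le_add_left ih _)
    unfold seriesWeight
    omega

namespace CompleteCGraAlgebra

variable {k : Type u} [Field k] {V : Type v} [AddCommGroup V] [Module k V]
variable (g : CompleteCGraAlgebra k V)

/-- The power series of given parity. -/
def seriesDeg (p : ZMod 2) : Submodule k (ℕ → V) where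
  carrier := {x | ∀ m, x m ∈ g.deg p}
  add_mem' hx hy m := Submodule.add_mem _ (hx m) (hy m)
  zero_mem' _ := Submodule.zero_mem _
  smul_mem' a _ hx m := Submodule.smul_mem _ a (hx m)

/-- The filtration of power series. -/
def seriesF (N : ℕ) : Submodule k (ℕ → V) where
  carrier := {x | ∀ m, x m ∈ g.F (seriesWeight N m)}
  add_mem' hx hy m := Submodule.add_mem _ (hx m) (hy m)
  zero_mem' _ := Submodule.zero_mem _
  smul_mem' a _ hx m := Submodule.smul_mem _ a (hx m)

theorem isCompl_seriesDeg : IsCompl (g.seriesDeg 0) (g.seriesDeg 1) := by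
  constructor
  · rw [Submodule.disjoint_def]
    intro x h0 h1
    funext m
    exact (Submodule.disjoint_def.1 g.isCompl_deg.1) _ (h0 m) (h1 m)
  · rw [codisjoint_iff, Submodule.eq_top_iff']
    intro x
    have h : ∀ m, ∃ y ∈ g.deg 0, ∃ z ∈ g.deg 1, y + z = x m := fun m =>
      Submodule.mem_sup.1 (by rw [g.isCompl_deg.sup_eq_top]; trivial)
    choose y hy z hz e using h
    exact Submodule.mem_sup.2 ⟨y, hy, z, hz, funext e⟩

theorem seriesF_graded (N : ℕ) : g.seriesF N =
    (g.seriesF N ⊓ g.seriesDeg 0) ⊔ (g.seriesF N ⊓ g.seriesDeg 1) := by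
  refine le_antisymm (fun x hx => ?_) (sup_le inf_le_left inf_le_left)
  have h : ∀ m, ∃ y ∈ g.F (seriesWeight N m) ⊓ g.deg 0,
      ∃ z ∈ g.F (seriesWeight N m) ⊓ g.deg 1, y + z = x m := fun m =>
    Submodule.mem_sup.1 (by rw [← g.F_graded]; exact hx m)
  choose y hy z hz e using h
  exact Submodule.mem_sup.2 ⟨y, ⟨fun m => (hy m).1, fun m => (hy m).2⟩, z,
    ⟨fun m => (hz m).1, fun m => (hz m).2⟩, funext e⟩

/-- The multilinear extension of the operations to power series. -/
noncomputable def seriesAct (n : ℕ) :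
    CGra k (Fin n) →ₗ[k] MultilinearMap k (fun _ : Fin n => ℕ → V) (ℕ → V) where
  toFun f := MultilinearMap.pi fun m =>
    ∑ c ∈ Finset.piAntidiag (Finset.univ : Finset (Fin n)) m,
      (g.act n f).compLinearMap fun i => LinearMap.proj (c i)
  map_add' f f' := by
    ext x m
    simp [Finset.sum_add_distrib]
  map_smul' a f := by
    ext x m
    simp [Finset.smul_sum]

theorem seriesAct_apply {n : ℕ} (f : CGra k (Fin n)) (x : Fin n → ℕ → V) (m : ℕ) :
    g.seriesAct n f x m = ∑ c ∈ Finset.piAntidiag (Finset.univ : Finset (Fin n)) m,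
      g.act n f fun i => x i (c i) := by
  simp [seriesAct]

theorem mem_piAntidiag_univ {n m : ℕ} {c : Fin n → ℕ} :
    c ∈ Finset.piAntidiag (Finset.univ : Finset (Fin n)) m ↔ ∑ i, c i = m := by
  simp [Finset.mem_piAntidiag]

theorem piAntidiag_one (m : ℕ) :
    Finset.piAntidiag (Finset.univ : Finset (Fin 1)) m = {fun _ => m} := by
  ext c
  rw [mem_piAntidiag_univ, Finset.mem_singleton, Fin.sum_univ_one]
  exact ⟨fun h => funext fun i => by rw [Subsingleton.elim i 0, h], fun h => by rw [h]⟩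

theorem update_apply_coeff {n : ℕ} (x : Fin n → ℕ → V) (c : Fin n → ℕ) (i : Fin n) (y : ℕ → V) :
    (fun j => Function.update x i y j (c j)) =
      Function.update (fun j => x j (c j)) i (y (c i)) := by
  funext j
  by_cases h : j = i
  · subst h; simp
  · simp [h]

/-- The argument of an operation with the middle entry `v`. -/
def insertMid {X : Type*} {a e : ℕ} (u : Fin a → X) (v : X) (w : Fin e → X) : Fin (a + 1 + e) → X :=
  Fin.append (Fin.append u fun _ : Fin 1 => v) w

theorem insertMid_update {X : Type*} {a e : ℕ} (u : Fin a → X) (v v' : X) (w : Fin e → X) :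
    insertMid u v w =
      Function.update (insertMid u v' w) (Fin.castAdd e (Fin.natAdd a (0 : Fin 1))) v := by
  funext i
  induction i using Fin.addCases with
  | left i =>
    induction i using Fin.addCases with
    | left i =>
      rw [Function.update_of_ne]
      · simp [insertMid]
      · simp [Fin.ext_iff]; omega
    | right i =>
      obtain rfl := Subsingleton.elim i 0
      simp [insertMid]
  | right i =>
    rw [Function.update_of_ne]
    · simp [insertMid]
    · simp [Fin.ext_iff]; omega

theorem act_insertMid_sum {a e : ℕ} {ι : Type*} (f : CGra k (Fin (a + 1 + e))) (u : Fin a → V)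
    (t : Finset ι) (v : ι → V) (w : Fin e → V) :
    g.act _ f (insertMid u (∑ i ∈ t, v i) w) = ∑ i ∈ t, g.act _ f (insertMid u (v i) w) := by
  rw [insertMid_update u _ 0 w, MultilinearMap.map_update_sum]
  exact Finset.sum_congr rfl fun i _ => by rw [← insertMid_update]

theorem series_act_comp (a m e : ℕ) (f : CGra k (Fin (a + 1 + e))) (h : CGra k (Fin m)) (q : ZMod 2)
    (hq : (h : Gra k (Fin m)) ∈ parity k (Fin m) q) (p : Fin (a + m + e) → ZMod 2)
    (x : Fin (a + m + e) → ℕ → V) (hx : ∀ i, x i ∈ g.seriesDeg (p i)) :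
    g.seriesAct (a + m + e) (CGra.comp a m e f h) x =
      ((-1 : ℤˣ) ^ (q * ∑ i : Fin a, p (Fin.castAdd e (Fin.castAdd m i)))) •
        g.seriesAct (a + 1 + e) f
          (insertMid (fun i : Fin a => x (Fin.castAdd e (Fin.castAdd m i)))
            (g.seriesAct m h (fun j => x (block a m e j)))
            (fun i : Fin e => x (Fin.natAdd (a + m) i))) := by
  funext N
  rw [Pi.smul_apply, seriesAct_apply, seriesAct_apply]
  have h1 : ∀ c' : Fin (a + 1 + e) → ℕ, (fun i => insertMid
      (fun i : Fin a => x (Fin.castAdd e (Fin.castAdd m i)))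
      (g.seriesAct m h (fun j => x (block a m e j)))
      (fun i : Fin e => x (Fin.natAdd (a + m) i)) i (c' i)) =
      insertMid (fun i : Fin a => x (Fin.castAdd e (Fin.castAdd m i)) (c' (Fin.castAdd e (Fin.castAdd 1 i))))
      (∑ c ∈ Finset.piAntidiag (Finset.univ : Finset (Fin m)) (c' (Fin.castAdd e (Fin.natAdd a 0))),
        g.act m h fun j => x (block a m e j) (c j))
      (fun i : Fin e => x (Fin.natAdd (a + m) i) (c' (Fin.natAdd (a + 1) i))) := by
    intro c'
    funext i
    induction i using Fin.addCases with
    | left i =>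
      induction i using Fin.addCases with
      | left i => simp [insertMid]
      | right i =>
        obtain rfl := Subsingleton.elim i 0
        simp [insertMid, seriesAct_apply]
    | right i => simp [insertMid]
  simp only [h1, act_insertMid_sum]
  rw [Finset.sum_sigma', Finset.smul_sum]
  have hsum : ∀ c : Fin (a + m + e) → ℕ, ∑ i, c i =
      ∑ i, c (Fin.castAdd e (Fin.castAdd m i)) + ∑ i, c (block a m e i) +
        ∑ i, c (Fin.natAdd (a + m) i) := fun c => by
    rw [Fin.sum_univ_add, Fin.sum_univ_add]; rfl
  have hsum' : ∀ c : Fin (a + 1 + e) → ℕ, ∑ i, c i =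
      ∑ i, c (Fin.castAdd e (Fin.castAdd 1 i)) + c (Fin.castAdd e (Fin.natAdd a 0)) +
        ∑ i, c (Fin.natAdd (a + 1) i) := fun c => by
    rw [Fin.sum_univ_add, Fin.sum_univ_add, Fin.sum_univ_one]
  refine Finset.sum_bij'
    (fun c _ => ⟨insertMid (fun i => c (Fin.castAdd e (Fin.castAdd m i)))
      (∑ j, c (block a m e j)) (fun i => c (Fin.natAdd (a + m) i)), fun j => c (block a m e j)⟩)
    (fun s _ => Fin.append (Fin.append (fun i => s.1 (Fin.castAdd e (Fin.castAdd 1 i))) s.2)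
      (fun i => s.1 (Fin.natAdd (a + 1) i))) ?_ ?_ ?_ ?_ ?_
  · intro c hc
    rw [mem_piAntidiag_univ, hsum] at hc
    rw [Finset.mem_sigma, mem_piAntidiag_univ, mem_piAntidiag_univ, hsum']
    simpa [insertMid] using hc
  · rintro ⟨c', c⟩ hs
    rw [Finset.mem_sigma, mem_piAntidiag_univ, mem_piAntidiag_univ, hsum'] at hs
    rw [mem_piAntidiag_univ, hsum]
    simpa [block, hs.2] using hs.1
  · intro c _
    funext i
    refine fin_cases_block (fun i => _ = c i) (fun i => ?_) (fun i => ?_) (fun i => ?_) i <;>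
      simp [insertMid, block]
  · rintro ⟨c', c⟩ hs
    rw [Finset.mem_sigma, mem_piAntidiag_univ, mem_piAntidiag_univ] at hs
    refine Sigma.ext ?_ ?_
    · funext i
      induction i using Fin.addCases with
      | left i =>
        induction i using Fin.addCases with
        | left i => simp [insertMid]
        | right i =>
          obtain rfl := Subsingleton.elim i 0
          simpa [insertMid, block] using hs.2
      | right i => simp [insertMid]
    · simp [block]
  · intro c _
    have := g.act_comp a m e f h q hq p (fun i => x i (c i)) fun i => hx i (c i)
    rw [this]
    simp [insertMid]

/-- Power series with coefficients in a complete algebra. -/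
noncomputable def series : CompleteCGraAlgebra k (ℕ → V) where
  deg := g.seriesDeg
  isCompl_deg := g.isCompl_seriesDeg
  d := LinearMap.pi fun m => g.d ∘ₗ LinearMap.proj m
  d_deg p x hx m := g.d_deg p _ (hx m)
  d_d x := funext fun m => g.d_d _
  F := g.seriesF
  F_zero := (Submodule.eq_top_iff').2 fun x m => by
    rw [show seriesWeight 0 m = 0 by simp [seriesWeight], g.F_zero]
    trivial
  F_anti N N' h x hx m := g.F_anti (by unfold seriesWeight; omega) (hx m)
  F_graded := g.seriesF_graded
  d_F N x hx m := g.d_F _ _ (hx m)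
  hausdorff x hx := funext fun m => g.hausdorff _ fun N =>
    g.F_anti (by unfold seriesWeight; omega) (hx (N + m + 1) m)
  complete u hu := by
    -- In order m, the i-th term is only known to lie in step i - m or so. The first m terms are set
    -- aside for the completeness of the coefficients to apply, and added back afterwards.
    have h : ∀ m, ∃ s, HasFSum g.F (fun N => u (N + m) m) s := fun m =>
      g.complete _ fun N => g.F_anti (by unfold seriesWeight; omega) (hu (N + m) m)
    choose s hs using h
    refine ⟨fun m => s m + ∑ i ∈ Finset.range m, u i m, fun N => ⟨N, fun K hK m => ?_⟩⟩
    have h1 : HasFSum g.F (fun i => u i m) (s m + ∑ i ∈ Finset.range m, u i m) := by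
      intro N'
      obtain ⟨M', h'⟩ := hs m N'
      refine ⟨M' + m, fun i hi => ?_⟩
      have := h' (i - m) (by omega)
      obtain ⟨j, rfl⟩ : ∃ j, i = m + j := ⟨i - m, by omega⟩
      rw [Finset.sum_range_add]
      simp only [Nat.add_sub_cancel_left] at this
      simp only [add_comm m]
      convert this using 1
      abel
    have h2 := h1.sub_mem (N := seriesWeight N m) (m := K) fun i hi =>
      g.F_anti (by unfold seriesWeight; omega) (hu i m)
    simpa using h2
  act := g.seriesAct
  act_deg n f q hf p x hx m := by
    rw [seriesAct_apply]
    exact Submodule.sum_mem _ fun c _ => g.act_deg n f q hf p _ fun i => hx i _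
  act_F n f N x hx m := by
    rw [seriesAct_apply]
    refine Submodule.sum_mem _ fun c hc => ?_
    rw [mem_piAntidiag_univ] at hc
    refine g.F_anti ?_ (g.act_F n f (fun i => seriesWeight (N i) (c i)) _ fun i => hx i _)
    rw [← hc]
    exact seriesWeight_sum _ _ _
  act_d n f q hf p x hx := by
    funext m
    simp only [LinearMap.pi_apply, LinearMap.comp_apply, LinearMap.proj_apply, Pi.smul_apply,
      Finset.sum_apply, seriesAct_apply, map_sum]
    simp only [Finset.smul_sum]
    rw [Finset.sum_comm]
    refine Finset.sum_congr rfl fun c _ => ?_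
    rw [g.act_d n f q hf p _ fun i => hx i _, Finset.smul_sum]
    refine Finset.sum_congr rfl fun i _ => ?_
    rw [update_apply_coeff]
    rfl
  act_unit x := by
    funext m
    rw [seriesAct_apply, piAntidiag_one, Finset.sum_singleton, g.act_unit]
  act_perm n f σ p x hx := by
    funext m
    rw [Pi.smul_apply, seriesAct_apply, seriesAct_apply, Finset.smul_sum]
    refine Finset.sum_bij' (fun c _ i => c (σ i)) (fun c _ i => c (σ.symm i)) ?_ ?_ ?_ ?_ ?_
    · intro c hc
      rw [mem_piAntidiag_univ] at hc ⊢
      rw [← hc, Equiv.sum_comp σ]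
    · intro c hc
      rw [mem_piAntidiag_univ] at hc ⊢
      rw [← hc, Equiv.sum_comp σ.symm]
    · intro c _; simp
    · intro c _; simp
    · intro c _
      exact g.act_perm n f σ p _ fun i => hx i _
  act_comp a m e f h q hq p x hx := g.series_act_comp a m e f h q hq p x hx

theorem series_act {n : ℕ} (f : CGra k (Fin n)) (x : Fin n → ℕ → V) (m : ℕ) :
    g.series.act n f x m = ∑ c ∈ Finset.piAntidiag (Finset.univ : Finset (Fin n)) m,
      g.act n f fun i => x i (c i) := g.seriesAct_apply f x m

end CompleteCGraAlgebra

/-! ## Algebras with a formal parameter -/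

/-- A complete algebra with an even linear operator `h` commuting with all the operations and
raising the filtration, for instance the multiplication by `ħ` on formal power series. -/
structure ParamAlgebra (k : Type u) [Field k] (W : Type v) [AddCommGroup W] [Module k W]
    extends CompleteCGraAlgebra k W where
  h : W →ₗ[k] W
  h_deg : ∀ p, ∀ x ∈ deg p, h x ∈ deg p
  h_d : ∀ x, h (d x) = d (h x)
  -- Required only from step 1 on: multiplying an arbitrary series by ħ need not bring its
  -- coefficients into F 1.
  h_F : ∀ N, ∀ x ∈ F (N + 1), h x ∈ F (N + 2)
  h_act : ∀ n (f : CGra k (Fin n)) (x : Fin n → W) (i : Fin n),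
    act n f (Function.update x i (h (x i))) = h (act n f x)

section Shift

variable {k : Type u} [Field k] {V : Type v} [AddCommGroup V] [Module k V]

/-- The multiplication of power series by the variable. -/
def seriesShift (k : Type u) [Field k] (V : Type v) [AddCommGroup V] [Module k V] :
    (ℕ → V) →ₗ[k] (ℕ → V) where
  toFun x m := match m with
    | 0 => 0
    | m + 1 => x m
  map_add' x y := by funext m; cases m <;> simp
  map_smul' a x := by funext m; cases m <;> simp

@[simp] theorem seriesShift_zero (x : ℕ → V) : seriesShift k V x 0 = 0 := rfl

@[simp] theorem seriesShift_succ (x : ℕ → V) (m : ℕ) : seriesShift k V x (m + 1) = x m := rfl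

theorem series_act_shift (g : CompleteCGraAlgebra k V) {n : ℕ} (f : CGra k (Fin n))
    (x : Fin n → ℕ → V) (i : Fin n) :
    g.series.act n f (Function.update x i (seriesShift k V (x i))) =
      seriesShift k V (g.series.act n f x) := by
  classical
  funext m
  rw [series_act]
  simp only [update_apply_coeff]
  have h0 : ∀ c : Fin n → ℕ, c i = 0 → g.act n f
      (Function.update (fun j => x j (c j)) i (seriesShift k V (x i) (c i))) = 0 := by
    intro c hc
    rw [hc, seriesShift_zero, MultilinearMap.map_update_zero]
  cases m with
  | zero =>
    rw [seriesShift_zero]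
    refine Finset.sum_eq_zero fun c hc => h0 c ?_
    rw [mem_piAntidiag_univ, Finset.sum_eq_zero_iff] at hc
    exact hc i (Finset.mem_univ _)
  | succ m =>
    rw [seriesShift_succ, series_act, ← Finset.sum_filter_add_sum_filter_not _ fun c => c i = 0,
      Finset.sum_eq_zero fun c hc => h0 c (Finset.mem_filter.1 hc).2, zero_add]
    have hs : ∀ (c : Fin n → ℕ) (a : ℕ), ∑ j, Function.update c i a j + c i = ∑ j, c j + a := by
      intro c a
      rw [Finset.sum_update_of_mem (Finset.mem_univ i),
        ← Finset.add_sum_erase _ c (Finset.mem_univ i), Finset.sdiff_singleton_eq_erase]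
      omega
    refine Finset.sum_bij' (fun c _ => Function.update c i (c i - 1))
      (fun c _ => Function.update c i (c i + 1)) ?_ ?_ ?_ ?_ ?_
    · intro c hc
      rw [Finset.mem_filter, mem_piAntidiag_univ] at hc
      rw [mem_piAntidiag_univ]
      have := hs c (c i - 1)
      omega
    · intro c hc
      rw [mem_piAntidiag_univ] at hc
      rw [Finset.mem_filter, mem_piAntidiag_univ]
      have := hs c (c i + 1)
      refine ⟨by omega, by simp⟩
    · intro c hc
      have := (Finset.mem_filter.1 hc).2
      simp [Nat.sub_add_cancel (Nat.pos_of_ne_zero this)]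
    · intro c _
      simp
    · intro c hc
      have := (Finset.mem_filter.1 hc).2
      congr 1
      funext j
      by_cases hj : j = i
      · subst hj
        obtain ⟨r, hr⟩ : ∃ r, c j = r + 1 := ⟨c j - 1, by omega⟩
        simp [hr]
      · simp [hj]

/-- The algebra of formal power series in `ħ`. -/
noncomputable def CompleteCGraAlgebra.hbar (g : CompleteCGraAlgebra k V) :
    ParamAlgebra k (ℕ → V) where
  toCompleteCGraAlgebra := g.series
  h := seriesShift k V
  h_deg p x hx m := by
    cases m with
    | zero => exact Submodule.zero_mem _
    | succ m => exact hx m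
  h_d x := by
    funext m
    cases m with
    | zero => exact (map_zero g.d).symm
    | succ m => rfl
  h_F N x hx m := by
    cases m with
    | zero => exact Submodule.zero_mem _
    | succ m => exact g.F_anti (by unfold seriesWeight; omega) (hx m)
  h_act n f x i := series_act_shift g f x i

/-- The algebra of formal power series in a time parameter, the parameter of the algebra of
coefficients acting coefficientwise. -/
noncomputable def ParamAlgebra.path (A : ParamAlgebra k V) : ParamAlgebra k (ℕ → V) where
  toCompleteCGraAlgebra := A.toCompleteCGraAlgebra.series
  h := LinearMap.pi fun m => A.h ∘ₗ LinearMap.proj m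
  h_deg p x hx m := A.h_deg p _ (hx m)
  h_d x := funext fun m => A.h_d _
  h_F N x hx m := by
    obtain ⟨r, hr⟩ : ∃ r, seriesWeight (N + 1) m = r + 1 :=
      ⟨seriesWeight (N + 1) m - 1, by unfold seriesWeight; omega⟩
    have h1 : x m ∈ A.F (r + 1) := hr ▸ hx m
    exact A.F_anti (by unfold seriesWeight at *; omega) (A.h_F _ _ h1)
  h_act n f x i := by
    funext m
    change A.series.act n f _ m = A.h (A.series.act n f x m)
    rw [series_act, series_act, map_sum]
    refine Finset.sum_congr rfl fun c _ => ?_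
    rw [update_apply_coeff, ← A.h_act n f _ i]
    rfl

end Shift

end DeformationGroup
namespace DeformationGroup

/-! ### Evaluating pre-Lie products of symmetric elements -/

section Symmetries

variable {k : Type u} [Field k] {V : Type v} [AddCommGroup V] [Module k V]

theorem koszulSign_eq_one {n : ℕ} {p : Fin n → ZMod 2} {σ : Equiv.Perm (Fin n)}
    (h : ∀ i j, i < j → σ j < σ i → p (σ i) * p (σ j) = 0) : koszulSign p σ = 1 := by
  refine Finset.prod_eq_one fun i _ => Finset.prod_eq_one fun j _ => ?_
  split_ifs with hij
  · rw [h i j hij.1 hij.2, uzpow_zero]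
  · rfl

/-- The component of arity `n` and `ħ`-degree `j`. -/
def comp (f : convCGra k) (n j : ℕ) : CGra k (Fin n) := ⟨f.1 n j, (f.2 n j).1⟩

theorem comp_zero (f : convCGra k) (j : ℕ) : comp f 0 j = 0 := Subtype.ext (noConst_of_mem f.2 j)

theorem perm_comp (f : convCGra k) (n j : ℕ) (σ : Equiv.Perm (Fin n)) :
    CGra.perm σ (comp f n j) = comp f n j := Subtype.ext ((f.2 n j).2 σ)

variable (g : CompleteCGraAlgebra k V)

theorem act_comp_swap (f : convCGra k) (n j : ℕ) (σ : Equiv.Perm (Fin n)) {p : Fin n → ZMod 2}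
    {x : Fin n → V} (hx : ∀ i, x i ∈ g.deg (p i))
    (h : ∀ i j, i < j → σ j < σ i → p (σ i) * p (σ j) = 0) :
    g.act n (comp f n j) x = g.act n (comp f n j) fun i => x (σ i) := by
  have := g.act_perm n (comp f n j) σ p x hx
  rwa [perm_comp, koszulSign_eq_one h, one_smul] at this

/-- Transport along an equality of arities such as c + 1 = 0 + 1 + c, which is not definitional. -/
theorem act_cast {n n' : ℕ} (h : n = n') (F : CGra k (Fin n)) : ∃ F' : CGra k (Fin n'),
    (F' : Gra k (Fin n')) = relabel (Fin.cast h) (F : Gra k (Fin n)) ∧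
      ∀ x : Fin n' → V, g.act n' F' x = g.act n F fun i => x (Fin.cast h i) := by
  subst h
  exact ⟨F, (relabel_id _).symm, fun x => rfl⟩

/-- Up to the renumbering that lists the inserted block first, H is an operadic composition at the
first vertex. By `hp`, exchanging two arguments never produces a sign, so equivariance can be used
freely. -/
theorem act_insert {m c n : ℕ} (hn : n = 0 + m + c) (π : Fin n → Fin (c + 1)) (e₁ : Fin m → Fin n)
    (e₂ : Fin c → Fin n) (h1 : ∀ j, π (e₁ j) = 0) (h2 : ∀ i, π (e₂ i) = i.succ)
    (he : Function.Injective e₁) (F : CGra k (Fin (c + 1))) (G : CGra k (Fin m)) (H : CGra k (Fin n))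
    (hH : (H : Gra k (Fin n)) = reconnect π (F : Gra k _) * relabel e₁ (G : Gra k _)) {q : ZMod 2}
    (hq : (G : Gra k (Fin m)) ∈ parity k (Fin m) q) {p : Fin n → ZMod 2} {x : Fin n → V}
    (hx : ∀ i, x i ∈ g.deg (p i)) (hp : ∀ i j, i ≠ j → p i * p j = 0) :
    g.act n H x = g.act (c + 1) F
      (Fin.cons (g.act m G fun i => x (e₁ i)) fun i => x (e₂ i)) := by
  subst hn
  set s : Fin (0 + m + c) → Fin (0 + m + c) := Fin.append (Fin.append Fin.elim0 e₁) e₂ with hs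
  have s1 : ∀ j, s (block 0 m c j) = e₁ j := fun j => by
    simp only [hs, block, Fin.append_left, Fin.append_right]
  have s2 : ∀ i, s (Fin.natAdd (0 + m) i) = e₂ i := fun i => by
    simp only [hs, Fin.append_right]
  have hinj : Function.Injective s := by
    intro a b
    refine fin_cases_block (fun a => s a = s b → a = b) (fun i => i.elim0) (fun i => ?_)
      (fun i => ?_) a <;>
    refine fin_cases_block (fun b => s _ = s b → _ = b) (fun i => i.elim0) (fun j => ?_)
      (fun j => ?_) b
    · rw [s1, s1]; exact fun h => by rw [he h]
    · rw [s1, s2]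
      intro h
      have := congrArg π h
      rw [h1, h2] at this
      exact (Fin.succ_ne_zero _ this.symm).elim
    · rw [s1, s2]
      intro h
      have := congrArg π h
      rw [h1, h2] at this
      exact (Fin.succ_ne_zero _ this).elim
    · rw [s2, s2]
      intro h
      have := congrArg π h
      rw [h2, h2] at this
      rw [Fin.succ_injective _ this]
  let σ : Equiv.Perm (Fin (0 + m + c)) := Equiv.ofBijective s (Finite.injective_iff_bijective.1 hinj)
  obtain ⟨F', hF', hact⟩ := act_cast g (show c + 1 = 0 + 1 + c by omega) F
  have key : H = CGra.perm σ (CGra.comp 0 m c F' G) := by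
    refine Subtype.ext ?_
    change (H : Gra k _) = relabel σ (graComp 0 m c F' G)
    rw [hH, graComp, map_mul, relabel_comp, hF',
      reconnect_relabel (ι' := σ.symm) (π' := π) (Fin.cast_injective _) σ.symm.injective,
      relabel_comp]
    · congr 1
      · rw [show (σ ∘ σ.symm : Fin (0 + m + c) → _) = id by funext i; simp, relabel_id]
      · congr 1
        congr 1
        funext j
        exact (s1 j).symm
    · intro a
      obtain ⟨b, rfl⟩ := σ.surjective a
      rw [Equiv.symm_apply_apply]
      change _ = Fin.cast _ (π (s b))
      refine fin_cases_block (fun b => collapse 0 m c b = Fin.cast _ (π (s b))) (fun i => i.elim0)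
        (fun i => ?_) (fun i => ?_) b
      · rw [s1, h1]
        simp only [collapse, block, Fin.append_left, Fin.append_right]
        exact Fin.ext (by simp)
      · rw [s2, h2]
        simp only [collapse, Fin.append_right]
        exact Fin.ext (by simp; omega)
    · intro v t hv
      exact ⟨σ v, by simp⟩
  rw [key, g.act_perm _ _ σ p x hx, koszulSign_eq_one, one_smul,
    g.act_comp 0 m c F' G q hq (fun i => p (σ i)) (fun i => x (σ i)) fun i => hx _]
  · rw [Finset.univ_eq_empty, Finset.sum_empty, mul_zero, uzpow_zero, one_smul, hact]
    congr 1
    funext i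
    refine Fin.cases ?_ (fun i => ?_) i
    · have : Fin.cast (show c + 1 = 0 + 1 + c by omega) 0 =
          Fin.castAdd c (Fin.natAdd 0 (0 : Fin 1)) := by simp [Fin.ext_iff]
      rw [this, Fin.append_left, Fin.append_right, Fin.cons_zero]
      congr 1
      funext j
      exact congrArg x (s1 j)
    · have : Fin.cast (show c + 1 = 0 + 1 + c by omega) i.succ = Fin.natAdd (0 + 1) i := by
        simp [Fin.ext_iff]; omega
      rw [this, Fin.append_right, Fin.cons_succ]
      exact congrArg x (s2 i)
  · intro i j hij _
    exact hp _ _ fun h => hij.ne (σ.injective h)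

/-- The pre-Lie product on the deformation complex. -/
noncomputable def pl (f f' : convCGra k) : convCGra k := ⟨preLie f f', preLie_mem f.2 f'.2⟩

theorem collapseSet_emb {n : ℕ} (S : Finset (Fin n)) (j : Fin S.card) :
    collapseSet S (S.orderEmbOfFin rfl j) = 0 := by
  rw [collapseSet, dif_neg]
  rw [Finset.mem_compl, not_not]
  exact Finset.orderEmbOfFin_mem _ _ _

theorem collapseSet_emb_compl {n : ℕ} (S : Finset (Fin n)) (i : Fin Sᶜ.card) :
    collapseSet S (Sᶜ.orderEmbOfFin rfl i) = i.succ := by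
  rw [collapseSet, dif_pos (Finset.orderEmbOfFin_mem _ _ _)]
  congr 1
  rw [OrderIso.symm_apply_eq]
  exact Subtype.ext (Finset.coe_orderIsoOfFin_apply _ _ _).symm

theorem act_pl (f f' : convCGra k) {q : ZMod 2} (hq : (f' : Conv k) ∈ convParity k q) (n j : ℕ)
    {p : Fin n → ZMod 2} {x : Fin n → V} (hx : ∀ i, x i ∈ g.deg (p i))
    (hp : ∀ i j, i ≠ j → p i * p j = 0) :
    g.act n (comp (pl f f') n j) x = ∑ S : Finset (Fin n),
      ∑ i ∈ Finset.HasAntidiagonal.antidiagonal j,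
        g.act (Sᶜ.card + 1) (comp f (Sᶜ.card + 1) i.1)
          (Fin.cons (g.act S.card (comp f' S.card i.2) fun a => x (S.orderEmbOfFin rfl a))
            fun a => x (Sᶜ.orderEmbOfFin rfl a)) := by
  have h1 : comp (pl f f') n j = ∑ S : Finset (Fin n),
      ∑ i ∈ Finset.HasAntidiagonal.antidiagonal j,
        (⟨insertSet S (f.1 (Sᶜ.card + 1) i.1) (f'.1 S.card i.2),
          insertSet_mem S (f.2 _ _).1 (f'.2 _ _).1⟩ : CGra k (Fin n)) := by
    refine Subtype.ext ?_
    simp only [Submodule.coe_sum]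
    rfl
  rw [h1, map_sum, sum_apply]
  refine Finset.sum_congr rfl fun S _ => ?_
  rw [map_sum, sum_apply]
  refine Finset.sum_congr rfl fun i _ => ?_
  have hS : n = 0 + S.card + Sᶜ.card := by
    have h1 := S.card_add_card_compl
    rw [Fintype.card_fin] at h1
    omega
  exact act_insert g hS (collapseSet S) (S.orderEmbOfFin rfl) (Sᶜ.orderEmbOfFin rfl)
    (collapseSet_emb S) (collapseSet_emb_compl S) (S.orderEmbOfFin rfl).injective
    (comp f _ i.1) (comp f' _ i.2) _ rfl (hq _ _) hx hp

/-! ### Sums over subsets of functions of the cardinality -/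

theorem sum_finset_card {n : ℕ} (Φ : ℕ → ℕ → V) :
    ∑ S : Finset (Fin n), Φ Sᶜ.card S.card =
      ∑ p ∈ Finset.HasAntidiagonal.antidiagonal n, n.choose p.2 • Φ p.1 p.2 := by
  have h := Finset.sum_powerset_apply_card (fun a => Φ (n - a) a) (x := (Finset.univ : Finset (Fin n)))
  rw [Finset.powerset_univ, Finset.card_univ, Fintype.card_fin] at h
  rw [← Finset.Nat.sum_antidiagonal_swap, Finset.Nat.sum_antidiagonal_eq_sum_range_succ_mk]
  simp only [Finset.card_compl, Fintype.card_fin, Prod.fst_swap, Prod.snd_swap]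
  exact h

/-- Subsets of n + 1 points are separated according to whether they contain 0, which will be the
place of a distinguished argument, then counted by their trace on the other n points. -/
theorem sum_finset_succ_card {n : ℕ} (Φ Φ' : ℕ → ℕ → V) :
    ∑ S : Finset (Fin (n + 1)), (if (0 : Fin (n + 1)) ∈ S then Φ Sᶜ.card S.card else Φ' Sᶜ.card S.card) =
      ∑ p ∈ Finset.HasAntidiagonal.antidiagonal n,
        n.choose p.2 • (Φ p.1 (p.2 + 1) + Φ' (p.1 + 1) p.2) := by
  set s : Finset (Fin (n + 1)) := Finset.univ.map ⟨Fin.succ, Fin.succ_injective n⟩ with hs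
  have hcard : s.card = n := by simp [hs]
  have h0 : (0 : Fin (n + 1)) ∉ s := by simp [hs, Fin.succ_ne_zero]
  have hu : (Finset.univ : Finset (Finset (Fin (n + 1)))) = (insert 0 s).powerset := by
    rw [← Finset.powerset_univ, Fin.univ_succ, Finset.cons_eq_insert]
  have hc : ∀ S : Finset (Fin (n + 1)), Sᶜ.card = n + 1 - S.card := fun S => by
    rw [Finset.card_compl, Fintype.card_fin]
  rw [hu, Finset.sum_powerset_insert h0]
  have e1 : ∑ t ∈ s.powerset, (if (0 : Fin (n + 1)) ∈ t then Φ tᶜ.card t.card else Φ' tᶜ.card t.card) =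
      ∑ t ∈ s.powerset, Φ' (n + 1 - t.card) t.card := by
    refine Finset.sum_congr rfl fun t ht => ?_
    rw [if_neg fun h => h0 (Finset.mem_powerset.1 ht h), hc]
  have e2 : ∑ t ∈ s.powerset, (if (0 : Fin (n + 1)) ∈ insert 0 t then
      Φ (insert 0 t)ᶜ.card (insert 0 t).card else Φ' (insert 0 t)ᶜ.card (insert 0 t).card) =
      ∑ t ∈ s.powerset, Φ (n - t.card) (t.card + 1) := by
    refine Finset.sum_congr rfl fun t ht => ?_
    rw [if_pos (Finset.mem_insert_self _ _), hc, Finset.card_insert_of_notMem fun h =>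
      h0 (Finset.mem_powerset.1 ht h), Nat.add_sub_add_right]
  rw [e1, e2, Finset.sum_powerset_apply_card fun a => Φ' (n + 1 - a) a,
    Finset.sum_powerset_apply_card fun a => Φ (n - a) (a + 1), hcard, add_comm,
    ← Finset.sum_add_distrib, ← Finset.Nat.sum_antidiagonal_swap,
    Finset.Nat.sum_antidiagonal_eq_sum_range_succ_mk]
  refine Finset.sum_congr rfl fun a ha => ?_
  have : a ≤ n := by simpa [Nat.lt_succ_iff] using ha
  simp only [Prod.fst_swap, Prod.snd_swap]
  rw [smul_add, Nat.sub_add_comm this]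

end Symmetries

end DeformationGroup
namespace DeformationGroup

namespace ParamAlgebra

/-! ### Symmetric elements as formal functions: values and derivatives -/

section Eval

variable {k : Type u} [Field k] {W : Type v} [AddCommGroup W] [Module k W]
variable (A : ParamAlgebra k W)

theorem hpow_deg (j : ℕ) {p : ZMod 2} {x : W} (hx : x ∈ A.deg p) : (A.h ^ j) x ∈ A.deg p := by
  induction j with
  | zero => exact hx
  | succ j ih => rw [pow_succ', Module.End.mul_apply]; exact A.h_deg _ _ ih

theorem hpow_F (j N : ℕ) {x : W} (hx : x ∈ A.F (N + 1)) : (A.h ^ j) x ∈ A.F (N + 1 + j) := by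
  induction j with
  | zero => exact hx
  | succ j ih =>
    rw [pow_succ', Module.End.mul_apply]
    have := A.h_F (N + j) _ (by rwa [show N + j + 1 = N + 1 + j by omega])
    rwa [show N + j + 2 = N + 1 + (j + 1) by omega] at this

theorem hpow_F' (j N : ℕ) {x : W} (hx : x ∈ A.F N) : (A.h ^ j) x ∈ A.F N := by
  cases N with
  | zero => rw [A.F_zero]; trivial
  | succ N => exact A.F_anti (by omega) (A.hpow_F j N hx)

theorem hpow_act {n : ℕ} (f : CGra k (Fin n)) (x : Fin n → W) (i : Fin n) (j : ℕ) (v : W) :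
    A.act n f (Function.update x i ((A.h ^ j) v)) = (A.h ^ j) (A.act n f (Function.update x i v)) := by
  induction j with
  | zero => rfl
  | succ j ih =>
    rw [pow_succ', Module.End.mul_apply, Module.End.mul_apply, ← ih]
    have := A.h_act n f (Function.update x i ((A.h ^ j) v)) i
    simpa using this

/-- The terms of the sum `∑ 1/b! ħ^j f(x₀, …, x_{p-1}, α, …, α)` with `b` arguments `α`. -/
noncomputable def genTerm (p : ℕ) (f : convCGra k) (X : ∀ b, Fin (b + p) → W) (i : ℕ × ℕ) : W :=
  (1 / (i.1.factorial : k)) • (A.h ^ i.2) (A.act (i.1 + p) (comp f (i.1 + p) i.2) (X i.1))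

theorem act_mem_F {n N : ℕ} (f : convCGra k) (j : ℕ) {x : Fin n → W} {c : Fin n → ℕ}
    (hx : ∀ i, x i ∈ A.F (c i + 1)) (hN : N ≤ n + ∑ i, c i) (j' : ℕ) :
    (A.h ^ j') (A.act n (comp f n j) x) ∈ A.F (N + j') := by
  rcases Nat.eq_zero_or_pos n with rfl | hn
  · rw [comp_zero]; simp
  · have h1 := A.act_F n (comp f n j) (fun i => c i + 1) x hx
    obtain ⟨r, hr⟩ : ∃ r, ∑ i, (c i + 1) = r + 1 := ⟨∑ i, (c i + 1) - 1, by
      simp [Finset.sum_add_distrib]; omega⟩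
    rw [hr] at h1
    refine A.F_anti ?_ (A.hpow_F j' r h1)
    rw [← hr]
    simp [Finset.sum_add_distrib]
    omega

theorem genTerm_mem (p : ℕ) (f : convCGra k) {X : ∀ b, Fin (b + p) → W}
    (hX : ∀ b i, X b i ∈ A.F 1) (i : ℕ × ℕ) : A.genTerm p f X i ∈ A.F (i.1 + p + i.2) :=
  Submodule.smul_mem _ _ (A.act_mem_F f _ (c := fun _ => 0) (hX _) (by simp) _)

theorem null_of_weight {ι : Type*} {F : ℕ → Submodule k W} (hF : Antitone F) {x : ι → W} (w : ι → ℕ)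
    (hx : ∀ i, x i ∈ F (w i)) (hw : ∀ N, {i | w i < N}.Finite) : Null F x := fun N =>
  ⟨(hw N).toFinset, fun i hi => hF (by simpa using hi) (hx i)⟩

theorem finite_lt_add (N : ℕ) : {i : ℕ × ℕ | i.1 + i.2 < N}.Finite := by
  refine (Finset.range N ×ˢ Finset.range N).finite_toSet.subset fun i hi => ?_
  have : i.1 + i.2 < N := hi
  simp; omega

theorem null_genTerm (p : ℕ) (f : convCGra k) {X : ∀ b, Fin (b + p) → W}
    (hX : ∀ b i, X b i ∈ A.F 1) : Null A.F (A.genTerm p f X) :=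
  null_of_weight A.F_anti (fun i => i.1 + i.2)
    (fun i => A.F_anti (by omega) (A.genTerm_mem p f hX i)) finite_lt_add

/-- The sum `∑ 1/b! ħ^j f(x₀, …, x_{p-1}, α, …, α)`. -/
noncomputable def gen (p : ℕ) (f : convCGra k) (X : ∀ b, Fin (b + p) → W) : W :=
  fsum A.F (A.genTerm p f X)

theorem exists_sumsTo {ι : Type*} {x : ι → W} (h : Null A.F x) : ∃ s, SumsTo A.F x s :=
  h.exists_sumsTo A.F_anti A.complete

theorem sumsTo_gen (p : ℕ) (f : convCGra k) {X : ∀ b, Fin (b + p) → W}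
    (hX : ∀ b i, X b i ∈ A.F 1) : SumsTo A.F (A.genTerm p f X) (A.gen p f X) :=
  sumsTo_fsum (A.exists_sumsTo (A.null_genTerm p f hX))

theorem gen_mem_F {p N : ℕ} {f : convCGra k} {X : ∀ b, Fin (b + p) → W}
    (hX : ∀ b i, X b i ∈ A.F 1) (h : ∀ i, A.genTerm p f X i ∈ A.F N) : A.gen p f X ∈ A.F N :=
  (A.sumsTo_gen p f hX).mem h

theorem mem_F_one_of {p : ℕ} {f : convCGra k} {X : ∀ b, Fin (b + p) → W}
    (hX : ∀ b i, X b i ∈ A.F 1) : A.gen p f X ∈ A.F 1 := by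
  refine A.gen_mem_F hX fun i => ?_
  rcases Nat.eq_zero_or_pos (i.1 + p) with h | h
  · have : A.act (i.1 + p) (comp f (i.1 + p) i.2) = 0 := by
      have : ∀ n, n = 0 → A.act n (comp f n i.2) = 0 := by
        rintro _ rfl
        rw [comp_zero, map_zero]
      exact this _ h
    rw [genTerm, this]
    simp
  · exact A.F_anti (by omega) (A.genTerm_mem p f hX i)

/-- The homogeneous parts are closed because the filtration is graded: the component of the sum in
the other parity lies in every F N. -/
theorem SumsTo.mem_deg {ι : Type*} {x : ι → W} {s : W} {p : ZMod 2} (h : SumsTo A.F x s)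
    (hx : ∀ i, x i ∈ A.deg p) : s ∈ A.deg p := by
  have key : ∀ p q : ZMod 2, IsCompl (A.deg p) (A.deg q) → (∀ N, A.F N =
      (A.F N ⊓ A.deg p) ⊔ (A.F N ⊓ A.deg q)) → (∀ i, x i ∈ A.deg p) → s ∈ A.deg p := by
    intro p q hpq hF hx
    obtain ⟨y, hy, z, hz, e⟩ := Submodule.mem_sup.1
      (show s ∈ A.deg p ⊔ A.deg q by rw [hpq.sup_eq_top]; trivial)
    have hz0 : z = 0 := A.hausdorff _ fun N => by
      obtain ⟨t, _, h2⟩ := h N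
      rw [hF] at h2
      obtain ⟨a, ha, b, hb, e'⟩ := Submodule.mem_sup.1 h2
      have h3 : z - b = a - y + ∑ i ∈ t, x i := by
        rw [← e] at e'
        rw [eq_sub_iff_add_eq.2 e'.symm.symm] at *
        abel
      have h4 : z - b = 0 := Submodule.disjoint_def.1 hpq.1 _ (by
        rw [h3]
        exact Submodule.add_mem _ (Submodule.sub_mem _ ha.2 hy)
          (Submodule.sum_mem _ fun i _ => hx i)) (Submodule.sub_mem _ hz hb.2)
      rw [sub_eq_zero.1 h4]
      exact hb.1
    rw [← e, hz0, add_zero]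
    exact hy
  fin_cases p
  · exact key 0 1 A.isCompl_deg A.F_graded hx
  · exact key 1 0 A.isCompl_deg.symm (fun N => by rw [sup_comm]; exact A.F_graded N) hx

theorem gen_deg {p : ℕ} {f : convCGra k} {X : ∀ b, Fin (b + p) → W} {q r : ZMod 2}
    (hX : ∀ b i, X b i ∈ A.F 1) (hf : (f : Conv k) ∈ convParity k q) (e : ∀ b, Fin (b + p) → ZMod 2)
    (he : ∀ b i, X b i ∈ A.deg (e b i)) (hr : ∀ b, q + ∑ i, e b i = r) : A.gen p f X ∈ A.deg r :=
  SumsTo.mem_deg A (A.sumsTo_gen p f hX) fun i => by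
    refine Submodule.smul_mem _ _ (A.hpow_deg _ ?_)
    rw [← hr i.1]
    exact A.act_deg _ _ q (hf _ _) _ _ (he _)

/-- Adding an argument at the first place. -/
def consX {p : ℕ} (v : W) (x : ∀ b, Fin (b + p) → W) : ∀ b, Fin (b + (p + 1)) → W :=
  fun b => (Fin.cons v (x b) : Fin (b + p + 1) → W)

/-- `∑ 1/n! ħ^j f(α, …, α)`. -/
noncomputable def ev (f : convCGra k) (α : W) : W := A.gen 0 f fun _ _ => α

/-- `∑ 1/b! ħ^j f(v, α, …, α)`. -/
noncomputable def dev (f : convCGra k) (α v : W) : W := A.gen 1 f (consX v fun _ _ => α)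

/-- `∑ 1/b! ħ^j f(v, w, α, …, α)`. -/
noncomputable def ddev (f : convCGra k) (α v w : W) : W :=
  A.gen 2 f (consX v (consX w fun _ _ => α))

theorem cons_mem {S : Submodule k W} {v : W} (hv : v ∈ S) {b : ℕ} {x : Fin b → W} (hx : ∀ i, x i ∈ S)
    (i : Fin (b + 1)) : (Fin.cons v x : Fin (b + 1) → W) i ∈ S :=
  Fin.cases hv hx i

theorem consX_mem {p : ℕ} {S : Submodule k W} {v : W} (hv : v ∈ S) {x : ∀ b, Fin (b + p) → W}
    (hx : ∀ b i, x b i ∈ S) (b : ℕ) (i : Fin (b + (p + 1))) : consX v x b i ∈ S :=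
  cons_mem hv (hx b) i

variable {A} {f : convCGra k} {α v w : W}

theorem ev_mem_F (hα : α ∈ A.F 1) : A.ev f α ∈ A.F 1 := A.mem_F_one_of fun _ _ => hα

theorem dev_mem_F (hα : α ∈ A.F 1) (hv : v ∈ A.F 1) : A.dev f α v ∈ A.F 1 :=
  A.mem_F_one_of (consX_mem hv fun _ _ => hα)

theorem ev_deg {q : ZMod 2} (hf : (f : Conv k) ∈ convParity k q) (hα : α ∈ A.F 1)
    (hα0 : α ∈ A.deg 0) : A.ev f α ∈ A.deg q :=
  A.gen_deg (fun _ _ => hα) hf (fun _ _ => 0) (fun _ _ => hα0) (by simp)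

theorem cons_deg {p : ZMod 2} (hv : v ∈ A.deg p) {b : ℕ} {x : Fin b → W} {e : Fin b → ZMod 2}
    (hx : ∀ i, x i ∈ A.deg (e i)) (i : Fin (b + 1)) :
    (Fin.cons v x : Fin (b + 1) → W) i ∈ A.deg ((Fin.cons p e : Fin (b + 1) → ZMod 2) i) :=
  Fin.cases hv hx i

theorem dev_deg {q p : ZMod 2} (hf : (f : Conv k) ∈ convParity k q) (hα : α ∈ A.F 1)
    (hα0 : α ∈ A.deg 0) (hv : v ∈ A.F 1) (hvp : v ∈ A.deg p) : A.dev f α v ∈ A.deg (q + p) :=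
  A.gen_deg (consX_mem hv fun _ _ => hα) hf (fun _ => Fin.cons p fun _ => 0)
    (fun _ => cons_deg hvp fun _ => hα0) fun b => by
      rw [Fin.sum_univ_succ]; simp

/-- Insertion of an argument at the first place. -/
noncomputable def consOp (A : ParamAlgebra k W) {b : ℕ} (F : CGra k (Fin (b + 1))) (x : Fin b → W) :
    W →ₗ[k] W :=
  (A.act (b + 1) F).toLinearMap (Fin.cons 0 x) 0

theorem consOp_apply {b : ℕ} (F : CGra k (Fin (b + 1))) (x : Fin b → W) (v : W) :
    A.consOp F x v = A.act (b + 1) F (Fin.cons v x) := by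
  change A.act (b + 1) F (Function.update _ _ _) = _
  rw [Fin.update_cons_zero]

theorem consOp_hpow {b : ℕ} (F : CGra k (Fin (b + 1))) (x : Fin b → W) (j : ℕ) (v : W) :
    A.consOp F x ((A.h ^ j) v) = (A.h ^ j) (A.consOp F x v) := A.hpow_act F _ 0 j v

theorem consOp_mem {b : ℕ} (F : CGra k (Fin (b + 1))) (x : Fin b → W) {N : ℕ} (hv : v ∈ A.F N) :
    A.consOp F x v ∈ A.F N := by
  rw [consOp_apply]
  refine A.F_anti ?_ (A.act_F _ F (Fin.cons N fun _ => 0) _ fun i => ?_)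
  · rw [Fin.sum_univ_succ]; simp
  · refine Fin.cases hv (fun i => ?_) i
    simp only [Fin.cons_succ, A.F_zero]; trivial

theorem genTerm_cons (p : ℕ) (f : convCGra k) (x : ∀ b, Fin (b + p) → W) (v : W) (i : ℕ × ℕ) :
    A.genTerm (p + 1) f (consX v x) i = ((1 / (i.1.factorial : k)) • ((A.h ^ i.2) ∘ₗ
      A.consOp (comp f (i.1 + p + 1) i.2) (x i.1))) v := by
  rw [LinearMap.smul_apply, LinearMap.comp_apply, consOp_apply]
  rfl

/-- Additivity in the first argument. -/
theorem gen_cons_add {p : ℕ} {x : ∀ b, Fin (b + p) → W} (hx : ∀ b i, x b i ∈ A.F 1)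
    {v v' : W} (hv : v ∈ A.F 1) (hv' : v' ∈ A.F 1) :
    A.gen (p + 1) f (consX (v + v') x) =
      A.gen (p + 1) f (consX v x) + A.gen (p + 1) f (consX v' x) := by
  refine (A.sumsTo_gen _ f (consX_mem (Submodule.add_mem _ hv hv') hx)).unique A.hausdorff
    (((A.sumsTo_gen _ f (consX_mem hv hx)).add
      (A.sumsTo_gen _ f (consX_mem hv' hx))).congr fun i => ?_)
  rw [genTerm_cons, genTerm_cons, genTerm_cons, map_add]

theorem dev_add {v v' : W} (hα : α ∈ A.F 1) (hv : v ∈ A.F 1) (hv' : v' ∈ A.F 1) :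
    A.dev f α (v + v') = A.dev f α v + A.dev f α v' := gen_cons_add (fun _ _ => hα) hv hv'

theorem ddev_add {v v' : W} (hα : α ∈ A.F 1) (hw : w ∈ A.F 1) (hv : v ∈ A.F 1) (hv' : v' ∈ A.F 1) :
    A.ddev f α (v + v') w = A.ddev f α v w + A.ddev f α v' w :=
  gen_cons_add (consX_mem hw fun _ _ => hα) hv hv'

/-- Linear operators applied to the first argument. -/
theorem gen_cons_map {p : ℕ} {x : ∀ b, Fin (b + p) → W} (hx : ∀ b i, x b i ∈ A.F 1) (T : W →ₗ[k] W)
    (hT : ∀ N, ∀ v ∈ A.F N, T v ∈ A.F N) (hTh : ∀ v, T (A.h v) = A.h (T v))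
    (hTa : ∀ n (F : CGra k (Fin (n + 1))) y v, A.consOp F y (T v) = T (A.consOp F y v))
    (hv : v ∈ A.F 1) :
    A.gen (p + 1) f (consX (T v) x) = T (A.gen (p + 1) f (consX v x)) := by
  refine (A.sumsTo_gen _ f (consX_mem (hT _ _ hv) hx)).unique A.hausdorff
    (((A.sumsTo_gen _ f (consX_mem hv hx)).map T fun N => ⟨N, hT N⟩).congr fun i => ?_)
  have : ∀ j w, T ((A.h ^ j) w) = (A.h ^ j) (T w) := by
    intro j w
    induction j with
    | zero => rfl
    | succ j ih => rw [pow_succ', Module.End.mul_apply, Module.End.mul_apply, hTh, ih]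
  rw [genTerm_cons, genTerm_cons, LinearMap.smul_apply, LinearMap.smul_apply, map_smul,
    LinearMap.comp_apply, LinearMap.comp_apply, hTa, this]

theorem dev_zero : A.dev f α 0 = 0 := by
  have h : ∀ i, A.genTerm 1 f (consX 0 fun _ _ => α) i = 0 := fun i => by
    rw [genTerm_cons, map_zero]
  have h1 : SumsTo A.F (A.genTerm 1 f (consX 0 fun _ _ => α)) 0 :=
    fun N => ⟨∅, fun i _ => by rw [h]; exact Submodule.zero_mem _, by simp⟩
  exact (sumsTo_fsum ⟨_, h1⟩).unique A.hausdorff h1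

/-! ### Naturality -/

theorem gen_map {W' : Type v} [AddCommGroup W'] [Module k W'] {A' : ParamAlgebra k W'} (T : W →ₗ[k] W')
    (hT : ∀ N, ∃ N', ∀ v ∈ A.F N', T v ∈ A'.F N) (hTh : ∀ v, T (A.h v) = A'.h (T v))
    {p : ℕ} {X : ∀ b, Fin (b + p) → W} (hX : ∀ b i, X b i ∈ A.F 1) (hX' : ∀ b i, T (X b i) ∈ A'.F 1)
    (hTa : ∀ b (F : CGra k (Fin (b + p))), T (A.act _ F (X b)) = A'.act _ F fun i => T (X b i)) :
    T (A.gen p f X) = A'.gen p f fun b i => T (X b i) := by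
  refine (((A.sumsTo_gen p f hX).map T hT).congr fun i => ?_).unique A'.hausdorff
    (A'.sumsTo_gen p f hX')
  have : ∀ j w, T ((A.h ^ j) w) = (A'.h ^ j) (T w) := by
    intro j w
    induction j with
    | zero => rfl
    | succ j ih => rw [pow_succ', Module.End.mul_apply, pow_succ', Module.End.mul_apply, hTh, ih]
  rw [genTerm, map_smul, this, hTa, genTerm]

theorem ev_map {W' : Type v} [AddCommGroup W'] [Module k W'] {A' : ParamAlgebra k W'} (T : W →ₗ[k] W')
    (hT : ∀ N, ∀ v ∈ A.F N, T v ∈ A'.F N) (hTh : ∀ v, T (A.h v) = A'.h (T v))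
    (hTa : ∀ n (F : CGra k (Fin n)) x, T (A.act n F x) = A'.act n F fun i => T (x i))
    (hα : α ∈ A.F 1) : T (A.ev f α) = A'.ev f (T α) :=
  gen_map T (fun N => ⟨N, hT N⟩) hTh (fun _ _ => hα) (fun _ _ => hT _ _ hα) fun _ F => hTa _ F _

theorem dev_map {W' : Type v} [AddCommGroup W'] [Module k W'] {A' : ParamAlgebra k W'} (T : W →ₗ[k] W')
    (hT : ∀ N, ∀ v ∈ A.F N, T v ∈ A'.F N) (hTh : ∀ v, T (A.h v) = A'.h (T v))
    (hTa : ∀ n (F : CGra k (Fin n)) x, T (A.act n F x) = A'.act n F fun i => T (x i))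
    (hα : α ∈ A.F 1) (hv : v ∈ A.F 1) : T (A.dev f α v) = A'.dev f (T α) (T v) := by
  have h : ∀ b, (fun i => T ((Fin.cons v fun _ => α : Fin (b + 1) → W) i)) =
      (Fin.cons (T v) fun _ => T α : Fin (b + 1) → W') := fun b => by
    funext i; refine Fin.cases rfl (fun _ => rfl) i
  rw [dev, gen_map T (fun N => ⟨N, hT N⟩) hTh (consX_mem hv fun _ _ => hα)
    (fun b i => hT _ _ (consX_mem hv (fun _ _ => hα) b i)) fun _ F => hTa _ F _, dev]
  congr 1
  funext b
  exact h b

/-! ### Convergence in the graphs -/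

theorem gen_hasSum {p : ℕ} {X : ∀ b, Fin (b + p) → W} (hX : ∀ b i, X b i ∈ A.F 1)
    {F : ℕ → convCGra k} (hF : ∀ l, (F l : Conv k) ∈ weightFil l)
    (hs : (f : Conv k) = convSum fun l => (F l : Conv k)) :
    SumsTo A.F (fun l => A.gen p (F l) X) (A.gen p f X) := by
  -- For a fixed arity and ħ-degree only finitely many l contribute, and large arities or ħ-degrees
  -- give small terms. The double family therefore tends to zero and can be summed in either order.
  have hzero : ∀ l (i : ℕ × ℕ), i.1 + p + i.2 ≤ l → A.genTerm p (F l) X i = 0 := by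
    intro l i h
    have : comp (F l) (i.1 + p) i.2 = 0 := Subtype.ext (hF l _ _ (by omega))
    rw [genTerm, this]; simp
  have hn : Null A.F fun c : ℕ × (ℕ × ℕ) => A.genTerm p (F c.1) X c.2 := by
    intro N
    refine ⟨Finset.range (N + p + 1) ×ˢ (Finset.range (N + 1) ×ˢ Finset.range (N + 1)), ?_⟩
    rintro ⟨l, i⟩ hi
    by_cases h : N ≤ i.1 + p + i.2
    · exact A.F_anti h (A.genTerm_mem p (F l) hX i)
    · simp only [Finset.mem_product, Finset.mem_range] at hi
      change A.genTerm p (F l) X i ∈ _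
      rw [hzero l i (by omega)]
      exact Submodule.zero_mem _
  obtain ⟨s, h⟩ := A.exists_sumsTo hn
  have h1 := h.prod fun l => A.sumsTo_gen p (F l) hX
  have h2 : SumsTo A.F (A.genTerm p f X) s := by
    refine h.prod_swap fun i => ?_
    have h3 := sumsTo_finset (F := A.F) (x := fun l => A.genTerm p (F l) X i)
      (Finset.range (i.1 + p + i.2)) fun l hl => hzero l i (by simpa using hl)
    have h4 : ∑ l ∈ Finset.range (i.1 + p + i.2), A.genTerm p (F l) X i = A.genTerm p f X i := by
      have h5 : comp f (i.1 + p) i.2 = ∑ l ∈ Finset.range (i.1 + p + i.2), comp (F l) (i.1 + p) i.2 := by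
        refine Subtype.ext ?_
        rw [Submodule.coe_sum]
        change f.1 _ _ = _
        rw [hs]
        rfl
      simp only [genTerm]
      rw [h5, map_sum, sum_apply, map_sum, Finset.smul_sum]
    rwa [h4] at h3
  rwa [(A.sumsTo_gen p f hX).unique A.hausdorff h2]

end Eval

end ParamAlgebra

end DeformationGroup
namespace DeformationGroup

namespace ParamAlgebra

/-! ### The chain rule for pre-Lie products -/

section Composition

variable {k : Type u} [Field k] {W : Type v} [AddCommGroup W] [Module k W]
variable {A : ParamAlgebra k W} {f f' : convCGra k} {α v w ξ : W}

theorem genTerm_mem_one (p : ℕ) (f : convCGra k) {X : ∀ b, Fin (b + p) → W}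
    (hX : ∀ b i, X b i ∈ A.F 1) (i : ℕ × ℕ) : A.genTerm p f X i ∈ A.F 1 := by
  rcases Nat.eq_zero_or_pos (i.1 + p) with h | h
  · have : A.act (i.1 + p) (comp f (i.1 + p) i.2) = 0 := by
      have : ∀ n, n = 0 → A.act n (comp f n i.2) = 0 := by
        rintro _ rfl
        rw [comp_zero, map_zero]
      exact this _ h
    rw [genTerm, this]
    simp
  · exact A.F_anti (by omega) (A.genTerm_mem p f hX i)

theorem consOp_mem_add {b : ℕ} (F : CGra k (Fin (b + 1))) {x : Fin b → W} (hx : ∀ i, x i ∈ A.F 1)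
    {N : ℕ} (hv : v ∈ A.F N) : A.consOp F x v ∈ A.F (N + b) := by
  rw [consOp_apply]
  refine A.F_anti ?_ (A.act_F _ F (Fin.cons N fun _ => 1) _ fun i => ?_)
  · rw [Fin.sum_univ_succ]; simp
  · exact Fin.cases hv (fun i => hx i) i

/-- The set of the decompositions of the pairs `c`. -/
def pairFib (c : ℕ × ℕ) : Finset ((ℕ × ℕ) × (ℕ × ℕ)) :=
  (Finset.HasAntidiagonal.antidiagonal c.1 ×ˢ Finset.HasAntidiagonal.antidiagonal c.2).map
    (Equiv.prodProdProdComm ℕ ℕ ℕ ℕ).toEmbedding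

theorem mem_pairFib (i : (ℕ × ℕ) × (ℕ × ℕ)) (c : ℕ × ℕ) :
    i ∈ pairFib c ↔ (i.1.1 + i.2.1, i.1.2 + i.2.2) = c := by
  obtain ⟨⟨b, i⟩, a, l⟩ := i
  rw [pairFib, Finset.mem_map_equiv]
  simp [Finset.HasAntidiagonal.mem_antidiagonal, Prod.ext_iff]

theorem finite_lt_add₄ (N : ℕ) :
    {i : (ℕ × ℕ) × (ℕ × ℕ) | i.1.1 + i.1.2 + i.2.1 + i.2.2 < N}.Finite := by
  refine ((Finset.range N ×ˢ Finset.range N) ×ˢ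
    (Finset.range N ×ˢ Finset.range N)).finite_toSet.subset fun i hi => ?_
  have : i.1.1 + i.1.2 + i.2.1 + i.2.2 < N := hi
  simp; omega

/-- Inserting one series in the first argument of another gives, by linearity and continuity, a
double series; it is unconditionally summable by weight and is regrouped by total number of free
arguments and total power of ħ. -/
theorem gen_gen (p r : ℕ) (f f' : convCGra k) {Y : ∀ b, Fin (b + p) → W} {X : ∀ b, Fin (b + r) → W}
    (hY : ∀ b i, Y b i ∈ A.F 1) (hX : ∀ b i, X b i ∈ A.F 1) :
    SumsTo A.F (fun c : ℕ × ℕ => ∑ s ∈ Finset.HasAntidiagonal.antidiagonal c.1,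
      ∑ t ∈ Finset.HasAntidiagonal.antidiagonal c.2,
        (1 / (s.1.factorial * s.2.factorial : k)) • (A.h ^ c.2)
          (A.act (s.1 + r + 1) (comp f (s.1 + r + 1) t.1)
            (Fin.cons (A.act (s.2 + p) (comp f' (s.2 + p) t.2) (Y s.2)) (X s.1))))
      (A.gen (r + 1) f (consX (A.gen p f' Y) X)) := by
  set x : (ℕ × ℕ) × (ℕ × ℕ) → W := fun c => ((1 / (c.1.1.factorial : k)) • ((A.h ^ c.1.2) ∘ₗ
    A.consOp (comp f (c.1.1 + r + 1) c.1.2) (X c.1.1))) (A.genTerm p f' Y c.2) with hx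
  have hn : Null A.F x := by
    refine null_of_weight A.F_anti (fun i => i.1.1 + i.1.2 + i.2.1 + i.2.2) (fun i => ?_)
      finite_lt_add₄
    have h1 := A.genTerm_mem p f' hY i.2
    have h2 := genTerm_mem_one (A := A) p f' hY i.2
    obtain ⟨M, hM, hM'⟩ : ∃ M, i.2.1 + p + i.2.2 ≤ M + 1 ∧ A.genTerm p f' Y i.2 ∈ A.F (M + 1) := by
      rcases Nat.eq_zero_or_pos (i.2.1 + p + i.2.2) with h | h
      · exact ⟨0, by omega, h2⟩
      · exact ⟨i.2.1 + p + i.2.2 - 1, by omega, by rwa [Nat.sub_add_cancel h]⟩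
    have h3 := consOp_mem_add (comp f (i.1.1 + r + 1) i.1.2) (hX i.1.1) hM'
    rw [show M + 1 + (i.1.1 + r) = M + (i.1.1 + r) + 1 by omega] at h3
    exact Submodule.smul_mem _ _ (A.F_anti (by omega) (A.hpow_F i.1.2 _ h3))
  obtain ⟨s, hs⟩ := A.exists_sumsTo hn
  have h1 : SumsTo A.F (A.genTerm (r + 1) f (consX (A.gen p f' Y) X)) s := by
    refine hs.prod fun c => ?_
    rw [genTerm_cons]
    exact (A.sumsTo_gen p f' hY).map (F' := A.F) ((1 / (c.1.factorial : k)) • ((A.h ^ c.2) ∘ₗ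
      A.consOp (comp f (c.1 + r + 1) c.2) (X c.1))) fun N => ⟨N, fun v hv =>
        Submodule.smul_mem _ _ (A.hpow_F' _ _ (consOp_mem _ _ hv))⟩
  have h2 := hs.fiber (fun i => (i.1.1 + i.2.1, i.1.2 + i.2.2)) pairFib mem_pairFib
  rw [(A.sumsTo_gen (r + 1) f (consX_mem (A.mem_F_one_of hY) hX)).unique A.hausdorff h1]
  refine h2.congr fun c => ?_
  rw [pairFib, Finset.sum_map, Finset.sum_product]
  refine Finset.sum_congr rfl fun s _ => Finset.sum_congr rfl fun t ht => ?_
  simp only [Equiv.coe_toEmbedding, Equiv.prodProdProdComm_apply, hx, genTerm]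
  rw [LinearMap.smul_apply, LinearMap.comp_apply, map_smul, map_smul, smul_smul, consOp_hpow,
    ← Module.End.mul_apply, ← pow_add, Finset.HasAntidiagonal.mem_antidiagonal.1 ht, consOp_apply,
    one_div_mul_one_div]

/-- The argument `(ξ, α, …, α)`. -/
def headArg (ξ α : W) (n : ℕ) (i : Fin n) : W := if (i : ℕ) = 0 then ξ else α

theorem headArg_succ (ξ α : W) (n : ℕ) :
    headArg ξ α (n + 1) = (Fin.cons ξ fun _ => α : Fin (n + 1) → W) := by
  funext i
  refine Fin.cases rfl (fun i => ?_) i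
  simp [headArg]

/-- The increasing enumeration of a set containing 0 starts with 0, so the distinguished argument
stays in front. -/
theorem headArg_emb {n : ℕ} (S : Finset (Fin (n + 1))) (h0 : (0 : Fin (n + 1)) ∈ S) :
    (fun a => headArg ξ α (n + 1) (S.orderEmbOfFin rfl a)) = headArg ξ α S.card := by
  funext a
  have : ((S.orderEmbOfFin rfl a : Fin (n + 1)) : ℕ) = 0 ↔ (a : ℕ) = 0 := by
    have h1 : ∀ a : Fin S.card, S.orderEmbOfFin rfl a = 0 → (a : ℕ) = 0 := by
      intro a h
      by_contra hne
      have hlt : (⟨0, by omega⟩ : Fin S.card) < a := by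
        rw [Fin.lt_def]; exact Nat.pos_of_ne_zero hne
      have := (S.orderEmbOfFin rfl).lt_iff_lt.2 hlt
      rw [h] at this
      exact (Fin.not_lt_zero _ this).elim
    obtain ⟨b, hb⟩ : ∃ b, S.orderEmbOfFin rfl b = 0 := by
      have : (0 : Fin (n + 1)) ∈ Set.range (S.orderEmbOfFin rfl) := by
        rw [Finset.range_orderEmbOfFin]; exact h0
      exact this
    constructor
    · intro h
      exact h1 a (Fin.ext h)
    · intro h
      have : a = b := Fin.ext (by rw [h, h1 b hb])
      rw [this, hb]; rfl
  simp only [headArg, this]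

theorem headArg_emb' {n : ℕ} (S : Finset (Fin (n + 1))) (h0 : (0 : Fin (n + 1)) ∉ S) :
    (fun a => headArg ξ α (n + 1) (S.orderEmbOfFin rfl a)) = fun _ => α := by
  funext a
  rw [headArg, if_neg]
  intro h
  have h1 := Finset.orderEmbOfFin_mem S rfl a
  rw [show S.orderEmbOfFin rfl a = 0 from Fin.ext h] at h1
  exact h0 h1

variable [CharZero k]

theorem choose_smul {n : ℕ} {s : ℕ × ℕ} (hs : s ∈ Finset.HasAntidiagonal.antidiagonal n) (v : W) :
    (1 / (n.factorial : k)) • (n.choose s.2 • v) = (1 / (s.1.factorial * s.2.factorial : k)) • v := by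
  rw [← Nat.cast_smul_eq_nsmul k, smul_smul]
  congr 1
  have h := Finset.HasAntidiagonal.mem_antidiagonal.1 hs
  have h1 := Nat.choose_mul_factorial_mul_factorial (show s.2 ≤ n by omega)
  rw [show n - s.2 = s.1 by omega] at h1
  have h2 : (n.factorial : k) = n.choose s.2 * s.2.factorial * s.1.factorial := by
    rw [← h1]; push_cast; rfl
  have hn : (n.factorial : k) ≠ 0 := Nat.cast_ne_zero.2 n.factorial_ne_zero
  have ha : (s.1.factorial : k) ≠ 0 := Nat.cast_ne_zero.2 s.1.factorial_ne_zero
  have hb : (s.2.factorial : k) ≠ 0 := Nat.cast_ne_zero.2 s.2.factorial_ne_zero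
  field_simp
  rw [h2]; ring

/-- The action of a pre-Lie product is a composition. -/
theorem ev_pl {q : ZMod 2} (hq : (f' : Conv k) ∈ convParity k q) (hα : α ∈ A.F 1)
    (hα0 : α ∈ A.deg 0) : A.ev (pl f f') α = A.dev f α (A.ev f' α) := by
  refine (A.sumsTo_gen 0 (pl f f') (X := fun _ _ => α) fun _ _ => hα).unique A.hausdorff
    ((gen_gen 0 0 f f' (Y := fun _ _ => α) (X := fun _ _ => α) (fun _ _ => hα)
      fun _ _ => hα).congr fun c => ?_)
  obtain ⟨n, j⟩ := c
  have h := act_pl A.toCompleteCGraAlgebra f f' hq n j (p := fun _ => 0) (x := fun _ => α)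
    (fun _ => hα0) (by simp)
  change _ = (1 / (n.factorial : k)) • (A.h ^ j) (A.act n (comp (pl f f') n j) fun _ => α)
  -- All arguments equal α, so a subset matters only through its cardinality, and the binomial
  -- coefficients turn 1/n! into the product 1/(b! a!) of the two expansions.
  rw [h, sum_finset_card (fun b a => ∑ i ∈ Finset.HasAntidiagonal.antidiagonal j,
    A.act (b + 1) (comp f (b + 1) i.1) (Fin.cons (A.act a (comp f' a i.2) fun _ => α) fun _ => α)),
    map_sum, Finset.smul_sum]
  refine Finset.sum_congr rfl fun s hs => ?_
  rw [map_nsmul, choose_smul hs, map_sum, Finset.smul_sum]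
  rfl

/-- The derivative of the action of a pre-Lie product. -/
theorem dev_pl {q r : ZMod 2} (hq : (f' : Conv k) ∈ convParity k q) (hα : α ∈ A.F 1)
    (hα0 : α ∈ A.deg 0) (hξ : ξ ∈ A.F 1) (hξr : ξ ∈ A.deg r) :
    A.dev (pl f f') α ξ = A.dev f α (A.dev f' α ξ) + A.ddev f α (A.ev f' α) ξ := by
  have hc : ∀ b (i : Fin (b + 0)), (fun _ => α : Fin (b + 0) → W) i ∈ A.F 1 := fun _ _ => hα
  refine (A.sumsTo_gen 1 (pl f f') (consX_mem hξ hc)).unique A.hausdorff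
    (((gen_gen 1 0 f f' (consX_mem hξ hc) hc).add
      (gen_gen 0 1 f f' hc (consX_mem hξ hc))).congr fun c => ?_)
  obtain ⟨n, j⟩ := c
  have h := act_pl A.toCompleteCGraAlgebra f f' hq (n + 1) j (p := Fin.cons r fun _ => 0)
    (x := headArg ξ α (n + 1)) (by
      rw [headArg_succ]
      exact cons_deg hξr fun _ => hα0) (by
      intro i i' hne
      refine Fin.cases (fun hne => ?_) (fun i hne => ?_) i hne
      · refine Fin.cases (fun hne => (hne rfl).elim) (fun i' _ => by simp) i' hne
      · simp)
  change _ = (1 / (n.factorial : k)) • (A.h ^ j) (A.act (n + 1) (comp (pl f f') (n + 1) j)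
    (Fin.cons ξ fun _ => α))
  rw [← headArg_succ, h]
  -- The distinguished argument ξ either enters f' (when 0 ∈ S) or stays an argument of f; these are
  -- the two terms of the chain rule.
  have h1 : ∀ S : Finset (Fin (n + 1)), ∑ i ∈ Finset.HasAntidiagonal.antidiagonal j,
        A.act (Sᶜ.card + 1) (comp f (Sᶜ.card + 1) i.1)
          (Fin.cons (A.act S.card (comp f' S.card i.2) fun a =>
            headArg ξ α (n + 1) (S.orderEmbOfFin rfl a))
            fun a => headArg ξ α (n + 1) (Sᶜ.orderEmbOfFin rfl a)) =
      if (0 : Fin (n + 1)) ∈ S then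
        (fun b m => ∑ i ∈ Finset.HasAntidiagonal.antidiagonal j, A.act (b + 1) (comp f (b + 1) i.1)
          (Fin.cons (A.act m (comp f' m i.2) (headArg ξ α m)) fun _ => α)) Sᶜ.card S.card
      else (fun b m => ∑ i ∈ Finset.HasAntidiagonal.antidiagonal j, A.act (b + 1) (comp f (b + 1) i.1)
          (Fin.cons (A.act m (comp f' m i.2) fun _ => α) (headArg ξ α b))) Sᶜ.card S.card := by
    intro S
    split_ifs with h0
    · rw [headArg_emb S h0, headArg_emb' Sᶜ (by simpa using h0)]
    · rw [headArg_emb' S h0, headArg_emb Sᶜ (by simpa using h0)]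
  rw [Finset.sum_congr rfl fun S _ => h1 S, sum_finset_succ_card
    (fun b m => ∑ i ∈ Finset.HasAntidiagonal.antidiagonal j, A.act (b + 1) (comp f (b + 1) i.1)
      (Fin.cons (A.act m (comp f' m i.2) (headArg ξ α m)) fun _ => α))
    (fun b m => ∑ i ∈ Finset.HasAntidiagonal.antidiagonal j, A.act (b + 1) (comp f (b + 1) i.1)
      (Fin.cons (A.act m (comp f' m i.2) fun _ => α) (headArg ξ α b))), map_sum, Finset.smul_sum, ← Finset.sum_add_distrib]
  refine Finset.sum_congr rfl fun s hs => ?_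
  rw [map_nsmul, choose_smul hs, map_add, smul_add, map_sum, map_sum, Finset.smul_sum,
    Finset.smul_sum]
  simp only [headArg_succ]
  rfl

end Composition

/-! ### Derivations -/

section Derivation

variable {k : Type u} [Field k] {W : Type v} [AddCommGroup W] [Module k W]
variable {A : ParamAlgebra k W} {f : convCGra k} {α v w ξ : W}

/-- Derivations of degree `r`, up to signs. -/
structure IsDer (A : ParamAlgebra k W) (D : W →ₗ[k] W) (r : ZMod 2) : Prop where
  deg : ∀ p, ∀ x ∈ A.deg p, D x ∈ A.deg (p + r)
  mem_F : ∀ N, ∀ x ∈ A.F N, D x ∈ A.F N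
  h : ∀ x, D (A.h x) = A.h (D x)
  act : ∀ n (f : CGra k (Fin n)) (q : ZMod 2), (f : Gra k (Fin n)) ∈ parity k (Fin n) q →
    ∀ (p : Fin n → ZMod 2) (x : Fin n → W), (∀ i, x i ∈ A.deg (p i)) →
      D (A.act n f x) = ((-1 : ℤˣ) ^ (r * q)) •
        ∑ i, ((-1 : ℤˣ) ^ (r * ∑ j with j < i, p j)) • A.act n f (Function.update x i (D (x i)))

theorem isDer_d (A : ParamAlgebra k W) : IsDer A A.d 1 where
  deg := A.d_deg
  mem_F := A.d_F
  h x := (A.h_d x).symm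
  act n f q hf p x hx := by simpa using A.act_d n f q hf p x hx

variable {D : W →ₗ[k] W} {r : ZMod 2}

theorem IsDer.hpow (hD : IsDer A D r) (j : ℕ) (x : W) : D ((A.h ^ j) x) = (A.h ^ j) (D x) := by
  induction j with
  | zero => rfl
  | succ j ih => rw [pow_succ', Module.End.mul_apply, Module.End.mul_apply, hD.h, ih]

/-- By symmetry the exceptional argument can be moved to the front; no sign appears because α is
even. -/
theorem act_comp_update_const {s : ZMod 2} (hα0 : α ∈ A.deg 0) (hv : v ∈ A.deg s) (b j : ℕ)
    (i : Fin (b + 1)) : A.act (b + 1) (comp f (b + 1) j) (Function.update (fun _ => α) i v) =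
      A.act (b + 1) (comp f (b + 1) j) (Fin.cons v fun _ => α) := by
  have h := act_comp_swap A.toCompleteCGraAlgebra f (b + 1) j (Equiv.swap 0 i)
    (p := Function.update (fun _ => 0) i s) (x := Function.update (fun _ => α) i v) (fun a => by
      by_cases ha : a = i
      · subst ha; simpa using hv
      · simpa [ha] using hα0) (fun a c _ hac => by
      by_cases ha : Equiv.swap 0 i a = i
      · have : Equiv.swap 0 i c ≠ i := fun hc => by rw [ha, hc] at hac; exact lt_irrefl _ hac
        simp [this]
      · simp [ha])
  rw [h]
  congr 1
  funext a
  refine Fin.cases ?_ (fun a => ?_) a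
  · simp
  · have : Equiv.swap 0 i a.succ ≠ i := fun h => by
      rw [Equiv.swap_apply_eq_iff, Equiv.swap_apply_right] at h
      exact Fin.succ_ne_zero _ h
    simp [this]

theorem act_comp_update_cons {p s : ZMod 2} (hα0 : α ∈ A.deg 0) (hξ : ξ ∈ A.deg p) (hv : v ∈ A.deg s)
    (b j : ℕ) (i : Fin (b + 1)) : A.act (b + 2) (comp f (b + 2) j)
      (Function.update (Fin.cons ξ fun _ => α : Fin (b + 2) → W) i.succ v) =
      A.act (b + 2) (comp f (b + 2) j) (Fin.cons ξ (Fin.cons v fun _ => α)) := by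
  have h10 : (1 : Fin (b + 2)) = (0 : Fin (b + 1)).succ := rfl
  have hs0 : Equiv.swap (1 : Fin (b + 2)) i.succ 0 = 0 :=
    Equiv.swap_apply_of_ne_of_ne (by rw [h10]; exact (Fin.succ_ne_zero _).symm)
      (Fin.succ_ne_zero _).symm
  have h := act_comp_swap A.toCompleteCGraAlgebra f (b + 2) j (Equiv.swap 1 i.succ)
    (p := Function.update (Fin.cons p fun _ => 0 : Fin (b + 2) → ZMod 2) i.succ s)
    (x := Function.update (Fin.cons ξ fun _ => α : Fin (b + 2) → W) i.succ v) (fun a => by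
      by_cases ha : a = i.succ
      · subst ha; simpa using hv
      · rw [Function.update_of_ne ha, Function.update_of_ne ha]
        exact cons_deg hξ (fun _ => hα0) a) (fun a c hac hca => by
      set σ := Equiv.swap (1 : Fin (b + 2)) i.succ with hσ
      have hz : ∀ e, σ e ≠ 0 → σ e ≠ i.succ →
          Function.update (Fin.cons p fun _ => 0 : Fin (b + 2) → ZMod 2) i.succ s (σ e) = 0 := by
        intro e h0 h1
        rw [Function.update_of_ne h1]
        obtain ⟨e', he'⟩ := Fin.exists_succ_eq.2 h0
        rw [← he']; simp
      by_cases hc : σ c = i.succ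
      · have hc' : c = 1 := by
          rw [hσ, Equiv.swap_apply_eq_iff, Equiv.swap_apply_right] at hc; exact hc
        have ha' : a = 0 := by
          rw [hc', Fin.lt_def] at hac
          exact Fin.ext (by simpa using hac)
        rw [ha', hs0] at hca
        exact (Fin.not_lt_zero _ hca).elim
      · by_cases hc0 : σ c = 0
        · have : c = 0 := σ.injective (hc0.trans hs0.symm)
          rw [this] at hac
          exact (Fin.not_lt_zero _ hac).elim
        · rw [hz c hc0 hc, mul_zero])
  rw [h]
  congr 1
  funext a
  refine Fin.cases ?_ (fun a => ?_) a
  · rw [hs0, Function.update_of_ne (Fin.succ_ne_zero _).symm]; rfl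
  · refine Fin.cases ?_ (fun a => ?_) a
    · rw [← h10, Equiv.swap_apply_left, Function.update_self]; rfl
    · have h1 : Equiv.swap (1 : Fin (b + 2)) i.succ a.succ.succ ≠ i.succ := fun h => by
        rw [Equiv.swap_apply_eq_iff, Equiv.swap_apply_right, h10] at h
        exact Fin.succ_ne_zero _ (Fin.succ_injective _ h)
      have h2 : Equiv.swap (1 : Fin (b + 2)) i.succ a.succ.succ ≠ 0 := fun h => by
        have := (Equiv.swap (1 : Fin (b + 2)) i.succ).injective (h.trans hs0.symm)
        exact Fin.succ_ne_zero _ this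
      rw [Function.update_of_ne h1]
      obtain ⟨e, he⟩ := Fin.exists_succ_eq.2 h2
      rw [← he]; rfl

/-- Differentiating the term of arity b + 1 leaves b arguments α, so a vanishing term at b = 0 has
to be dropped before comparing series. -/
theorem SumsTo.dropZero {F : ℕ → Submodule k W} {x : ℕ × ℕ → W} {s : W} (h : SumsTo F x s)
    (h0 : ∀ j, x (0, j) = 0) : SumsTo F (fun i : ℕ × ℕ => x (i.1 + 1, i.2)) s := by
  classical
  intro N
  obtain ⟨t, h1, h2⟩ := h N
  have hinj : Function.Injective fun i : ℕ × ℕ => (i.1 + 1, i.2) := by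
    rintro ⟨a, b⟩ ⟨c, d⟩ h
    simpa using h
  refine ⟨t.preimage _ hinj.injOn, fun i hi => h1 _ (by simpa using hi), ?_⟩
  rw [Finset.sum_preimage _ t hinj.injOn x fun i _ hi => ?_]
  · exact h2
  · obtain ⟨a, b⟩ := i
    cases a with
    | zero => exact h0 b
    | succ a => exact (hi ⟨(a, b), rfl⟩).elim

theorem SumsTo.units_smul {F : ℕ → Submodule k W} {ι : Type*} {x : ι → W} {s : W} (h : SumsTo F x s)
    (e : ℤˣ) : SumsTo F (fun i => e • x i) (e • s) := by
  rcases Int.units_eq_one_or e with rfl | rfl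
  · simpa using h
  · have := h.map (F' := F) (-LinearMap.id) fun N => ⟨N, fun y hy => Submodule.neg_mem _ hy⟩
    simpa [Units.smul_def] using this

theorem units_smul_comm' (e : ℤˣ) (T : W →ₗ[k] W) (v : W) : T (e • v) = e • T v := by
  rcases Int.units_eq_one_or e with rfl | rfl <;> simp [Units.smul_def]

theorem units_smul_smul (e : ℤˣ) (c : k) (v : W) : c • (e • v) = e • (c • v) := by
  rcases Int.units_eq_one_or e with rfl | rfl <;> simp [Units.smul_def]

variable [CharZero k]

theorem factorial_smul (b : ℕ) (v : W) :
    (1 / ((b + 1).factorial : k)) • ((b + 1) • v) = (1 / (b.factorial : k)) • v := by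
  rw [← Nat.cast_smul_eq_nsmul k, smul_smul]
  congr 1
  have h1 : ((b + 1 : ℕ) : k) ≠ 0 := Nat.cast_ne_zero.2 b.succ_ne_zero
  have h2 : (b.factorial : k) ≠ 0 := Nat.cast_ne_zero.2 b.factorial_ne_zero
  rw [Nat.factorial_succ]
  push_cast at h1 ⊢
  field_simp

/-- Leibniz rule: the b + 1 places give equal contributions, and (b + 1)/(b + 1)! = 1/b!. -/
theorem IsDer.ev (hD : IsDer A D r) {q : ZMod 2} (hf : (f : Conv k) ∈ convParity k q)
    (hα : α ∈ A.F 1) (hα0 : α ∈ A.deg 0) :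
    D (A.ev f α) = ((-1 : ℤˣ) ^ (r * q)) • A.dev f α (D α) := by
  have h1 := (A.sumsTo_gen 0 f (X := fun _ _ => α) fun _ _ => hα).map D fun N => ⟨N, hD.mem_F N⟩
  have h2 : ∀ j, D (A.genTerm 0 f (fun _ _ => α) (0, j)) = 0 := fun j => by
    have : A.act 0 (comp f 0 j) = 0 := by rw [comp_zero, map_zero]
    change D ((1 / (Nat.factorial 0 : k)) • (A.h ^ j) (A.act 0 (comp f 0 j) _)) = 0
    rw [this]
    simp
  have hc : ∀ b (i : Fin (b + 0)), (fun _ => α : Fin (b + 0) → W) i ∈ A.F 1 := fun _ _ => hα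
  have hDα := hD.mem_F _ _ hα
  refine (SumsTo.dropZero h1 h2).unique A.hausdorff
    ((SumsTo.units_smul (A.sumsTo_gen 1 f (consX_mem hDα hc)) _).congr fun i => ?_)
  obtain ⟨b, j⟩ := i
  change _ = D ((1 / ((b + 1).factorial : k)) • (A.h ^ j) (A.act (b + 1) (comp f (b + 1) j) fun _ => α))
  rw [map_smul, hD.hpow, hD.act _ _ q (hf _ _) (fun _ => 0) _ fun _ => hα0]
  simp only [act_comp_update_const hα0 (hD.deg _ _ hα0), Finset.sum_const_zero, mul_zero, uzpow_zero,
    one_smul, Finset.sum_const, Finset.card_univ, Fintype.card_fin]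
  rw [units_smul_comm', units_smul_smul, map_nsmul, factorial_smul]
  rfl

theorem IsDer.dev (hD : IsDer A D r) {q p : ZMod 2} (hf : (f : Conv k) ∈ convParity k q)
    (hα : α ∈ A.F 1) (hα0 : α ∈ A.deg 0) (hξ : ξ ∈ A.F 1) (hξp : ξ ∈ A.deg p) :
    D (A.dev f α ξ) = ((-1 : ℤˣ) ^ (r * q)) •
      (A.dev f α (D ξ) + ((-1 : ℤˣ) ^ (r * p)) • A.ddev f α ξ (D α)) := by
  have hc : ∀ b (i : Fin (b + 0)), (fun _ => α : Fin (b + 0) → W) i ∈ A.F 1 := fun _ _ => hα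
  have hDα := hD.mem_F _ _ hα
  have h1 := (A.sumsTo_gen 1 f (consX_mem hξ hc)).map D fun N => ⟨N, hD.mem_F N⟩
  have h2 := SumsTo.units_smul (A.sumsTo_gen 1 f (consX_mem (hD.mem_F _ _ hξ) hc))
    (-(-1 : ℤˣ) ^ (r * q))
  have hterm : ∀ b j, D (A.genTerm 1 f (consX ξ fun _ _ => α) (b, j)) =
      ((-1 : ℤˣ) ^ (r * q)) • (A.genTerm 1 f (consX (D ξ) fun _ _ => α) (b, j) +
        (1 / (b.factorial : k)) • (A.h ^ j) (((-1 : ℤˣ) ^ (r * p)) • ∑ i : Fin b,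
          A.act (b + 1) (comp f (b + 1) j)
            (Function.update (Fin.cons ξ fun _ => α : Fin (b + 1) → W) i.succ (D α)))) := by
    intro b j
    change D ((1 / (b.factorial : k)) • (A.h ^ j) (A.act (b + 1) (comp f (b + 1) j)
      (Fin.cons ξ fun _ => α))) = _
    rw [map_smul, hD.hpow, hD.act _ _ q (hf _ _) (Fin.cons p fun _ => 0) _
      (cons_deg hξp fun _ => hα0), Fin.sum_univ_succ, units_smul_comm', units_smul_smul, map_add,
      smul_add]
    congr 2
    · simp only [Fin.not_lt_zero, Finset.filter_false, Finset.sum_empty, mul_zero, uzpow_zero,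
        one_smul, Fin.cons_zero, Fin.update_cons_zero]
      rfl
    · congr 2
      rw [Finset.smul_sum]
      refine Finset.sum_congr rfl fun i _ => ?_
      rw [Fin.cons_succ]
      congr 3
      rw [Finset.sum_filter, Fin.sum_univ_succ]
      simp
  -- The contributions of D applied to ξ are subtracted first; the rest starts at b = 1 and is
  -- reindexed as a second derivative.
  have h3 := h1.add h2
  have hz : ∀ j, D (A.genTerm 1 f (consX ξ fun _ _ => α) (0, j)) +
      (-(-1 : ℤˣ) ^ (r * q)) • A.genTerm 1 f (consX (D ξ) fun _ _ => α) (0, j) = 0 := by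
    intro j
    rw [hterm, Finset.univ_eq_empty, Finset.sum_empty, smul_zero, map_zero, smul_zero, add_zero,
      Units.neg_smul, add_neg_cancel]
  have h4 := SumsTo.dropZero h3 hz
  have h5 := SumsTo.units_smul (SumsTo.units_smul
    (A.sumsTo_gen 2 f (consX_mem hξ (consX_mem hDα hc))) ((-1 : ℤˣ) ^ (r * p))) ((-1 : ℤˣ) ^ (r * q))
  have h6 := h4.unique A.hausdorff (h5.congr fun i => by
    obtain ⟨b, j⟩ := i
    rw [hterm, smul_add, Units.neg_smul, add_assoc, add_comm, add_assoc, neg_add_cancel, add_zero]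
    congr 1
    simp only [act_comp_update_cons hα0 hξp (hD.deg _ _ hα0), Finset.sum_const, Finset.card_univ,
      Fintype.card_fin]
    rw [units_smul_comm', units_smul_smul, map_nsmul, factorial_smul]
    rfl)
  rw [Units.neg_smul, ← sub_eq_add_neg, sub_eq_iff_eq_add] at h6
  rw [smul_add, add_comm]
  exact h6

end Derivation

end ParamAlgebra

end DeformationGroup
namespace DeformationGroup

namespace ParamAlgebra

/-! ### Paths -/

section Path

variable {k : Type u} [Field k] {W : Type v} [AddCommGroup W] [Module k W]
variable {A : ParamAlgebra k W} {f : convCGra k} {α v w ξ : W}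

theorem mem_path_F_one {a : ℕ → W} : a ∈ A.path.F 1 ↔ ∀ m, a m ∈ A.F 1 := by
  have h : ∀ m, seriesWeight 1 m = 1 := fun m => by unfold seriesWeight; omega
  constructor
  · intro h' m
    have : a m ∈ A.F (seriesWeight 1 m) := h' m
    rwa [h] at this
  · intro h' m
    have := h' m
    rwa [← h m] at this

theorem path_act {n : ℕ} (F : CGra k (Fin n)) (x : Fin n → ℕ → W) (m : ℕ) :
    A.path.act n F x m = ∑ c ∈ Finset.piAntidiag (Finset.univ : Finset (Fin n)) m,
      A.act n F fun i => x i (c i) := A.toCompleteCGraAlgebra.series_act F x m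

theorem path_h (x : ℕ → W) (m : ℕ) : A.path.h x m = A.h (x m) := rfl

theorem path_hpow (j : ℕ) (x : ℕ → W) (m : ℕ) : (A.path.h ^ j) x m = (A.h ^ j) (x m) := by
  induction j with
  | zero => rfl
  | succ j ih => rw [pow_succ', Module.End.mul_apply, path_h, ih, pow_succ', Module.End.mul_apply]

theorem path_proj_mem (N m : ℕ) {x : ℕ → W} (hx : x ∈ A.path.F (N + m + 1)) : x m ∈ A.F N :=
  A.F_anti (by unfold seriesWeight; omega) (show x m ∈ A.F (seriesWeight (N + m + 1) m) from hx m)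

theorem path_genTerm (p : ℕ) (X : ∀ b, Fin (b + p) → ℕ → W) (i : ℕ × ℕ) (m : ℕ) :
    A.path.genTerm p f X i m = (1 / (i.1.factorial : k)) • (A.h ^ i.2)
      (A.path.act (i.1 + p) (comp f (i.1 + p) i.2) (X i.1) m) := by
  rw [genTerm, Pi.smul_apply, path_hpow]

theorem sumsTo_path_gen {p : ℕ} {X : ∀ b, Fin (b + p) → ℕ → W} (hX : ∀ b i, X b i ∈ A.path.F 1)
    (m : ℕ) : SumsTo A.F (fun i => A.path.genTerm p f X i m) (A.path.gen p f X m) :=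
  (A.path.sumsTo_gen p f hX).map (F' := A.F) (LinearMap.proj m) fun N =>
    ⟨N + m + 1, fun _ hv => path_proj_mem N m hv⟩

/-- The value at time zero. -/
theorem path_ev_zero {a : ℕ → W} (ha : a ∈ A.path.F 1) : A.path.ev f a 0 = A.ev f (a 0) := by
  refine ev_map (A := A.path) (A' := A) (LinearMap.proj 0) (fun N v hv => ?_) (fun v => rfl)
    (fun n F x => ?_) ha
  · have : v 0 ∈ A.F (seriesWeight N 0) := hv 0
    rwa [show seriesWeight N 0 = N by unfold seriesWeight; omega] at this
  · rw [LinearMap.proj_apply, path_act, Finset.piAntidiag_zero, Finset.sum_singleton]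
    rfl

theorem path_dev_zero {a x : ℕ → W} (ha : a ∈ A.path.F 1) (hx : x ∈ A.path.F 1) :
    A.path.dev f a x 0 = A.dev f (a 0) (x 0) := by
  refine dev_map (A := A.path) (A' := A) (LinearMap.proj 0) (fun N v hv => ?_) (fun v => rfl)
    (fun n F x => ?_) ha hx
  · have : v 0 ∈ A.F (seriesWeight N 0) := hv 0
    rwa [show seriesWeight N 0 = N by unfold seriesWeight; omega] at this
  · rw [LinearMap.proj_apply, path_act, Finset.piAntidiag_zero, Finset.sum_singleton]
    rfl

/-- Causality: a contribution to order m only involves coefficients of order at most m of the first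
argument. -/
theorem path_gen_cons_eq_zero {p m : ℕ} {X : ∀ b, Fin (b + p) → ℕ → W} {u : ℕ → W}
    (hX : ∀ b i, X b i ∈ A.path.F 1) (hu : u ∈ A.path.F 1) (h : ∀ i ≤ m, u i = 0) :
    A.path.gen (p + 1) f (consX u X) m = 0 := by
  have h1 := sumsTo_path_gen (A := A) (f := f) (consX_mem hu hX) m
  refine A.hausdorff _ fun N => h1.mem fun i => ?_
  have h2 : A.path.act (i.1 + (p + 1)) (comp f (i.1 + (p + 1)) i.2) (consX u X i.1) m = 0 := by
    rw [path_act]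
    refine Finset.sum_eq_zero fun c hc => ?_
    rw [mem_piAntidiag_univ] at hc
    refine MultilinearMap.map_coord_zero _ (0 : Fin (i.1 + p + 1)) (h _ ?_)
    rw [← hc]
    exact Finset.single_le_sum (f := c) (fun _ _ => Nat.zero_le _) (Finset.mem_univ _)
  rw [path_genTerm, h2]
  simp

theorem shift_mem_path_F {u : ℕ → W} {N : ℕ} (hu : u ∈ A.path.F N) : seriesShift k W u ∈ A.path.F N := by
  intro m
  cases m with
  | zero => exact Submodule.zero_mem _
  | succ m => exact A.F_anti (by unfold seriesWeight; omega) (hu m)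

/-- Division by t: v agrees with t u through order m + 1. Applied with v = t da/dt, it yields
differential equations in terms of the velocity u of the path a. -/
theorem path_gen_cons_shift {p m : ℕ} {X : ∀ b, Fin (b + p) → ℕ → W} {v u : ℕ → W}
    (hX : ∀ b i, X b i ∈ A.path.F 1) (hv : v ∈ A.path.F 1) (hu : u ∈ A.path.F 1) (h0 : v 0 = 0)
    (h : ∀ i ≤ m, v (i + 1) = u i) :
    A.path.gen (p + 1) f (consX v X) (m + 1) = A.path.gen (p + 1) f (consX u X) m := by
  have hT := shift_mem_path_F hu
  have h1 := gen_cons_map (A := A.path) (f := f) hX (seriesShift k W)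
    (fun N v hv => shift_mem_path_F hv) (fun v => by
      funext m
      cases m with
      | zero => exact (map_zero A.h).symm
      | succ m => rfl)
    (fun n F y v => by
      have := series_act_shift A.toCompleteCGraAlgebra F (Fin.cons v y) 0
      rw [Fin.update_cons_zero] at this
      rw [consOp_apply, consOp_apply]
      exact this) hu
  have h2 := gen_cons_add (A := A.path) (f := f) hX (Submodule.sub_mem _ hv hT) hT
  rw [sub_add_cancel] at h2
  rw [h2, Pi.add_apply, path_gen_cons_eq_zero hX (Submodule.sub_mem _ hv hT), h1, zero_add,
    seriesShift_succ]
  intro i hi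
  cases i with
  | zero => simp [h0]
  | succ i => simp [h i (by omega)]

/-- The operator `t d/dt`. -/
def euler (k : Type u) [Field k] (W : Type v) [AddCommGroup W] [Module k W] :
    (ℕ → W) →ₗ[k] (ℕ → W) :=
  LinearMap.pi fun m => (m : k) • LinearMap.proj m

theorem euler_apply (x : ℕ → W) (m : ℕ) : euler k W x m = (m : k) • x m := rfl

/-- The orders of the arguments add up to the order of the result. The operator t d/dt is used
instead of d/dt because it preserves the filtration of power series. -/
theorem isDer_euler (A : ParamAlgebra k W) : IsDer A.path (euler k W) 0 where
  deg p x hx m := by rw [add_zero]; exact Submodule.smul_mem _ _ (hx m)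
  mem_F N x hx m := Submodule.smul_mem _ _ (hx m)
  h x := by funext m; exact (map_smul A.h _ _).symm
  act n F q _ p x _ := by
    funext m
    simp only [zero_mul, uzpow_zero, one_smul]
    rw [euler_apply, path_act, Finset.sum_apply, Finset.smul_sum]
    simp only [path_act]
    rw [Finset.sum_comm]
    refine Finset.sum_congr rfl fun c hc => ?_
    rw [mem_piAntidiag_univ] at hc
    simp only [update_apply_coeff, euler_apply, MultilinearMap.map_update_smul,
      Function.update_eq_self]
    rw [← Finset.sum_smul, ← hc]
    push_cast
    rfl

/-! ### Values at time one -/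

theorem act_sub_mem {n N : ℕ} (F : CGra k (Fin n)) {y z : Fin n → W} (h : ∀ i, y i - z i ∈ A.F N) :
    A.act n F y - A.act n F z ∈ A.F N := by
  classical
  have key : ∀ s : Finset (Fin n), A.act n F y - A.act n F (s.piecewise z y) ∈ A.F N := by
    intro s
    induction s using Finset.induction_on with
    | empty => simp
    | insert i s hi ih =>
      have h1 : s.piecewise z y = Function.update (s.piecewise z y) i (y i) := by
        rw [← Finset.piecewise_eq_of_notMem s z y hi, Function.update_eq_self]
      have h2 : A.act n F (s.piecewise z y) - A.act n F (Function.update (s.piecewise z y) i (z i)) ∈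
          A.F N := by
        rw [show A.act n F (s.piecewise z y) = A.act n F (Function.update (s.piecewise z y) i (y i))
          from congrArg _ h1, ← MultilinearMap.map_update_sub]
        refine A.F_anti ?_ (A.act_F n F (Function.update (fun _ => 0) i N) _ fun j => ?_)
        · rw [Finset.sum_update_of_mem (Finset.mem_univ i)]; omega
        · by_cases hj : j = i
          · subst hj; simpa using h j
          · simp [hj, A.F_zero]
      rw [Finset.piecewise_insert]
      simpa using Submodule.add_mem _ ih h2
  simpa using key Finset.univ

/-- A multilinear operation commutes with infinite sums in its arguments; the resulting multiple sum
is regrouped by total order in t. -/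
theorem act_eval {n : ℕ} (F : CGra k (Fin n)) {x : Fin n → ℕ → W} {y : Fin n → W}
    (h : ∀ i, SumsTo A.F (x i) (y i)) : SumsTo A.F (A.path.act n F x) (A.act n F y) := by
  classical
  have h1 : SumsTo A.F (fun c : Fin n → ℕ => A.act n F fun i => x i (c i)) (A.act n F y) := by
    intro N
    choose t ht ht' using fun i => h i N
    refine ⟨Fintype.piFinset t, fun c hc => ?_, ?_⟩
    · rw [Fintype.mem_piFinset, not_forall] at hc
      obtain ⟨i, hi⟩ := hc
      refine A.F_anti ?_ (A.act_F n F (Function.update (fun _ => 0) i N) _ fun j => ?_)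
      · rw [Finset.sum_update_of_mem (Finset.mem_univ i)]; omega
      · by_cases hj : j = i
        · subst hj; simpa using ht j _ hi
        · simp [hj, A.F_zero]
    · rw [← MultilinearMap.map_sum_finset]
      exact act_sub_mem F ht'
  exact (h1.fiber (fun c => ∑ i, c i) (fun m => Finset.piAntidiag Finset.univ m)
    fun c m => mem_piAntidiag_univ).congr fun m => (path_act F x m).symm

theorem act_mem_F_sum {n N : ℕ} (f : convCGra k) (j : ℕ) {x : Fin n → W} {c : Fin n → ℕ}
    (hx : ∀ i, x i ∈ A.F (c i)) (hc : ∀ i, 1 ≤ c i) (hN : N ≤ ∑ i, c i) (j' : ℕ) :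
    (A.h ^ j') (A.act n (comp f n j) x) ∈ A.F (N + j') := by
  have h : ∀ i, c i - 1 + 1 = c i := fun i => Nat.sub_add_cancel (hc i)
  refine A.act_mem_F f j (c := fun i => c i - 1) (fun i => by rw [h]; exact hx i) ?_ j'
  have h1 : ∑ i, (c i - 1 + 1) = ∑ i, c i := Finset.sum_congr rfl fun i _ => h i
  rw [Finset.sum_add_distrib] at h1
  simp at h1
  omega

theorem path_genTerm_mem {p : ℕ} {X : ∀ b, Fin (b + p) → ℕ → W}
    (hX : ∀ b i m, X b i m ∈ A.F (max 1 m)) (i : ℕ × ℕ) (m : ℕ) :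
    A.path.genTerm p f X i m ∈ A.F (max (i.1 + p) m + i.2) := by
  rw [path_genTerm, path_act, map_sum]
  refine Submodule.smul_mem _ _ (Submodule.sum_mem _ fun c hc => ?_)
  rw [mem_piAntidiag_univ] at hc
  refine act_mem_F_sum f _ (fun j => hX _ j _) (fun j => le_max_left _ _) ?_ _
  refine max_le ?_ (hc ▸ Finset.sum_le_sum fun j _ => le_max_right _ _)
  calc i.1 + p = ∑ j : Fin (i.1 + p), 1 := by simp
    _ ≤ _ := Finset.sum_le_sum fun j _ => le_max_left _ _

/-- The part of order m of the term with b + p arguments and ħ^j has weight at least max (b + p) m +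
j, so the double family tends to zero. Summing first over terms or first over orders computes the
value at t = 1 in two ways. -/
theorem gen_eval {p : ℕ} {X : ∀ b, Fin (b + p) → ℕ → W} {Y : ∀ b, Fin (b + p) → W}
    (hX : ∀ b i m, X b i m ∈ A.F (max 1 m)) (hY : ∀ b i, SumsTo A.F (X b i) (Y b i)) :
    SumsTo A.F (A.path.gen p f X) (A.gen p f Y) := by
  have hX1 : ∀ b i, X b i ∈ A.path.F 1 := fun b i =>
    mem_path_F_one.2 fun m => A.F_anti (le_max_left 1 m) (hX b i m)
  have hY1 : ∀ b i, Y b i ∈ A.F 1 := fun b i => (hY b i).mem fun m => A.F_anti (le_max_left 1 m) (hX b i m)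
  have hn : Null A.F fun c : (ℕ × ℕ) × ℕ => A.path.genTerm p f X c.1 c.2 := by
    refine null_of_weight A.F_anti (fun c => max (c.1.1 + p) c.2 + c.1.2)
      (fun c => path_genTerm_mem hX c.1 c.2) fun N => ?_
    refine ((Finset.range N ×ˢ Finset.range N) ×ˢ Finset.range N).finite_toSet.subset fun c hc => ?_
    have : max (c.1.1 + p) c.2 + c.1.2 < N := hc
    simp; omega
  obtain ⟨s, hs⟩ := A.exists_sumsTo hn
  have h1 := hs.prod_swap fun m => sumsTo_path_gen (A := A) (f := f) hX1 m
  have h2 : SumsTo A.F (A.genTerm p f Y) s := by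
    refine hs.prod fun i => ?_
    have h3 := (act_eval (comp f (i.1 + p) i.2) (hY i.1)).map (F' := A.F)
      ((1 / (i.1.factorial : k)) • (A.h ^ i.2)) fun N => ⟨N, fun v hv =>
        Submodule.smul_mem _ _ (A.hpow_F' _ _ hv)⟩
    exact h3.congr fun m => (path_genTerm p X i m).symm
  rwa [(A.sumsTo_gen p f hY1).unique A.hausdorff h2]

theorem path_gen_decay {p : ℕ} {X : ∀ b, Fin (b + p) → ℕ → W}
    (hX : ∀ b i m, X b i m ∈ A.F (max 1 m)) (m : ℕ) : A.path.gen p f X m ∈ A.F (max 1 m) := by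
  have hX1 : ∀ b i, X b i ∈ A.path.F 1 := fun b i =>
    mem_path_F_one.2 fun m => A.F_anti (le_max_left 1 m) (hX b i m)
  refine (sumsTo_path_gen (A := A) (f := f) hX1 m).mem fun i => ?_
  rcases Nat.eq_zero_or_pos (i.1 + p) with h | h
  · have : ∀ n, n = 0 → A.path.act n (comp f n i.2) = 0 := by
      rintro _ rfl
      rw [comp_zero, map_zero]
    rw [path_genTerm, this _ h]
    simp
  · exact A.F_anti (by omega) (path_genTerm_mem hX i m)

/-- Paths whose coefficients tend to zero. -/
def Decay (A : ParamAlgebra k W) (a : ℕ → W) : Prop := ∀ m, a m ∈ A.F (max 1 m)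

theorem Decay.mem {a : ℕ → W} (ha : Decay A a) : a ∈ A.path.F 1 :=
  mem_path_F_one.2 fun m => A.F_anti (le_max_left 1 m) (ha m)

theorem consX_decay {p : ℕ} {x : ℕ → W} (hx : Decay A x) {X : ∀ b, Fin (b + p) → ℕ → W}
    (hX : ∀ b i m, X b i m ∈ A.F (max 1 m)) (b : ℕ) (i : Fin (b + (p + 1))) (m : ℕ) :
    consX x X b i m ∈ A.F (max 1 m) :=
  Fin.cases (motive := fun i => (consX x X b : Fin (b + p + 1) → ℕ → W) i m ∈ A.F (max 1 m)) (hx m)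
    (fun i => hX b i m) i

theorem Decay.ev {a : ℕ → W} (ha : Decay A a) : Decay A (A.path.ev f a) :=
  path_gen_decay fun _ _ => ha

/-- Weight m + 1 in order m, stronger than `Decay`, is what `gauge_of_path` demands of the generator
of a gauge flow. -/
theorem dev_strong {a x : ℕ → W} (ha : Decay A a) (hx : ∀ m, x m ∈ A.F (m + 1)) (m : ℕ) :
    A.path.dev f a x m ∈ A.F (m + 1) := by
  have hx' : Decay A x := fun m => A.F_anti (by omega) (hx m)
  refine (sumsTo_path_gen (A := A) (f := f) (consX_mem hx'.mem fun _ _ => ha.mem) m).mem fun i => ?_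
  rw [path_genTerm, path_act, map_sum]
  refine Submodule.smul_mem _ _ (Submodule.sum_mem _ fun c hc => ?_)
  rw [mem_piAntidiag_univ] at hc
  change Fin (i.1 + 1) → ℕ at c
  change ∑ j : Fin (i.1 + 1), c j = m at hc
  refine A.F_anti (Nat.le_add_right (m + 1) i.2) (act_mem_F_sum f _ (n := i.1 + 1)
    (c := Fin.cons (c 0 + 1) fun j => max 1 (c j.succ)) (fun j => ?_) (fun j => ?_) ?_ _)
  · exact Fin.cases (motive := fun j : Fin (i.1 + 1) => (Fin.cons x fun _ => a : Fin (i.1 + 1) → ℕ → W)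
      j (c j) ∈ A.F ((Fin.cons (c 0 + 1) fun j => max 1 (c j.succ) : Fin (i.1 + 1) → ℕ) j))
      (hx _) (fun j => ha _) j
  · exact Fin.cases (motive := fun j : Fin (i.1 + 1) =>
      1 ≤ (Fin.cons (c 0 + 1) fun j => max 1 (c j.succ) : Fin (i.1 + 1) → ℕ) j)
      (Nat.le_add_left _ _) (fun j => le_max_left _ _) j
  · rw [Fin.sum_univ_succ] at hc ⊢
    have := Finset.sum_le_sum fun (j : Fin i.1) (_ : j ∈ Finset.univ) => le_max_right 1 (c j.succ)
    simp only [Fin.cons_zero, Fin.cons_succ]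
    omega

theorem ev_eval {a : ℕ → W} (ha : Decay A a) {s : W} (hs : SumsTo A.F a s) :
    SumsTo A.F (A.path.ev f a) (A.ev f s) := gen_eval (fun _ _ => ha) fun _ _ => hs

theorem dev_eval {a x : ℕ → W} (ha : Decay A a) (hx : Decay A x) {s y : W} (hs : SumsTo A.F a s)
    (hy : SumsTo A.F x y) : SumsTo A.F (A.path.dev f a x) (A.dev f s y) :=
  gen_eval (consX_decay hx fun _ _ => ha) fun b i =>
    Fin.cases (motive := fun i : Fin (b + 0 + 1) => SumsTo A.F
      ((consX x (fun _ _ => a) b : Fin (b + 0 + 1) → ℕ → W) i)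
      ((consX y (fun _ _ => s) b : Fin (b + 0 + 1) → W) i)) hy (fun _ => hs) i

end Path

/-! ### Exponentials -/

section Exponential

variable {k : Type u} [Field k] {W : Type v} [AddCommGroup W] [Module k W]
variable {A : ParamAlgebra k W} {f : convCGra k} {α v w ξ : W}

theorem gen_smul {p : ℕ} {X : ∀ b, Fin (b + p) → W} (hX : ∀ b i, X b i ∈ A.F 1) (c : k) :
    A.gen p (c • f) X = c • A.gen p f X := by
  refine (A.sumsTo_gen p (c • f) hX).unique A.hausdorff (((A.sumsTo_gen p f hX).map (F' := A.F)
    (c • LinearMap.id) fun N => ⟨N, fun v hv => Submodule.smul_mem _ _ hv⟩).congr fun i => ?_)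
  have : comp (c • f) (i.1 + p) i.2 = c • comp f (i.1 + p) i.2 := rfl
  change c • A.genTerm p f X i = _
  simp only [genTerm]
  rw [this, map_smul, smul_apply, map_smul, smul_comm]

theorem gen_add {f' : convCGra k} {p : ℕ} {X : ∀ b, Fin (b + p) → W} (hX : ∀ b i, X b i ∈ A.F 1) :
    A.gen p (f + f') X = A.gen p f X + A.gen p f' X := by
  refine (A.sumsTo_gen p (f + f') hX).unique A.hausdorff
    (((A.sumsTo_gen p f hX).add (A.sumsTo_gen p f' hX)).congr fun i => ?_)
  have : comp (f + f') (i.1 + p) i.2 = comp f (i.1 + p) i.2 + comp f' (i.1 + p) i.2 := rfl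
  simp only [genTerm]
  rw [this, map_add, add_apply, map_add, smul_add]

theorem gen_mem_of_weight {p m : ℕ} {X : ∀ b, Fin (b + p) → W} (hX : ∀ b i, X b i ∈ A.F 1)
    (hf : (f : Conv k) ∈ weightFil m) : A.gen p f X ∈ A.F (m + 1) := by
  refine A.gen_mem_F hX fun i => ?_
  by_cases h : i.1 + p + i.2 < m + 1
  · have : comp f (i.1 + p) i.2 = 0 := Subtype.ext (hf _ _ h)
    rw [genTerm, this]; simp
  · exact A.F_anti (by omega) (A.genTerm_mem p f hX i)

/-- The unit `𝟙`. -/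
noncomputable def oneC (k : Type u) [Field k] : convCGra k := ⟨convOne, convOne_mem⟩

theorem comp_oneC : comp (oneC k) 1 0 = CGra.unit k := by
  refine Subtype.ext ?_
  change convOne 1 0 = graph k []
  simp [convOne, graph]

theorem comp_oneC_eq_zero {n j : ℕ} (h : ¬(n = 1 ∧ j = 0)) : comp (oneC k) n j = 0 :=
  Subtype.ext (if_neg h)

theorem ev_one (hα : α ∈ A.F 1) : A.ev (oneC k) α = α := by
  refine (A.sumsTo_gen 0 _ (X := fun _ _ => α) fun _ _ => hα).unique A.hausdorff ?_
  have h := sumsTo_single (F := A.F) (x := A.genTerm 0 (oneC k) fun _ _ => α) (1, 0) fun i hi => by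
    rw [genTerm, comp_oneC_eq_zero]
    · simp
    · rintro ⟨h1, h2⟩
      exact hi (Prod.ext h1 h2)
  have h1 : A.genTerm 0 (oneC k) (fun _ _ => α) (1, 0) = α := by
    change (1 / (Nat.factorial 1 : k)) • (A.h ^ 0) (A.act 1 (comp (oneC k) 1 0) fun _ => α) = α
    rw [comp_oneC, A.act_unit]
    simp
  rwa [h1] at h

theorem dev_one (hα : α ∈ A.F 1) (hξ : ξ ∈ A.F 1) : A.dev (oneC k) α ξ = ξ := by
  refine (A.sumsTo_gen 1 _ (consX_mem hξ fun _ _ => hα)).unique A.hausdorff ?_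
  have h := sumsTo_single (F := A.F) (x := A.genTerm 1 (oneC k) (consX ξ fun _ _ => α)) (0, 0)
    fun i hi => by
      rw [genTerm, comp_oneC_eq_zero]
      · simp
      · rintro ⟨h1, h2⟩
        exact hi (Prod.ext (by simpa using h1) h2)
  have h1 : A.genTerm 1 (oneC k) (consX ξ fun _ _ => α) (0, 0) = ξ := by
    change (1 / (Nat.factorial 0 : k)) • (A.h ^ 0) (A.act 1 (comp (oneC k) 1 0) _) = ξ
    rw [comp_oneC, A.act_unit]
    simp [consX]
  rwa [h1] at h

theorem oneC_pl (f : convCGra k) : pl (oneC k) f = f := Subtype.ext (convOne_preLie f.2)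

variable (A) in
theorem act_stick_sign {p s : ZMod 2} {n : ℕ} {x : Fin (n + 2) → W} {e : Fin (n + 2) → ZMod 2}
    (hx : ∀ i, x i ∈ A.deg (e i)) (h0 : e 0 = p) (h1 : e 1 = s) (he : ∀ i : Fin n, e i.succ.succ = 0)
    (j : ℕ) : A.act (n + 2) (comp f (n + 2) j) x = ((-1 : ℤˣ) ^ (p * s)) •
      A.act (n + 2) (comp f (n + 2) j) fun i => x (Equiv.swap 0 1 i) := by
  have h := A.act_perm (n + 2) (comp f (n + 2) j) (Equiv.swap 0 1) e x hx
  rw [perm_comp] at h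
  rw [h]
  congr 1
  rw [koszulSign, Finset.prod_eq_single 0, Finset.prod_eq_single 1]
  · simp [h0, h1, mul_comm]
  · intro b _ hb
    rw [if_neg]
    rintro ⟨h2, h3⟩
    rw [Equiv.swap_apply_left] at h3
    have hb0 : b ≠ 0 := h2.ne'
    rw [Equiv.swap_apply_of_ne_of_ne hb0 hb, Fin.lt_def] at h3
    have : (b : ℕ) ≠ 0 := fun h => hb0 (Fin.ext h)
    simp at h3
    omega
  · simp
  · intro a _ ha
    refine Finset.prod_eq_one fun b _ => ?_
    split_ifs with hab
    · have hb0 : b ≠ 0 := fun h => by rw [h] at hab; exact Fin.not_lt_zero _ hab.1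
      by_cases hb : b = 1
      · have hab1 := hab.1
        rw [hb, Fin.lt_def] at hab1
        exact (ha (Fin.ext (by simpa using hab1))).elim
      · obtain ⟨b', hb'⟩ := Fin.exists_succ_eq.2 hb0
        have hb'' : b' ≠ 0 := by rintro rfl; exact hb hb'.symm
        obtain ⟨c, hc⟩ : ∃ c : Fin n, c.succ.succ = b := by
          rcases n with _ | n
          · exact (hb'' (Fin.ext (by omega))).elim
          · obtain ⟨c, hc⟩ := Fin.exists_succ_eq.2 hb''
            exact ⟨c, by rw [hc, hb']⟩
        rw [Equiv.swap_apply_of_ne_of_ne hb0 hb, ← hc, he, mul_zero, uzpow_zero]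
    · rfl
  · simp

theorem ddev_swap {p s : ZMod 2} (hα : α ∈ A.F 1) (hα0 : α ∈ A.deg 0) (hv : v ∈ A.F 1)
    (hvp : v ∈ A.deg p) (hw : w ∈ A.F 1) (hws : w ∈ A.deg s) :
    A.ddev f α v w = ((-1 : ℤˣ) ^ (p * s)) • A.ddev f α w v := by
  have hc : ∀ b (i : Fin (b + 0)), (fun _ => α : Fin (b + 0) → W) i ∈ A.F 1 := fun _ _ => hα
  refine (A.sumsTo_gen 2 f (consX_mem hv (consX_mem hw hc))).unique A.hausdorff
    ((SumsTo.units_smul (A.sumsTo_gen 2 f (consX_mem hw (consX_mem hv hc))) _).congr fun i => ?_)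
  obtain ⟨b, j⟩ := i
  have h := A.act_stick_sign (f := f) (p := p) (s := s) (n := b)
    (x := Fin.cons v (Fin.cons w fun _ => α)) (e := Fin.cons p (Fin.cons s fun _ => 0))
    (cons_deg hvp (cons_deg hws fun _ => hα0)) rfl rfl (fun i => rfl) j
  have h1 : (fun i => (Fin.cons v (Fin.cons w fun _ => α) : Fin (b + 2) → W) (Equiv.swap 0 1 i)) =
      Fin.cons w (Fin.cons v fun _ => α) := by
    funext i
    refine Fin.cases ?_ (fun i => ?_) i
    · rw [Equiv.swap_apply_left]; rfl
    · refine Fin.cases ?_ (fun i => ?_) i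
      · rw [show (0 : Fin (b + 1)).succ = (1 : Fin (b + 2)) from rfl, Equiv.swap_apply_right]; rfl
      · rw [Equiv.swap_apply_of_ne_of_ne (a := 0) (b := 1) (Fin.succ_ne_zero _)
          (show i.succ.succ ≠ (0 : Fin (b + 1)).succ from fun h =>
            Fin.succ_ne_zero i (Fin.succ_injective _ h))]
        rfl
  rw [h1] at h
  change _ = (1 / (b.factorial : k)) • (A.h ^ j) (A.act (b + 2) (comp f (b + 2) j)
    (Fin.cons v (Fin.cons w fun _ => α)))
  rw [h, units_smul_comm', units_smul_smul]
  rfl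

variable [CharZero k] {μ : convCGra k}

/-- The terms of `exp(R_μ)(f)`. -/
noncomputable def expC (μ f : convCGra k) (m : ℕ) : convCGra k :=
  (1 / (m.factorial : k)) • (fun f => pl f μ)^[m] f

theorem iter_parity (hμ : (μ : Conv k) ∈ convParity k 0) {q : ZMod 2}
    (hf : (f : Conv k) ∈ convParity k q) (m : ℕ) :
    (((fun f => pl f μ)^[m] f : convCGra k) : Conv k) ∈ convParity k q := by
  induction m with
  | zero => exact hf
  | succ m ih =>
    rw [Function.iterate_succ_apply']
    have h := preLie_parity ih hμ
    rwa [add_zero] at h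

/-- The coefficient form of d/dt exp(t R_μ) f = exp(t R_μ)(f ⋆ μ). -/
theorem expC_succ (μ f : convCGra k) (m : ℕ) :
    ((m + 1 : ℕ) : k) • expC μ f (m + 1) = expC μ (pl f μ) m := by
  rw [expC, expC, smul_smul, Function.iterate_succ_apply]
  congr 1
  have h1 : ((m + 1 : ℕ) : k) ≠ 0 := Nat.cast_ne_zero.2 m.succ_ne_zero
  have h2 : (m.factorial : k) ≠ 0 := Nat.cast_ne_zero.2 m.factorial_ne_zero
  rw [Nat.factorial_succ]
  push_cast at h1 ⊢
  field_simp

theorem expC_zero (μ f : convCGra k) : expC μ f 0 = f := by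
  rw [expC]; simp

/-- The path `t ↦ e^{tμ} α`. -/
noncomputable def evPath (A : ParamAlgebra k W) (μ f : convCGra k) (α : W) : ℕ → W :=
  fun m => A.ev (expC μ f m) α

/-- The derivative of `evPath` in the direction of `ξ`. -/
noncomputable def devPath (A : ParamAlgebra k W) (μ f : convCGra k) (α ξ : W) : ℕ → W :=
  fun m => A.dev (expC μ f m) α ξ

theorem evPath_mem (hα : α ∈ A.F 1) : A.evPath μ f α ∈ A.path.F 1 :=
  mem_path_F_one.2 fun _ => ev_mem_F hα

theorem devPath_mem (hα : α ∈ A.F 1) (hξ : ξ ∈ A.F 1) : A.devPath μ f α ξ ∈ A.path.F 1 :=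
  mem_path_F_one.2 fun _ => dev_mem_F hα hξ

theorem evPath_deg (hμ : (μ : Conv k) ∈ convParity k 0) {q : ZMod 2}
    (hf : (f : Conv k) ∈ convParity k q) (hα : α ∈ A.F 1) (hα0 : α ∈ A.deg 0) :
    A.evPath μ f α ∈ A.path.deg q := fun m =>
  ev_deg (Submodule.smul_mem _ _ (iter_parity hμ hf m)) hα hα0

theorem devPath_deg (hμ : (μ : Conv k) ∈ convParity k 0) {q r : ZMod 2}
    (hf : (f : Conv k) ∈ convParity k q) (hα : α ∈ A.F 1) (hα0 : α ∈ A.deg 0) (hξ : ξ ∈ A.F 1)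
    (hξr : ξ ∈ A.deg r) : A.devPath μ f α ξ ∈ A.path.deg (q + r) := fun m =>
  dev_deg (Submodule.smul_mem _ _ (iter_parity hμ hf m)) hα hα0 hξ hξr

theorem evPath_succ (hα : α ∈ A.F 1) (m : ℕ) :
    ((m + 1 : ℕ) : k) • A.evPath μ f α (m + 1) = A.evPath μ (pl f μ) α m := by
  rw [evPath, evPath, ← expC_succ, ev, ev, gen_smul fun _ _ => hα]

theorem devPath_succ (hα : α ∈ A.F 1) (hξ : ξ ∈ A.F 1) (m : ℕ) :
    ((m + 1 : ℕ) : k) • A.devPath μ f α ξ (m + 1) = A.devPath μ (pl f μ) α ξ m := by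
  rw [devPath, devPath, ← expC_succ, dev, dev, gen_smul (consX_mem hξ fun _ _ => hα)]

theorem convParity_one : ((oneC k : convCGra k) : Conv k) ∈ convParity k 0 := convOne_parity

/-- f(e^{tμ}α) = (exp(t R_μ) f)(α). The path e^{tμ}α has velocity μ(e^{tμ}α), so the left side has
derivative (f ⋆ μ)(e^{tμ}α) by `ev_pl`. The right side obeys the same rule, so the induction on
orders replaces f by f ⋆ μ and must treat all f simultaneously. -/
theorem ev_evPath (hμ : (μ : Conv k) ∈ convParity k 0) (hα : α ∈ A.F 1) (hα0 : α ∈ A.deg 0)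
    {q : ZMod 2} (hf : (f : Conv k) ∈ convParity k q) :
    A.path.ev f (A.evPath μ (oneC k) α) = A.evPath μ f α := by
  funext m
  induction m using Nat.strong_induction_on generalizing f q with
  | _ m ih =>
    have ha := evPath_mem (μ := μ) (f := oneC k) hα
    have ha0 := evPath_deg hμ convParity_one hα hα0
    cases m with
    | zero =>
      rw [path_ev_zero ha, evPath, evPath, expC_zero, expC_zero, ev_one hα]
    | succ m =>
      have h1 := congrFun ((isDer_euler A).ev hf ha ha0) (m + 1)
      rw [zero_mul, uzpow_zero, one_smul, euler_apply, dev,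
        path_gen_cons_shift (u := A.path.ev μ (A.evPath μ (oneC k) α)) (fun _ _ => ha)
          ((isDer_euler A).mem_F _ _ ha) (ev_mem_F ha) (by simp [euler_apply])] at h1
      · change _ = A.path.dev f _ _ m at h1
        rw [← ev_pl hμ ha ha0, ih m (Nat.lt_succ_self m) (q := q + 0) (preLie_parity hf hμ),
          ← evPath_succ hα] at h1
        exact smul_right_injective _ (Nat.cast_ne_zero.2 m.succ_ne_zero) h1
      · intro i hi
        rw [euler_apply, evPath_succ hα, ih i (by omega) hμ, oneC_pl]

/-- The first variation of `ev_evPath`. The two terms of the time derivative are those of the chain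
rule `dev_pl`, and merge into the derivative of f ⋆ μ. -/
theorem dev_devPath (hμ : (μ : Conv k) ∈ convParity k 0) (hα : α ∈ A.F 1) (hα0 : α ∈ A.deg 0)
    {q r : ZMod 2} (hf : (f : Conv k) ∈ convParity k q) (hξ : ξ ∈ A.F 1) (hξr : ξ ∈ A.deg r) :
    A.path.dev f (A.evPath μ (oneC k) α) (A.devPath μ (oneC k) α ξ) = A.devPath μ f α ξ := by
  funext m
  induction m using Nat.strong_induction_on generalizing f q with
  | _ m ih =>
    have ha := evPath_mem (μ := μ) (f := oneC k) hα
    have ha0 := evPath_deg hμ convParity_one hα hα0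
    have hx := devPath_mem (μ := μ) (f := oneC k) hα hξ
    have hxr := devPath_deg hμ convParity_one hα hα0 hξ hξr
    rw [zero_add] at hxr
    cases m with
    | zero =>
      rw [path_dev_zero ha hx, evPath, devPath, devPath, expC_zero, expC_zero, ev_one hα,
        dev_one hα hξ]
    | succ m =>
      have hE := (isDer_euler A).mem_F _ _ ha
      have hE0 := (isDer_euler A).deg _ _ ha0
      have h1 := congrFun ((isDer_euler A).dev hf ha ha0 hx hxr) (m + 1)
      -- Puts the velocity of the path in the first place, where `path_gen_cons_shift` can divide by
      -- t.
      rw [ddev_swap ha ha0 hx hxr hE hE0] at h1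
      simp only [zero_mul, mul_zero, add_zero, uzpow_zero, one_smul] at h1
      rw [euler_apply, Pi.add_apply, dev, dev, ddev,
        path_gen_cons_shift (u := A.path.dev μ (A.evPath μ (oneC k) α) (A.devPath μ (oneC k) α ξ))
          (fun _ _ => ha) ((isDer_euler A).mem_F _ _ hx) (dev_mem_F ha hx) (by simp [euler_apply]),
        path_gen_cons_shift (u := A.path.ev μ (A.evPath μ (oneC k) α)) (consX_mem hx fun _ _ => ha)
          hE (ev_mem_F ha) (by simp [euler_apply])] at h1
      · have h2 := congrFun (dev_pl (f := f) hμ ha ha0 hx hxr) m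
        rw [Pi.add_apply, dev, dev, ddev] at h2
        rw [← h2] at h1
        change _ = A.path.dev (pl f μ) _ _ m at h1
        rw [ih m (Nat.lt_succ_self m) (q := q + 0) (preLie_parity hf hμ), ← devPath_succ hα hξ] at h1
        exact smul_right_injective _ (Nat.cast_ne_zero.2 m.succ_ne_zero) h1
      · intro i hi
        rw [euler_apply, evPath_succ hα, ev_evPath hμ hα hα0 hμ, oneC_pl]
      · intro i hi
        rw [euler_apply, devPath_succ hα hξ, ih i (by omega) hμ, oneC_pl]

end Exponential

end ParamAlgebra

end DeformationGroup
namespace DeformationGroup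

/-! ## The action on Maurer–Cartan elements -/

section Elements

variable {k : Type u} [Field k]

/-- The Maurer–Cartan element `θ`. -/
noncomputable def thetaC (k : Type u) [Field k] : convCGra k := ⟨theta k, theta_mem⟩

theorem comp_thetaC_stick : comp (thetaC k) 2 0 = CGra.stick k := rfl

theorem comp_thetaC_loop : comp (thetaC k) 1 1 = CGra.loop k := rfl

theorem comp_thetaC_eq_zero {n j : ℕ} (h : ¬(n = 2 ∧ j = 0)) (h' : ¬(n = 1 ∧ j = 1)) :
    comp (thetaC k) n j = 0 := by
  refine Subtype.ext ?_
  change theta k n j = 0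
  unfold theta
  split
  · exact (h ⟨rfl, rfl⟩).elim
  · exact (h' ⟨rfl, rfl⟩).elim
  · rfl

variable [CharZero k]

/-- `exp(R_x)(f)`, where `R_x` is the right pre-Lie multiplication by `x`. -/
noncomputable def cexp (x : evenCycles k) (f : convCGra k) : convCGra k :=
  ⟨convExp x f, convExp_mem x.2 f.2⟩

/-- An even cycle as an element of the deformation complex. -/
def cyc (x : evenCycles k) : convCGra k := ⟨x, (mem_evenCycles.1 x.2).1⟩

theorem cyc_parity (x : evenCycles k) : (cyc x : Conv k) ∈ convParity k 0 :=
  (mem_evenCycles.1 x.2).2.1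

theorem coe_expC (x : evenCycles k) (f : convCGra k) (m : ℕ) :
    (ParamAlgebra.expC (cyc x) f m : Conv k) = expSeries x f m := by
  have h : ∀ m, (((fun f => pl f (cyc x))^[m] f : convCGra k) : Conv k) = (preLie.flip (x : Conv k))^[m] f := by
    intro m
    induction m with
    | zero => rfl
    | succ m ih =>
      rw [Function.iterate_succ_apply', Function.iterate_succ_apply', ← ih]
      rfl
  rw [expSeries, ← h]
  rfl

theorem expC_weight (x : evenCycles k) (f : convCGra k) (m : ℕ) :
    (ParamAlgebra.expC (cyc x) f m : Conv k) ∈ weightFil m := by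
  rw [coe_expC]
  exact expSeries_weight x.2 f.2 m

theorem cexp_eq (x : evenCycles k) (f : convCGra k) :
    (cexp x f : Conv k) = convSum fun m => (ParamAlgebra.expC (cyc x) f m : Conv k) := by
  simp only [coe_expC]
  rfl

theorem cexp_parity (x : evenCycles k) {f : convCGra k} {q : ZMod 2} (hf : (f : Conv k) ∈ convParity k q) :
    (cexp x f : Conv k) ∈ convParity k q := convExp_parity x.2 hf

theorem cexp_bchMul (x y : evenCycles k) (f : convCGra k) :
    cexp (bchMul x y) f = cexp y (cexp x f) := Subtype.ext (convExp_bchMul x y f.2)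

theorem cexp_theta (x : evenCycles k) : cexp x (thetaC k) = pl (cexp x (ParamAlgebra.oneC k)) (thetaC k) :=
  Subtype.ext (convExp_theta x.2)

end Elements

/-! ### Time-one transforms by cycles and the Maurer–Cartan equation -/

namespace ParamAlgebra

variable {k : Type u} [Field k] [CharZero k] {W : Type v} [AddCommGroup W] [Module k W]
variable {A : ParamAlgebra k W} {f : convCGra k} {α v w ξ : W}

theorem evPath_strong (x : evenCycles k) (f : convCGra k) (hα : α ∈ A.F 1) (m : ℕ) :
    A.evPath (cyc x) f α m ∈ A.F (m + 1) :=
  gen_mem_of_weight (fun _ _ => hα) (expC_weight x f m)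

theorem evPath_decay (x : evenCycles k) (f : convCGra k) (hα : α ∈ A.F 1) :
    Decay A (A.evPath (cyc x) f α) := fun m => A.F_anti (by omega) (evPath_strong x f hα m)

theorem devPath_decay (x : evenCycles k) (f : convCGra k) (hα : α ∈ A.F 1) (hξ : ξ ∈ A.F 1) :
    Decay A (A.devPath (cyc x) f α ξ) := fun m => A.F_anti (show max 1 m ≤ m + 1 by omega) <|
  gen_mem_of_weight (consX_mem hξ fun _ _ => hα) (expC_weight x f m)

theorem sumsTo_evPath (x : evenCycles k) (f : convCGra k) (hα : α ∈ A.F 1) :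
    SumsTo A.F (A.evPath (cyc x) f α) (A.ev (cexp x f) α) :=
  gen_hasSum (fun _ _ => hα) (expC_weight x f) (cexp_eq x f)

theorem sumsTo_devPath (x : evenCycles k) (f : convCGra k) (hα : α ∈ A.F 1) (hξ : ξ ∈ A.F 1) :
    SumsTo A.F (A.devPath (cyc x) f α ξ) (A.dev (cexp x f) α ξ) :=
  gen_hasSum (consX_mem hξ fun _ _ => hα) (expC_weight x f) (cexp_eq x f)

/-- Evaluation at the transform of `α` by `e^x`. -/
theorem ev_cexp (x : evenCycles k) {q : ZMod 2} (hf : (f : Conv k) ∈ convParity k q)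
    (hα : α ∈ A.F 1) (hα0 : α ∈ A.deg 0) : A.ev f (A.ev (cexp x (oneC k)) α) = A.ev (cexp x f) α := by
  have h := ev_eval (f := f) (evPath_decay x (oneC k) hα) (sumsTo_evPath x (oneC k) hα)
  rw [ev_evPath (cyc_parity x) hα hα0 hf] at h
  exact h.unique A.hausdorff (sumsTo_evPath x f hα)

theorem dev_cexp (x : evenCycles k) {q r : ZMod 2} (hf : (f : Conv k) ∈ convParity k q)
    (hα : α ∈ A.F 1) (hα0 : α ∈ A.deg 0) (hξ : ξ ∈ A.F 1) (hξr : ξ ∈ A.deg r) :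
    A.dev f (A.ev (cexp x (oneC k)) α) (A.dev (cexp x (oneC k)) α ξ) = A.dev (cexp x f) α ξ := by
  have h := dev_eval (f := f) (evPath_decay x (oneC k) hα) (devPath_decay x (oneC k) hα hξ)
    (sumsTo_evPath x (oneC k) hα) (sumsTo_devPath x (oneC k) hα hξ)
  rw [dev_devPath (cyc_parity x) hα hα0 hf hξ hξr] at h
  exact h.unique A.hausdorff (sumsTo_devPath x f hα hξ)

/-- The transform of `α` by `e^x`. -/
noncomputable def trans (A : ParamAlgebra k W) (x : evenCycles k) (α : W) : W :=
  A.ev (cexp x (oneC k)) α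

theorem cexp_one_parity (x : evenCycles k) : (cexp x (oneC k) : Conv k) ∈ convParity k 0 :=
  cexp_parity x convParity_one

theorem trans_mem (x : evenCycles k) (hα : α ∈ A.F 1) : A.trans x α ∈ A.F 1 := ev_mem_F hα

theorem trans_deg (x : evenCycles k) (hα : α ∈ A.F 1) (hα0 : α ∈ A.deg 0) : A.trans x α ∈ A.deg 0 :=
  ev_deg (cexp_one_parity x) hα hα0

/-- R is an anti-representation, but f(e^y·α) = (exp(R_y) f)(α) reverses the order once more, so the
result is a left action. -/
theorem trans_bchMul (x y : evenCycles k) (hα : α ∈ A.F 1) (hα0 : α ∈ A.deg 0) :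
    A.trans (bchMul x y) α = A.trans x (A.trans y α) := by
  rw [trans, trans, trans, ev_cexp y (cexp_one_parity x) hα hα0, cexp_bchMul]

theorem trans_zero (hα : α ∈ A.F 1) : A.trans 0 α = α := by
  have h : cexp (0 : evenCycles k) (oneC k) = oneC k := by
    refine Subtype.ext (HasFSum.unique weightFil_hausdorff (hasFSum_convExp (0 : evenCycles k).2
      convOne_mem) ?_)
    intro N
    refine ⟨1, fun m hm => ?_⟩
    rw [Finset.sum_eq_single 0]
    · simp [expSeries, oneC]
    · intro b _ hb
      obtain ⟨b, rfl⟩ := Nat.exists_eq_succ_of_ne_zero hb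
      rw [expSeries, Function.iterate_succ_apply']
      simp
    · intro h; simp at h; omega
  rw [trans, h, ev_one hα]

/-- The curvature `d α + ħ Δ α + ½ {α, α}`. -/
noncomputable def curv (A : ParamAlgebra k W) (α : W) : W := A.d α + A.ev (thetaC k) α

theorem thetaC_parity : (thetaC k : Conv k) ∈ convParity k 1 := theta_parity

/-- By the Leibniz rule d(μ(α)) = Dμ(α)(dα), and by hypothesis θ(μ(α)) = Dμ(α)(θ(α)). For μ = e^x
the hypothesis is provided by `ev_cexp` and `cexp_theta`, that is, by x being a cycle. -/
theorem curv_ev {μ : convCGra k} (hμ : (μ : Conv k) ∈ convParity k 0)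
    (hθ : A.ev (thetaC k) (A.ev μ α) = A.ev (pl μ (thetaC k)) α) (hα : α ∈ A.F 1) (hα0 : α ∈ A.deg 0) :
    A.curv (A.ev μ α) = A.dev μ α (A.curv α) := by
  rw [curv, (isDer_d A).ev hμ hα hα0, hθ, ev_pl thetaC_parity hα hα0, mul_zero, uzpow_zero, one_smul,
    ← dev_add hα (A.d_F _ _ hα) (ev_mem_F hα), curv]

theorem curv_trans (x : evenCycles k) (hα : α ∈ A.F 1) (hα0 : α ∈ A.deg 0) (h : A.curv α = 0) :
    A.curv (A.trans x α) = 0 := by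
  rw [trans, curv_ev (cexp_one_parity x) ?_ hα hα0, h, dev_zero]
  rw [ev_cexp x thetaC_parity hα hα0, cexp_theta]

/-! ### The bracket -/

theorem vec_two (f : Fin 2 → W) : f = ![f 0, f 1] := by
  funext i; fin_cases i <;> rfl

theorem vec_one (f : Fin 1 → W) : f = ![f 0] := by
  funext i; fin_cases i; rfl

theorem update_vec_one (x x' : W) : Function.update ![x] 0 x' = ![x'] := by
  funext i; fin_cases i; rfl

theorem update_vec_zero (x x' y : W) : Function.update ![x, y] 0 x' = ![x', y] := by
  funext i; fin_cases i <;> rfl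

theorem update_vec_last (x y y' : W) : Function.update ![x, y] 1 y' = ![x, y'] := by
  funext i; fin_cases i <;> rfl

/-- The operator `ħ Δ`. -/
noncomputable def hDelta (A : ParamAlgebra k W) : W →ₗ[k] W :=
  A.h ∘ₗ LinearMap.mk ⟨A.Delta, fun x y => by
    have h := (A.act 1 (CGra.loop k)).map_update_add ![x] 0 x y
    simp only [update_vec_one] at h
    exact h⟩ fun a x => by
    have h := (A.act 1 (CGra.loop k)).map_update_smul ![x] 0 a x
    simp only [update_vec_one] at h
    exact h

theorem hDelta_apply (x : W) : A.hDelta x = A.h (A.Delta x) := rfl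

/-- The bracket, as a bilinear map. -/
noncomputable def br (A : ParamAlgebra k W) : W →ₗ[k] W →ₗ[k] W :=
  LinearMap.mk₂ k A.bracket
    (fun x x' y => by
      have h := (A.act 2 (CGra.stick k)).map_update_add ![x, y] 0 x x'
      simp only [update_vec_zero] at h
      exact h)
    (fun a x y => by
      have h := (A.act 2 (CGra.stick k)).map_update_smul ![x, y] 0 a x
      simp only [update_vec_zero] at h
      exact h)
    (fun x y y' => by
      have h := (A.act 2 (CGra.stick k)).map_update_add ![x, y] 1 y y'
      simp only [update_vec_last] at h
      exact h)
    (fun a x y => by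
      have h := (A.act 2 (CGra.stick k)).map_update_smul ![x, y] 1 a y
      simp only [update_vec_last] at h
      exact h)

theorem br_apply (x y : W) : A.br x y = A.bracket x y := rfl

theorem ev_theta (hα : α ∈ A.F 1) :
    A.ev (thetaC k) α = A.hDelta α + (1 / 2 : k) • A.br α α := by
  refine (A.sumsTo_gen 0 _ (X := fun _ _ => α) fun _ _ => hα).unique A.hausdorff ?_
  have h := sumsTo_finset (F := A.F) (x := A.genTerm 0 (thetaC k) fun _ _ => α) {(1, 1), (2, 0)}
    fun i hi => by
      rw [genTerm, comp_thetaC_eq_zero]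
      · simp
      · rintro ⟨h1, h2⟩
        exact hi (by simp [Prod.ext_iff]; omega)
      · rintro ⟨h1, h2⟩
        exact hi (by simp [Prod.ext_iff]; omega)
  rw [Finset.sum_pair (by simp)] at h
  have h1 : A.genTerm 0 (thetaC k) (fun _ _ => α) (1, 1) = A.hDelta α := by
    change (1 / (Nat.factorial 1 : k)) • (A.h ^ 1) (A.act 1 (comp (thetaC k) 1 1) fun _ => α) = _
    rw [comp_thetaC_loop, vec_one fun _ => α]
    simp [hDelta_apply, Delta]
  have h2 : A.genTerm 0 (thetaC k) (fun _ _ => α) (2, 0) = (1 / 2 : k) • A.br α α := by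
    change (1 / (Nat.factorial 2 : k)) • (A.h ^ 0) (A.act 2 (comp (thetaC k) 2 0) fun _ => α) = _
    rw [comp_thetaC_stick, vec_two fun _ => α]
    simp [br_apply, bracket]
  rwa [h1, h2] at h

theorem dev_theta (hα : α ∈ A.F 1) (hξ : ξ ∈ A.F 1) :
    A.dev (thetaC k) α ξ = A.hDelta ξ + A.br ξ α := by
  refine (A.sumsTo_gen 1 _ (consX_mem hξ fun _ _ => hα)).unique A.hausdorff ?_
  have h := sumsTo_finset (F := A.F) (x := A.genTerm 1 (thetaC k) (consX ξ fun _ _ => α))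
    {(0, 1), (1, 0)} fun i hi => by
      rw [genTerm, comp_thetaC_eq_zero]
      · simp
      · rintro ⟨h1, h2⟩
        exact hi (by simp [Prod.ext_iff]; omega)
      · rintro ⟨h1, h2⟩
        exact hi (by simp [Prod.ext_iff]; omega)
  rw [Finset.sum_pair (by simp)] at h
  have h1 : A.genTerm 1 (thetaC k) (consX ξ fun _ _ => α) (0, 1) = A.hDelta ξ := by
    change (1 / (Nat.factorial 0 : k)) • (A.h ^ 1) (A.act 1 (comp (thetaC k) 1 1) (Fin.cons ξ _)) = _
    rw [comp_thetaC_loop, vec_one (Fin.cons ξ _)]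
    simp [hDelta_apply, Delta]
  have h2 : A.genTerm 1 (thetaC k) (consX ξ fun _ _ => α) (1, 0) = A.br ξ α := by
    change (1 / (Nat.factorial 1 : k)) • (A.h ^ 0) (A.act 2 (comp (thetaC k) 2 0)
      (Fin.cons ξ fun _ => α)) = _
    rw [comp_thetaC_stick, vec_two (Fin.cons ξ fun _ => α)]
    simp only [Nat.factorial_one, Nat.cast_one, div_one, one_smul, pow_zero, Module.End.one_apply]
    rfl
  rwa [h1, h2] at h

end ParamAlgebra

/-! ### Identities between graphs with few vertices -/

section Graphs

variable {k : Type u} [Field k]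

theorem reconnect_single {V W : Type} [DecidableEq V] [Fintype W] (π : W → V) (x y : V) :
    reconnect π (graph k [s(x, y)]) = ∑ x' with π x' = x, ∑ y' with π y' = y, edge k s(x', y') := by
  simp [graph, reconnect, edge, ExteriorAlgebra.map_apply_ι, reconnectEdge]

theorem edge_mul_swap {V : Type} (e e' : Sym2 V) : edge k e * edge k e' = -(edge k e' * edge k e) := by
  rw [eq_neg_iff_add_eq_zero]
  exact ExteriorAlgebra.ι_add_mul_swap _ _

theorem edge_mul_self {V : Type} (e : Sym2 V) : edge k e * edge k e = 0 :=
  ExteriorAlgebra.ι_sq_zero _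

theorem relabel_single {V V' : Type} (f : V → V') (x y : V) :
    relabel f (graph k [s(x, y)]) = edge k s(f x, f y) := by
  rw [relabel_graph]; simp [graph]

theorem graph_single {V : Type} (e : Sym2 V) : graph k [e] = edge k e := by simp [graph]

theorem comp_stick_stick_right : (CGra.comp 1 2 0 (CGra.stick k) (CGra.stick k) : Gra k (Fin 3)) =
    (edge k s(0, 1) + edge k s(0, 2)) * edge k s(1, 2) := by
  change reconnect (collapse 1 2 0) (graph k [s(0, 1)]) * relabel (block 1 2 0) (graph k [s(0, 1)]) = _
  rw [reconnect_single, relabel_single,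
    show (Finset.univ.filter fun x => collapse 1 2 0 x = 0) = {0} by decide,
    show (Finset.univ.filter fun x => collapse 1 2 0 x = 1) = {1, 2} by decide]
  rw [Finset.sum_singleton, Finset.sum_pair (by decide)]
  rfl

theorem comp_stick_stick_left : (CGra.comp 0 2 1 (CGra.stick k) (CGra.stick k) : Gra k (Fin 3)) =
    (edge k s(0, 2) + edge k s(1, 2)) * edge k s(0, 1) := by
  change reconnect (collapse 0 2 1) (graph k [s(0, 1)]) * relabel (block 0 2 1) (graph k [s(0, 1)]) = _
  rw [reconnect_single, relabel_single,
    show (Finset.univ.filter fun x => collapse 0 2 1 x = 0) = {0, 1} by decide,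
    show (Finset.univ.filter fun x => collapse 0 2 1 x = 1) = {2} by decide]
  rw [Finset.sum_pair (by decide), Finset.sum_singleton, Finset.sum_singleton]
  rfl

/-- Reconnecting the two ends of the loop gives each of the two loops once and the edge twice; the
latter is killed by multiplication with the same edge. -/
theorem comp_loop_stick : (CGra.comp 0 2 0 (CGra.loop k) (CGra.stick k) : Gra k (Fin 2)) =
    (edge k s(0, 0) + edge k s(1, 1)) * edge k s(0, 1) := by
  change reconnect (collapse 0 2 0) (graph k [s(0, 0)]) * relabel (block 0 2 0) (graph k [s(0, 1)]) = _
  rw [reconnect_single, relabel_single,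
    show (Finset.univ.filter fun x => collapse 0 2 0 x = 0) = {0, 1} by decide]
  rw [Finset.sum_pair (by decide), Finset.sum_pair (by decide), Finset.sum_pair (by decide)]
  have h : s((1 : Fin 2), 0) = s(0, 1) := Sym2.eq_swap
  change (edge k s((0 : Fin 2), 0) + edge k s((0 : Fin 2), 1) + (edge k s((1 : Fin 2), 0) +
    edge k s((1 : Fin 2), 1))) * edge k s((0 : Fin 2), 1) = _
  rw [h]
  simp only [add_mul, edge_mul_self, add_zero, zero_add]

theorem comp_stick_loop_left : (CGra.comp 0 1 1 (CGra.stick k) (CGra.loop k) : Gra k (Fin 2)) =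
    edge k s(0, 1) * edge k s(0, 0) := by
  change reconnect (collapse 0 1 1) (graph k [s(0, 1)]) * relabel (block 0 1 1) (graph k [s(0, 0)]) = _
  rw [reconnect_single, relabel_single,
    show (Finset.univ.filter fun x => collapse 0 1 1 x = 0) = {0} by decide,
    show (Finset.univ.filter fun x => collapse 0 1 1 x = 1) = {1} by decide]
  rw [Finset.sum_singleton, Finset.sum_singleton]
  rfl

theorem comp_stick_loop_right : (CGra.comp 1 1 0 (CGra.stick k) (CGra.loop k) : Gra k (Fin 2)) =
    edge k s(0, 1) * edge k s(1, 1) := by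
  change reconnect (collapse 1 1 0) (graph k [s(0, 1)]) * relabel (block 1 1 0) (graph k [s(0, 0)]) = _
  rw [reconnect_single, relabel_single,
    show (Finset.univ.filter fun x => collapse 1 1 0 x = 0) = {0} by decide,
    show (Finset.univ.filter fun x => collapse 1 1 0 x = 1) = {1} by decide]
  rw [Finset.sum_singleton, Finset.sum_singleton]
  rfl

/-- The source of the derivation property of Δ with respect to the bracket. -/
theorem comp_loop_stick_add : (CGra.comp 0 2 0 (CGra.loop k) (CGra.stick k) : CGra k (Fin 2)) =
    -((CGra.comp 0 1 1 (CGra.stick k) (CGra.loop k) : CGra k (Fin 2)) +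
      (CGra.comp 1 1 0 (CGra.stick k) (CGra.loop k) : CGra k (Fin 2))) := by
  refine Subtype.ext ?_
  change (CGra.comp 0 2 0 (CGra.loop k) (CGra.stick k) : Gra k (Fin 2)) =
    -((CGra.comp 0 1 1 (CGra.stick k) (CGra.loop k) : Gra k (Fin 2)) +
      (CGra.comp 1 1 0 (CGra.stick k) (CGra.loop k) : Gra k (Fin 2)))
  rw [comp_loop_stick, comp_stick_loop_left, comp_stick_loop_right, add_mul,
    edge_mul_swap s((0 : Fin 2), 0), edge_mul_swap s((1 : Fin 2), 1), neg_add]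

theorem perm_stick : CGra.perm (Equiv.swap 0 1) (CGra.stick k) = CGra.stick k := by
  refine Subtype.ext ?_
  change relabel _ (graph k [s(0, 1)]) = graph k [s(0, 1)]
  rw [relabel_single, graph_single, Equiv.swap_apply_left, Equiv.swap_apply_right, Sym2.eq_swap]

theorem jacobi_graph : (CGra.comp 0 2 1 (CGra.stick k) (CGra.stick k) : CGra k (Fin 3)) =
    -((CGra.comp 1 2 0 (CGra.stick k) (CGra.stick k) : CGra k (Fin 3)) +
      CGra.perm (Equiv.swap 0 1) (CGra.comp 1 2 0 (CGra.stick k) (CGra.stick k) : CGra k (Fin 3))) := by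
  refine Subtype.ext ?_
  change (CGra.comp 0 2 1 (CGra.stick k) (CGra.stick k) : Gra k (Fin 3)) =
    -((CGra.comp 1 2 0 (CGra.stick k) (CGra.stick k) : Gra k (Fin 3)) +
      relabel (Equiv.swap (0 : Fin 3) 1)
        (CGra.comp 1 2 0 (CGra.stick k) (CGra.stick k) : Gra k (Fin 3)))
  rw [comp_stick_stick_left, comp_stick_stick_right]
  have h : ∀ x y : Fin 3, relabel (Equiv.swap (0 : Fin 3) 1) (edge k s(x, y)) =
      edge k s(Equiv.swap (0 : Fin 3) 1 x, Equiv.swap (0 : Fin 3) 1 y) := fun x y => by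
    rw [← graph_single, relabel_single]
  rw [map_mul, map_add, h, h, h, Equiv.swap_apply_left, Equiv.swap_apply_right,
    show Equiv.swap (0 : Fin 3) 1 2 = 2 by decide, show s((1 : Fin 3), 0) = s(0, 1) from Sym2.eq_swap]
  simp only [add_mul]
  rw [edge_mul_swap s((0 : Fin 3), 2) s(0, 1), edge_mul_swap s((1 : Fin 3), 2) s(0, 1),
    edge_mul_swap s((1 : Fin 3), 2) s(0, 2)]
  abel

end Graphs

end DeformationGroup
namespace DeformationGroup

namespace ParamAlgebra

/-! ### The Lie algebra of odd elements -/

section Lie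

variable {k : Type u} [Field k] [CharZero k] {W : Type v} [AddCommGroup W] [Module k W]
variable (A : ParamAlgebra k W) {x y v w : W}

theorem induction_deg {P : W → Prop} (h0 : ∀ x ∈ A.deg 0, P x) (h1 : ∀ x ∈ A.deg 1, P x)
    (ha : ∀ x y, P x → P y → P (x + y)) (x : W) : P x := by
  obtain ⟨a, ha', b, hb, rfl⟩ := Submodule.mem_sup.1
    (show x ∈ A.deg 0 ⊔ A.deg 1 by rw [A.isCompl_deg.2.eq_top]; trivial)
  exact ha _ _ (h0 _ ha') (h1 _ hb)

variable {A}

theorem br_mem {i j : ℕ} (hx : x ∈ A.F i) (hy : y ∈ A.F j) : A.br x y ∈ A.F (i + j) := by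
  have h := A.act_F 2 (CGra.stick k) ![i, j] ![x, y] fun l => by fin_cases l; exacts [hx, hy]
  rwa [Fin.sum_univ_two] at h

theorem br_deg {p q : ZMod 2} (hx : x ∈ A.deg p) (hy : y ∈ A.deg q) :
    A.br x y ∈ A.deg (1 + (p + q)) := by
  have h := A.act_deg 2 (CGra.stick k) 1 (edge_mem_parity _) ![p, q] ![x, y] fun l => by
    fin_cases l; exacts [hx, hy]
  rwa [Fin.sum_univ_two] at h

theorem hDelta_mem {i : ℕ} (hx : x ∈ A.F i) : A.hDelta x ∈ A.F i := by
  have h := A.act_F 1 (CGra.loop k) ![i] ![x] fun l => by fin_cases l; exact hx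
  rw [Fin.sum_univ_one] at h
  exact A.hpow_F' 1 i h

theorem hDelta_deg {p : ZMod 2} (hx : x ∈ A.deg p) : A.hDelta x ∈ A.deg (p + 1) := by
  have h := A.act_deg 1 (CGra.loop k) 1 (edge_mem_parity _) ![p] ![x] fun l => by
    fin_cases l; exact hx
  rw [Fin.sum_univ_one, add_comm] at h
  exact A.h_deg _ _ h

theorem br_swap {p q : ZMod 2} (hx : x ∈ A.deg p) (hy : y ∈ A.deg q) :
    A.br x y = ((-1 : ℤˣ) ^ (p * q)) • A.br y x := by
  have h := A.act_perm 2 (CGra.stick k) (Equiv.swap 0 1) ![p, q] ![x, y] fun l => by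
    fin_cases l; exacts [hx, hy]
  rw [perm_stick, vec_two fun i => ![x, y] (Equiv.swap 0 1 i), Equiv.swap_apply_left,
    Equiv.swap_apply_right] at h
  have hs : koszulSign ![p, q] (Equiv.swap 0 1) = (-1 : ℤˣ) ^ (p * q) := by
    simp [koszulSign, Fin.prod_univ_two, mul_comm]
  rw [hs] at h
  exact h

theorem h_br_left : A.br (A.h x) y = A.h (A.br x y) := by
  have h := A.h_act 2 (CGra.stick k) ![x, y] 0
  rwa [update_vec_zero] at h

theorem h_br_right : A.br x (A.h y) = A.h (A.br x y) := by
  have h := A.h_act 2 (CGra.stick k) ![x, y] 1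
  rwa [update_vec_last] at h

theorem odd_sign : ((-1 : ℤˣ) ^ (1 : ZMod 2)) = -1 := by decide

/-- `d` and `ħ Δ` are derivations of the bracket of odd elements. -/
theorem d_br (hx : x ∈ A.deg 1) (hy : y ∈ A.deg 1) :
    A.d (A.br x y) = A.br x (A.d y) - A.br y (A.d x) := by
  have h := A.act_d 2 (CGra.stick k) 1 (edge_mem_parity _) ![1, 1] ![x, y] fun l => by
    fin_cases l; exacts [hx, hy]
  rw [Fin.sum_univ_two] at h
  have e0 : ∑ j : Fin 2 with j < 0, (![1, 1] : Fin 2 → ZMod 2) j = 0 := by decide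
  have e1 : ∑ j : Fin 2 with j < 1, (![1, 1] : Fin 2 → ZMod 2) j = 1 := by decide
  rw [e0, e1, update_vec_zero, update_vec_last] at h
  have hd := A.d_deg _ _ hx
  rw [show (1 : ZMod 2) + 1 = 0 by decide] at hd
  have hs := br_swap hd hy
  rw [zero_mul, uzpow_zero, one_smul] at hs
  rw [odd_sign, uzpow_zero, one_smul, Units.neg_smul, one_smul, Units.neg_smul, one_smul] at h
  change A.d (A.br x y) = -(A.br (A.d x) y + -A.br x (A.d y)) at h
  rw [h, hs]
  abel

theorem act_loop_stick {p q : ZMod 2} (hx : x ∈ A.deg p) (hy : y ∈ A.deg q) :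
    A.act 2 (CGra.comp 0 2 0 (CGra.loop k) (CGra.stick k) : CGra k (Fin 2)) ![x, y] =
      A.Delta (A.br x y) := by
  refine (A.act_comp 0 2 0 (CGra.loop k) (CGra.stick k) 1 (edge_mem_parity _) ![p, q] ![x, y]
    fun l => by fin_cases l; exacts [hx, hy]).trans ?_
  simp only [Finset.univ_eq_empty, Finset.sum_empty, mul_zero, uzpow_zero, one_smul]
  exact congrArg (A.act 1 (CGra.loop k)) (funext fun i => by
    fin_cases i
    exact congrArg (A.act 2 (CGra.stick k)) (funext fun j => by fin_cases j <;> rfl))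

theorem act_stick_loop_left {p q : ZMod 2} (hx : x ∈ A.deg p) (hy : y ∈ A.deg q) :
    A.act 2 (CGra.comp 0 1 1 (CGra.stick k) (CGra.loop k) : CGra k (Fin 2)) ![x, y] =
      A.br (A.Delta x) y := by
  refine (A.act_comp 0 1 1 (CGra.stick k) (CGra.loop k) 1 (edge_mem_parity _) ![p, q] ![x, y]
    fun l => by fin_cases l; exacts [hx, hy]).trans ?_
  simp only [Finset.univ_eq_empty, Finset.sum_empty, mul_zero, uzpow_zero, one_smul]
  exact congrArg (A.act 2 (CGra.stick k)) (funext fun i => by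
    fin_cases i
    · exact congrArg (A.act 1 (CGra.loop k)) (funext fun j => by fin_cases j; rfl)
    · rfl)

theorem act_stick_loop_right {p q : ZMod 2} (hx : x ∈ A.deg p) (hy : y ∈ A.deg q) :
    A.act 2 (CGra.comp 1 1 0 (CGra.stick k) (CGra.loop k) : CGra k (Fin 2)) ![x, y] =
      ((-1 : ℤˣ) ^ p) • A.br x (A.Delta y) := by
  refine (A.act_comp 1 1 0 (CGra.stick k) (CGra.loop k) 1 (edge_mem_parity _) ![p, q] ![x, y]
    fun l => by fin_cases l; exacts [hx, hy]).trans ?_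
  rw [Fin.sum_univ_one, one_mul]
  exact congrArg _ (congrArg (A.act 2 (CGra.stick k)) (funext fun i => by
    fin_cases i
    · rfl
    · exact congrArg (A.act 1 (CGra.loop k)) (funext fun j => by fin_cases j; rfl)))

theorem Delta_br (hx : x ∈ A.deg 1) (hy : y ∈ A.deg 1) :
    A.hDelta (A.br x y) = A.br x (A.hDelta y) - A.br y (A.hDelta x) := by
  have h0 := act_loop_stick hx hy
  rw [comp_loop_stick_add, map_neg, map_add, neg_apply, add_apply, act_stick_loop_left hx hy,
    act_stick_loop_right hx hy, odd_sign, Units.neg_smul, one_smul] at h0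
  have hd := A.act_deg 1 (CGra.loop k) 1 (edge_mem_parity _) ![1] ![x] fun l => by
    fin_cases l; exact hx
  rw [Fin.sum_univ_one, show (1 : ZMod 2) + ![1] 0 = 0 by decide] at hd
  have hs : A.br (A.Delta x) y = _ := br_swap hd hy
  rw [zero_mul, uzpow_zero, one_smul] at hs
  rw [hDelta_apply, hDelta_apply, hDelta_apply, h_br_right, h_br_right, ← map_sub, ← h0, hs]
  congr 1
  abel

theorem act_nested_left {p q r : ZMod 2} (hx : x ∈ A.deg p) (hy : y ∈ A.deg q) (hv : v ∈ A.deg r) :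
    A.act 3 (CGra.comp 0 2 1 (CGra.stick k) (CGra.stick k) : CGra k (Fin 3)) ![x, y, v] =
      A.br (A.br x y) v := by
  refine (A.act_comp 0 2 1 (CGra.stick k) (CGra.stick k) 1 (edge_mem_parity _) ![p, q, r] ![x, y, v]
    fun l => by fin_cases l; exacts [hx, hy, hv]).trans ?_
  simp only [Finset.univ_eq_empty, Finset.sum_empty, mul_zero, uzpow_zero, one_smul]
  exact congrArg (A.act 2 (CGra.stick k)) (funext fun i => by
    fin_cases i
    · exact congrArg (A.act 2 (CGra.stick k)) (funext fun j => by fin_cases j <;> rfl)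
    · rfl)

theorem act_nested_right {p q r : ZMod 2} (hx : x ∈ A.deg p) (hy : y ∈ A.deg q) (hv : v ∈ A.deg r) :
    A.act 3 (CGra.comp 1 2 0 (CGra.stick k) (CGra.stick k) : CGra k (Fin 3)) ![x, y, v] =
      ((-1 : ℤˣ) ^ p) • A.br x (A.br y v) := by
  refine (A.act_comp 1 2 0 (CGra.stick k) (CGra.stick k) 1 (edge_mem_parity _) ![p, q, r] ![x, y, v]
    fun l => by fin_cases l; exacts [hx, hy, hv]).trans ?_
  rw [Fin.sum_univ_one, one_mul]
  exact congrArg _ (congrArg (A.act 2 (CGra.stick k)) (funext fun i => by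
    fin_cases i
    · rfl
    · exact congrArg (A.act 2 (CGra.stick k)) (funext fun j => by fin_cases j <;> rfl)))

theorem jacobi (hx : x ∈ A.deg 1) (hy : y ∈ A.deg 1) (v : W) :
    A.br (A.br x y) v = A.br x (A.br y v) - A.br y (A.br x v) := by
  have key : ∀ r, ∀ v ∈ A.deg r, A.br (A.br x y) v = A.br x (A.br y v) - A.br y (A.br x v) := by
    intro r v hv
    rw [← act_nested_left hx hy hv, jacobi_graph, map_neg, map_add, neg_apply, add_apply,
      act_nested_right hx hy hv]
    have hp := A.act_perm 3 (CGra.comp 1 2 0 (CGra.stick k) (CGra.stick k) : CGra k (Fin 3))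
      (Equiv.swap 0 1) ![1, 1, r] ![x, y, v] fun l => by fin_cases l; exacts [hx, hy, hv]
    have hs : ∀ r, koszulSign ![1, 1, r] (Equiv.swap (0 : Fin 3) 1) = -1 := by decide
    have hv' : (fun i => ![x, y, v] (Equiv.swap (0 : Fin 3) 1 i)) = ![y, x, v] := by
      funext i; fin_cases i <;> rfl
    rw [hp, hs, hv', act_nested_right hy hx hv, odd_sign]
    simp only [Units.neg_smul, one_smul]
    abel
  refine A.induction_deg (key 0) (key 1) (fun a b ha hb => ?_) v
  simp only [map_add]
  rw [ha, hb]
  abel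

end Lie

end ParamAlgebra

end DeformationGroup
namespace DeformationGroup

/-! ## Time-ordered exponentials in complete representations -/

section Ordered

variable {k : Type u} [Field k] [CharZero k] {L L' : Type*} [AddCommGroup L] [Module k L] [AddCommGroup L']
  [Module k L']

theorem map_cauchy_iterate {br : L → L → L} {br' : L' → L' → L'} (T : L →ₗ[k] L')
    (hT : ∀ a b, T (br a b) = br' (T a) (T b)) {X : ℕ → L} {X' : ℕ → L'} (a : ℕ → L) {m : ℕ}
    (hX : ∀ i ≤ m, T (X i) = X' i) (n : ℕ) :
    ∀ i ≤ m, T ((cauchy br X)^[n] a i) = (cauchy br' X')^[n] (fun i => T (a i)) i := by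
  induction n with
  | zero => intro i _; rfl
  | succ n ih =>
    intro i hi
    rw [Function.iterate_succ_apply', Function.iterate_succ_apply', cauchy, cauchy, map_sum]
    refine Finset.sum_congr rfl fun p hp => ?_
    have hp' := Finset.HasAntidiagonal.mem_antidiagonal.1 hp
    rw [hT, hX _ (by omega), ih _ (by omega)]

/-- The Magnus expansion only uses brackets, so it can be formed in the Lie algebra and compared
with its image in operators. -/
theorem map_magnus {br : L → L → L} {br' : L' → L' → L'} (T : L →ₗ[k] L')
    (hT : ∀ a b, T (br a b) = br' (T a) (T b)) (β : ℕ → k) (a : ℕ → L) (m : ℕ) :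
    T (magnus br β a m) = magnus br' β (fun i => T (a i)) m := by
  induction m using Nat.strong_induction_on with
  | _ m ih =>
    cases m with
    | zero => rw [magnus_zero, magnus_zero, map_zero]
    | succ m =>
      rw [magnus_succ, magnus_succ, map_smul, map_sum]
      congr 1
      refine Finset.sum_congr rfl fun n _ => ?_
      rw [map_smul, map_cauchy_iterate T hT a (fun i hi => ih i (by omega)) n m le_rfl]

open Polynomial in
theorem polyEval_one_eq {A : Type*} [Ring A] [Algebra k A] (P : A[X]) {D : ℕ} (h : P.natDegree < D) :
    polyEval A (1 : k) P = ∑ m ∈ Finset.range D, P.coeff m := by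
  conv_lhs => rw [P.as_sum_range' D h]
  rw [map_sum]
  refine Finset.sum_congr rfl fun m _ => ?_
  rw [polyEval_monomial, one_pow, one_smul]

variable {M : Type*} [AddCommGroup M] [Module k M]

open Polynomial in
/-- The solution at time one of a linear differential equation with values in a Lie algebra is given
by an exponential. -/
theorem magnus_ordered {br : L → L → L} {ρ : L →ₗ[k] Module.End k M} {F : ℕ → Submodule k M}
    {J : ℕ → Submodule k L} (h0 : F 0 = ⊤) (hF : Antitone F) (hJ0 : J 0 = ⊤)
    (hρ : ∀ a b, ρ (br a b) = comm (ρ a) (ρ b))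
    (hρF : ∀ i j, ∀ a ∈ J i, ∀ x ∈ F j, ρ a x ∈ F (j + i)) {a : ℕ → L} (ha : ∀ i, a i ∈ J (i + 1))
    {α : ℕ → M} (hα : ∀ m, ((m + 1 : ℕ) : k) • α (m + 1) =
      ∑ p ∈ Finset.HasAntidiagonal.antidiagonal m, ρ (a p.1) (α p.2)) {N : ℕ} (hN : 0 < N) {S : L}
    (hS : S - ∑ m ∈ Finset.range N, magnus br (fun n => PowerSeries.coeff n (expQuot k)⁻¹) a m ∈ J N) :
    ∑ m ∈ Finset.range N, α m - ∑ i ∈ Finset.range (2 * N), (1 / (i.factorial : k)) • (ρ S ^ i) (α 0) ∈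
      F N := by
  have hcast : ∀ m : ℕ, ((m + 1 : ℕ) : k) ≠ 0 := fun m => Nat.cast_ne_zero.2 m.succ_ne_zero
  have hαF : ∀ m, α m ∈ F m := by
    intro m
    induction m using Nat.strong_induction_on with
    | _ m ih =>
      cases m with
      | zero => rw [h0]; trivial
      | succ m =>
        have h1 : ((m + 1 : ℕ) : k) • α (m + 1) ∈ F (m + 1) := by
          rw [hα]
          refine Submodule.sum_mem _ fun p hp => ?_
          have hp' := Finset.HasAntidiagonal.mem_antidiagonal.1 hp
          have := hρF _ _ _ (ha p.1) _ (ih p.2 (by omega))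
          rwa [show p.2 + (p.1 + 1) = m + 1 by omega] at this
        have h2 := Submodule.smul_mem _ (((m + 1 : ℕ) : k)⁻¹) h1
        rwa [smul_smul, inv_mul_cancel₀ (hcast m), one_smul] at h2
  have hle : ∀ x, F N ≤ (F N).comap (ρ x) := fun x v hv =>
    hρF 0 N x (by rw [hJ0]; trivial) v hv
  let T : L →ₗ[k] Module.End k (M ⧸ F N) :=
    { toFun := fun x => (F N).mapQ (F N) (ρ x) (hle x)
      map_add' := fun x y => by
        refine Submodule.linearMap_qext _ (LinearMap.ext fun v => ?_)
        simp
      map_smul' := fun c x => by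
        refine Submodule.linearMap_qext _ (LinearMap.ext fun v => ?_)
        simp }
  have hTapp : ∀ x v, T x ((F N).mkQ v) = (F N).mkQ (ρ x v) := fun x v => rfl
  have hT : ∀ x y, T (br x y) = comm (T x) (T y) := fun x y => by
    refine Submodule.linearMap_qext _ (LinearMap.ext fun v => ?_)
    simp only [LinearMap.comp_apply, comm, LinearMap.sub_apply, Module.End.mul_apply, hTapp, hρ,
      map_sub]
  have hfil := nilFiltration_quot h0 hF hN
  have hTJ : ∀ i, ∀ x ∈ J i, T x ∈ quotFil F N i := fun i x hx =>
    mapQ_mem_quotFil (ρ x) (fun m v hv => hρF i m x hx v hv) (hle x)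
  -- Modulo F N the coefficients of the generator act by zero from order N on, so the generator
  -- becomes a polynomial.
  set P : (Module.End k (M ⧸ F N))[X] := ∑ i ∈ Finset.range N, monomial i (T (a i)) with hP
  have hPc : ∀ i, P.coeff i = T (a i) := by
    intro i
    rw [hP, finsetSum_coeff]
    simp only [coeff_monomial, Finset.sum_ite_eq', Finset.mem_range]
    split_ifs with h
    · rfl
    · exact (hfil.eq_zero (by omega) (hTJ _ _ (ha i))).symm
  have hPJ : ∀ i, P.coeff i ∈ quotFil F N (i + 1) := fun i => by rw [hPc]; exact hTJ _ _ (ha i)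
  set U := nexp k (2 * N) (magnusPoly k N P.coeff) with hU
  have hd : derivative U = P * U := derivative_nexp_magnusPoly hfil le_rfl hPJ
  have hU0 : U.coeff 0 = 1 :=
    coeff_zero_nexp (by rw [coeff_magnusPoly hfil hPJ, magnus_zero]) (by omega)
  -- The coefficients of U applied to α 0 satisfy the recursion that determines the α m.
  have hUα : ∀ m, U.coeff m ((F N).mkQ (α 0)) = (F N).mkQ (α m) := by
    intro m
    induction m using Nat.strong_induction_on with
    | _ m ih =>
      cases m with
      | zero => rw [hU0]; rfl
      | succ m =>
        have h1 := congrArg (fun R : (Module.End k (M ⧸ F N))[X] => coeff R m ((F N).mkQ (α 0))) hd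
        simp only [coeff_derivative, coeff_mul, LinearMap.sum_apply, Module.End.mul_apply] at h1
        have h2 : ∑ p ∈ Finset.HasAntidiagonal.antidiagonal m, P.coeff p.1 (U.coeff p.2 ((F N).mkQ (α 0))) =
            (F N).mkQ (((m + 1 : ℕ) : k) • α (m + 1)) := by
          rw [hα, map_sum]
          refine Finset.sum_congr rfl fun p hp => ?_
          have hp' := Finset.HasAntidiagonal.mem_antidiagonal.1 hp
          rw [ih p.2 (by omega), hPc, hTapp]
        rw [h2, map_smul] at h1
        have h3 : ((m : Module.End k (M ⧸ F N)) + 1) ((F N).mkQ (α 0)) =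
            ((m + 1 : ℕ) : k) • (F N).mkQ (α 0) := by
          have : ((m : Module.End k (M ⧸ F N)) + 1) = algebraMap k _ ((m + 1 : ℕ) : k) := by simp
          rw [this, Module.algebraMap_end_apply]
        rw [h3, map_smul] at h1
        exact smul_right_injective _ (hcast m) h1
  -- At t = 1 the Magnus polynomial of the operators is the image of S, by naturality.
  have hTS : polyEval _ (1 : k) (magnusPoly k N P.coeff) = T S := by
    have h1 : T S = T (∑ m ∈ Finset.range N,
        magnus br (fun n => PowerSeries.coeff n (expQuot k)⁻¹) a m) := by
      rw [← sub_eq_zero, ← map_sub]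
      exact hfil.eq_zero le_rfl (hTJ _ _ hS)
    rw [h1, magnusPoly, map_sum, map_sum]
    refine Finset.sum_congr rfl fun m _ => ?_
    rw [polyEval_monomial, one_pow, one_smul, map_magnus T hT]
    congr 1
    exact funext hPc
  have hpow : ∀ (i : ℕ) (v : M), (T S ^ i) ((F N).mkQ v) = (F N).mkQ ((ρ S ^ i) v) := by
    intro i v
    induction i with
    | zero => rfl
    | succ i ih => rw [pow_succ', Module.End.mul_apply, ih, hTapp, pow_succ', Module.End.mul_apply]
  have hE := congrArg (fun R => R ((F N).mkQ (α 0)))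
    (nexp_map (k := k) (polyEval (Module.End k (M ⧸ F N)) (1 : k)) (2 * N) (magnusPoly k N P.coeff))
  -- The range is taken long enough to contain all of U and to exceed N; the extra coefficients of α
  -- lie in F N and are removed afterwards.
  rw [← hU, hTS, polyEval_one_eq U (show U.natDegree < U.natDegree + 1 + N by omega)] at hE
  simp only [nexp, LinearMap.sum_apply, LinearMap.smul_apply, hUα, hpow, ← map_smul, ← map_sum] at hE
  have h5 : ∑ m ∈ Finset.range (U.natDegree + 1 + N), α m - ∑ m ∈ Finset.range N, α m ∈ F N := by
    rw [← Finset.sum_sdiff (Finset.range_mono (show N ≤ U.natDegree + 1 + N by omega)), add_sub_cancel_right]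
    refine Submodule.sum_mem _ fun m hm => hF ?_ (hαF m)
    simp at hm; omega
  have h6 := (Submodule.Quotient.eq (F N)).1 hE
  have h7 := Submodule.sub_mem _ h6 h5
  rw [sub_sub_sub_cancel_left] at h7
  simpa only [map_smul] using h7

end Ordered

/-! ### The gauge action as a linear representation -/

namespace ParamAlgebra

variable {k : Type u} [Field k] [CharZero k] {W : Type v} [AddCommGroup W] [Module k W]
variable {A : ParamAlgebra k W} {α v w ξ : W}

/-- The operator `d + ħ Δ`. -/
noncomputable def totalD (A : ParamAlgebra k W) : W →ₗ[k] W := A.d + A.hDelta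

theorem totalD_mem {i : ℕ} {x : W} (hx : x ∈ A.F i) : A.totalD x ∈ A.F i :=
  Submodule.add_mem _ (A.d_F _ _ hx) (hDelta_mem hx)

/-- The terms of the gauge action. -/
noncomputable def gauge (A : ParamAlgebra k W) (ξ α : W) : ℕ → W
  | 0 => α
  | i + 1 => (1 / ((i + 1).factorial : k)) • ((A.br ξ)^[i + 1] α + (A.br ξ)^[i] (A.totalD ξ))

theorem iterate_br_mem {i : ℕ} (hξ : ξ ∈ A.F 1) (hv : v ∈ A.F i) (n : ℕ) :
    (A.br ξ)^[n] v ∈ A.F (i + n) := by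
  induction n with
  | zero => exact hv
  | succ n ih =>
    rw [Function.iterate_succ_apply', show i + (n + 1) = 1 + (i + n) by omega]
    exact br_mem hξ ih

theorem gauge_mem (hξ : ξ ∈ A.F 1) (hα : α ∈ A.F 1) (i : ℕ) : A.gauge ξ α i ∈ A.F (max 1 i) := by
  cases i with
  | zero => exact hα
  | succ i =>
    refine Submodule.smul_mem _ _ (Submodule.add_mem _ ?_ ?_)
    · exact A.F_anti (by omega) (iterate_br_mem hξ hα (i + 1))
    · exact A.F_anti (by omega) (iterate_br_mem hξ (totalD_mem hξ) i)

theorem gauge_mem_one (hξ : ξ ∈ A.F 1) (hα : α ∈ A.F 1) (i : ℕ) : A.gauge ξ α i ∈ A.F 1 :=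
  A.F_anti (le_max_left _ _) (gauge_mem hξ hα i)

theorem totalD_br {x y : W} (hx : x ∈ A.deg 1) (hy : y ∈ A.deg 1) :
    A.totalD (A.br x y) = A.br x (A.totalD y) - A.br y (A.totalD x) := by
  simp only [totalD, LinearMap.add_apply, d_br hx hy, Delta_br hx hy, map_add]
  abel

/-- The bracket of odd elements. -/
noncomputable def oddBr (A : ParamAlgebra k W) (x y : A.deg 1) : A.deg 1 :=
  ⟨A.br x y, br_deg x.2 y.2⟩

/-- The infinitesimal gauge action `(v, c) ↦ ({x, v} + c (d x + ħ Δ x), 0)`. -/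
noncomputable def gaugeRep (A : ParamAlgebra k W) : A.deg 1 →ₗ[k] Module.End k (W × k) where
  toFun x := LinearMap.inl k W k ∘ₗ
    ((A.br x).coprod (LinearMap.toSpanSingleton k W (A.totalD x)))
  map_add' x y := by
    refine LinearMap.ext fun v => ?_
    refine Prod.ext ?_ ?_
    · simp; abel
    · simp
  map_smul' c x := by
    refine LinearMap.ext fun v => ?_
    refine Prod.ext ?_ ?_
    · simp [smul_comm c v.2]
    · simp

theorem gaugeRep_apply (x : A.deg 1) (v : W) (c : k) :
    A.gaugeRep x (v, c) = (A.br x v + c • A.totalD x, 0) := by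
  simp [gaugeRep]

/-- The additional scalar coordinate makes the affine gauge action linear. The identity combines the
Jacobi identity with the derivation property of d + ħΔ. -/
theorem gaugeRep_br (x y : A.deg 1) :
    A.gaugeRep (A.oddBr x y) = comm (A.gaugeRep x) (A.gaugeRep y) := by
  refine LinearMap.ext fun v => ?_
  obtain ⟨v, c⟩ := v
  rw [comm, LinearMap.sub_apply, Module.End.mul_apply, Module.End.mul_apply, gaugeRep_apply,
    gaugeRep_apply, gaugeRep_apply, gaugeRep_apply, gaugeRep_apply]
  refine Prod.ext ?_ (by simp)
  change A.br (A.br x y) v + c • A.totalD (A.br x y) = A.br x (A.br y v + c • A.totalD y) +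
    (0 : k) • A.totalD x - (A.br y (A.br x v + c • A.totalD x) + (0 : k) • A.totalD y)
  rw [jacobi x.2 y.2, totalD_br x.2 y.2]
  simp only [map_add, map_smul, zero_smul, smul_sub]
  abel

theorem gaugeRep_pow (x : A.deg 1) (v : W) (i : ℕ) :
    ((1 / (i.factorial : k)) • (A.gaugeRep x ^ i) (v, (1 : k))).1 = A.gauge x v i := by
  cases i with
  | zero => simp [gauge]
  | succ i =>
    have h : (A.gaugeRep x ^ (i + 1)) (v, (1 : k)) =
        ((A.br x)^[i + 1] v + (A.br x)^[i] (A.totalD x), 0) := by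
      induction i with
      | zero => rw [zero_add, pow_one, gaugeRep_apply, one_smul]; rfl
      | succ i ih =>
        rw [pow_succ', Module.End.mul_apply, ih, gaugeRep_apply, zero_smul, add_zero, map_add,
          ← Function.iterate_succ_apply' (A.br x), ← Function.iterate_succ_apply' (A.br x)]
    rw [h]
    rfl

/-- The filtration of `W × k` used in the study of the gauge action. -/
def gaugeFil (A : ParamAlgebra k W) : ℕ → Submodule k (W × k)
  | 0 => ⊤
  | i + 1 => (A.F (i + 1)).prod ⊥

theorem mem_gaugeFil {v : W} (i : ℕ) (hv : v ∈ A.F i) : (v, (0 : k)) ∈ A.gaugeFil i := by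
  cases i with
  | zero => trivial
  | succ i => exact ⟨hv, rfl⟩

theorem fst_mem_of_gaugeFil {v : W × k} {i : ℕ} (hv : v ∈ A.gaugeFil i) : v.1 ∈ A.F i := by
  cases i with
  | zero => rw [A.F_zero]; trivial
  | succ i => exact hv.1

theorem gaugeFil_anti : Antitone A.gaugeFil := by
  intro i j h v hv
  cases i with
  | zero => trivial
  | succ i =>
    obtain ⟨j, rfl⟩ : ∃ j', j = j' + 1 := ⟨j - 1, by omega⟩
    exact ⟨A.F_anti h hv.1, hv.2⟩

/-- Two elements joined by a path which is tangent to the gauge action are gauge equivalent. -/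
theorem gauge_of_path {a ξ : ℕ → W} (ha : Decay A a) (hξ : ∀ m, ξ m ∈ A.F (m + 1))
    (hξ1 : ∀ m, ξ m ∈ A.deg 1) (h : ∀ m, ((m + 1 : ℕ) : k) • a (m + 1) =
      A.totalD (ξ m) + ∑ p ∈ Finset.HasAntidiagonal.antidiagonal m, A.br (ξ p.1) (a p.2))
    {s : W} (hs : SumsTo A.F a s) :
    ∃ η ∈ A.F 1 ⊓ A.deg 1, SumsTo A.F (A.gauge η (a 0)) s := by
  set J : ℕ → Submodule k (A.deg 1) := fun i => (A.F i).comap (A.deg 1).subtype with hJ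
  set ξ' : ℕ → A.deg 1 := fun m => ⟨ξ m, hξ1 m⟩ with hξ'
  have hξJ : ∀ m, ξ' m ∈ J (m + 1) := hξ
  set X := magnus A.oddBr (fun n => PowerSeries.coeff n (expQuot k)⁻¹) ξ' with hX
  have hXJ : ∀ m, X m ∈ J m := magnus_mem (br := A.oddBr) (J := J) _ (fun i j x hx y hy => br_mem hx hy) hξJ
  have hXF : ∀ m, (X m : W) ∈ A.F m := hXJ
  have hXF1 : ∀ m, (X m : W) ∈ A.F 1 := fun m => by
    cases m with
    | zero => rw [hX, magnus_zero]; exact Submodule.zero_mem _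
    | succ m => exact A.F_anti (by omega) (hXF (m + 1))
  obtain ⟨S, hS⟩ := A.exists_sumsTo (x := fun m => (X m : W)) fun N =>
    ⟨Finset.range N, fun i hi => A.F_anti (by simpa using hi) (hXF i)⟩
  have hS1 : S ∈ A.F 1 := hS.mem hXF1
  have hSd : S ∈ A.deg 1 := SumsTo.mem_deg A hS fun m => (X m).2
  refine ⟨S, ⟨hS1, hSd⟩, fun N => ⟨Finset.range (2 * (N + 1)), fun i hi => ?_, ?_⟩⟩
  · simp at hi
    exact A.F_anti (by omega) (gauge_mem hS1 (A.F_anti (le_max_left _ _) (ha 0)) i)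
  have hSN : (⟨S, hSd⟩ : A.deg 1) - ∑ m ∈ Finset.range (N + 1), X m ∈ J (N + 1) := by
    have h1 := hS.hasFSum.sub_mem (N := N + 1) (m := N + 1) fun i hi => A.F_anti hi (hXF i)
    change S - ((∑ m ∈ Finset.range (N + 1), X m : A.deg 1) : W) ∈ A.F (N + 1)
    rwa [Submodule.coe_sum]
  -- The path is lifted to W × k with constant scalar coordinate 1, whose only coefficient is in
  -- order zero.
  have key := magnus_ordered (F := A.gaugeFil) (J := J) (ρ := A.gaugeRep) (br := A.oddBr)
    (α := fun m => (a m, if m = 0 then 1 else 0)) (a := ξ') rfl gaugeFil_anti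
    (by ext x; simp [hJ, A.F_zero]) gaugeRep_br (fun i j x hx v hv => ?_) hξJ (fun m => ?_)
    (Nat.succ_pos N) hSN
  · have h1 := fst_mem_of_gaugeFil key
    rw [Prod.fst_sub, Prod.fst_sum, Prod.fst_sum] at h1
    simp only [if_true, gaugeRep_pow] at h1
    have h2 := hs.hasFSum.sub_mem (N := N + 1) (m := N + 1) fun i hi => A.F_anti (by omega) (ha i)
    have h3 := Submodule.add_mem _ h2 h1
    rw [sub_add_sub_cancel] at h3
    exact A.F_anti (by omega) h3
  · obtain ⟨v, c⟩ := v
    rw [gaugeRep_apply]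
    refine mem_gaugeFil _ (Submodule.add_mem _ ?_ ?_)
    · rw [add_comm]; exact br_mem hx (fst_mem_of_gaugeFil hv)
    -- The inhomogeneous term only has the weight of x. This suffices at level zero; at positive
    -- levels the scalar coordinate is zero and the term is absent.
    · cases j with
      | zero => exact Submodule.smul_mem _ _ (by rw [zero_add]; exact totalD_mem hx)
      | succ j =>
        have : c = 0 := hv.2
        rw [this, zero_smul]
        exact Submodule.zero_mem _
  · simp only [gaugeRep_apply]
    refine Prod.ext ?_ ?_
    · rw [Prod.smul_fst, Prod.fst_sum, h, Finset.sum_add_distrib, add_comm]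
      congr 1
      rw [Finset.sum_eq_single (m, 0)]
      · simp [hξ']
      · intro p hp hp'
        have := Finset.HasAntidiagonal.mem_antidiagonal.1 hp
        rw [if_neg, zero_smul]
        intro h0
        exact hp' (Prod.ext (by simp; omega) h0)
      · intro h; simp at h
    · simp [Prod.snd_sum]

end ParamAlgebra

end DeformationGroup
namespace DeformationGroup

/-! ## Flows of gauge transformations -/

section Series

variable {k : Type u} [Field k] {V : Type v} [AddCommGroup V] [Module k V]

theorem series_bracket (g : CompleteCGraAlgebra k V) (x y : ℕ → V) (m : ℕ) :
    g.series.bracket x y m =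
      ∑ p ∈ Finset.HasAntidiagonal.antidiagonal m, g.bracket (x p.1) (y p.2) := by
  rw [bracket, series_act]
  refine Finset.sum_bij' (fun c _ => (c 0, c 1)) (fun p _ => ![p.1, p.2]) ?_ ?_ ?_ ?_ ?_
  · intro c hc
    rw [mem_piAntidiag_univ, Fin.sum_univ_two] at hc
    exact Finset.HasAntidiagonal.mem_antidiagonal.2 hc
  · intro p hp
    rw [mem_piAntidiag_univ, Fin.sum_univ_two]
    exact Finset.HasAntidiagonal.mem_antidiagonal.1 hp
  · intro c _
    funext i; fin_cases i <;> rfl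
  · intro p _; rfl
  · intro c _
    rw [bracket]
    congr 1
    funext i; fin_cases i <;> rfl

theorem series_Delta (g : CompleteCGraAlgebra k V) (x : ℕ → V) (m : ℕ) :
    g.series.Delta x m = g.Delta (x m) := by
  rw [Delta, series_act, Delta, Finset.sum_eq_single ![m]]
  · congr 1
    funext i; fin_cases i; rfl
  · intro c hc hc'
    rw [mem_piAntidiag_univ, Fin.sum_univ_one] at hc
    refine (hc' ?_).elim
    funext i; fin_cases i; exact hc
  · intro h
    exact (h (mem_piAntidiag_univ.2 (by simp))).elim

end Series

section MoreGraphs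

variable {k : Type u} [Field k]

theorem comp_loop_loop : (CGra.comp 0 1 0 (CGra.loop k) (CGra.loop k) : CGra k (Fin 1)) = 0 := by
  refine Subtype.ext ?_
  change reconnect (collapse 0 1 0) (graph k [s(0, 0)]) * relabel (block 0 1 0) (graph k [s(0, 0)]) = 0
  rw [reconnect_single, relabel_single,
    show (Finset.univ.filter fun x => collapse 0 1 0 x = 0) = {0} by decide]
  rw [Finset.sum_singleton, Finset.sum_singleton]
  exact edge_mul_self _

end MoreGraphs

/-! ### Curvature along gauge flows, transport by cycles, action of boundaries -/

namespace ParamAlgebra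

variable {k : Type u} [Field k] [CharZero k] {W : Type v} [AddCommGroup W] [Module k W]
variable {A : ParamAlgebra k W} {f : convCGra k} {α v w ξ x : W}

theorem path_br (x y : ℕ → W) (m : ℕ) : A.path.br x y m =
    ∑ p ∈ Finset.HasAntidiagonal.antidiagonal m, A.br (x p.1) (y p.2) :=
  series_bracket A.toCompleteCGraAlgebra x y m

theorem path_hDelta (x : ℕ → W) (m : ℕ) : A.path.hDelta x m = A.hDelta (x m) :=
  congrArg A.h (series_Delta A.toCompleteCGraAlgebra x m)

theorem path_d (x : ℕ → W) (m : ℕ) : A.path.d x m = A.d (x m) := rfl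

theorem hDelta_hDelta (x : W) : A.hDelta (A.hDelta x) = 0 := by
  have key : ∀ p, ∀ x ∈ A.deg p, A.Delta (A.Delta x) = 0 := by
    intro p x hx
    have h := A.act_comp 0 1 0 (CGra.loop k) (CGra.loop k) 1 (edge_mem_parity _) ![p] ![x]
      fun l => by fin_cases l; exact hx
    change A.act 1 (CGra.comp 0 1 0 (CGra.loop k) (CGra.loop k) : CGra k (Fin 1)) ![x] = _ at h
    rw [comp_loop_loop, map_zero] at h
    simp only [Finset.univ_eq_empty, Finset.sum_empty, mul_zero, uzpow_zero, one_smul] at h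
    refine Eq.trans ?_ h.symm
    exact congrArg (A.act 1 (CGra.loop k)) (funext fun i => by
      fin_cases i
      exact congrArg (A.act 1 (CGra.loop k)) (funext fun j => by fin_cases j; rfl))
  have hh : ∀ x, A.hDelta (A.hDelta x) = A.h (A.h (A.Delta (A.Delta x))) := fun x => by
    have := A.h_act 1 (CGra.loop k) ![A.Delta x] 0
    rw [update_vec_one] at this
    exact congrArg A.h this
  refine A.induction_deg (P := fun x => A.hDelta (A.hDelta x) = 0) (fun x hx => ?_) (fun x hx => ?_)
    (fun x y hx hy => ?_) x
  · rw [hh, key 0 x hx]; simp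
  · rw [hh, key 1 x hx]; simp
  · rw [map_add, map_add, hx, hy, add_zero]

theorem d_hDelta {p : ZMod 2} (hx : x ∈ A.deg p) : A.d (A.hDelta x) = -A.hDelta (A.d x) := by
  have h := A.act_d 1 (CGra.loop k) 1 (edge_mem_parity _) ![p] ![x] fun l => by
    fin_cases l; exact hx
  rw [Fin.sum_univ_one, update_vec_one, odd_sign, Units.neg_smul, one_smul] at h
  have e0 : ∑ j : Fin 1 with j < 0, (![p] : Fin 1 → ZMod 2) j = 0 := by
    simp
  rw [e0, uzpow_zero, one_smul] at h
  rw [hDelta_apply, ← A.h_d]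
  exact (congrArg A.h h).trans (map_neg _ _)

theorem d_br_odd_even (hx : x ∈ A.deg 1) (hα : α ∈ A.deg 0) :
    A.d (A.br x α) = A.br x (A.d α) - A.br (A.d x) α := by
  have h := A.act_d 2 (CGra.stick k) 1 (edge_mem_parity _) ![1, 0] ![x, α] fun l => by
    fin_cases l; exacts [hx, hα]
  rw [Fin.sum_univ_two] at h
  have e0 : ∑ j : Fin 2 with j < 0, (![1, 0] : Fin 2 → ZMod 2) j = 0 := by decide
  have e1 : ∑ j : Fin 2 with j < 1, (![1, 0] : Fin 2 → ZMod 2) j = 1 := by decide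
  rw [e0, e1, update_vec_zero, update_vec_last] at h
  rw [odd_sign, uzpow_zero, one_smul, Units.neg_smul, one_smul, Units.neg_smul, one_smul] at h
  change A.d (A.br x α) = -(A.br (A.d x) α + -A.br x (A.d α)) at h
  rw [h]
  abel

theorem hDelta_br_odd_even (hx : x ∈ A.deg 1) (hα : α ∈ A.deg 0) :
    A.hDelta (A.br x α) = A.br x (A.hDelta α) - A.br (A.hDelta x) α := by
  have h0 := act_loop_stick hx hα
  rw [comp_loop_stick_add, map_neg, map_add, neg_apply, add_apply, act_stick_loop_left hx hα,
    act_stick_loop_right hx hα, odd_sign, Units.neg_smul, one_smul] at h0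
  rw [hDelta_apply, hDelta_apply, hDelta_apply, h_br_right, h_br_left, ← map_sub, ← h0]
  congr 1
  abel

/-- The Jacobi identity with the even argument α repeated. -/
theorem br_br_even (hα : α ∈ A.deg 0) (hx : x ∈ A.deg 1) :
    A.br (A.br x α) α = (1 / 2 : k) • A.br x (A.br α α) := by
  have h := act_nested_left hα hα hx
  rw [jacobi_graph, map_neg, map_add, neg_apply, add_apply, act_nested_right hα hα hx] at h
  have hp := A.act_perm 3 (CGra.comp 1 2 0 (CGra.stick k) (CGra.stick k) : CGra k (Fin 3))
    (Equiv.swap 0 1) ![0, 0, 1] ![α, α, x] fun l => by fin_cases l; exacts [hα, hα, hx]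
  have hs : koszulSign ![0, 0, 1] (Equiv.swap (0 : Fin 3) 1) = 1 := by decide
  have hv' : (fun i => ![α, α, x] (Equiv.swap (0 : Fin 3) 1 i)) = ![α, α, x] := by
    funext i; fin_cases i <;> rfl
  rw [hp, hs, hv', act_nested_right hα hα hx, uzpow_zero, one_smul, one_smul] at h
  have h1 : A.br α x = A.br x α := by
    have := br_swap hα hx
    rwa [zero_mul, uzpow_zero, one_smul] at this
  have h2 : A.br α (A.br x α) = A.br (A.br x α) α := by
    have := br_swap hα (br_deg hx hα)
    rwa [zero_mul, uzpow_zero, one_smul] at this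
  have h3 : A.br (A.br α α) x = -A.br x (A.br α α) := by
    have := br_swap (br_deg hα hα) hx
    rwa [show ((1 : ZMod 2) + (0 + 0)) * 1 = 1 by decide, odd_sign, Units.neg_smul, one_smul] at this
  rw [h1, h2, h3, neg_inj, ← two_smul k] at h
  rw [← h, smul_smul]
  norm_num

theorem curv_eq (hα : α ∈ A.F 1) : A.curv α = A.d α + (A.hDelta α + (1 / 2 : k) • A.br α α) := by
  rw [curv, ev_theta hα]

/-- The direction of the gauge action of `ξ` at `α`. -/
noncomputable def dir (A : ParamAlgebra k W) (α ξ : W) : W := A.d ξ + A.dev (thetaC k) α ξ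

theorem dir_eq (hα : α ∈ A.F 1) (hξ : ξ ∈ A.F 1) :
    A.dir α ξ = A.totalD ξ + A.br ξ α := by
  rw [dir, dev_theta hα hξ, totalD, LinearMap.add_apply, add_assoc]

theorem dir_mem (hα : α ∈ A.F 1) (hξ : ξ ∈ A.F 1) : A.dir α ξ ∈ A.F 1 :=
  Submodule.add_mem _ (A.d_F _ _ hξ) (dev_mem_F hα hξ)

/-- The derivative of the curvature in the direction of the gauge action. -/
theorem dir_dir (hα : α ∈ A.F 1) (hα0 : α ∈ A.deg 0) (hξ : ξ ∈ A.F 1) (hξ1 : ξ ∈ A.deg 1) :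
    A.dir α (A.dir α ξ) = A.br ξ (A.curv α) := by
  have hu := dir_mem hα hξ
  rw [dir_eq hα hu, dir_eq hα hξ, curv_eq hα]
  simp only [totalD, LinearMap.add_apply, map_add, A.d_d, hDelta_hDelta, d_hDelta hξ1,
    d_br_odd_even hξ1 hα0, hDelta_br_odd_even hξ1 hα0, br_br_even hα0 hξ1, map_smul]
  abel

/-- The path `a` is tangent to the gauge action of the path `x`. -/
def Flow (A : ParamAlgebra k W) (a x : ℕ → W) : Prop :=
  ∀ m, ((m + 1 : ℕ) : k) • a (m + 1) = A.path.dir a x m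

theorem Flow.gauge {a x : ℕ → W} (h : Flow A a x) (ha : Decay A a) (hx : ∀ m, x m ∈ A.F (m + 1))
    (hx1 : x ∈ A.path.deg 1) {s : W} (hs : SumsTo A.F a s) :
    ∃ η ∈ A.F 1 ⊓ A.deg 1, SumsTo A.F (A.gauge η (a 0)) s := by
  refine gauge_of_path ha hx hx1 (fun m => ?_) hs
  rw [h, dir_eq ha.mem (mem_path_F_one.2 fun m => A.F_anti (by omega) (hx m)), Pi.add_apply, path_br,
    totalD, LinearMap.add_apply, Pi.add_apply, path_d, path_hDelta]
  rfl

/-- By `dir_dir` the curvature c satisfies the homogeneous linear equation c' = {x, c}, so it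
vanishes order by order once it vanishes at time zero. -/
theorem Flow.curv_eq_zero {a x : ℕ → W} (h : Flow A a x) (ha : a ∈ A.path.F 1)
    (ha0 : a ∈ A.path.deg 0) (hx : x ∈ A.path.F 1) (hx1 : x ∈ A.path.deg 1)
    (h0 : A.curv (a 0) = 0) : A.path.curv a = 0 := by
  funext m
  induction m using Nat.strong_induction_on with
  | _ m ih =>
    cases m with
    | zero =>
      change A.path.d a 0 + A.path.ev (thetaC k) a 0 = 0
      rw [path_ev_zero ha]
      exact h0
    | succ m =>
      have h1 := congrFun ((isDer_euler A).ev thetaC_parity ha ha0) (m + 1)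
      rw [zero_mul, uzpow_zero, one_smul, euler_apply, dev,
        path_gen_cons_shift (u := A.path.dir a x) (fun _ _ => ha)
          ((isDer_euler A).mem_F _ _ ha) (dir_mem ha hx) (by simp [euler_apply]) fun i _ => h i] at h1
      have h2 : ((m + 1 : ℕ) : k) • A.path.curv a (m + 1) = A.path.dir a (A.path.dir a x) m := by
        rw [curv, Pi.add_apply, smul_add, h1, path_d, ← map_smul, h]
        rfl
      rw [dir_dir ha ha0 hx hx1, path_br, Finset.sum_eq_zero fun p hp => ?_] at h2
      · exact (smul_eq_zero.1 h2).resolve_left (Nat.cast_ne_zero.2 m.succ_ne_zero)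
      · have hp' := Finset.HasAntidiagonal.mem_antidiagonal.1 hp
        rw [ih p.2 (by omega), Pi.zero_apply, map_zero]

theorem ddev_zero_left (hα : α ∈ A.F 1) (hw : w ∈ A.F 1) : A.ddev f α 0 w = 0 := by
  have h := ddev_add (A := A) (f := f) hα hw (Submodule.zero_mem _) (Submodule.zero_mem _)
  rw [add_zero] at h
  exact left_eq_add.1 h

/-- Let φ be the transform by e^y. Differentiating φ ⋆ θ and d ∘ φ produces, besides the expected
term, the second derivative of φ in the directions dα + θ(α) and ξ. The first of these is the
curvature, so the identity needs a Maurer–Cartan element. -/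
theorem dir_trans (y : evenCycles k) (hα : α ∈ A.F 1) (hα0 : α ∈ A.deg 0) (hξ : ξ ∈ A.F 1)
    (hξ1 : ξ ∈ A.deg 1) (hc : A.curv α = 0) :
    A.dir (A.trans y α) (A.dev (cexp y (oneC k)) α ξ) = A.dev (cexp y (oneC k)) α (A.dir α ξ) := by
  have hφ := cexp_one_parity y
  have he := ev_mem_F (A := A) (f := thetaC k) hα
  have he1 := ev_deg (A := A) thetaC_parity hα hα0
  have hd := A.d_F _ _ hα
  have hd1 := A.d_deg _ _ hα0
  rw [zero_add] at hd1
  have hz : A.ddev (cexp y (oneC k)) α (A.d α) ξ + A.ddev (cexp y (oneC k)) α (A.ev (thetaC k) α) ξ = 0 := by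
    rw [← ddev_add hα hξ hd he]
    change A.ddev _ _ (A.curv α) _ = 0
    rw [hc, ddev_zero_left hα hξ]
  rw [dir, dir, trans, dev_cexp y thetaC_parity hα hα0 hξ hξ1, cexp_theta,
    dev_pl thetaC_parity hα hα0 hξ hξ1, (isDer_d A).dev hφ hα hα0 hξ hξ1,
    ddev_swap hα hα0 hξ hξ1 hd hd1, dev_add hα (A.d_F _ _ hξ) (dev_mem_F hα hξ), smul_smul]
  simp only [mul_zero, mul_one, uzpow_zero, one_smul, odd_sign, neg_mul_neg]
  rw [add_add_add_comm, hz, add_zero]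

theorem Flow.trans {a x : ℕ → W} (h : Flow A a x) (y : evenCycles k) (ha : a ∈ A.path.F 1)
    (ha0 : a ∈ A.path.deg 0) (hx : x ∈ A.path.F 1) (hx1 : x ∈ A.path.deg 1)
    (hc : A.path.curv a = 0) :
    Flow A (A.path.trans y a) (A.path.dev (cexp y (oneC k)) a x) := by
  intro m
  rw [dir_trans y ha ha0 hx hx1 hc]
  have h1 := congrFun ((isDer_euler A).ev (cexp_one_parity y) ha ha0) (m + 1)
  rw [zero_mul, uzpow_zero, one_smul, euler_apply, dev,
    path_gen_cons_shift (u := A.path.dir a x) (fun _ _ => ha)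
      ((isDer_euler A).mem_F _ _ ha) (dir_mem ha hx) (by simp [euler_apply]) fun i _ => h i] at h1
  exact h1

/-- The constant path. -/
def constPath (ξ : W) (m : ℕ) : W := if m = 0 then ξ else 0

/-- Read as coefficients of t^i, the terms of the gauge action form the path t ↦ e^{tξ}·α, generated
by the constant ξ. -/
theorem flow_gauge (hα : α ∈ A.F 1) (hξ : ξ ∈ A.F 1) :
    Flow A (A.gauge ξ α) (constPath ξ) := by
  have ha : A.gauge ξ α ∈ A.path.F 1 := mem_path_F_one.2 (gauge_mem_one hξ hα)
  have hx : constPath ξ ∈ A.path.F 1 := mem_path_F_one.2 fun m => by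
    unfold constPath; split_ifs
    exacts [hξ, Submodule.zero_mem _]
  intro m
  have h1 : ∑ p ∈ Finset.HasAntidiagonal.antidiagonal m, A.br (constPath ξ p.1) (A.gauge ξ α p.2) =
      A.br ξ (A.gauge ξ α m) := by
    rw [Finset.sum_eq_single (0, m)]
    · rfl
    · intro p hp hp'
      have := Finset.HasAntidiagonal.mem_antidiagonal.1 hp
      have h0 : p.1 ≠ 0 := fun h0 => hp' (Prod.ext h0 (by simp; omega))
      simp [constPath, h0]
    · intro h; simp at h
  rw [dir_eq ha hx, Pi.add_apply, path_br, h1, totalD, LinearMap.add_apply, Pi.add_apply, path_d,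
    path_hDelta]
  have hf : ∀ m : ℕ, ((m + 1 : ℕ) : k) * (1 / ((m + 1).factorial : k)) = 1 / (m.factorial : k) := by
    intro m
    have h1 : ((m + 1 : ℕ) : k) ≠ 0 := Nat.cast_ne_zero.2 m.succ_ne_zero
    have h2 : (m.factorial : k) ≠ 0 := Nat.cast_ne_zero.2 m.factorial_ne_zero
    rw [Nat.factorial_succ]
    push_cast at h1 ⊢
    field_simp
  rw [ParamAlgebra.gauge, smul_smul, hf]
  cases m with
  | zero =>
    simp [constPath, ParamAlgebra.gauge, totalD, add_comm]
  | succ m =>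
    rw [Function.iterate_succ_apply' (A.br ξ) (m + 1), Function.iterate_succ_apply' (A.br ξ) m (A.totalD ξ),
      ← map_add, ← map_smul]
    simp [constPath, ParamAlgebra.gauge]

theorem gauge_deg (hξ1 : ξ ∈ A.deg 1) (hα0 : α ∈ A.deg 0) (i : ℕ) : A.gauge ξ α i ∈ A.deg 0 := by
  have h : ∀ n, ∀ v ∈ A.deg 0, (A.br ξ)^[n] v ∈ A.deg 0 := by
    intro n v hv
    induction n with
    | zero => exact hv
    | succ n ih => rw [Function.iterate_succ_apply']; exact br_deg hξ1 ih
  cases i with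
  | zero => exact hα0
  | succ i =>
    refine Submodule.smul_mem _ _ (Submodule.add_mem _ (h _ _ hα0) (h _ _ ?_))
    exact Submodule.add_mem _ (A.d_deg _ _ hξ1) (hDelta_deg hξ1)

/-- The action of cycles preserves gauge equivalence. -/
theorem gauge_trans (y : evenCycles k) {β : W} (hα : α ∈ A.F 1) (hα0 : α ∈ A.deg 0)
    (hc : A.curv α = 0) (hξ : ξ ∈ A.F 1) (hξ1 : ξ ∈ A.deg 1) (hs : SumsTo A.F (A.gauge ξ α) β) :
    ∃ η ∈ A.F 1 ⊓ A.deg 1, SumsTo A.F (A.gauge η (A.trans y α)) (A.trans y β) := by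
  have hD : Decay A (A.gauge ξ α) := gauge_mem hξ hα
  have ha := hD.mem
  have ha0 : A.gauge ξ α ∈ A.path.deg 0 := gauge_deg hξ1 hα0
  have hxs : ∀ m, constPath ξ m ∈ A.F (m + 1) := fun m => by
    unfold constPath; split_ifs with h
    · subst h; exact hξ
    · exact Submodule.zero_mem _
  have hx : constPath ξ ∈ A.path.F 1 := mem_path_F_one.2 fun m => A.F_anti (by omega) (hxs m)
  have hx1 : constPath ξ ∈ A.path.deg 1 := fun m => by
    unfold constPath; split_ifs
    exacts [hξ1, Submodule.zero_mem _]
  have hF := flow_gauge hα hξ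
  have hcurv := hF.curv_eq_zero ha ha0 hx hx1 hc
  have h0 : A.path.trans y (A.gauge ξ α) 0 = A.trans y α := path_ev_zero ha
  rw [← h0]
  refine (hF.trans y ha ha0 hx hx1 hcurv).gauge hD.ev (dev_strong hD hxs) ?_ (ev_eval hD hs)
  have := dev_deg (A := A.path) (cexp_one_parity y) ha ha0 hx hx1
  rwa [zero_add] at this

/-- Boundaries act by gauge transformations. -/
theorem gauge_boundary {b : evenCycles k} {h : convCGra k} (hh : (h : Conv k) ∈ convParity k 1)
    (hb : cyc b = pl (thetaC k) h + pl h (thetaC k)) (hα : α ∈ A.F 1) (hα0 : α ∈ A.deg 0)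
    (hc : A.curv α = 0) :
    ∃ η ∈ A.F 1 ⊓ A.deg 1, SumsTo A.F (A.gauge η α) (A.trans b α) := by
  have hbp := cyc_parity b
  set a := A.evPath (cyc b) (oneC k) α with ha'
  have hD : Decay A a := evPath_decay b (oneC k) hα
  have ha := hD.mem
  have ha0 : a ∈ A.path.deg 0 := evPath_deg hbp convParity_one hα hα0
  have hx := evPath_mem (A := A) (μ := cyc b) (f := h) hα
  have hx1 : A.evPath (cyc b) h α ∈ A.path.deg 1 := evPath_deg hbp hh hα hα0
  have hxe : A.path.ev h a = A.evPath (cyc b) h α := ev_evPath hbp hα hα0 hh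
  -- In order m, the curvature of t ↦ e^{tb}·α is the derivative at α of the m-th coefficient of
  -- e^{tb}, applied to the curvature of α.
  have hcurv : A.path.curv a = 0 := by
    funext m
    have hE : pl (expC (cyc b) (oneC k) m) (thetaC k) = expC (cyc b) (thetaC k) m := by
      refine Subtype.ext ?_
      change preLie (expC (cyc b) (oneC k) m : Conv k) (theta k) = _
      rw [coe_expC, coe_expC, expSeries, expSeries, map_smul, LinearMap.smul_apply]
      exact congrArg _ (iterate_preLie_theta b.2 m).symm
    have hp : (expC (cyc b) (oneC k) m : Conv k) ∈ convParity k 0 :=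
      Submodule.smul_mem _ _ (iter_parity hbp convParity_one m)
    rw [curv, Pi.add_apply, ha', ev_evPath hbp hα hα0 thetaC_parity, path_d, evPath, evPath, ← hE,
      (isDer_d A).ev hp hα hα0, ev_pl thetaC_parity hα hα0, mul_zero, uzpow_zero, one_smul,
      ← dev_add hα (A.d_F _ _ hα) (ev_mem_F hα)]
    change A.dev _ α (A.curv α) = 0
    rw [hc, dev_zero]
  have hflow : Flow A a (A.evPath (cyc b) h α) := by
    intro m
    have h1 : A.path.dev h a (A.path.d a) + A.path.dev h a (A.path.ev (thetaC k) a) = 0 := by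
      rw [← dev_add ha (A.path.d_F _ _ ha) (ev_mem_F ha)]
      change A.path.dev h a (A.path.curv a) = 0
      rw [hcurv, dev_zero]
    have h2 : A.path.ev (cyc b) a = A.path.dev (thetaC k) a (A.path.ev h a) +
        A.path.dev h a (A.path.ev (thetaC k) a) := by
      rw [hb, ← ev_pl hh ha ha0, ← ev_pl thetaC_parity ha ha0]
      exact gen_add fun _ _ => ha
    -- The velocity is b(a) = Dθ(a)h(a) + Dh(a)θ(a). On a Maurer–Cartan path Dh(a)θ(a) = -Dh(a)(da),
    -- which is d(h(a)) because h is odd. So the velocity is the gauge direction of h(a).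
    have h3 : A.path.dir a (A.path.ev h a) = A.path.ev (cyc b) a := by
      rw [dir, (isDer_d _).ev hh ha ha0, h2, one_mul, odd_sign, Units.neg_smul, one_smul,
        eq_neg_of_add_eq_zero_left h1, neg_neg, add_comm]
    rw [← hxe, h3, ha', evPath_succ hα, oneC_pl, ev_evPath hbp hα hα0 hbp]
  have h0 : a 0 = α := by
    rw [ha', evPath, expC_zero, ev_one hα]
  have := hflow.gauge hD (evPath_strong b h hα) hx1 (sumsTo_evPath b (oneC k) hα)
  rwa [h0] at this

end ParamAlgebra

end DeformationGroup
namespace DeformationGroup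

/-! ## The actions of the groups of cycles and of homology classes -/

section Actions

variable {k : Type u} [Field k] {V : Type v} [AddCommGroup V] [Module k V]
variable (g : CompleteCGraAlgebra k V)

theorem mem_hbar_F_one {a : ℕ → V} : a ∈ g.hbar.F 1 ↔ ∀ m, a m ∈ g.F 1 := by
  have h : ∀ m, seriesWeight 1 m = 1 := fun m => by unfold seriesWeight; omega
  constructor
  · intro h' m
    have : a m ∈ g.F (seriesWeight 1 m) := h' m
    rwa [h] at this
  · intro h' m
    have := h' m
    rwa [← h m] at this

theorem SumsTo.coeff {ι : Type*} {x : ι → ℕ → V} {s : ℕ → V} (h : SumsTo g.hbar.F x s) (p : ℕ) :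
    SumsTo g.F (fun i => x i p) (s p) :=
  h.map (F' := g.F) (LinearMap.proj p) fun N => ⟨N + p + 1, fun v hv =>
    g.F_anti (by unfold seriesWeight; omega) (show v p ∈ g.F (seriesWeight (N + p + 1) p) from hv p)⟩

theorem seriesShift_pow (j : ℕ) (x : ℕ → V) (p : ℕ) :
    (seriesShift k V ^ j) x p = if j ≤ p then x (p - j) else 0 := by
  induction j generalizing p with
  | zero => simp
  | succ j ih =>
    rw [pow_succ', Module.End.mul_apply]
    cases p with
    | zero => simp
    | succ p => rw [seriesShift_succ, ih]; simp

variable [CharZero k]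

theorem hbar_br (x y : ℕ → V) : g.hbar.br x y = g.hBracket x y :=
  funext fun m => series_bracket g x y m

theorem hbar_totalD (x : ℕ → V) : g.hbar.totalD x = g.hD x := by
  funext m
  cases m with
  | zero => exact add_zero _
  | succ m => exact congrArg (g.d (x (m + 1)) + ·) (series_Delta g x m)

theorem hbar_gauge (ξ α : ℕ → V) (i : ℕ) : g.hbar.gauge ξ α i = g.gaugeTerm ξ α i := by
  have h : ⇑(g.hbar.br ξ) = g.hBracket ξ := funext fun y => hbar_br g ξ y
  cases i with
  | zero => rfl
  | succ i => rw [ParamAlgebra.gauge, gaugeTerm, h, hbar_totalD]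

theorem hbar_curv {α : ℕ → V} (hα : α ∈ g.hbar.F 1) :
    g.hbar.curv α = g.hD α + (1 / 2 : k) • g.hBracket α α := by
  rw [ParamAlgebra.curv_eq hα, ← add_assoc, hbar_br, ← hbar_totalD]
  rfl

variable {g}

theorem MC.mem (α : g.MC) : α.1 ∈ g.hbar.F 1 := (mem_hbar_F_one g).2 fun p => (α.2.1 p).1

theorem MC.deg (α : g.MC) : α.1 ∈ g.hbar.deg 0 := fun p => (α.2.1 p).2

theorem MC.curv (α : g.MC) : g.hbar.curv α.1 = 0 := (hbar_curv g (MC.mem α)).trans α.2.2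

/-- The definition asks for convergence of each coefficient of ħ. The gauge terms decay for the
filtration of series, so their sum exists there, and its coefficients identify it. -/
theorem gaugeRel_iff (α β : g.MC) : g.GaugeRel α β ↔
    ∃ ξ ∈ g.hbar.F 1 ⊓ g.hbar.deg 1, SumsTo g.hbar.F (g.hbar.gauge ξ α.1) β.1 := by
  constructor
  · rintro ⟨ξ, hξ, h⟩
    have hξ1 : ξ ∈ g.hbar.F 1 := (mem_hbar_F_one g).2 fun p => (hξ p).1
    refine ⟨ξ, ⟨hξ1, fun p => (hξ p).2⟩, ?_⟩
    obtain ⟨s, hs⟩ := g.hbar.exists_sumsTo (x := g.hbar.gauge ξ α.1) fun N =>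
      ⟨Finset.range N, fun i hi => g.hbar.F_anti (by simp at hi; omega)
        (ParamAlgebra.gauge_mem hξ1 (MC.mem α) i)⟩
    have : s = β.1 := by
      funext p
      have h1 := (SumsTo.coeff g hs p).hasFSum
      simp only [hbar_gauge] at h1
      exact h1.unique g.hausdorff (h p)
    rwa [← this]
  · rintro ⟨ξ, ⟨hξ, hξ1⟩, h⟩
    refine ⟨ξ, fun p => ⟨(mem_hbar_F_one g).1 hξ p, hξ1 p⟩, fun p => ?_⟩
    have h1 := (SumsTo.coeff g h p).hasFSum
    simpa only [hbar_gauge] using h1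

/-- The action of an even cycle on a Maurer–Cartan element. -/
noncomputable def actMC (x : evenCycles k) (α : g.MC) : g.MC :=
  ⟨g.hbar.trans x α.1, fun p => ⟨(mem_hbar_F_one g).1 (ParamAlgebra.trans_mem x (MC.mem α)) p,
    ParamAlgebra.trans_deg x (MC.mem α) (MC.deg α) p⟩,
    (hbar_curv g (ParamAlgebra.trans_mem x (MC.mem α))).symm.trans
      (ParamAlgebra.curv_trans x (MC.mem α) (MC.deg α) (MC.curv α))⟩

theorem actMC_zero (α : g.MC) : actMC 0 α = α := Subtype.ext (ParamAlgebra.trans_zero (MC.mem α))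

theorem actMC_bchMul (x y : evenCycles k) (α : g.MC) :
    actMC (bchMul x y) α = actMC x (actMC y α) :=
  Subtype.ext (ParamAlgebra.trans_bchMul x y (MC.mem α) (MC.deg α))

/-- The sum over arities and powers of ħ is reorganised by arity; at a given order p only the powers
j ≤ p of the exponential contribute. -/
theorem isAction_actMC (x : evenCycles k) (α : g.MC) :
    g.IsAction (x : Conv k) α.1 (actMC x α).1 := by
  set φ := cexp x (ParamAlgebra.oneC k) with hφ
  refine ⟨fun n j => comp φ n j, isPreLieExp_convExp x.2, fun p => ?_⟩
  have h := SumsTo.coeff g (g.hbar.sumsTo_gen 0 φ (X := fun _ _ => α.1) fun _ _ => MC.mem α) p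
  refine (h.prod fun n => ?_).hasFSum
  have h1 : ∀ j, g.hbar.genTerm 0 φ (fun _ _ => α.1) (n, j) p =
      if j ≤ p then (1 / (n.factorial : k)) • g.hEval (comp φ n j) α.1 (p - j) else 0 := by
    intro j
    change (1 / (n.factorial : k)) • ((seriesShift k V ^ j) (g.series.act n (comp φ n j) fun _ => α.1) p) = _
    rw [seriesShift_pow]
    split_ifs
    · rw [series_act]; rfl
    · rw [smul_zero]
  have h2 := sumsTo_finset (F := g.F) (x := fun j => g.hbar.genTerm 0 φ (fun _ _ => α.1) (n, j) p)
    (Finset.range (p + 1)) fun j hj => by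
      rw [h1, if_neg (by simpa using hj)]
  have h3 : ∑ j ∈ Finset.range (p + 1), g.hbar.genTerm 0 φ (fun _ _ => α.1) (n, j) p =
      g.actionTerm (fun n j => comp φ n j) α.1 p n := by
    rw [actionTerm, Finset.Nat.sum_antidiagonal_eq_sum_range_succ_mk, Finset.smul_sum]
    refine Finset.sum_congr rfl fun j hj => ?_
    rw [h1, if_pos (by simp at hj; omega)]
  rwa [h3] at h2

theorem gaugeRel_actMC (x : evenCycles k) (α β : g.MC) (h : g.GaugeRel α β) :
    g.GaugeRel (actMC x α) (actMC x β) := by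
  rw [gaugeRel_iff] at h ⊢
  obtain ⟨ξ, ⟨hξ, hξ1⟩, hs⟩ := h
  exact ParamAlgebra.gauge_trans x (MC.mem α) (MC.deg α) (MC.curv α) hξ hξ1 hs

theorem gaugeRel_actMC_boundary {b : evenCycles k} (hb : (b : Conv k) ∈ evenBoundaries k) (α : g.MC) :
    g.GaugeRel α (actMC b α) := by
  rw [gaugeRel_iff]
  obtain ⟨h, ⟨hc, hp⟩, e⟩ := hb
  rw [twistedDiff_apply_one] at e
  exact ParamAlgebra.gauge_boundary (h := ⟨h, hc⟩) hp (Subtype.ext e.symm) (MC.mem α) (MC.deg α)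
    (MC.curv α)

/-- The action of an even cycle on the moduli space. -/
noncomputable def actModuli (x : evenCycles k) : g.Moduli → g.Moduli :=
  Quot.map (actMC x) (gaugeRel_actMC x)

theorem actModuli_zero (m : g.Moduli) : actModuli 0 m = m := by
  induction m using Quot.ind with
  | _ α => exact congrArg (Quot.mk _) (actMC_zero α)

theorem actModuli_bchMul (x y : evenCycles k) (m : g.Moduli) :
    actModuli (bchMul x y) m = actModuli x (actModuli y m) := by
  induction m using Quot.ind with
  | _ α => exact congrArg (Quot.mk _) (actMC_bchMul x y α)

theorem actModuli_boundary {b : evenCycles k} (hb : (b : Conv k) ∈ evenBoundaries k) (m : g.Moduli) :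
    actModuli b m = m := by
  induction m using Quot.ind with
  | _ α => exact (Quot.sound (gaugeRel_actMC_boundary hb α)).symm

/-- The classes form a group, so x y⁻¹ is a boundary and acts trivially; then x = (x y⁻¹) y acts as
y. -/
theorem actModuli_congr {x y : evenCycles k} (h : (x : Conv k) - y ∈ evenBoundaries k) (m : g.Moduli) :
    actModuli x m = actModuli y m := by
  let := cycleGroup k
  let := homologyGroup k
  have h1 : homologyClass k (x * y⁻¹) = homologyClass k 1 := by
    have e : homologyClass k x = homologyClass k y := homologyClass_eq_iff.2 h
    change homologyClass k x * homologyClass k y⁻¹ = _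
    rw [e]
    exact congrArg (homologyClass k) (mul_inv_cancel y)
  have h2 := homologyClass_eq_iff.1 h1
  have h3 : ((x * y⁻¹ : evenCycles k) : Conv k) ∈ evenBoundaries k := by
    have : ((1 : evenCycles k) : Conv k) = 0 := rfl
    rwa [this, sub_zero] at h2
  have h4 : x = bchMul (x * y⁻¹) y := (inv_mul_cancel_right x y).symm
  rw [h4, actModuli_bchMul, actModuli_boundary h3]

/-- The action of an even homology class on the moduli space. -/
noncomputable def actHomology (h : EvenHomology k) : g.Moduli → g.Moduli :=
  Quotient.liftOn h actModuli fun _ _ hxy =>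
    funext fun m => actModuli_congr (homologyClass_eq_iff.1 (Quotient.sound hxy)) m

variable (g)

/-- The action of the group of even cycles on Maurer–Cartan elements. -/
noncomputable def mcHom :
    letI := cycleGroup k
    evenCycles k →* Equiv.Perm g.MC :=
  letI := cycleGroup k
  letI : MulAction (evenCycles k) g.MC :=
    { smul := actMC
      one_smul := actMC_zero
      mul_smul := actMC_bchMul }
  MulAction.toPermHom (evenCycles k) g.MC

/-- The action of the group of even homology classes on the moduli space. -/
noncomputable def moduliHom :
    letI := homologyGroup k
    EvenHomology k →* Equiv.Perm g.Moduli :=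
  letI := homologyGroup k
  letI : MulAction (EvenHomology k) g.Moduli :=
    { smul := actHomology
      one_smul := actModuli_zero
      mul_smul := fun a b m => by
        obtain ⟨x, rfl⟩ := Submodule.Quotient.mk_surjective _ a
        obtain ⟨y, rfl⟩ := Submodule.Quotient.mk_surjective _ b
        exact actModuli_bchMul x y m }
  MulAction.toPermHom (EvenHomology k) g.Moduli

variable {g} {V' : Type v} [AddCommGroup V'] [Module k V'] {g' : CompleteCGraAlgebra k V'}

theorem mapMC_actMC (ψ : Hom g g') (x : evenCycles k) (α : g.MC) :
    ψ.mapMC (actMC x α) = actMC x (ψ.mapMC α) := by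
  refine Subtype.ext ?_
  exact ParamAlgebra.ev_map (A := g.hbar) (A' := g'.hbar)
    (LinearMap.pi fun p => ψ.toLin ∘ₗ LinearMap.proj p) (fun N v hv m => ψ.map_F _ _ (hv m))
    (fun v => by
      funext m
      cases m with
      | zero => exact map_zero ψ.toLin
      | succ m => rfl)
    (fun n F x => by
      funext m
      change ψ.toLin (g.series.act n F x m) = g'.series.act n F _ m
      rw [series_act, series_act, map_sum]
      exact Finset.sum_congr rfl fun c _ => ψ.map_act n F _) (MC.mem α)

theorem mapModuli_actHomology (ψ : Hom g g') (h : EvenHomology k) (m : g.Moduli) :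
    ψ.mapModuli (actHomology h m) = actHomology h (ψ.mapModuli m) := by
  obtain ⟨x, rfl⟩ := Submodule.Quotient.mk_surjective _ h
  induction m using Quot.ind with
  | _ α => exact congrArg (Quot.mk _) (mapMC_actMC ψ x α)

end Actions

end DeformationGroup

theorem mainTheorem2 (k : Type u) [Field k] [CharZero k] :
    ∃ (_ : Group (evenCycles k)) (_ : Group (EvenHomology k)),
      -- the groups of even cycles and of even homology classes under BCH, with unit 0
      ((1 : evenCycles k) : Conv k) = 0 ∧
      (∀ x y : evenCycles k, IsBCH (x : Conv k) y ((x * y : evenCycles k) : Conv k)) ∧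
      homologyClass k 1 = 1 ∧
      (∀ x y : evenCycles k, homologyClass k (x * y) = homologyClass k x * homologyClass k y) ∧
      -- the actions on Maurer–Cartan elements and on their moduli spaces
      ∃ (ρ : ∀ (V : Type v) [AddCommGroup V] [Module k V] (g : CompleteCGraAlgebra k V),
            evenCycles k →* Equiv.Perm g.MC)
        (ρH : ∀ (V : Type v) [AddCommGroup V] [Module k V] (g : CompleteCGraAlgebra k V),
            EvenHomology k →* Equiv.Perm g.Moduli),
        -- the explicit formula
        (∀ (V : Type v) [AddCommGroup V] [Module k V] (g : CompleteCGraAlgebra k V)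
          (x : evenCycles k) (α : g.MC), g.IsAction (x : Conv k) α.1 (ρ V g x α).1) ∧
        -- the second action is induced by the first one
        (∀ (V : Type v) [AddCommGroup V] [Module k V] (g : CompleteCGraAlgebra k V)
          (x : evenCycles k) (α : g.MC),
          ρH V g (homologyClass k x) (g.moduliClass α) = g.moduliClass (ρ V g x α)) ∧
        -- functoriality
        (∀ (V V' : Type v) [AddCommGroup V] [Module k V] [AddCommGroup V'] [Module k V']
          (g : CompleteCGraAlgebra k V) (g' : CompleteCGraAlgebra k V') (ψ : Hom g g'),
          (∀ (x : evenCycles k) (α : g.MC),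
            ψ.mapMC (ρ V g x α) = ρ V' g' x (ψ.mapMC α)) ∧
          (∀ (h : EvenHomology k) (m : g.Moduli),
            ψ.mapModuli (ρH V g h m) = ρH V' g' h (ψ.mapModuli m))) := by
  -- The product and the action of homology classes are computed on representatives, so the
  -- compatibilities with passing to classes hold by definition.
  refine ⟨cycleGroup k, homologyGroup k, rfl, isBCH_bchMul, rfl, fun _ _ => rfl,
    fun V _ _ g => mcHom g, fun V _ _ g => moduliHom g, fun V _ _ g x α => isAction_actMC x α,
    fun V _ _ g x α => rfl, fun V V' _ _ _ _ g g' ψ => ⟨mapMC_actMC ψ, mapModuli_actHomology ψ⟩⟩
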